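/- Let $p>1$, $p'=p/(p-1)$, and $\phi_m(s)=|s|^{m-2}s$ for $s\neq0$, $\phi_m(0)=0$. Let $a,b:(0,\infty)\to(0,\infty)$ be of class $C^1$ and suppose: (W1) $(b/a)^{1/p}\in L^1_{\rm loc}([0,\infty))$ and $\chi(r):=\int_0^r (b/a)^{1/p}\,dt\to+\infty$ as $r\to+\infty$; (W2) $\psi:=\left(\frac1p\frac{a'}{a}+\frac1{p'}\frac{b'}{b}\right)\left(\frac ab\right)^{1/p}$ is positive and strictly decreasing on $(0,\infty)$; (W3) there are $C_1,C_2>0$ such that $C_1\le\chi(r)\psi(r)\le C_2$ for all $r>0$; (W4) for every $r_0>0$, $\lim_{r\to+\infty}\left[a(r+r_0)^{p'-1}b(r+r_0)-a(r)^{p'-1}b(r)\right]=+\infty$. Let $f:\mathbb R\to\mathbb R$ and $F(s)=\int_0^s f(t)\,dt$ satisfy: (f1) $f$ is continuous, locally Lipschitz on $\mathbb R\setminus\{0\}$, and $f(0)=0$; (f2) there are $\beta^-<0<\beta^+$ such that $F<0$ on $(\beta^-,\beta^+)\setminus\{0\}$, $F(\beta^\pm)=0$, $f>0$ on $[\beta^+,\infty)$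 and $f<0$ on $(-\infty,\beta^-]$; moreover $\lim_{s\to+\infty}F(s)=\lim_{s\to-\infty}F(s)$ (finite or $+\infty$). Put $B(r)=\int_0^r b(t)\,dt$, $\mathcal T_W(z)=\int_0^z\phi_{p'}\!\left(\frac{B(r)}{a(r)}\right)dr$ and $$\mu^*=\limsup_{r\to0_+}\left[\frac1{p\,a}\left(\frac{Ba}{b}\right)'-\left(\frac Bb\right)'\right].$$ Suppose further: (SC$_W$) there exist $\alpha\in(0,1)$, $\mu\ge\mu^*$ and $r_0>0$ such that $\mu+\left(\frac Bb\right)'-\frac1{p\,a}\left(\frac{Ba}b\right)'\ge0$ on $(0,r_0)$ and $$\lim_{s\to+\infty}\ \inf_{s_1,s_2\in[\alpha s,s]}\big(F(s_2)-\mu\,s_2f(s_2)\big)\,B\!\left(\mathcal T_W^{-1}\!\left(\frac{(1-\alpha)s}{\phi_{p'}(f(s_1))}\right)\right)=+\infty .$$ Then for every integer $k\ge0$ there is a function $u\in C([0,\infty))\cap C^1((0,\infty))$ with $a\,\phi_p(u')\in C^1((0,\infty))$ and $u(0)>0$ such that $$\big(a\,\phi_p(u')\big)'+b\,f(u)=0\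 \text{ on }(0,\infty),\qquad \lim_{r\to0_+}a(r)\,\phi_p(u'(r))=0,\qquad \lim_{r\to+\infty}u(r)=0,$$ and $u$ has exactly $k$ nodes, where a node is a zero of $u$ in the interior of the support of $u$. -/

import Mathlib

open Set Filter Topology MeasureTheory

namespace NodalRadial

noncomputable section

/-- The odd power `φ_p(s) = |s|^(p-2) s`, with `φ_p(0) = 0`. -/
def phi (p s : ℝ) : ℝ := |s| ^ (p - 2) * s

/-- The primitive `F(s) = ∫_0^s f`. -/
def primF (f : ℝ → ℝ) (s : ℝ) : ℝ := ∫ t in (0 : ℝ)..s, f t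

/-- The change of variable `χ(r) = ∫_0^r (b/a)^(1/p)`. -/
def chi (p : ℝ) (a b : ℝ → ℝ) (r : ℝ) : ℝ := ∫ t in (0 : ℝ)..r, (b t / a t) ^ (1 / p)

/-- The function `ψ = ((1/p) a'/a + (1/p') b'/b) (a/b)^(1/p)`. -/
def psi (p : ℝ) (a b : ℝ → ℝ) (r : ℝ) : ℝ :=
  (1 / p * (deriv a r / a r) + 1 / p.conjExponent * (deriv b r / b r)) * (a r / b r) ^ (1 / p)

/-- Positivity, regularity and integrability of the weights. -/
structure CondW1 (p : ℝ) (a b : ℝ → ℝ) : Prop where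
  pos_a : ∀ r, 0 < r → 0 < a r
  pos_b : ∀ r, 0 < r → 0 < b r
  smooth_a : ContDiffOn ℝ 1 a (Ioi 0)
  smooth_b : ContDiffOn ℝ 1 b (Ioi 0)
  locInt : LocallyIntegrableOn (fun t => (b t / a t) ^ (1 / p)) (Ici 0)
  tendsto_chi : Tendsto (chi p a b) atTop atTop

/-- `ψ` is positive and strictly decreasing on the positive half line. -/
def CondW2 (p : ℝ) (a b : ℝ → ℝ) : Prop :=
  (∀ r, 0 < r → 0 < psi p a b r) ∧ StrictAntiOn (psi p a b) (Ioi 0)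

/-- `χ ψ` lies between two positive constants. -/
def CondW3 (p : ℝ) (a b : ℝ → ℝ) : Prop :=
  ∃ C₁ C₂ : ℝ, 0 < C₁ ∧ 0 < C₂ ∧
    ∀ r, 0 < r → C₁ ≤ chi p a b r * psi p a b r ∧ chi p a b r * psi p a b r ≤ C₂

/-- The increments of `a^(p'-1) b` over steps of fixed length tend to infinity. -/
def CondW4 (p : ℝ) (a b : ℝ → ℝ) : Prop :=
  ∀ r₀ : ℝ, 0 < r₀ →
    Tendsto (fun r => a (r + r₀) ^ (p.conjExponent - 1) * b (r + r₀)
      - a r ^ (p.conjExponent - 1) * b r) atTop atTop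

/-- Regularity of the nonlinearity. -/
structure CondF1 (f : ℝ → ℝ) : Prop where
  cont : Continuous f
  locLip : LocallyLipschitzOn {0}ᶜ f
  zero : f 0 = 0

/-- Sign conditions on the nonlinearity and its primitive; the common limit of `F` at `±∞`
may be finite or infinite. -/
def CondF2 (f : ℝ → ℝ) : Prop :=
  (∃ βm βp : ℝ, βm < 0 ∧ 0 < βp ∧
    (∀ s ∈ Ioo βm βp, s ≠ 0 → primF f s < 0) ∧
    primF f βm = 0 ∧ primF f βp = 0 ∧
    (∀ s, βp ≤ s → 0 < f s) ∧ (∀ s, s ≤ βm → f s < 0)) ∧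
  ∃ L : EReal, Tendsto (fun s => (primF f s : EReal)) atTop (𝓝 L) ∧
    Tendsto (fun s => (primF f s : EReal)) atBot (𝓝 L)

/-- `B(r) = ∫_0^r b`. -/
def capB (b : ℝ → ℝ) (r : ℝ) : ℝ := ∫ t in (0 : ℝ)..r, b t

/-- `T_W(z) = ∫_0^z φ_{p'}(B/a)`. -/
def capT (p : ℝ) (a b : ℝ → ℝ) (z : ℝ) : ℝ :=
  ∫ r in (0 : ℝ)..z, phi p.conjExponent (capB b r / a r)

/-- The inverse of `T_W` on `[0, ∞)`. -/
def capTInv (p : ℝ) (a b : ℝ → ℝ) : ℝ → ℝ := Function.invFunOn (capT p a b) (Ici 0)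

/-- The function `(1/(p a)) (B a / b)' - (B / b)'`. -/
def critFun (p : ℝ) (a b : ℝ → ℝ) (r : ℝ) : ℝ :=
  1 / (p * a r) * deriv (fun t => capB b t * a t / b t) r - deriv (fun t => capB b t / b t) r

/-- The critical number `μ*`, the upper limit of `critFun` at `0+`. -/
def muStar (p : ℝ) (a b : ℝ → ℝ) : EReal :=
  limsup (fun r => (critFun p a b r : EReal)) (𝓝[>] 0)

/-- The weighted sub-criticality condition. The infimum is taken in the extended reals. -/
def CondSCW (p : ℝ) (a b f : ℝ → ℝ) : Prop :=
  ∃ α μ r₀ : ℝ, α ∈ Ioo (0 : ℝ) 1 ∧ muStar p a b ≤ (μ : EReal) ∧ 0 < r₀ ∧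
    (∀ r ∈ Ioo 0 r₀, 0 ≤ μ + deriv (fun t => capB b t / b t) r
      - 1 / (p * a r) * deriv (fun t => capB b t * a t / b t) r) ∧
    Tendsto (fun s : ℝ => ⨅ s₁ ∈ Icc (α * s) s, ⨅ s₂ ∈ Icc (α * s) s,
      (((primF f s₂ - μ * s₂ * f s₂) *
        capB b (capTInv p a b ((1 - α) * s / phi p.conjExponent (f s₁))) : ℝ) : EReal))
      atTop (𝓝 ⊤)

/-- Classical solutions on `(0, ∞)` of `(a φ_p(u'))' + b f(u) = 0`, with `a φ_p(u') → 0` at `0+`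
and `u → 0` at infinity; only the values of `u` on `[0, ∞)` matter. -/
structure IsSolution (p : ℝ) (a b f u : ℝ → ℝ) : Prop where
  cont : ContinuousOn u (Ici 0)
  smooth : ContDiffOn ℝ 1 u (Ioi 0)
  smooth_flux : ContDiffOn ℝ 1 (fun r => a r * phi p (deriv u r)) (Ioi 0)
  eqn : ∀ r, 0 < r → deriv (fun t => a t * phi p (deriv u t)) r + b r * f (u r) = 0
  flux_zero : Tendsto (fun r => a r * phi p (deriv u r)) (𝓝[>] 0) (𝓝 0)
  decay : Tendsto u atTop (𝓝 0)

/-- The nodes of `u`: the zeros of `u` in the interior of its support (the closure in `[0, ∞)` of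
the set where `u` does not vanish). -/
def nodes (u : ℝ → ℝ) : Set ℝ :=
  {r | 0 < r ∧ u r = 0 ∧ r ∈ interior (closure {x | 0 ≤ x ∧ u x ≠ 0})}

end

end NodalRadial

/-! ### Planar topology: a Poincaré–Miranda theorem and a chord lemma for simple paths. -/

namespace NodalRadial

/-! In the variable t = χ(r) the equation becomes the planar system v' = φ_P(y), y' = -f(v) - η y
with P = p'. Here q is a^(1/p) b^(1/p') read in t, η = q'/q is ψ read in t, and q y is the flux a
φ_p(u'). The energy |y|^P/P + F(v) is dissipated by the friction η, which by (W2) and (W3) decreases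
and is of order 1/t. The nodes of u are the zeros of v at which y does not vanish.

Neither φ_P nor f need be Lipschitz at 0, and the system is singular at t = 0. So φ_P and f are
replaced by locally Lipschitz g = K' and h = H', and the system is solved on [ε, T] with data (l, 0)
at ε. The clockwise polar angle of (v, y) passes the levels π/2 + jπ only upwards (`IsAngle.cross`),
hence counts zeros. Orbits starting in the well around 0, where F < 0, have no zero. If the final
angle reaches π/2 + kπ for some l below a bound Λ that does not depend on the regularization,
continuity in l selects an orbit with k zeros before T and one more at T (`exists_selection`).

The bound Λ is the heart of the proof (`exists_uniform_first`). Fix τ and let l grow until the first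
l₁ at which the angle, or the amplitude I = (v² + y²)/2, is large at time τ. Up to then the
endpoints, in the coordinates (angle, I), trace a simple arc in a bounded region. The action ∫ q (y
g(y) - K(y) - H(v)) has differential q(τ) y dv along this arc, which is q(τ) I d(angle) up to an
exact term; so its variation is an area. A simple arc that extends by rays to infinity at both ends
turns a bounded amount around every point off it (`IsProperArc.abs_im_integral_le`), so the area is
at most a constant times that of a disc containing the arc (`IsProperArc.abs_area_le`). Thus the
action at l₁ is bounded, however large l₁ is (`Flow.exists_first`). Bounded action bounds
dissipation and energy (`Orbit.bounds_of_action`), and then a Pohozaev argument with (SC_W) excludes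
large l₁ (`Orbit.lt_of_subcritical`). If F is bounded, speeds are bounded and Λ is found directly.

If it is the amplitude that is large at τ, the energy there exceeds a fixed level, and late friction
is too weak to prevent k + 1 further swings in bounded time (`IsAngle.lt_of_energy`).

Finally ε → 0, T → ∞ and g, h tend to φ_P, f. The approximations have positive energy up to T, since
v(T) = 0 and y(T) ≠ 0. Crossing the well therefore takes bounded time and requires a definite energy
(`exists_drop`), which keeps the first k zeros bounded and nondegenerate in the limit, while the
last one escapes with T. A limit of nonnegative energy and eventually constant sign tends to 0
(`LimitSol.tendsto_zero`). -/

lemma le_of_avoids_Ioo {θ : ℝ → ℝ} {d e : ℝ} (hde : d < e) (hθ : ContinuousOn θ (Icc 0 1))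
    (h0 : θ 0 ≤ d) (hav : ∀ t ∈ Icc (0:ℝ) 1, θ t ∉ Ioo d e) : θ 1 ≤ d := by
  by_contra! h
  set m := min (θ 1) ((d + e) / 2) with hm
  have hm1 : d < m := lt_min h (by linarith)
  have hm2 : m < e := (min_le_right _ _).trans_lt (by linarith)
  obtain ⟨t, ht, hteq⟩ := intermediate_value_Icc (zero_le_one) hθ
    (show m ∈ Icc (θ 0) (θ 1) from ⟨by linarith, min_le_left _ _⟩)
  exact hav t ht (by rw [hteq]; exact ⟨hm1, hm2⟩)

lemma ge_of_avoids_Ioo {θ : ℝ → ℝ} {d e : ℝ} (hde : e < d) (hθ : ContinuousOn θ (Icc 0 1))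
    (h0 : d ≤ θ 0) (hav : ∀ t ∈ Icc (0:ℝ) 1, θ t ∉ Ioo e d) : d ≤ θ 1 := by
  have := le_of_avoids_Ioo (θ := fun t => - θ t) (d := -d) (e := -e) (by linarith) hθ.neg
    (by simpa using h0) (fun t ht h => hav t ht ⟨by linarith [h.2], by linarith [h.1]⟩)
  linarith

/-- A planar Poincaré–Miranda theorem. -/
lemma exists_zero_of_boundary_signs {G : ℝ × ℝ → ℂ} (hG : Continuous G)
    (hl : ∀ b ∈ Icc (0:ℝ) 1, (G (0, b)).re ≤ 0) (hr : ∀ b ∈ Icc (0:ℝ) 1, 0 ≤ (G (1, b)).re)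
    (hb : ∀ a ∈ Icc (0:ℝ) 1, (G (a, 0)).im < 0) (ht : ∀ a ∈ Icc (0:ℝ) 1, 0 < (G (a, 1)).im) :
    ∃ a ∈ Icc (0:ℝ) 1, ∃ b ∈ Icc (0:ℝ) 1, G (a, b) = 0 := by
  by_contra! hne
  -- Composition with the retraction onto the square makes the nonvanishing map global, so that it
  -- has a continuous logarithm on the plane. Its argument is then followed along the boundary: left
  -- and top edges force it to be at most -π at the corner (1, 1), bottom and right edges at least
  -- -π/2.
  let cl : ℝ × ℝ → ℝ × ℝ := fun x => (max 0 (min 1 x.1), max 0 (min 1 x.2))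
  have hcl : Continuous cl := by fun_prop
  have hmem : ∀ x : ℝ, max 0 (min 1 x) ∈ Icc (0:ℝ) 1 := fun x =>
    ⟨le_max_left _ _, max_le zero_le_one (min_le_left _ _)⟩
  have hid : ∀ x ∈ Icc (0:ℝ) 1, max 0 (min 1 x) = x := fun x hx => by
    rw [min_eq_right hx.2, max_eq_right hx.1]
  obtain ⟨ℓ, hℓc, hℓ⟩ := Complex.exists_continuousOn_eqOn_exp_comp (U := (univ : Set (ℝ × ℝ)))
    (g := fun x => G (cl x))
    (by
      have : ContractibleSpace (univ : Set (ℝ × ℝ)) := (Homeomorph.Set.univ _).contractibleSpace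
      exact SimplyConnectedSpace.ofContractible _) isOpen_univ (hG.comp hcl).continuousOn (by
      rintro ⟨x, -, hx⟩
      exact hne _ (hmem _) _ (hmem _) hx)
  have hℓ' : Continuous ℓ := by simpa [continuousOn_univ] using hℓc
  have hexp : ∀ a ∈ Icc (0:ℝ) 1, ∀ b ∈ Icc (0:ℝ) 1, Complex.exp (ℓ (a, b)) = G (a, b) := by
    intro a ha b hb
    have := hℓ (mem_univ (a, b))
    simpa [cl, hid a ha, hid b hb] using this
  set ϑ : ℝ × ℝ → ℝ := fun x => (ℓ x).im with hϑ
  have hϑc : Continuous ϑ := Complex.continuous_im.comp hℓ'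
  have hre : ∀ a ∈ Icc (0:ℝ) 1, ∀ b ∈ Icc (0:ℝ) 1,
      (G (a, b)).re = Real.exp (ℓ (a, b)).re * Real.cos (ϑ (a, b)) := by
    intro a ha b hb
    rw [← hexp a ha b hb, Complex.exp_re]
  have him : ∀ a ∈ Icc (0:ℝ) 1, ∀ b ∈ Icc (0:ℝ) 1,
      (G (a, b)).im = Real.exp (ℓ (a, b)).re * Real.sin (ϑ (a, b)) := by
    intro a ha b hb
    rw [← hexp a ha b hb, Complex.exp_im]
  have z0 : (0:ℝ) ∈ Icc (0:ℝ) 1 := ⟨le_rfl, zero_le_one⟩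
  have z1 : (1:ℝ) ∈ Icc (0:ℝ) 1 := ⟨zero_le_one, le_rfl⟩
  have pi := Real.pi_pos
  -- normalisation at the corner
  obtain ⟨j, hj⟩ : ∃ j : ℤ, ϑ (0, 0) - j * (2 * Real.pi) ∈ Ioc (-Real.pi) (-Real.pi + 2 * Real.pi) := by
    obtain ⟨j, hj, -⟩ := existsUnique_sub_zsmul_mem_Ioc (by positivity : (0:ℝ) < 2 * Real.pi)
      (ϑ (0,0)) (-Real.pi)
    exact ⟨j, by simpa using hj⟩
  set θ : ℝ × ℝ → ℝ := fun x => ϑ x - j * (2 * Real.pi) with hθ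
  have hθc : Continuous θ := hϑc.sub continuous_const
  have cosθ : ∀ x, Real.cos (θ x) = Real.cos (ϑ x) := fun x => Real.cos_sub_int_mul_two_pi _ _
  have sinθ : ∀ x, Real.sin (θ x) = Real.sin (ϑ x) := fun x => Real.sin_sub_int_mul_two_pi _ _
  have cosl : ∀ b ∈ Icc (0:ℝ) 1, Real.cos (θ (0, b)) ≤ 0 := by
    intro b hb'
    have := hl b hb'
    rw [hre 0 z0 b hb', ← cosθ] at this
    by_contra! h
    have := mul_pos (Real.exp_pos (ℓ (0, b)).re) h
    linarith
  have cosr : ∀ b ∈ Icc (0:ℝ) 1, 0 ≤ Real.cos (θ (1, b)) := by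
    intro b hb'
    have := hr b hb'
    rw [hre 1 z1 b hb', ← cosθ] at this
    exact nonneg_of_mul_nonneg_right this (Real.exp_pos _)
  have sinb : ∀ a ∈ Icc (0:ℝ) 1, Real.sin (θ (a, 0)) < 0 := by
    intro a ha
    have := hb a ha
    rw [him a ha 0 z0, ← sinθ] at this
    exact neg_of_mul_neg_right this (Real.exp_pos _).le
  have sint : ∀ a ∈ Icc (0:ℝ) 1, 0 < Real.sin (θ (a, 1)) := by
    intro a ha
    have := ht a ha
    rw [him a ha 1 z1, ← sinθ] at this
    exact (pos_iff_pos_of_mul_pos this).1 (Real.exp_pos _)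
  -- the corner (0,0)
  have c00 : θ (0, 0) ≤ -(Real.pi / 2) := by
    have h1 := cosl 0 z0
    have h2 := sinb 0 z0
    by_contra! h
    rcases le_or_gt 0 (θ (0,0)) with h3 | h3
    · have : 0 ≤ Real.sin (θ (0,0)) := Real.sin_nonneg_of_nonneg_of_le_pi h3 (by linarith [hj.2])
      linarith
    · have := Real.cos_pos_of_mem_Ioo (x := θ (0,0)) ⟨by linarith, by linarith⟩
      linarith
  have c00' : -Real.pi < θ (0, 0) := hj.1
  have sgn1 : ∀ x, x ∈ Ioo (-Real.pi / 2) (Real.pi / 2) → 0 < Real.cos x := fun x hx =>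
    Real.cos_pos_of_mem_Ioo ⟨by linarith [hx.1], hx.2⟩
  -- left edge
  have L1 : θ (0, 1) ≤ -(Real.pi / 2) :=
    le_of_avoids_Ioo (θ := fun b => θ (0, b)) (e := Real.pi / 2) (by linarith)
      (by fun_prop) c00 (fun t ht h => by
        have := Real.cos_pos_of_mem_Ioo ⟨by linarith [h.1], h.2⟩
        linarith [cosl t ht])
  have L2 : -(3 * Real.pi / 2) ≤ θ (0, 1) :=
    ge_of_avoids_Ioo (θ := fun b => θ (0, b)) (e := -(5 * Real.pi / 2)) (by linarith)
      (by fun_prop) (by linarith) (fun t ht h => by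
        have h2 := Real.cos_pos_of_mem_Ioo (x := θ (0, t) + 2 * Real.pi)
          ⟨by linarith [h.1], by linarith [h.2]⟩
        rw [Real.cos_add_two_pi] at h2
        linarith [cosl t ht])
  have L3 : θ (0, 1) < -Real.pi := by
    by_contra! h
    have := Real.sin_nonneg_of_nonneg_of_le_pi (x := -θ (0,1)) (by linarith) (by linarith)
    rw [Real.sin_neg] at this
    linarith [sint 0 z0]
  -- top edge
  have T1 : θ (1, 1) ≤ -Real.pi :=
    le_of_avoids_Ioo (θ := fun a => θ (a, 1)) (e := 0) (by linarith)
      (by fun_prop) L3.le (fun t ht h => by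
        have h2 := Real.sin_neg_of_neg_of_neg_pi_lt h.2 h.1
        linarith [sint t ht])
  -- bottom edge
  have B1 : θ (1, 0) ≤ 0 :=
    le_of_avoids_Ioo (θ := fun a => θ (a, 0)) (e := Real.pi) (by linarith)
      (by fun_prop) (by linarith) (fun t ht h => by
        have h2 := Real.sin_pos_of_pos_of_lt_pi h.1 h.2
        linarith [sinb t ht])
  have B2 : -Real.pi ≤ θ (1, 0) :=
    ge_of_avoids_Ioo (θ := fun a => θ (a, 0)) (e := -(2 * Real.pi)) (by linarith)
      (by fun_prop) (by linarith) (fun t ht h => by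
        have h2 := Real.sin_pos_of_pos_of_lt_pi (x := θ (t,0) + 2 * Real.pi)
          (by linarith [h.1]) (by linarith [h.2])
        rw [Real.sin_add_two_pi] at h2
        linarith [sinb t ht])
  have B3 : -(Real.pi / 2) ≤ θ (1, 0) := by
    by_contra! h
    have h2 := Real.cos_neg_of_pi_div_two_lt_of_lt (x := -θ (1,0)) (by linarith) (by linarith)
    rw [Real.cos_neg] at h2
    linarith [cosr 0 z0]
  -- right edge
  have R1 : -(Real.pi / 2) ≤ θ (1, 1) :=
    ge_of_avoids_Ioo (θ := fun b => θ (1, b)) (e := -(3 * Real.pi / 2)) (by linarith)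
      (by fun_prop) B3 (fun t ht h => by
        have h2 := Real.cos_neg_of_pi_div_two_lt_of_lt (x := -θ (1,t)) (by linarith [h.2])
          (by linarith [h.1])
        rw [Real.cos_neg] at h2
        linarith [cosr t ht])
  linarith

/-- If the logarithm of a simple path has maximal real part at both ends, its argument varies by at
most `2π`. -/
lemma im_sub_le_two_pi_of_injective_exp {g : ℝ → ℂ} (hg : Continuous g)
    (hinj : ∀ s ∈ Icc (0:ℝ) 1, ∀ t ∈ Icc (0:ℝ) 1, s < t → g t - g s ≠ 2 * Real.pi * Complex.I)
    (h0 : ∀ t ∈ Icc (0:ℝ) 1, (g t).re ≤ (g 0).re) (h1 : ∀ t ∈ Icc (0:ℝ) 1, (g t).re ≤ (g 1).re) :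
    (g 1 - g 0).im ≤ 2 * Real.pi := by
  by_contra! h
  have z0 : (0:ℝ) ∈ Icc (0:ℝ) 1 := ⟨le_rfl, zero_le_one⟩
  have z1 : (1:ℝ) ∈ Icc (0:ℝ) 1 := ⟨zero_le_one, le_rfl⟩
  have hpi := Real.pi_pos
  -- The coordinate `x.2` is the length of a chord and `x.1` places it in [0, 1]. Left and right
  -- edges are chords from 0 and chords ending at 1, where the real part has the sign given by `h0`
  -- and `h1`; the bottom edge is chords of length zero and the top edge is the full chord. A zero
  -- is a chord of value 2πi, that is a double point of the path.
  obtain ⟨a, ha, b, hb, hab⟩ := exists_zero_of_boundary_signs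
    (G := fun x => g (x.1 * (1 - x.2) + x.2) - g (x.1 * (1 - x.2)) - 2 * Real.pi * Complex.I)
    (by fun_prop)
    (fun b hb => by simpa using h0 b hb)
    (fun b hb => by simpa using h1 (1 - b) ⟨by linarith [hb.2], by linarith [hb.1]⟩)
    (fun a ha => by simpa using hpi)
    (fun a ha => by simpa using h)
  rcases hb.1.eq_or_lt with hb0 | hb0
  · subst hb0
    simp at hab
  · refine hinj (a * (1 - b)) ?_ (a * (1 - b) + b) ?_ (by linarith) (sub_eq_zero.1 hab)
    · constructor
      · exact mul_nonneg ha.1 (by linarith [hb.2])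
      · nlinarith [ha.1, ha.2, hb.1, hb.2]
    · constructor
      · have := mul_nonneg ha.1 (show 0 ≤ 1 - b by linarith [hb.2]); linarith
      · nlinarith [ha.1, ha.2, hb.1, hb.2]

end NodalRadial

/-! ### The Cauchy kernel averaged over circles and discs. -/

namespace NodalRadial

open Metric ComplexConjugate

lemma circleAverage_inv_sub_of_lt {z : ℂ} {ρ : ℝ} (h0 : 0 < ρ) (h : ρ < ‖z‖) :
    Real.circleAverage (fun w => (z - w)⁻¹) 0 ρ = z⁻¹ := by
  have : DiffContOnCl ℂ (fun w => (z - w)⁻¹) (ball (0:ℂ) |ρ|) := by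
    apply DifferentiableOn.diffContOnCl
    rw [abs_of_pos h0, closure_ball _ h0.ne']
    intro w hw
    have hne : z - w ≠ 0 := by
      intro h'
      rw [sub_eq_zero.1 h'] at h
      exact absurd (mem_closedBall_zero_iff.1 hw) (not_le.2 h)
    exact ((differentiableAt_id.const_sub z).inv hne).differentiableWithinAt
  simpa using this.circleAverage

/-- The integrand has a pole inside the disc. On the circle, however, w̄ = ρ²/w, so the integrand is
the conjugate of w/(z̄w - ρ²), which is holomorphic on the closed disc and vanishes at the centre.
-/
lemma circleAverage_inv_sub_of_gt {z : ℂ} {ρ : ℝ} (h : ‖z‖ < ρ) :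
    Real.circleAverage (fun w => (z - w)⁻¹) 0 ρ = 0 := by
  have h0 : 0 < ρ := (norm_nonneg z).trans_lt h
  have hne : ∀ w ∈ closedBall (0:ℂ) ρ, conj z * w - ρ ^ 2 ≠ 0 := by
    intro w hw h'
    have h1 : ‖conj z * w‖ = ρ ^ 2 := by
      rw [sub_eq_zero.1 h']; simp
    rw [norm_mul, RCLike.norm_conj] at h1
    have h2 := mem_closedBall_zero_iff.1 hw
    nlinarith [norm_nonneg z, norm_nonneg w]
  have hd : DiffContOnCl ℂ (fun w => w / (conj z * w - ρ ^ 2)) (ball (0:ℂ) |ρ|) := by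
    apply DifferentiableOn.diffContOnCl
    rw [abs_of_pos h0, closure_ball _ h0.ne']
    intro w hw
    have h1 : DifferentiableAt ℂ (fun w => conj z * w - (ρ:ℂ) ^ 2) w := by fun_prop
    exact (DifferentiableAt.fun_div differentiableAt_id h1 (hne w hw)).differentiableWithinAt
  have e1 := hd.circleAverage
  have e2 : Real.circleAverage (fun w => (z - w)⁻¹) 0 ρ
      = conj (Real.circleAverage (fun w => w / (conj z * w - ρ ^ 2)) 0 ρ) := by
    have hci : CircleIntegrable (fun w => w / (conj z * w - ρ ^ 2)) 0 ρ := by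
      refine ContinuousOn.circleIntegrable h0.le ?_
      refine ContinuousOn.mono (s := closedBall 0 ρ) ?_ sphere_subset_closedBall
      exact continuousOn_id.div (by fun_prop) hne
    have := (Complex.conjCLE : ℂ →L[ℝ] ℂ).circleAverage_comp_comm hci
    simp only [ContinuousLinearEquiv.coe_coe, Complex.conjCLE_apply] at this
    rw [← this]
    apply Real.circleAverage_congr_sphere
    intro w hw
    have hw' : ‖w‖ = ρ := by simpa [abs_of_pos h0] using hw
    have hww : w * conj w = ρ ^ 2 := by
      rw [Complex.mul_conj, Complex.normSq_eq_norm_sq, hw']; push_cast; ring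
    have hw0 : w ≠ 0 := by
      intro h'; rw [h', norm_zero] at hw'; exact h0.ne hw'
    have hcw0 : conj w ≠ 0 := by simpa using hw0
    simp only [Function.comp, Complex.conjCLE_apply, map_div₀,
      map_sub, map_mul, Complex.conj_conj, map_pow, Complex.conj_ofReal]
    rw [← hww, ← sub_mul, div_mul_cancel_right₀ hcw0]
  rw [e2, e1]; simp

lemma integral_circle_inv_sub (z : ℂ) (ρ : ℝ) :
    ∫ θ in Ioo (-Real.pi) Real.pi, (z - ρ * (Real.cos θ + Real.sin θ * Complex.I))⁻¹
      = 2 * Real.pi * Real.circleAverage (fun w => (z - w)⁻¹) 0 ρ := by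
  have hpi := Real.pi_pos
  rw [Real.circleAverage_eq_integral_add (-Real.pi), ← integral_Ioc_eq_integral_Ioo,
    ← intervalIntegral.integral_of_le (by linarith)]
  have : ∀ θ : ℝ, circleMap 0 ρ θ = ρ * (Real.cos θ + Real.sin θ * Complex.I) := by
    intro θ
    simp [circleMap, Complex.exp_mul_I]
  simp only [this]
  rw [intervalIntegral.integral_comp_add_right
    (fun θ : ℝ => (z - ρ * (Real.cos θ + Real.sin θ * Complex.I))⁻¹)]
  rw [zero_add, show 2 * Real.pi + -Real.pi = Real.pi by ring, Complex.real_smul]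
  push_cast
  rw [← mul_assoc, mul_inv_cancel₀ (by simp [hpi.ne']), one_mul]

lemma locallyIntegrable_inv_complex : LocallyIntegrable (fun w : ℂ => w⁻¹) := by
  refine locallyIntegrable_of_norm_le_rpow (C := 1) (α := 1) ?_ ?_ ?_ ?_
  · simp
  · simp
  · exact ae_of_all _ fun x => by simp [Real.rpow_neg_one]
  · exact measurable_inv.aestronglyMeasurable

lemma integrableOn_inv_sub (z : ℂ) (R : ℝ) :
    IntegrableOn (fun P : ℂ => (z - P)⁻¹) (ball 0 R) := by
  have h1 : IntegrableOn (fun w : ℂ => w⁻¹) (closedBall z R) :=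
    locallyIntegrable_inv_complex.integrableOn_isCompact (isCompact_closedBall _ _)
  have h2 : IntegrableOn (fun w : ℂ => w⁻¹) (ball z R) := h1.mono_set ball_subset_closedBall
  rw [← integrable_indicator_iff measurableSet_ball] at h2 ⊢
  have h3 := h2.comp_sub_left z
  refine h3.congr (ae_of_all _ fun P => ?_)
  by_cases h : P ∈ ball (0:ℂ) R
  · have : z - P ∈ ball z R := by simpa [mem_ball, dist_eq_norm] using h
    simp [indicator_of_mem h, indicator_of_mem this]
  · have : z - P ∉ ball z R := by simpa [mem_ball, dist_eq_norm] using h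
    simp [indicator_of_notMem h, indicator_of_notMem this]

/-- Newton's formula for the Cauchy kernel on a disc. -/
lemma integral_ball_inv_sub {z : ℂ} {R : ℝ} (hz : ‖z‖ < R) :
    ∫ P in ball (0:ℂ) R, (z - P)⁻¹ = Real.pi * conj z := by
  set f : ℂ → ℂ := (ball (0:ℂ) R).indicator (fun P => (z - P)⁻¹) with hf
  have hfi : Integrable f := (integrable_indicator_iff measurableSet_ball).2 (integrableOn_inv_sub z R)
  have hfm : Measurable f :=
    (measurable_const.sub measurable_id).inv.indicator measurableSet_ball
  rw [← integral_indicator measurableSet_ball, ← hf, ← Complex.integral_comp_polarCoord_symm]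
  have hsymm : Measurable (fun p : ℝ × ℝ => Complex.polarCoord.symm p) := by
    have : (fun p : ℝ × ℝ => Complex.polarCoord.symm p)
        = fun p : ℝ × ℝ => ((p.1 : ℂ) * (Real.cos p.2 + Real.sin p.2 * Complex.I)) := by
      ext p; rw [Complex.polarCoord_symm_apply]
    rw [this]; fun_prop
  have hint : IntegrableOn (fun p : ℝ × ℝ => p.1 • f (Complex.polarCoord.symm p))
      (Ioi 0 ×ˢ Ioo (-Real.pi) Real.pi) := by
    refine ⟨(measurable_fst.smul (hfm.comp hsymm)).aestronglyMeasurable, ?_⟩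
    have h1 : ∫⁻ w, ‖f w‖ₑ < ⊤ := hfi.2
    rw [← Complex.lintegral_comp_polarCoord_symm] at h1
    refine lt_of_le_of_lt (le_of_eq ?_) h1
    refine setLIntegral_congr_fun (measurableSet_Ioi.prod measurableSet_Ioo) (fun p hp => ?_)
    simp only [enorm_smul, smul_eq_mul]
    rw [Real.enorm_of_nonneg (le_of_lt hp.1)]
  rw [show polarCoord.target = Ioi (0:ℝ) ×ˢ Ioo (-Real.pi) Real.pi from rfl, Measure.volume_eq_prod,
    setIntegral_prod _ hint]
  -- Only circles of radius below ‖z‖ contribute. The circle through z, where the kernel is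
  -- singular, is a single radius and is discarded as a null set.
  have key : ∀ ρ ∈ Ioi (0:ℝ), ρ ≠ ‖z‖ →
      ∫ θ in Ioo (-Real.pi) Real.pi, ρ • f (Complex.polarCoord.symm (ρ, θ))
      = (Ioc 0 ‖z‖).indicator (fun ρ : ℝ => (ρ : ℂ) * (2 * Real.pi * z⁻¹)) ρ := by
    intro ρ hρ hne
    have hρ0 : 0 < ρ := hρ
    rw [integral_smul]
    by_cases hR : ρ < R
    · have e : ∀ θ : ℝ, f (Complex.polarCoord.symm (ρ, θ))
          = (z - ρ * (Real.cos θ + Real.sin θ * Complex.I))⁻¹ := by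
        intro θ
        have : Complex.polarCoord.symm (ρ, θ) ∈ ball (0:ℂ) R := by
          rw [mem_ball_zero_iff, Complex.norm_polarCoord_symm]
          simpa [abs_of_pos hρ0] using hR
        rw [hf, indicator_of_mem this, Complex.polarCoord_symm_apply]
      simp only [e]
      rw [integral_circle_inv_sub]
      rcases lt_or_gt_of_ne hne with h | h
      · rw [circleAverage_inv_sub_of_lt hρ0 h, indicator_of_mem (show ρ ∈ Ioc 0 ‖z‖ from ⟨hρ0, h.le⟩),
          Complex.real_smul]
      · rw [circleAverage_inv_sub_of_gt h, indicator_of_notMem (fun h' => absurd h'.2 (not_le.2 h))]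
        simp
    · have e : ∀ θ : ℝ, f (Complex.polarCoord.symm (ρ, θ)) = 0 := by
        intro θ
        apply indicator_of_notMem
        rw [mem_ball_zero_iff, Complex.norm_polarCoord_symm]
        simpa [abs_of_pos hρ0] using hR
      simp only [e]
      rw [indicator_of_notMem (fun h' => absurd (h'.2.trans_lt hz) hR)]
      simp
  have e1 : ∫ ρ in Ioi (0:ℝ), ∫ θ in Ioo (-Real.pi) Real.pi, ρ • f (Complex.polarCoord.symm (ρ, θ))
      = ∫ ρ in Ioi (0:ℝ), (Ioc 0 ‖z‖).indicator (fun ρ : ℝ => (ρ : ℂ) * (2 * Real.pi * z⁻¹)) ρ := by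
    apply setIntegral_congr_ae measurableSet_Ioi
    have : ∀ᵐ ρ : ℝ, ρ ≠ ‖z‖ := by simp [ae_iff, measure_singleton]
    filter_upwards [this] with ρ h1 h2 using key ρ h2 h1
  rw [e1, setIntegral_indicator measurableSet_Ioc, inter_eq_self_of_subset_right Ioc_subset_Ioi_self,
    ← intervalIntegral.integral_of_le (norm_nonneg z), intervalIntegral.integral_mul_const]
  have e2 : ∫ x in (0:ℝ)..‖z‖, (x : ℂ) = ((‖z‖ ^ 2 / 2 : ℝ) : ℂ) := by
    rw [intervalIntegral.integral_ofReal, integral_id]; simp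
  rw [e2]
  by_cases hz0 : z = 0
  · simp [hz0]
  have h3 : z * conj z = (‖z‖ ^ 2 : ℝ) := by
    rw [Complex.mul_conj, Complex.normSq_eq_norm_sq]
  push_cast at h3 ⊢
  rw [← h3]; field_simp

/-- Translating by z moves the disc into the one of radius 2R, where the integral of 1/|w| is
finite. The uniformity in z is what justifies Fubini along a curve. -/
lemma exists_integral_ball_norm_inv_sub_le (R : ℝ) :
    ∃ C : ℝ, ∀ z : ℂ, ‖z‖ ≤ R → ∫ P in ball (0:ℂ) R, ‖(z - P)⁻¹‖ ≤ C := by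
  have h0 : IntegrableOn (fun w : ℂ => ‖w⁻¹‖) (ball 0 (2 * R)) :=
    IntegrableOn.mono_set (locallyIntegrable_inv_complex.integrableOn_isCompact
      (isCompact_closedBall 0 (2*R))).norm ball_subset_closedBall
  refine ⟨∫ w in ball (0:ℂ) (2 * R), ‖w⁻¹‖, fun z hz => ?_⟩
  rw [← integral_indicator measurableSet_ball, ← integral_indicator measurableSet_ball]
  rw [← integral_sub_left_eq_self ((ball (0:ℂ) (2 * R)).indicator fun w : ℂ => ‖w⁻¹‖) volume z]
  refine integral_mono_of_nonneg ?_ ?_ ?_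
  · exact ae_of_all _ fun P => indicator_nonneg (fun _ _ => norm_nonneg _) _
  · exact ((integrable_indicator_iff measurableSet_ball).2 h0).comp_sub_left z
  · refine ae_of_all _ fun P => ?_
    by_cases h : P ∈ ball (0:ℂ) R
    · have h2 : z - P ∈ ball (0:ℂ) (2 * R) := by
        rw [mem_ball_zero_iff] at h ⊢
        linarith [norm_sub_le z P]
      simp only [indicator_of_mem h, indicator_of_mem h2]; exact le_rfl
    · rw [indicator_of_notMem h]
      exact indicator_nonneg (fun _ _ => norm_nonneg _) _

end NodalRadial

/-! ### Winding and area bounds for properly embedded arcs. -/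

namespace NodalRadial

open Metric ComplexConjugate
open scoped NNReal

/-- The logarithm is the primitive of γ'/(γ - P). Since γ is only Lipschitz, exp(-g)(γ - P) is
differentiated almost everywhere; it is absolutely continuous, so a derivative vanishing almost
everywhere makes it constant. -/
lemma exists_log_lift {γ : ℝ → ℂ} {C : ℝ≥0} (hγ : LipschitzWith C γ) {P : ℂ}
    (hP : ∀ t, γ t ≠ P) :
    ∃ g : ℝ → ℂ, Continuous g ∧ (∀ t, Complex.exp (g t) = γ t - P) ∧
      ∀ a b, g b - g a = ∫ t in a..b, deriv γ t / (γ t - P) := by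
  set F : ℝ → ℂ := fun t => deriv γ t / (γ t - P) with hF
  have hne : ∀ t, γ t - P ≠ 0 := fun t => sub_ne_zero.2 (hP t)
  have hγc := hγ.continuous
  have hFm : Measurable F := (measurable_deriv γ).div (hγc.measurable.sub_const P)
  have hbc : Continuous fun t => (C : ℝ) * ‖(γ t - P)⁻¹‖ :=
    continuous_const.mul ((hγc.sub continuous_const).inv₀ hne).norm
  have hFb : ∀ t, ‖F t‖ ≤ (C : ℝ) * ‖(γ t - P)⁻¹‖ := by
    intro t
    simp only [hF, div_eq_mul_inv, norm_mul]
    exact mul_le_mul_of_nonneg_right (norm_deriv_le_of_lipschitz hγ) (norm_nonneg _)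
  have hFi : ∀ a b, IntervalIntegrable F volume a b := fun a b =>
    (hbc.intervalIntegrable a b).mono_fun hFm.aestronglyMeasurable
      (ae_of_all _ fun t => (hFb t).trans (le_abs_self _))
  obtain ⟨c, hc⟩ : ∃ c, Complex.exp c = γ 0 - P := ⟨Complex.log (γ 0 - P), Complex.exp_log (hne 0)⟩
  set g : ℝ → ℂ := fun t => c + ∫ s in (0:ℝ)..t, F s with hg
  have hgc : Continuous g := continuous_const.add (intervalIntegral.continuous_primitive hFi 0)
  have hgsub : ∀ a b, g b - g a = ∫ t in a..b, F t := by
    intro a b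
    simp only [hg, add_sub_add_left_eq_sub]
    rw [intervalIntegral.integral_interval_sub_left (hFi _ _) (hFi _ _)]
  refine ⟨g, hgc, ?_, hgsub⟩
  suffices H : ∀ S : ℝ, 0 < S → ∀ t ∈ Icc (-S) S, Complex.exp (-g t) * (γ t - P) = 1 by
    intro t
    have h1 := H (|t| + 1) (by positivity) t ⟨by linarith [neg_abs_le t], by linarith [le_abs_self t]⟩
    rw [Complex.exp_neg, inv_mul_eq_one₀ (Complex.exp_ne_zero _)] at h1
    exact h1
  intro S hS
  have hu : uIcc (-S) S = Icc (-S) S := uIcc_of_le (by linarith)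
  obtain ⟨M, hM⟩ := (isCompact_Icc (a := -S) (b := S)).exists_bound_of_continuousOn hbc.continuousOn
  obtain ⟨r, hr⟩ := (isCompact_Icc (a := -S) (b := S)).exists_bound_of_continuousOn hgc.continuousOn
  have hgL : LipschitzOnWith (Real.toNNReal M) (fun t => -g t) (Icc (-S) S) := by
    refine LipschitzOnWith.of_dist_le_mul fun a ha b hb => ?_
    rw [dist_neg_neg, dist_comm, dist_eq_norm, hgsub, dist_comm, Real.dist_eq]
    refine intervalIntegral.norm_integral_le_of_norm_le_const fun t ht => ?_
    have ht' : t ∈ Icc (-S) S :=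
      (uIcc_subset_Icc ha hb) (uIoc_subset_uIcc ht)
    have h3 := hM t ht'
    rw [Real.norm_of_nonneg (by positivity)] at h3
    exact ((hFb t).trans h3).trans (Real.le_coe_toNNReal M)
  have hexpL : LipschitzOnWith (Real.toNNReal (Real.exp r)) Complex.exp (closedBall 0 r) := by
    refine Convex.lipschitzOnWith_of_nnnorm_deriv_le (𝕜 := ℂ)
      (fun x _ => Complex.differentiableAt_exp) (fun x hx => ?_) (convex_closedBall _ _)
    rw [Complex.deriv_exp, ← NNReal.coe_le_coe, coe_nnnorm, Complex.norm_exp,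
      Real.coe_toNNReal _ (Real.exp_pos _).le, Real.exp_le_exp]
    exact (Complex.re_le_norm x).trans (mem_closedBall_zero_iff.1 hx)
  have h1 : AbsolutelyContinuousOnInterval (fun t => Complex.exp (-g t)) (-S) S := by
    apply LipschitzOnWith.absolutelyContinuousOnInterval (K := Real.toNNReal (Real.exp r) * Real.toNNReal M)
    rw [hu]
    refine hexpL.comp hgL (fun t ht => ?_)
    rw [mem_closedBall_zero_iff, norm_neg]
    exact hr t ht
  have h2 : AbsolutelyContinuousOnInterval (fun t => γ t - P) (-S) S := by
    apply LipschitzOnWith.absolutelyContinuousOnInterval (K := C)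
    refine LipschitzOnWith.of_dist_le_mul fun a _ b _ => ?_
    rw [dist_sub_right]; exact hγ.dist_le_mul a b
  have h3 := h1.smul h2
  obtain ⟨K, hK⟩ := h3.const_of_ae_hasDerivAt_zero (by
    have d1 := (hFi (-S) S).ae_hasDerivAt_integral
    have d2 := hγ.ae_differentiableAt_real
    filter_upwards [d1, d2] with t h1 h2 ht
    have hg' : HasDerivAt g (F t) t := by
      have := h1 ht 0 (by rw [hu]; exact ⟨by linarith, hS.le⟩)
      simpa [hg] using this.const_add c
    have e1 := (hg'.neg.cexp).mul (h2.hasDerivAt.sub_const P)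
    have e2 : Complex.exp ((-g) t) * -F t * (γ t - P) + Complex.exp ((-g) t) * deriv γ t = 0 := by
      simp only [hF]
      field_simp [hne t]
      ring
    rw [e2] at e1
    exact e1)
  have hK0 := hK 0 (by rw [hu]; exact ⟨by linarith, hS.le⟩)
  have hK1 : K = 1 := by
    rw [← hK0]
    simp only [smul_eq_mul, Pi.smul_apply', hg, intervalIntegral.integral_same, add_zero]
    rw [Complex.exp_neg, hc, inv_mul_cancel₀ (hne 0)]
  intro t ht
  have := hK t (by rw [hu]; exact ht)
  rw [hK1] at this
  exact this

/-- If the argument changed by exactly π between parameters s and x, the two points would lie on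
opposite sides of P. The point of the segment with parameter (x + ms)/(1 + m), where m is the ratio
of the distances to P, would then be P itself. -/
lemma im_sub_lt_pi_of_segment {g : ℝ → ℂ} (hg : Continuous g) {s t : ℝ} {P z d : ℂ}
    (hst : s ≤ t) (h : ∀ x ∈ Icc s t, Complex.exp (g x) = z + x * d - P)
    (hP : ∀ x ∈ Icc s t, z + x * d ≠ P) : |(g t - g s).im| < Real.pi := by
  by_contra! hcon
  have hc : ContinuousOn (fun x => |(g x - g s).im|) (Icc s t) := by fun_prop
  obtain ⟨x, hx, hxe⟩ := intermediate_value_Icc hst hc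
    (show Real.pi ∈ Icc _ _ from ⟨by simp [Real.pi_pos.le], hcon⟩)
  simp only at hxe
  have hq : Complex.exp (g x - g s) = -(Real.exp (g x - g s).re : ℂ) := by
    apply Complex.ext
    · rw [Complex.exp_re, ← Real.cos_abs, hxe, Real.cos_pi, Complex.neg_re, Complex.ofReal_re]; ring
    · rw [Complex.exp_im]
      have : Real.sin (g x - g s).im = 0 := by
        rcases abs_choice (g x - g s).im with h' | h' <;> rw [h'] at hxe
        · rw [hxe, Real.sin_pi]
        · rw [← neg_neg (g x - g s).im, hxe, Real.sin_neg, Real.sin_pi, neg_zero]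
      rw [this, mul_zero, Complex.neg_im, Complex.ofReal_im, neg_zero]
  set m := Real.exp (g x - g s).re with hm
  have hm0 : 0 < m := Real.exp_pos _
  have h1 : z + x * d - P = -m * (z + s * d - P) := by
    rw [← h x hx, ← h s ⟨le_rfl, hst⟩, ← hq, ← Complex.exp_add]; congr 1; ring
  have h2 : (1 + m : ℂ) ≠ 0 := by
    intro h'
    have := congrArg Complex.re h'
    simp at this; linarith
  refine hP ((x + m * s) / (1 + m)) ⟨?_, ?_⟩ ?_
  · rw [le_div_iff₀ (by linarith)]; nlinarith [hx.1]
  · rw [div_le_iff₀ (by linarith)]; nlinarith [hx.2]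
  · push_cast
    have h3 : (1 + m : ℂ) * (z + (x + m * s) / (1 + m) * d - P) = 0 := by
      have : (1 + m : ℂ) * (z + (x + m * s) / (1 + m) * d - P)
        = (z + x * d - P) + m * (z + s * d - P) := by field_simp; ring
      rw [this, h1]; ring
    rcases mul_eq_zero.1 h3 with h4 | h4
    · exact absurd h4 h2
    · exact sub_eq_zero.1 h4

/-- An arc extended by rays at both ends to a properly embedded line. -/
structure IsProperArc (γ : ℝ → ℂ) (d₀ d₁ : ℂ) : Prop where
  inj : Function.Injective γ
  ray₀ : ∀ t ≤ 0, γ t = γ 0 + t * d₀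
  ray₁ : ∀ t, 1 ≤ t → γ t = γ 1 - d₁ + t * d₁
  ne₀ : d₀ ≠ 0
  ne₁ : d₁ ≠ 0

/-- Cut the rays at `a` and `b`, where the distance to P first exceeds its maximum on the arc by
one. On [a, b] the logarithm of γ - P has maximal real part at both ends, so the chord lemma applied
in both directions bounds the variation of the argument by 2π. The two pieces of ray cost less than
π each, which makes 4π in total. -/
lemma IsProperArc.abs_im_integral_le {γ : ℝ → ℂ} {d₀ d₁ : ℂ} {C : ℝ≥0} (h : IsProperArc γ d₀ d₁)
    (hγ : LipschitzWith C γ) {P : ℂ} (hP : ∀ t, γ t ≠ P) :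
    |(∫ t in (0:ℝ)..1, deriv γ t / (γ t - P)).im| ≤ 4 * Real.pi := by
  obtain ⟨g, hgc, hge, hgi⟩ := exists_log_lift hγ hP
  have hγc := hγ.continuous
  -- a level reached far out on both rays
  obtain ⟨M, hM⟩ := (isCompact_Icc (a := (0:ℝ)) (b := 1)).exists_bound_of_continuousOn
    (f := fun t => γ t - P) (by fun_prop)
  have hM0 : 0 ≤ M := (norm_nonneg _).trans (hM 0 ⟨le_rfl, zero_le_one⟩)
  set N := M + 1 with hN
  have far₀ : ∃ S < 0, N ≤ ‖γ S - P‖ := by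
    have hd := norm_pos_iff.2 h.ne₀
    refine ⟨-((2 * M + 2) / ‖d₀‖), by simp only [neg_neg_iff_pos]; positivity, ?_⟩
    have hS : -((2 * M + 2) / ‖d₀‖) ≤ 0 := by simp only [neg_nonpos]; positivity
    rw [h.ray₀ _ hS]
    have e1 : γ 0 + ((-((2 * M + 2) / ‖d₀‖) : ℝ) : ℂ) * d₀ - P
      = ((-((2 * M + 2) / ‖d₀‖) : ℝ) : ℂ) * d₀ + (γ 0 - P) := by ring
    rw [e1]
    have e2 : ‖((-((2 * M + 2) / ‖d₀‖) : ℝ) : ℂ) * d₀‖ = 2 * M + 2 := by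
      rw [norm_mul, Complex.norm_real, Real.norm_eq_abs, abs_neg, abs_of_nonneg (by positivity),
        div_mul_cancel₀ _ hd.ne']
    have := norm_sub_norm_le (((-((2 * M + 2) / ‖d₀‖) : ℝ) : ℂ) * d₀) (-(γ 0 - P))
    rw [sub_neg_eq_add, e2, norm_neg] at this
    have := hM 0 ⟨le_rfl, zero_le_one⟩
    linarith
  have far₁ : ∃ S > 1, N ≤ ‖γ S - P‖ := by
    have hd := norm_pos_iff.2 h.ne₁
    refine ⟨1 + (2 * M + 2) / ‖d₁‖, by simp only [gt_iff_lt, lt_add_iff_pos_right]; positivity, ?_⟩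
    have hS : 1 ≤ 1 + (2 * M + 2) / ‖d₁‖ := by simp only [le_add_iff_nonneg_right]; positivity
    rw [h.ray₁ _ hS]
    have e1 : γ 1 - d₁ + ((1 + (2 * M + 2) / ‖d₁‖ : ℝ) : ℂ) * d₁ - P
      = (((2 * M + 2) / ‖d₁‖ : ℝ) : ℂ) * d₁ + (γ 1 - P) := by push_cast; ring
    rw [e1]
    have e2 : ‖(((2 * M + 2) / ‖d₁‖ : ℝ) : ℂ) * d₁‖ = 2 * M + 2 := by
      rw [norm_mul, Complex.norm_real, Real.norm_eq_abs, abs_of_nonneg (by positivity),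
        div_mul_cancel₀ _ hd.ne']
    have := norm_sub_norm_le ((((2 * M + 2) / ‖d₁‖ : ℝ) : ℂ) * d₁) (-(γ 1 - P))
    rw [sub_neg_eq_add, e2, norm_neg] at this
    have := hM 1 ⟨zero_le_one, le_rfl⟩
    linarith
  obtain ⟨S₀, hS₀, hfS₀⟩ := far₀
  obtain ⟨S₁, hS₁, hfS₁⟩ := far₁
  have hcl : IsClosed {t | N ≤ ‖γ t - P‖} := isClosed_le continuous_const (by fun_prop)
  obtain ⟨a, ⟨ha1, ha2⟩, hamax⟩ := ((isCompact_Icc (a := S₀) (b := 0)).inter_right hcl).exists_isGreatest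
    ⟨S₀, ⟨le_rfl, hS₀.le⟩, hfS₀⟩
  obtain ⟨b, ⟨hb1, hb2⟩, hbmin⟩ := ((isCompact_Icc (a := (1:ℝ)) (b := S₁)).inter_right hcl).exists_isLeast
    ⟨S₁, ⟨hS₁.le, le_rfl⟩, hfS₁⟩
  simp only [mem_ofPred_eq] at ha2 hb2
  have ha0 : a < 0 := lt_of_le_of_ne ha1.2 (by
    rintro rfl; have := hM 0 ⟨le_rfl, zero_le_one⟩; linarith)
  have hb0 : 1 < b := lt_of_le_of_ne hb1.1 (by
    rintro rfl; have := hM 1 ⟨zero_le_one, le_rfl⟩; linarith)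
  have hin : ∀ t ∈ Ioo a b, ‖γ t - P‖ < N := by
    intro t ht
    by_contra! hcon
    rcases le_total t 0 with h0 | h0
    · exact absurd (hamax ⟨⟨by linarith [ha1.1, ht.1], h0⟩, hcon⟩) (not_le.2 ht.1)
    · rcases le_total t 1 with h1 | h1
      · have := hM t ⟨h0, h1⟩; linarith
      · exact absurd (hbmin ⟨⟨h1, by linarith [hb1.2, ht.2]⟩, hcon⟩) (not_le.2 ht.2)
  have hab : a < b := by linarith
  have hle : ∀ t ∈ Icc a b, ‖γ t - P‖ ≤ N := by
    intro t ht
    have : t ∈ closure (Ioo a b) := by rw [closure_Ioo hab.ne]; exact ht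
    exact closure_minimal (fun x hx => (hin x hx).le)
      (isClosed_le (by fun_prop : Continuous fun t => ‖γ t - P‖) continuous_const) this
  have hre : ∀ t, (g t).re = Real.log ‖γ t - P‖ := fun t => by
    rw [← hge t, Complex.norm_exp, Real.log_exp]
  have hpos : ∀ t, 0 < ‖γ t - P‖ := fun t => norm_pos_iff.2 (sub_ne_zero.2 (hP t))
  have hree : ∀ t ∈ Icc a b, (g t).re ≤ Real.log N := fun t ht => by
    rw [hre]; exact Real.log_le_log (hpos t) (hle t ht)
  have hrea : Real.log N ≤ (g a).re := by rw [hre]; exact Real.log_le_log (by positivity) ha2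
  have hreb : Real.log N ≤ (g b).re := by rw [hre]; exact Real.log_le_log (by positivity) hb2
  have hexpne : ∀ s t, s ≠ t → Complex.exp (g s) ≠ Complex.exp (g t) := by
    intro s t hst heq
    rw [hge, hge] at heq
    exact hst (h.inj (sub_left_injective heq))
  have mem : ∀ t ∈ Icc (0:ℝ) 1, a + t * (b - a) ∈ Icc a b := fun t ht =>
    ⟨by nlinarith [ht.1], by nlinarith [ht.2]⟩
  have mem' : ∀ t ∈ Icc (0:ℝ) 1, b - t * (b - a) ∈ Icc a b := fun t ht =>
    ⟨by nlinarith [ht.2], by nlinarith [ht.1]⟩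
  have up : (g b - g a).im ≤ 2 * Real.pi := by
    have := im_sub_le_two_pi_of_injective_exp (g := fun t => g (a + t * (b - a))) (by fun_prop)
      (by
        intro s _ t _ hst heq
        refine hexpne (a + t * (b - a)) (a + s * (b - a)) (by
          intro h'; have : (t - s) * (b - a) = 0 := by linarith
          rcases mul_eq_zero.1 this with h'' | h'' <;> linarith) ?_
        rw [sub_eq_iff_eq_add.1 heq, Complex.exp_add, Complex.exp_two_pi_mul_I, one_mul])
      (fun t ht => by simpa using (hree _ (mem t ht)).trans hrea)
      (fun t ht => by simpa using (hree _ (mem t ht)).trans hreb)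
    simpa using this
  have dn : (g a - g b).im ≤ 2 * Real.pi := by
    have := im_sub_le_two_pi_of_injective_exp (g := fun t => g (b - t * (b - a))) (by fun_prop)
      (by
        intro s _ t _ hst heq
        refine hexpne (b - t * (b - a)) (b - s * (b - a)) (by
          intro h'; have : (t - s) * (b - a) = 0 := by linarith
          rcases mul_eq_zero.1 this with h'' | h'' <;> linarith) ?_
        rw [sub_eq_iff_eq_add.1 heq, Complex.exp_add, Complex.exp_two_pi_mul_I, one_mul])
      (fun t ht => by simpa using (hree _ (mem' t ht)).trans hreb)
      (fun t ht => by simpa using (hree _ (mem' t ht)).trans hrea)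
    simpa using this
  have r0 := im_sub_lt_pi_of_segment hgc (z := γ 0) (d := d₀) (P := P) ha0.le
    (fun x hx => by rw [hge, h.ray₀ x hx.2]) (fun x hx => by rw [← h.ray₀ x hx.2]; exact hP x)
  have r1 := im_sub_lt_pi_of_segment hgc (z := γ 1 - d₁) (d := d₁) (P := P) hb0.le
    (fun x hx => by rw [hge, h.ray₁ x hx.1]) (fun x hx => by rw [← h.ray₁ x hx.1]; exact hP x)
  rw [← hgi]
  simp only [Complex.sub_im] at *
  rw [abs_lt] at r0 r1
  rw [abs_le]
  constructor <;> linarith [r0.1, r0.2, r1.1, r1.2]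

/-- A Lipschitz curve has Hausdorff dimension at most 1, so almost every point of the plane is off
the curve and has a winding bound. -/
lemma volume_range_lipschitz_eq_zero {γ : ℝ → ℂ} {C : ℝ≥0} (hγ : LipschitzWith C γ) :
    volume (range γ) = 0 := by
  have h1 : (Measure.hausdorffMeasure (X := ℂ) ((2 : ℝ≥0) : ℝ)).IsAddHaarMeasure := by
    have := MeasureTheory.isAddHaarMeasure_hausdorffMeasure (E := ℂ)
    rw [Complex.finrank_real_complex] at this
    simpa using this
  have h2 : (volume : Measure ℂ) ≪ Measure.hausdorffMeasure ((2 : ℝ≥0) : ℝ) :=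
    Measure.absolutelyContinuous_isAddHaarMeasure _ _
  refine measure_zero_of_dimH_lt h2 ?_
  refine lt_of_le_of_lt (hγ.dimH_range_le) ?_
  rw [Real.dimH_univ]; norm_num

/-- The area form along a properly embedded arc is bounded by the area of a disc containing it. -/
lemma IsProperArc.abs_area_le {γ : ℝ → ℂ} {d₀ d₁ : ℂ} {C : ℝ≥0} (h : IsProperArc γ d₀ d₁)
    (hγ : LipschitzWith C γ) {R : ℝ} (hR : ∀ t ∈ Icc (0:ℝ) 1, ‖γ t‖ < R) :
    |(∫ t in (0:ℝ)..1, deriv γ t * conj (γ t)).im| ≤ 4 * Real.pi * R ^ 2 := by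
  have hpi := Real.pi_pos
  have hR0 : 0 < R := (norm_nonneg _).trans_lt (hR 0 ⟨le_rfl, zero_le_one⟩)
  have hγc := hγ.continuous
  obtain ⟨K, hK⟩ := exists_integral_ball_norm_inv_sub_le R
  set μ := volume.restrict (Ioc (0:ℝ) 1) with hμ
  set ν := volume.restrict (ball (0:ℂ) R) with hν
  set G : ℝ → ℂ → ℂ := fun t P => deriv γ t * (γ t - P)⁻¹ with hG
  have hGm : Measurable (Function.uncurry G) := by
    have h1 : Measurable fun x : ℝ × ℂ => deriv γ x.1 := (measurable_deriv γ).comp measurable_fst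
    have h2 : Measurable fun x : ℝ × ℂ => (γ x.1 - x.2)⁻¹ :=
      ((hγc.measurable.comp measurable_fst).sub measurable_snd).inv
    exact h1.mul h2
  have hGi : Integrable (Function.uncurry G) (μ.prod ν) := by
    rw [integrable_prod_iff hGm.aestronglyMeasurable]
    constructor
    · exact ae_of_all _ fun t => (integrableOn_inv_sub (γ t) R).const_mul (deriv γ t)
    · refine Integrable.mono' (g := fun _ => C * K) (integrable_const _)
        (hGm.norm.stronglyMeasurable.integral_prod_right).aestronglyMeasurable ?_
      rw [hμ, ae_restrict_iff' measurableSet_Ioc]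
      refine ae_of_all _ fun t ht => ?_
      rw [Real.norm_of_nonneg (integral_nonneg fun _ => norm_nonneg _)]
      simp only [Function.uncurry, hG, norm_mul]
      rw [integral_const_mul]
      exact mul_le_mul (norm_deriv_le_of_lipschitz hγ) (hK _ (hR t ⟨ht.1.le, ht.2⟩).le)
        (integral_nonneg fun _ => norm_nonneg _) C.2
  -- Integrating γ'/(γ - P) over both t and P: with P inside, Newton's formula produces π times the
  -- area integral; with t inside, almost every P contributes at most 4π in absolute value, and the
  -- disc has area πR².
  have hswap := integral_integral_swap hGi
  have hL : ∫ t, ∫ P, G t P ∂ν ∂μ = Real.pi * ∫ t in (0:ℝ)..1, deriv γ t * conj (γ t) := by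
    rw [intervalIntegral.integral_of_le zero_le_one, ← integral_const_mul]
    refine setIntegral_congr_fun measurableSet_Ioc fun t ht => ?_
    simp only [hG]
    rw [integral_const_mul, integral_ball_inv_sub (hR t ⟨ht.1.le, ht.2⟩)]
    ring
  have hRi : Integrable (fun P => ∫ t, G t P ∂μ) ν := hGi.integral_prod_right
  have hae : ∀ᵐ P ∂ν, ‖(∫ t, G t P ∂μ).im‖ ≤ 4 * Real.pi := by
    apply ae_restrict_of_ae
    have : ∀ᵐ P : ℂ, P ∉ range γ := by
      rw [ae_iff]
      simp only [not_not]
      exact volume_range_lipschitz_eq_zero hγ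
    filter_upwards [this] with P hP
    have := h.abs_im_integral_le hγ (P := P) (fun t ht => hP ⟨t, ht⟩)
    rw [intervalIntegral.integral_of_le zero_le_one] at this
    simpa [hG, div_eq_mul_inv] using this
  have himP : (∫ P, ∫ t, G t P ∂μ ∂ν).im = ∫ P, (∫ t, G t P ∂μ).im ∂ν := by
    have := (Complex.imCLM).integral_comp_comm hRi
    simpa using this.symm
  have hfin : IsFiniteMeasure ν := ⟨by
    rw [hν, Measure.restrict_apply_univ]; exact measure_ball_lt_top⟩
  have hb := norm_integral_le_of_norm_le_const hae
  rw [← himP, ← hswap, hL] at hb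
  have hvol : ν.real univ = Real.pi * R ^ 2 := by
    rw [hν, measureReal_def, Measure.restrict_apply_univ, Complex.volume_ball]
    simp [ENNReal.toReal_mul, hR0.le]; ring
  rw [hvol] at hb
  have him : (Real.pi * ∫ t in (0:ℝ)..1, deriv γ t * conj (γ t)).im
      = Real.pi * (∫ t in (0:ℝ)..1, deriv γ t * conj (γ t)).im := by simp
  rw [him, Real.norm_eq_abs, abs_mul, abs_of_pos hpi] at hb
  have : Real.pi * |(∫ t in (0:ℝ)..1, deriv γ t * conj (γ t)).im| ≤ Real.pi * (4 * Real.pi * R ^ 2) := by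
    linarith
  exact le_of_mul_le_mul_left this hpi

/-- Planar area bound in real coordinates, for an arc whose lower end can be continued downwards and
whose upper end can be continued to the right or upwards. -/
lemma abs_sub_le_of_arc {X Z W : ℝ → ℝ} {a b ρ : ℝ} {C : ℝ≥0} (hab : a < b)
    (hX : LipschitzOnWith C X (Icc a b)) (hZ : LipschitzOnWith C Z (Icc a b))
    (hW : LipschitzOnWith C W (Icc a b))
    (hinj : ∀ s ∈ Icc a b, ∀ t ∈ Icc a b, s < t → X s = X t → Z s ≠ Z t)
    (hlow : ∀ t ∈ Ioc a b, Z a < Z t)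
    (hend : (∀ t ∈ Ico a b, X t < X b) ∨ ∀ t ∈ Ico a b, Z t < Z b)
    (hXb : ∀ t ∈ Icc a b, |X t| ≤ ρ) (hZb : ∀ t ∈ Icc a b, |Z t| ≤ ρ) (hρ : 0 < ρ)
    (hd : ∀ t ∈ Ioo a b, ∀ x z, HasDerivAt X x t → HasDerivAt Z z t → HasDerivAt W (Z t * x) t) :
    |W b - W a| ≤ (1 + 8 * Real.pi) * ρ ^ 2 := by
  have hba : 0 < b - a := sub_pos.2 hab
  set c : ℝ → ℝ := fun t => a + (b - a) * max 0 (min 1 t) with hc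
  have hmem : ∀ t, c t ∈ Icc a b := by
    intro t
    have h1 : 0 ≤ max 0 (min 1 t) := le_max_left _ _
    have h2 : max 0 (min 1 t) ≤ 1 := max_le zero_le_one (min_le_left _ _)
    constructor <;> simp only [hc] <;> nlinarith
  have c0 : ∀ t ≤ 0, c t = a := fun t ht => by
    simp only [hc]; rw [max_eq_left ((min_le_right _ _).trans ht)]; ring
  have c1 : ∀ t, 1 ≤ t → c t = b := fun t ht => by
    simp only [hc]; rw [min_eq_left ht, max_eq_right zero_le_one]; ring
  have c01 : ∀ t ∈ Icc (0:ℝ) 1, c t = a + (b - a) * t := fun t ht => by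
    simp only [hc]; rw [min_eq_right ht.2, max_eq_right ht.1]
  have hcL : LipschitzWith (Real.toNNReal (b - a)) c := by
    refine LipschitzWith.of_dist_le_mul fun s t => ?_
    rw [Real.coe_toNNReal _ hba.le, Real.dist_eq, Real.dist_eq]
    simp only [hc]
    rw [show a + (b - a) * max 0 (min 1 s) - (a + (b - a) * max 0 (min 1 t))
      = (b - a) * (max 0 (min 1 s) - max 0 (min 1 t)) by ring, abs_mul, abs_of_pos hba]
    refine mul_le_mul_of_nonneg_left ?_ hba.le
    refine (abs_max_sub_max_le_max _ _ _ _).trans (max_le (by simp) ?_)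
    refine (abs_min_sub_min_le_max _ _ _ _).trans (max_le (by simp) le_rfl)
  have hcomp : ∀ Y : ℝ → ℝ, LipschitzOnWith C Y (Icc a b) →
      LipschitzWith (C * Real.toNNReal (b - a)) (fun t => Y (c t)) := fun Y hY => by
    have := hY.comp (hcL.lipschitzOnWith (s := univ)) (fun t _ => hmem t)
    exact lipschitzOnWith_univ.1 this
  have hX' := hcomp X hX
  have hZ' := hcomp Z hZ
  have hW' := hcomp W hW
  obtain ⟨d, hd0, hend'⟩ : ∃ d : ℂ, 0 ≤ d.re ∧ 0 ≤ d.im ∧ d ≠ 0 ∧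
      ((0 < d.re ∧ ∀ t ∈ Ico a b, X t < X b) ∨ (0 < d.im ∧ ∀ t ∈ Ico a b, Z t < Z b)) := by
    rcases hend with h | h
    · exact ⟨1, by simp, by simp, by simp, Or.inl ⟨by simp, h⟩⟩
    · exact ⟨Complex.I, by simp, by simp, by simp, Or.inr ⟨by simp, h⟩⟩
  obtain ⟨hd1, hdne, hend'⟩ := hend'
  -- The arc is continued straight down below its lower end, and in the direction `d`, to the right
  -- or upwards, beyond its upper end. `hlow` keeps the first ray off the arc, `hend` the second,
  -- and the two rays are at different heights.
  set γ : ℝ → ℂ := fun t => ((X (c t) : ℝ) : ℂ) + ((Z (c t) : ℝ) : ℂ) * Complex.I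
    + ((min 0 t : ℝ) : ℂ) * Complex.I + ((max 0 (t - 1) : ℝ) : ℂ) * d with hγ
  have hre : ∀ t, (γ t).re = X (c t) + max 0 (t - 1) * d.re := fun t => by simp [hγ]
  have him : ∀ t, (γ t).im = Z (c t) + min 0 t + max 0 (t - 1) * d.im := fun t => by simp [hγ]
  have hne : ∀ s t, s < t → γ s = γ t → False := by
      intro s t hst heq
      have e1 := congrArg Complex.re heq
      have e2 := congrArg Complex.im heq
      rw [hre, hre] at e1
      rw [him, him] at e2
      rcases le_or_gt t 0 with ht | ht
      · rw [c0 s (by linarith), c0 t ht, min_eq_right ht, min_eq_right (by linarith : s ≤ 0),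
          max_eq_left (by linarith : s - 1 ≤ 0), max_eq_left (by linarith : t - 1 ≤ 0)] at e2
        linarith
      rcases lt_or_ge s 0 with hs | hs
      · rw [c0 s hs.le, min_eq_left ht.le, min_eq_right hs.le,
          max_eq_left (by linarith : s - 1 ≤ 0)] at e2
        have h1 : Z a ≤ Z (c t) := by
          rcases (hmem t).1.eq_or_lt with h | h
          · rw [← h]
          · exact (hlow _ ⟨h, (hmem t).2⟩).le
        have h2 : 0 ≤ max 0 (t - 1) * d.im := mul_nonneg (le_max_left _ _) hd1
        linarith
      rw [min_eq_left hs, min_eq_left ht.le] at e2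
      rcases le_or_gt t 1 with ht1 | ht1
      · rw [max_eq_left (by linarith : s - 1 ≤ 0), max_eq_left (by linarith : t - 1 ≤ 0)] at e1 e2
        refine hinj (c s) (hmem s) (c t) (hmem t) ?_ (by linarith) (by linarith)
        rw [c01 s ⟨hs, by linarith⟩, c01 t ⟨ht.le, ht1⟩]
        nlinarith
      rw [c1 t ht1.le, max_eq_right (by linarith : 0 ≤ t - 1)] at e1 e2
      rcases le_or_gt 1 s with hs1 | hs1
      · rw [c1 s hs1, max_eq_right (by linarith : 0 ≤ s - 1)] at e1 e2
        rcases hend' with ⟨h, -⟩ | ⟨h, -⟩ <;> nlinarith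
      · rw [max_eq_left (by linarith : s - 1 ≤ 0)] at e1 e2
        have hcs : c s ∈ Ico a b := ⟨(hmem s).1, by rw [c01 s ⟨hs, hs1.le⟩]; nlinarith⟩
        rcases hend' with ⟨h, h'⟩ | ⟨h, h'⟩
        · have := h' _ hcs
          nlinarith [mul_pos (show 0 < t - 1 by linarith) h]
        · have := h' _ hcs
          nlinarith [mul_pos (show 0 < t - 1 by linarith) h]
  have harc : IsProperArc γ Complex.I d := by
    refine ⟨fun s t h => ?_, fun t ht => ?_, fun t ht => ?_, Complex.I_ne_zero, hdne⟩
    · rcases lt_trichotomy s t with h' | h' | h'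
      · exact (hne s t h' h).elim
      · exact h'
      · exact (hne t s h' h.symm).elim
    · simp only [hγ]
      rw [c0 t ht, c0 0 le_rfl, min_eq_right ht, max_eq_left (by linarith : t - 1 ≤ 0)]
      simp
    · simp only [hγ]
      rw [c1 t ht, c1 1 le_rfl, min_eq_left (by linarith : 0 ≤ t), max_eq_right (by linarith : 0 ≤ t - 1)]
      simp; ring
  have hγL : ∃ K, LipschitzWith K γ := by
    have l1 : LipschitzWith 1 (fun t : ℝ => ((t : ℝ) : ℂ)) :=
      LipschitzWith.of_dist_le_mul fun s t => by simp [Complex.dist_eq, ← Complex.ofReal_sub, Real.dist_eq]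
    have l2 : LipschitzWith 1 (fun t : ℝ => min 0 t) := by
      simpa using (LipschitzWith.id (α := ℝ)).const_min 0
    have l3 : LipschitzWith 1 (fun t : ℝ => max 0 (t - 1)) := by
      have : LipschitzWith 1 (fun t : ℝ => t - 1) := LipschitzWith.of_dist_le_mul fun s t => by simp
      simpa using this.const_max 0
    have lm : ∀ (e : ℂ), LipschitzWith ‖e‖₊ (fun z : ℂ => z * e) := fun e =>
      LipschitzWith.of_dist_le_mul fun s t => by
        rw [dist_eq_norm, dist_eq_norm, ← sub_mul, norm_mul, mul_comm]; rfl
    exact ⟨_, (((l1.comp hX').add ((lm _).comp (l1.comp hZ'))).add ((lm _).comp (l1.comp l2))).add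
      ((lm _).comp (l1.comp l3))⟩
  obtain ⟨K, hK⟩ := hγL
  have harea := harc.abs_area_le hK (R := 2 * ρ) (fun t ht => by
    have h1 : ‖γ t‖ ≤ |(γ t).re| + |(γ t).im| := Complex.norm_le_abs_re_add_abs_im _
    have h2 := Complex.norm_le_sqrt_two_mul_max (γ t)
    rw [hre, him, min_eq_left ht.1, max_eq_left (by linarith [ht.2] : t - 1 ≤ 0)] at h2
    simp only [zero_mul, add_zero] at h2
    have h3 : max |X (c t)| |Z (c t)| ≤ ρ := max_le (hXb _ (hmem t)) (hZb _ (hmem t))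
    have h4 : √2 < 2 := by
      rw [Real.sqrt_lt' (by norm_num)]; norm_num
    have h5 : 0 ≤ √2 := Real.sqrt_nonneg 2
    nlinarith)
  -- compare with W
  have hWi := hW'.lipschitzOnWith (s := uIcc 0 1) |>.absolutelyContinuousOnInterval.integral_deriv_eq_sub
  have hXZi := ((hX'.lipschitzOnWith (s := uIcc 0 1)).absolutelyContinuousOnInterval.mul
    (hZ'.lipschitzOnWith (s := uIcc 0 1)).absolutelyContinuousOnInterval)
  have hXZ := hXZi.integral_deriv_eq_sub
  have iW := (hW'.lipschitzOnWith (s := uIcc 0 1)).absolutelyContinuousOnInterval.intervalIntegrable_deriv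
  have iXZ := hXZi.intervalIntegrable_deriv
  have hint : IntervalIntegrable (fun t => deriv γ t * conj (γ t)) volume 0 1 := by
    have h1 : Continuous fun t => (K : ℝ) * ‖γ t‖ := continuous_const.mul hK.continuous.norm
    refine (h1.intervalIntegrable 0 1).mono_fun
      ((measurable_deriv γ).mul (Complex.continuous_conj.comp hK.continuous).measurable).aestronglyMeasurable
      (ae_of_all _ fun t => ?_)
    simp only [norm_mul, RCLike.norm_conj, norm_norm, NNReal.norm_eq]
    exact mul_le_mul_of_nonneg_right (norm_deriv_le_of_lipschitz hK) (norm_nonneg _)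
  have him2 : (∫ t in (0:ℝ)..1, deriv γ t * conj (γ t)).im
      = ∫ t in (0:ℝ)..1, (deriv γ t * conj (γ t)).im := by
    have := Complex.imCLM.intervalIntegral_comp_comm hint
    simpa using this.symm
  -- The imaginary part is X Z' - Z X' = (X Z)' - 2 Z X', and Z X' is W'. So W(b) - W(a) is half a
  -- boundary term minus half the area integral. The latter is at most 16πρ² because the arc lies in
  -- the disc of radius 2ρ, and the boundary term is at most 2ρ².
  have hcong : ∫ t in (0:ℝ)..1, (deriv γ t * conj (γ t)).im
      = ∫ t in (0:ℝ)..1, (deriv ((fun t => X (c t)) * fun t => Z (c t)) t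
        - 2 * deriv (fun t => W (c t)) t) := by
    apply intervalIntegral.integral_congr_ae
    have h1 := hX'.ae_differentiableAt_real
    have h2 := hZ'.ae_differentiableAt_real
    have h3 : ∀ᵐ t : ℝ, t ≠ 1 := by simp [ae_iff, measure_singleton]
    filter_upwards [h1, h2, h3] with t dX dZ ht1 ht
    rw [uIoc_of_le zero_le_one] at ht
    have ht' : t ∈ Ioo (0:ℝ) 1 := ⟨ht.1, lt_of_le_of_ne ht.2 ht1⟩
    have hev : ∀ᶠ s in 𝓝 t, s ∈ Ioo (0:ℝ) 1 := Ioo_mem_nhds ht'.1 ht'.2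
    -- derivatives in the original parameter
    set l := a + (b - a) * t with hl
    have hlm : l ∈ Ioo a b := ⟨by simp only [hl]; nlinarith [ht'.1], by simp only [hl]; nlinarith [ht'.2]⟩
    have htl : (l - a) / (b - a) = t := by simp only [hl]; field_simp; ring
    have hback : ∀ Y : ℝ → ℝ, DifferentiableAt ℝ (fun t => Y (c t)) t →
        HasDerivAt Y (deriv (fun t => Y (c t)) t * (1 / (b - a))) l := by
      intro Y hY
      have h5 : HasDerivAt (fun s => (s - a) / (b - a)) (1 / (b - a)) l :=
        ((hasDerivAt_id l).sub_const a).div_const _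
      have h6 : HasDerivAt (fun t => Y (c t)) (deriv (fun t => Y (c t)) t) ((l - a) / (b - a)) := by
        rw [htl]; exact hY.hasDerivAt
      have h7 := h6.comp l h5
      refine h7.congr_of_eventuallyEq ?_
      have : ∀ᶠ s in 𝓝 l, s ∈ Ioo a b := Ioo_mem_nhds hlm.1 hlm.2
      filter_upwards [this] with s hs
      simp only [Function.comp]
      rw [c01 _ ⟨div_nonneg (by linarith [hs.1]) hba.le, by rw [div_le_one hba]; linarith [hs.2]⟩]
      congr 1; field_simp; ring
    have hcl : c t = l := c01 t ⟨ht'.1.le, ht'.2.le⟩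
    have hWl := hd l hlm _ _ (hback X dX) (hback Z dZ)
    have hct : HasDerivAt c (b - a) t := by
      have : HasDerivAt (fun t => a + (b - a) * t) (b - a) t := by
        simpa using ((hasDerivAt_id t).const_mul (b - a)).const_add a
      refine this.congr_of_eventuallyEq ?_
      filter_upwards [hev] with s hs
      exact c01 s ⟨hs.1.le, hs.2.le⟩
    have hWt : HasDerivAt (fun t => W (c t)) (Z (c t) * deriv (fun t => X (c t)) t) t := by
      rw [← hcl] at hWl
      have := hWl.comp t hct
      have e : Z (c t) * deriv (fun t => X (c t)) t
          = Z (c t) * (deriv (fun t => X (c t)) t * (1 / (b - a))) * (b - a) := by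
        field_simp
      rw [e]
      exact this
    have hγt : HasDerivAt γ ((deriv (fun t => X (c t)) t : ℝ)
        + (deriv (fun t => Z (c t)) t : ℝ) * Complex.I) t := by
      have e1 := (dX.hasDerivAt.ofReal_comp).add ((dZ.hasDerivAt.ofReal_comp).mul_const Complex.I)
      refine e1.congr_of_eventuallyEq ?_
      filter_upwards [hev] with s hs
      simp only [hγ]
      rw [min_eq_left hs.1.le, max_eq_left (by linarith [hs.2] : s - 1 ≤ 0)]
      simp
    have hXZt := dX.hasDerivAt.mul dZ.hasDerivAt
    rw [hγt.deriv, hXZt.deriv, hWt.deriv]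
    have r1 : (γ t).re = X (c t) := by
      rw [hre, max_eq_left (by linarith [ht'.2] : t - 1 ≤ 0)]; ring
    have r2 : (γ t).im = Z (c t) := by
      rw [him, max_eq_left (by linarith [ht'.2] : t - 1 ≤ 0), min_eq_left ht'.1.le]; ring
    simp only [Complex.mul_im, Complex.add_re, Complex.add_im, Complex.ofReal_re, Complex.ofReal_im,
      Complex.mul_re, Complex.I_re, Complex.I_im, Complex.conj_re, Complex.conj_im, r1, r2]
    ring
  rw [him2, hcong, intervalIntegral.integral_sub iXZ (iW.const_mul 2),
    intervalIntegral.integral_const_mul, hWi, hXZ] at harea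
  simp only [Pi.mul_apply, c0 0 le_rfl, c1 1 le_rfl] at harea
  have b1 : |X b * Z b| ≤ ρ ^ 2 := by
    rw [abs_mul, sq]
    exact mul_le_mul (hXb b ⟨hab.le, le_rfl⟩) (hZb b ⟨hab.le, le_rfl⟩) (abs_nonneg _) hρ.le
  have b2 : |X a * Z a| ≤ ρ ^ 2 := by
    rw [abs_mul, sq]
    exact mul_le_mul (hXb a ⟨le_rfl, hab.le⟩) (hZb a ⟨le_rfl, hab.le⟩) (abs_nonneg _) hρ.le
  rw [abs_le] at b1 b2 harea ⊢
  constructor <;> nlinarith [harea.1, harea.2, b1.1, b1.2, b2.1, b2.2]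

end NodalRadial

/-! ### The regularized planar system and its flow. -/

namespace NodalRadial

open scoped NNReal

/-- A weight `q` on the half line with logarithmic derivative `η`. -/
structure Weight (q η : ℝ → ℝ) (C₁ C₂ : ℝ) : Prop where
  C₁_pos : 0 < C₁
  C₂_pos : 0 < C₂
  pos : ∀ t, 0 < t → 0 < q t
  deriv : ∀ t, 0 < t → HasDerivAt q (η t * q t) t
  cont : ContinuousOn η (Ioi 0)
  anti : AntitoneOn η (Ioi 0)
  low : ∀ t, 0 < t → C₁ ≤ t * η t
  up : ∀ t, 0 < t → t * η t ≤ C₂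

/-- A regularized odd power `g` of order `P - 1` with primitive `K`. -/
structure Kinetic (P c m : ℝ) (g K : ℝ → ℝ) : Prop where
  one_lt : 1 < P
  c_pos : 0 < c
  m_pos : 0 < m
  lip : LocallyLipschitz g
  odd : ∀ y, g (-y) = -g y
  hasDeriv : ∀ y, HasDerivAt K (g y) y
  zero : K 0 = 0
  ub : ∀ y, 0 ≤ y → g y ≤ y ^ (P - 1)
  lb : ∀ y, 0 ≤ y → c * min 1 y ^ m ≤ g y
  growth : ∀ y, y * g y ≤ P * (K y + 1)

/-- A locally Lipschitz force `h` with potential `H` bounded below by `-Fb`. -/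
structure Potential (Fb : ℝ) (h H : ℝ → ℝ) : Prop where
  Fb_nonneg : 0 ≤ Fb
  lip : LocallyLipschitz h
  zero : h 0 = 0
  hasDeriv : ∀ s, HasDerivAt H (h s) s
  zero' : H 0 = 0
  lower : ∀ s, -Fb ≤ H s

/-- Solutions of the regularized system with data `(l, 0)` at time `ε`. -/
structure Sol (g h η : ℝ → ℝ) (ε T l : ℝ) (v y : ℝ → ℝ) : Prop where
  dv : ∀ t ∈ Icc ε T, HasDerivAt v (g (y t)) t
  dy : ∀ t ∈ Icc ε T, HasDerivAt y (-h (v t) - η t * y t) t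
  v_init : v ε = l
  y_init : y ε = 0

namespace Weight

variable {q η : ℝ → ℝ} {C₁ C₂ : ℝ}

lemma eta_pos (w : Weight q η C₁ C₂) {t : ℝ} (ht : 0 < t) : 0 < η t :=
  (pos_iff_pos_of_mul_pos (w.C₁_pos.trans_le (w.low t ht))).1 ht

end Weight

namespace Kinetic

variable {P c m : ℝ} {g K : ℝ → ℝ}

lemma map_zero (k : Kinetic P c m g K) : g 0 = 0 := by
  have := k.odd 0
  rw [neg_zero] at this
  linarith

lemma pos (k : Kinetic P c m g K) {y : ℝ} (hy : 0 < y) : 0 < g y :=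
  lt_of_lt_of_le (mul_pos k.c_pos (Real.rpow_pos_of_pos (lt_min one_pos hy) _)) (k.lb y hy.le)

lemma neg (k : Kinetic P c m g K) {y : ℝ} (hy : y < 0) : g y < 0 := by
  have := k.pos (y := -y) (by linarith)
  rw [k.odd] at this
  linarith

lemma mul_pos (k : Kinetic P c m g K) {y : ℝ} (hy : y ≠ 0) : 0 < y * g y := by
  rcases lt_or_gt_of_ne hy with h | h
  · exact mul_pos_of_neg_of_neg h (k.neg h)
  · exact _root_.mul_pos h (k.pos h)

lemma mul_nonneg (k : Kinetic P c m g K) (y : ℝ) : 0 ≤ y * g y := by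
  by_cases h : y = 0
  · simp [h]
  · exact (k.mul_pos h).le

lemma continuous (k : Kinetic P c m g K) : Continuous g := k.lip.continuous

lemma abs_le (k : Kinetic P c m g K) (y : ℝ) : |g y| ≤ |y| ^ (P - 1) := by
  rcases le_total 0 y with h | h
  · rw [abs_of_nonneg h, abs_of_nonneg]
    · exact k.ub y h
    · rcases h.eq_or_lt with rfl | h
      · rw [k.map_zero]
      · exact (k.pos h).le
  · rw [abs_of_nonpos h]
    have h1 := k.ub (-y) (by linarith)
    rw [k.odd] at h1
    rw [abs_of_nonpos]
    · exact h1
    · rcases h.eq_or_lt with rfl | h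
      · rw [k.map_zero]
      · exact (k.neg h).le

lemma monotoneOn (k : Kinetic P c m g K) : MonotoneOn K (Ici 0) := by
  refine monotoneOn_of_hasDerivWithinAt_nonneg (f' := g) (convex_Ici 0)
    (fun y _ => (k.hasDeriv y).continuousAt.continuousWithinAt)
    (fun y _ => (k.hasDeriv y).hasDerivWithinAt) (fun y hy => ?_)
  rw [interior_Ici] at hy
  exact (k.pos hy).le

lemma even (k : Kinetic P c m g K) (y : ℝ) : K (-y) = K y := by
  have hd : ∀ y, HasDerivAt (fun y => K (-y) - K y) 0 y := by
    intro y
    have h1 := ((k.hasDeriv (-y)).scomp y (hasDerivAt_neg y)).fun_sub (k.hasDeriv y)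
    rw [k.odd] at h1
    simpa [Function.comp_def] using h1
  have := is_const_of_deriv_eq_zero (fun y => (hd y).differentiableAt) (fun y => (hd y).deriv) y 0
  simp at this
  linarith

lemma abs (k : Kinetic P c m g K) (y : ℝ) : K |y| = K y := by
  rcases abs_choice y with h | h <;> rw [h]
  exact k.even y

lemma nonneg (k : Kinetic P c m g K) (y : ℝ) : 0 ≤ K y := by
  rw [← k.abs, ← k.zero]
  exact k.monotoneOn self_mem_Ici (abs_nonneg y) (abs_nonneg y)

/-- Beyond |y| = 1 the slope of K is at least c. This coercivity turns energy bounds into bounds on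
y whose constants survive the removal of the regularization. -/
lemma linear_le (k : Kinetic P c m g K) (y : ℝ) : c * (|y| - 1) ≤ K y := by
  rw [← k.abs y]
  rcases le_total |y| 1 with h | h
  · have := k.nonneg |y|
    nlinarith [k.c_pos]
  · have hm : MonotoneOn (fun y => K y - c * (y - 1)) (Ici 1) := by
      refine monotoneOn_of_hasDerivWithinAt_nonneg (f' := fun y => g y - c) (convex_Ici 1)
        (fun y _ => ?_) (fun y _ => ?_) (fun y hy => ?_)
      · have := (k.hasDeriv y).continuousAt
        exact (this.sub (by fun_prop)).continuousWithinAt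
      · have := (k.hasDeriv y).fun_sub (((hasDerivAt_id y).sub_const 1).const_mul c)
        simpa using this.hasDerivWithinAt
      · rw [interior_Ici] at hy
        have h1 := k.lb y (by linarith [mem_Ioi.1 hy])
        rw [min_eq_left (le_of_lt hy), Real.one_rpow] at h1
        linarith
    have := hm self_mem_Ici h h
    simp only [sub_self, mul_zero, sub_zero] at this
    linarith [k.nonneg 1]

lemma zero_lt (k : Kinetic P c m g K) {y : ℝ} (hy : y ≠ 0) : 0 < K y := by
  refine lt_of_le_of_ne (k.nonneg y) fun h => ?_
  have hmin : IsLocalMin K y := Filter.Eventually.of_forall fun z => by rw [← h]; exact k.nonneg z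
  have := hmin.hasDerivAt_eq_zero (k.hasDeriv y)
  have h2 := k.mul_pos hy
  rw [this, mul_zero] at h2
  exact lt_irrefl _ h2

end Kinetic

namespace Potential

variable {Fb : ℝ} {h H : ℝ → ℝ}

lemma continuous (p : Potential Fb h H) : Continuous h := p.lip.continuous

lemma continuous' (p : Potential Fb h H) : Continuous H :=
  continuous_iff_continuousAt.2 fun s => (p.hasDeriv s).continuousAt

end Potential

lemma Kinetic.continuous' {P c m : ℝ} {g K : ℝ → ℝ} (k : Kinetic P c m g K) : Continuous K :=
  continuous_iff_continuousAt.2 fun s => (k.hasDeriv s).continuousAt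

lemma hasDerivAt_energy {g K h H v y : ℝ → ℝ} {P c m Fb e t : ℝ} (k : Kinetic P c m g K)
    (p : Potential Fb h H) (dv : HasDerivAt v (g (y t)) t)
    (dy : HasDerivAt y (-h (v t) - e * y t) t) :
    HasDerivAt (fun t => K (y t) + H (v t)) (-(e * (y t * g (y t)))) t := by
  have h1 : HasDerivAt (fun t => K (y t) + H (v t))
      (g (y t) * (-h (v t) - e * y t) + h (v t) * g (y t)) t :=
    ((k.hasDeriv (y t)).comp t dy).fun_add ((p.hasDeriv (v t)).comp t dv)
  have h2 : g (y t) * (-h (v t) - e * y t) + h (v t) * g (y t) = -(e * (y t * g (y t))) := by ring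
  rwa [h2] at h1

namespace Sol

variable {q η g K h H v y : ℝ → ℝ} {C₁ C₂ P c m Fb ε T l : ℝ}

lemma continuousOn_v (s : Sol g h η ε T l v y) : ContinuousOn v (Icc ε T) := fun t ht =>
  (s.dv t ht).continuousAt.continuousWithinAt

lemma continuousOn_y (s : Sol g h η ε T l v y) : ContinuousOn y (Icc ε T) := fun t ht =>
  (s.dy t ht).continuousAt.continuousWithinAt

end Sol

/-- Energy decays along solutions on an initial interval. -/
lemma antitoneOn_energy {η g K h H v y : ℝ → ℝ} {P c m Fb a b : ℝ} (k : Kinetic P c m g K)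
    (p : Potential Fb h H) (hη : ∀ t ∈ Icc a b, 0 ≤ η t)
    (hvc : ContinuousOn v (Icc a b)) (hyc : ContinuousOn y (Icc a b))
    (dv : ∀ t ∈ Ioo a b, HasDerivAt v (g (y t)) t)
    (dy : ∀ t ∈ Ioo a b, HasDerivAt y (-h (v t) - η t * y t) t) :
    AntitoneOn (fun t => K (y t) + H (v t)) (Icc a b) := by
  refine antitoneOn_of_hasDerivWithinAt_nonpos (f' := fun t => -(η t * (y t * g (y t))))
    (convex_Icc a b) ?_ (fun t ht => ?_) (fun t ht => ?_)
  · exact (k.continuous'.comp_continuousOn hyc).add (p.continuous'.comp_continuousOn hvc)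
  · rw [interior_Icc] at ht
    exact (hasDerivAt_energy k p (dv t ht) (dy t ht)).hasDerivWithinAt
  · rw [interior_Icc] at ht
    have := mul_nonneg (hη t (Ioo_subset_Icc_self ht)) (k.mul_nonneg (y t))
    linarith

lemma exists_lipschitzWith_comp_clamp {f : ℝ → ℝ} (hf : LocallyLipschitz f) {M : ℝ} (hM : 0 ≤ M) :
    ∃ K : ℝ≥0, LipschitzWith K fun s => f (max (-M) (min M s)) := by
  obtain ⟨K, hK⟩ := (hf.locallyLipschitzOn (s := Icc (-M) M)).exists_lipschitzOnWith_of_compact isCompact_Icc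
  refine ⟨K, LipschitzWith.of_dist_le_mul fun s t => ?_⟩
  have hm : ∀ s, max (-M) (min M s) ∈ Icc (-M) M := fun s =>
    ⟨le_max_left _ _, max_le (by linarith) (min_le_left _ _)⟩
  refine (hK.dist_le_mul _ (hm s) _ (hm t)).trans (mul_le_mul_of_nonneg_left ?_ K.2)
  rw [Real.dist_eq, Real.dist_eq]
  refine (abs_max_sub_max_le_max _ _ _ _).trans (max_le (by simp) ?_)
  exact (abs_min_sub_min_le_max _ _ _ _).trans (max_le (by simp) le_rfl)

/-- The regularized system has a global flow, bi-Lipschitz in the initial value. -/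
theorem exists_flow {q η g K h H : ℝ → ℝ} {C₁ C₂ P c m Fb ε T Λ : ℝ} (w : Weight q η C₁ C₂)
    (k : Kinetic P c m g K) (p : Potential Fb h H) (hε : 0 < ε) (hεT : ε < T) (hΛ : 0 ≤ Λ) :
    ∃ V Y : ℝ → ℝ → ℝ, ∃ L : ℝ, 0 < L ∧ (∀ l ∈ Icc 0 Λ, Sol g h η ε T l (V l) (Y l)) ∧
      (∀ t ∈ Icc ε T, V 0 t = 0 ∧ Y 0 t = 0) ∧
      (∀ l ∈ Icc 0 Λ, ∀ t ∈ Icc ε T, |V l t| ≤ L ∧ |Y l t| ≤ L) ∧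
      ∀ l ∈ Icc 0 Λ, ∀ l' ∈ Icc 0 Λ, ∀ t ∈ Icc ε T,
        |V l t - V l' t| ≤ L * |l - l'| ∧ |Y l t - Y l' t| ≤ L * |l - l'| ∧
        |l - l'| ≤ L * (|V l t - V l' t| + |Y l t - Y l' t|) := by
  -- a priori bounds
  obtain ⟨Hm, hHm⟩ := (isCompact_Icc (a := (0:ℝ)) (b := Λ)).exists_bound_of_continuousOn
    p.continuous'.continuousOn
  have hHm0 : 0 ≤ Hm := (norm_nonneg _).trans (hHm 0 ⟨le_rfl, hΛ⟩)
  -- Energy starts below `Hm` and decays, while K(y) ≥ c(|y| - 1) and H ≥ -Fb. This bounds |y| by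
  -- `Y0`, hence the speed by `Y0 ^ (P - 1)` and |v| by `V0`. Truncating the vector field at a level
  -- M above both makes it globally Lipschitz and leaves these solutions unchanged.
  set Y0 := (Hm + Fb) / c + 1 with hY0
  have hc := k.c_pos
  have hFb := p.Fb_nonneg
  have hY0p : 0 < Y0 := by positivity
  set V0 := Λ + Y0 ^ (P - 1) * (T - ε) with hV0
  have hV0p : 0 ≤ V0 := by
    have : 0 ≤ Y0 ^ (P - 1) * (T - ε) := mul_nonneg (by positivity) (by linarith)
    linarith
  set M := Y0 + V0 + 1 with hM
  have hM0 : 0 ≤ M := by positivity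
  set cl : ℝ → ℝ := fun s => max (-M) (min M s) with hcl
  have cl_id : ∀ s, |s| ≤ M → cl s = s := fun s hs => by
    rw [_root_.abs_le] at hs
    simp only [hcl]; rw [min_eq_right hs.2, max_eq_right hs.1]
  have cl_abs : ∀ s, |cl s| ≤ M := fun s => by
    rw [_root_.abs_le]
    exact ⟨le_max_left _ _, max_le (by linarith) (min_le_left _ _)⟩
  have clmem : ∀ s, cl s ∈ Icc (-M) M := fun s => _root_.abs_le.1 (cl_abs s)
  obtain ⟨Kg, hKg⟩ := exists_lipschitzWith_comp_clamp k.lip hM0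
  obtain ⟨Kh, hKh⟩ := exists_lipschitzWith_comp_clamp p.lip hM0
  obtain ⟨Ki, hKi⟩ := exists_lipschitzWith_comp_clamp (LipschitzWith.id (α := ℝ)).locallyLipschitz hM0
  obtain ⟨Bg, hBg⟩ := (isCompact_Icc (a := -M) (b := M)).exists_bound_of_continuousOn
    k.continuous.continuousOn
  obtain ⟨Bh, hBh⟩ := (isCompact_Icc (a := -M) (b := M)).exists_bound_of_continuousOn
    p.continuous.continuousOn
  have hBg0 : 0 ≤ Bg := (norm_nonneg _).trans (hBg 0 ⟨by linarith, hM0⟩)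
  have hBh0 : 0 ≤ Bh := (norm_nonneg _).trans (hBh 0 ⟨by linarith, hM0⟩)
  set e := η (ε / 2) with he
  have he0 : 0 < e := w.eta_pos (by linarith)
  have hηb : ∀ t ∈ Icc (ε / 2) (T + 1), 0 ≤ η t ∧ η t ≤ e := fun t ht => by
    have ht0 : 0 < t := by linarith [ht.1]
    exact ⟨(w.eta_pos ht0).le, w.anti (show 0 < ε / 2 by linarith) ht0 ht.1⟩
  set Φ : ℝ → ℝ × ℝ → ℝ × ℝ := fun t x => (g (cl x.2), -h (cl x.1) - η t * cl x.2) with hΦ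
  set KΦ : ℝ≥0 := Kg + Kh + Real.toNNReal e * Ki with hKΦ
  have hlip : ∀ t ∈ Icc (ε / 2) (T + 1), LipschitzWith KΦ (Φ t) := by
    intro t ht
    refine LipschitzWith.of_dist_le_mul fun x z => ?_
    have d1 : dist x.1 z.1 ≤ dist x z := by rw [Prod.dist_eq]; exact le_max_left _ _
    have d2 : dist x.2 z.2 ≤ dist x z := by rw [Prod.dist_eq]; exact le_max_right _ _
    have e1 := hKg.dist_le_mul x.2 z.2
    have e2 := hKh.dist_le_mul x.1 z.1
    have e3 := hKi.dist_le_mul x.2 z.2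
    simp only [id] at e3
    have hk : (KΦ : ℝ) = Kg + Kh + e * Ki := by
      simp only [hKΦ, NNReal.coe_add, NNReal.coe_mul, Real.coe_toNNReal _ he0.le]
    have d0 : 0 ≤ dist x z := dist_nonneg
    have f1 : (Kg : ℝ) * dist x.2 z.2 ≤ Kg * dist x z := mul_le_mul_of_nonneg_left d2 Kg.2
    have f2 : (Kh : ℝ) * dist x.1 z.1 ≤ Kh * dist x z := mul_le_mul_of_nonneg_left d1 Kh.2
    have f3 : (Ki : ℝ) * dist x.2 z.2 ≤ Ki * dist x z := mul_le_mul_of_nonneg_left d2 Ki.2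
    have g1 : 0 ≤ (Kg : ℝ) * dist x z := mul_nonneg Kg.2 d0
    have g2 : 0 ≤ (Kh : ℝ) * dist x z := mul_nonneg Kh.2 d0
    have g3 : 0 ≤ (Ki : ℝ) * dist x z := mul_nonneg Ki.2 d0
    rw [Prod.dist_eq, hk]
    refine max_le ?_ ?_
    · simp only [hΦ]
      nlinarith [mul_nonneg he0.le g3]
    · simp only [hΦ]
      rw [Real.dist_eq] at e2 e3 ⊢
      rw [show -h (cl x.1) - η t * cl x.2 - (-h (cl z.1) - η t * cl z.2)
        = -(h (cl x.1) - h (cl z.1)) - η t * (cl x.2 - cl z.2) by ring]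
      have := abs_sub (-(h (cl x.1) - h (cl z.1))) (η t * (cl x.2 - cl z.2))
      rw [abs_neg, abs_mul, abs_of_nonneg (hηb t ht).1] at this
      have h4 : η t * |cl x.2 - cl z.2| ≤ e * (Ki * dist x z) :=
        mul_le_mul (hηb t ht).2 (e3.trans f3) (abs_nonneg _) he0.le
      simp only [hcl] at h4 this e2 ⊢
      nlinarith
  have t0 : ε ∈ Icc (ε / 2) (T + 1) := ⟨by linarith, by linarith⟩
  set B := Bg + Bh + e * M with hB
  have hB0 : 0 ≤ B := by positivity
  have hbound : ∀ t ∈ Icc (ε / 2) (T + 1), ∀ x, ‖Φ t x‖ ≤ B := by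
    intro t ht x
    rw [Prod.norm_def]
    have h1 := hBg _ (clmem x.2)
    have h2 := hBh _ (clmem x.1)
    have h3 : 0 ≤ e * M := by positivity
    refine max_le (by simp only [hΦ]; linarith) ?_
    simp only [hΦ]
    have := abs_sub (-h (cl x.1)) (η t * cl x.2)
    rw [abs_neg, abs_mul, abs_of_nonneg (hηb t ht).1] at this
    have h4 : η t * |cl x.2| ≤ e * M := mul_le_mul (hηb t ht).2 (cl_abs _) (abs_nonneg _) he0.le
    rw [Real.norm_eq_abs] at h2 ⊢
    linarith
  set A := B * (T + 1) + Λ with hA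
  have hA0 : 0 ≤ A := by
    have : 0 ≤ B * (T + 1) := mul_nonneg hB0 (by linarith)
    linarith
  -- The time interval [ε/2, T + 1] is larger than needed, so that solutions have two-sided
  -- derivatives on all of [ε, T].
  have hPL : IsPicardLindelof Φ (⟨ε, t0⟩ : Icc (ε / 2) (T + 1)) (0 : ℝ × ℝ) (Real.toNNReal A)
      (Real.toNNReal Λ) (Real.toNNReal B) KΦ := by
    refine ⟨fun t ht => (hlip t ht).lipschitzOnWith, fun x _ => ?_, fun t ht x _ => ?_, ?_⟩
    · have : ContinuousOn η (Icc (ε / 2) (T + 1)) := w.cont.mono fun t ht => by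
        simp only [mem_Ioi]; linarith [ht.1]
      simp only [hΦ]
      fun_prop
    · rw [Real.coe_toNNReal _ hB0]; exact hbound t ht x
    · rw [Real.coe_toNNReal _ hB0, Real.coe_toNNReal _ hΛ, Real.coe_toNNReal _ hA0]
      simp only [hA]
      have : max (T + 1 - ε) (ε - ε / 2) ≤ T + 1 := max_le (by linarith) (by linarith)
      nlinarith
  have hex : ∀ l : ℝ, ∃ α : ℝ → ℝ × ℝ, l ∈ Icc 0 Λ → α ε = (l, 0) ∧
      ∀ t ∈ Icc (ε / 2) (T + 1), HasDerivWithinAt α (Φ t (α t)) (Icc (ε / 2) (T + 1)) t := by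
    intro l
    by_cases hl : l ∈ Icc 0 Λ
    · obtain ⟨α, h1, h2⟩ := hPL.exists_eq_forall_mem_Icc_hasDerivWithinAt (x := (l, 0)) (by
        rw [mem_closedBall_zero_iff, Prod.norm_def, Real.coe_toNNReal _ hΛ]
        simp only [norm_zero]
        exact max_le (by rw [Real.norm_of_nonneg hl.1]; exact hl.2) hΛ)
      exact ⟨α, fun _ => ⟨h1, h2⟩⟩
    · exact ⟨fun _ => 0, fun h => absurd h hl⟩
  choose α hα using hex
  have hαd : ∀ l ∈ Icc 0 Λ, ∀ t ∈ Icc ε T, HasDerivAt (α l) (Φ t (α l t)) t := fun l hl t ht =>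
    ((hα l hl).2 t ⟨by linarith [ht.1], by linarith [ht.2]⟩).hasDerivAt
      (Icc_mem_nhds (by linarith [ht.1]) (by linarith [ht.2]))
  have hd1 : ∀ l ∈ Icc 0 Λ, ∀ t ∈ Icc ε T, HasDerivAt (fun t => (α l t).1) (g (cl (α l t).2)) t :=
    fun l hl t ht => (hasFDerivAt_fst (𝕜 := ℝ) (E := ℝ) (F := ℝ)).comp_hasDerivAt t (hαd l hl t ht)
  have hd2 : ∀ l ∈ Icc 0 Λ, ∀ t ∈ Icc ε T,
      HasDerivAt (fun t => (α l t).2) (-h (cl (α l t).1) - η t * cl (α l t).2) t :=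
    fun l hl t ht => (hasFDerivAt_snd (𝕜 := ℝ) (E := ℝ) (F := ℝ)).comp_hasDerivAt t (hαd l hl t ht)
  have hsub : ∀ t ∈ Icc ε T, t ∈ Icc (ε / 2) (T + 1) := fun t ht =>
    ⟨by linarith [ht.1], by linarith [ht.2]⟩
  set Ex := Real.exp (KΦ * T) with hEx
  -- Gronwall in both directions
  have hgr : ∀ a b : ℝ → ℝ × ℝ, (∀ t ∈ Icc ε T, HasDerivAt a (Φ t (a t)) t) →
      (∀ t ∈ Icc ε T, HasDerivAt b (Φ t (b t)) t) → ∀ t ∈ Icc ε T,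
      dist (a t) (b t) ≤ dist (a ε) (b ε) * Ex ∧ dist (a ε) (b ε) ≤ dist (a t) (b t) * Ex := by
    intro a b ha hb t ht
    have cont : ∀ a : ℝ → ℝ × ℝ, (∀ t ∈ Icc ε T, HasDerivAt a (Φ t (a t)) t) →
        ContinuousOn a (Icc ε T) := fun a ha t ht => (ha t ht).continuousAt.continuousWithinAt
    have hexp : Real.exp (KΦ * (t - ε)) ≤ Ex := Real.exp_le_exp.2
      (mul_le_mul_of_nonneg_left (by linarith [ht.2]) KΦ.2)
    constructor
    · have := dist_le_of_trajectories_ODE_of_mem (v := Φ) (s := fun _ => univ) (K := KΦ)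
        (a := ε) (b := T) (δ := dist (a ε) (b ε)) (f := a) (g := b)
        (fun t ht => (hlip t (hsub t ⟨ht.1, ht.2.le⟩)).lipschitzOnWith) (cont a ha)
        (fun t ht => (ha t ⟨ht.1, ht.2.le⟩).hasDerivWithinAt) (fun _ _ => trivial) (cont b hb)
        (fun t ht => (hb t ⟨ht.1, ht.2.le⟩).hasDerivWithinAt) (fun _ _ => trivial) le_rfl t ht
      exact this.trans (mul_le_mul_of_nonneg_left hexp dist_nonneg)
    -- Gronwall for the time-reversed system bounds the distance at ε by the distance at t. This is
    -- the lower half of the bi-Lipschitz estimate, which later gives injectivity of the endpoint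
    -- map and keeps orbits off the origin.
    · have hrev : ∀ s ∈ Icc 0 (t - ε), t - s ∈ Icc ε T := fun s hs =>
        ⟨by linarith [hs.2], by linarith [hs.1, ht.2]⟩
      have hd : ∀ a : ℝ → ℝ × ℝ, (∀ t ∈ Icc ε T, HasDerivAt a (Φ t (a t)) t) →
          ∀ s ∈ Icc 0 (t - ε), HasDerivAt (fun s => a (t - s)) (-Φ (t - s) (a (t - s))) s := by
        intro a ha s hs
        have := (ha _ (hrev s hs)).scomp s ((hasDerivAt_id s).const_sub t)
        simpa [Function.comp_def] using this
      have := dist_le_of_trajectories_ODE_of_mem (v := fun s x => -Φ (t - s) x) (s := fun _ => univ)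
        (K := KΦ) (a := 0) (b := t - ε) (δ := dist (a t) (b t)) (f := fun s => a (t - s))
        (g := fun s => b (t - s))
        (fun s hs => ((hlip _ (hsub _ (hrev s ⟨hs.1, hs.2.le⟩))).neg).lipschitzOnWith)
        (fun s hs => (hd a ha s hs).continuousAt.continuousWithinAt)
        (fun s hs => (hd a ha s ⟨hs.1, hs.2.le⟩).hasDerivWithinAt) (fun _ _ => trivial)
        (fun s hs => (hd b hb s hs).continuousAt.continuousWithinAt)
        (fun s hs => (hd b hb s ⟨hs.1, hs.2.le⟩).hasDerivWithinAt) (fun _ _ => trivial) (by simp)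
        (t - ε) ⟨by linarith [ht.1], le_rfl⟩
      simp only [sub_sub_cancel, sub_zero] at this
      exact this.trans (mul_le_mul_of_nonneg_left hexp dist_nonneg)
  -- solutions stay where the truncation is inactive
  have hstay : ∀ l ∈ Icc 0 Λ, ∀ t ∈ Icc ε T, |(α l t).1| < M ∧ |(α l t).2| < M := by
    intro l hl
    by_contra! hcon
    obtain ⟨tb, htb, htb2⟩ := hcon
    have hac : ContinuousOn (α l) (Icc ε T) := fun t ht =>
      (hαd l hl t ht).continuousAt.continuousWithinAt
    have hv : ContinuousOn (fun t => (α l t).1) (Icc ε T) := continuous_fst.comp_continuousOn hac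
    have hy : ContinuousOn (fun t => (α l t).2) (Icc ε T) := continuous_snd.comp_continuousOn hac
    have hnc : ContinuousOn (fun t => max |(α l t).1| |(α l t).2|) (Icc ε T) := ContinuousOn.sup hv.abs hy.abs
    have hcpt : IsCompact (Icc ε T ∩ (fun t => max |(α l t).1| |(α l t).2|) ⁻¹' (Ici M)) :=
      isCompact_Icc.of_isClosed_subset (hnc.preimage_isClosed_of_isClosed isClosed_Icc isClosed_Ici)
        inter_subset_left
    obtain ⟨s, ⟨hs1, hs2⟩, hsmin⟩ := hcpt.exists_isLeast ⟨tb, htb, by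
      simp only [mem_preimage, mem_Ici]
      by_contra! h'
      rw [max_lt_iff] at h'
      exact absurd (htb2 h'.1) (not_le.2 h'.2)⟩
    simp only [mem_preimage, mem_Ici] at hs2
    have hlt : ∀ t ∈ Ico ε s, |(α l t).1| < M ∧ |(α l t).2| < M := by
      intro t ht
      rw [← max_lt_iff]
      by_contra! h'
      exact absurd (hsmin ⟨⟨ht.1, by linarith [ht.2, hs1.2]⟩, h'⟩) (not_le.2 ht.2)
    have hss : Icc ε s ⊆ Icc ε T := Icc_subset_Icc_right hs1.2
    have dv : ∀ t ∈ Ioo ε s, HasDerivAt (fun t => (α l t).1) (g (α l t).2) t := fun t ht => by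
      have h1 := hd1 l hl t (hss ⟨ht.1.le, ht.2.le⟩)
      rwa [cl_id _ (hlt t ⟨ht.1.le, ht.2⟩).2.le] at h1
    have dy : ∀ t ∈ Ioo ε s, HasDerivAt (fun t => (α l t).2) (-h (α l t).1 - η t * (α l t).2) t :=
      fun t ht => by
      have h1 := hd2 l hl t (hss ⟨ht.1.le, ht.2.le⟩)
      rwa [cl_id _ (hlt t ⟨ht.1.le, ht.2⟩).2.le, cl_id _ (hlt t ⟨ht.1.le, ht.2⟩).1.le] at h1
    have hE := antitoneOn_energy k p (fun t ht => (hηb t (hsub t (hss ht))).1) (hv.mono hss)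
      (hy.mono hss) dv dy
    have hyb : ∀ t ∈ Icc ε s, |(α l t).2| ≤ Y0 := by
      intro t ht
      have h1 := hE ⟨le_rfl, hs1.1⟩ ht ht.1
      simp only [(hα l hl).1, k.zero] at h1
      have h2 := k.linear_le (α l t).2
      have h3 := p.lower (α l t).1
      have h4 := (le_abs_self _).trans (hHm l hl)
      have h5 : c * (|(α l t).2| - 1) ≤ Hm + Fb := by linarith
      simp only [hY0]
      rw [← sub_le_iff_le_add, le_div_iff₀ hc]
      linarith
    have hvb : |(α l s).1| ≤ V0 := by
      have h1 := (convex_Icc ε s).norm_image_sub_le_of_norm_hasDerivWithin_le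
        (f := fun t => (α l t).1) (f' := fun t => g (cl (α l t).2)) (C := Y0 ^ (P - 1)) (x := ε) (y := s)
        (fun t ht => (hd1 l hl t (hss ht)).hasDerivWithinAt)
        (fun t ht => by
          rw [cl_id _ ((hyb t ht).trans (by simp only [hM]; linarith))]
          exact (k.abs_le _).trans (Real.rpow_le_rpow (abs_nonneg _) (hyb t ht)
            (by linarith [k.one_lt]))) ⟨le_rfl, hs1.1⟩ ⟨hs1.1, le_rfl⟩
      simp only [(hα l hl).1, Real.norm_eq_abs] at h1
      rw [abs_of_nonneg (by linarith [hs1.1] : 0 ≤ s - ε)] at h1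
      have h2 : Y0 ^ (P - 1) * (s - ε) ≤ Y0 ^ (P - 1) * (T - ε) :=
        mul_le_mul_of_nonneg_left (by linarith [hs1.2]) (by positivity)
      have h3 := abs_sub_abs_le_abs_sub (α l s).1 l
      rw [abs_of_nonneg hl.1] at h3
      simp only [hV0]
      linarith [hl.2]
    have := hyb s ⟨hs1.1, le_rfl⟩
    rcases le_max_iff.1 hs2 with h' | h' <;> simp only [hM] at h' <;> linarith
  have hz : ∀ t ∈ Icc ε T, HasDerivAt (fun _ : ℝ => (0 : ℝ × ℝ)) (Φ t 0) t := fun t _ => by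
    have h1 : Φ t 0 = 0 := by
      simp only [hΦ, Prod.fst_zero, Prod.snd_zero]
      rw [cl_id 0 (by simpa using hM0), k.map_zero, p.zero]
      simp
    rw [h1]; exact hasDerivAt_const _ _
  have hL1 : 1 ≤ Ex := by
    rw [hEx, Real.one_le_exp_iff]
    exact mul_nonneg KΦ.2 (by linarith)
  refine ⟨fun l t => (α l t).1, fun l t => (α l t).2, Ex + M, by positivity, fun l hl => ?_,
    fun t ht => ?_, fun l hl t ht => ?_, fun l hl l' hl' t ht => ?_⟩
  · refine ⟨fun t ht => ?_, fun t ht => ?_, by simp [(hα l hl).1], by simp [(hα l hl).1]⟩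
    · have h1 := hd1 l hl t ht
      rwa [cl_id _ (hstay l hl t ht).2.le] at h1
    · have h1 := hd2 l hl t ht
      rwa [cl_id _ (hstay l hl t ht).2.le, cl_id _ (hstay l hl t ht).1.le] at h1
  · have h0 : (0:ℝ) ∈ Icc 0 Λ := ⟨le_rfl, hΛ⟩
    have := (hgr (α 0) (fun _ => 0) (hαd 0 h0) hz t ht).1
    rw [(hα 0 h0).1] at this
    have h2 : dist ((0, 0) : ℝ × ℝ) 0 = 0 := by simp
    rw [h2, zero_mul] at this
    have h3 : α 0 t = 0 := dist_le_zero.1 this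
    simp [h3]
  · have := hstay l hl t ht
    exact ⟨by linarith [this.1], by linarith [this.2]⟩
  · have h1 := hgr (α l) (α l') (hαd l hl) (hαd l' hl') t ht
    rw [(hα l hl).1, (hα l' hl').1] at h1
    have h2 : dist ((l, 0) : ℝ × ℝ) (l', 0) = |l - l'| := by
      rw [Prod.dist_eq]; simp [Real.dist_eq]
    rw [h2, Prod.dist_eq, Real.dist_eq, Real.dist_eq] at h1
    have h4 : 0 ≤ |l - l'| := abs_nonneg _
    have h5 : 0 ≤ |(α l t).1 - (α l' t).1| := abs_nonneg _
    have h6 : 0 ≤ |(α l t).2 - (α l' t).2| := abs_nonneg _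
    have h7 := (max_le_iff.1 h1.1)
    have h8 : max |(α l t).1 - (α l' t).1| |(α l t).2 - (α l' t).2|
      ≤ |(α l t).1 - (α l' t).1| + |(α l t).2 - (α l' t).2| := max_le (by linarith) (by linarith)
    have h9 : |l - l'| * Ex ≤ (Ex + M) * |l - l'| := by
      have := mul_nonneg hM0 h4; linarith
    refine ⟨h7.1.trans h9, h7.2.trans h9, ?_⟩
    refine h1.2.trans ?_
    rw [mul_comm]
    exact mul_le_mul (by linarith) h8 (le_max_of_le_left h5) (by positivity)

end NodalRadial

/-! ### The polar angle as a counter of zeros. -/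

namespace NodalRadial

open scoped NNReal

lemma exists_lt_of_hasDerivAt_pos_left {f : ℝ → ℝ} {f' a t : ℝ} (hf : HasDerivAt f f' t)
    (hp : 0 < f') (ha : a < t) : ∃ s ∈ Ioo a t, f s < f t := by
  have h1 := (hasDerivAt_iff_tendsto_slope.1 hf).eventually (lt_mem_nhds hp)
  have h2 : ∀ᶠ s in 𝓝[<] t, 0 < slope f t s := h1.filter_mono (nhdsWithin_mono _ fun x hx => ne_of_lt hx)
  obtain ⟨s, hs1, hs2⟩ := (h2.and (Ioo_mem_nhdsLT ha)).exists
  refine ⟨s, hs2, ?_⟩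
  rw [slope_def_field, div_pos_iff] at hs1
  rcases hs1 with h | h
  · linarith [hs2.2, h.2]
  · linarith [h.1]

lemma exists_lt_of_hasDerivAt_pos_right {f : ℝ → ℝ} {f' b t : ℝ} (hf : HasDerivAt f f' t)
    (hp : 0 < f') (hb : t < b) : ∃ s ∈ Ioo t b, f t < f s := by
  obtain ⟨s, hs, h⟩ := exists_lt_of_hasDerivAt_pos_left (f := fun s => -f (-s)) (t := -t) (a := -b)
    (f' := f') (by
      have := (((neg_neg t).symm ▸ hf : HasDerivAt f f' (-(-t))).scomp (-t) (hasDerivAt_neg (-t))).neg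
      simpa [Function.comp_def] using! this) hp (by linarith)
  simp only [neg_neg] at h
  exact ⟨-s, ⟨by linarith [hs.2], by linarith [hs.1]⟩, by linarith⟩

/-- A level crossed only with positive derivative is crossed at most once. -/
lemma lt_of_crosses_upward {f f' : ℝ → ℝ} {a b θ : ℝ} (hf : ∀ t ∈ Icc a b, HasDerivAt f (f' t) t)
    (hp : ∀ t ∈ Icc a b, f t = θ → 0 < f' t) {s t : ℝ} (hs : s ∈ Icc a b) (ht : t ∈ Icc a b)
    (hst : s < t) (h : θ ≤ f s) : θ < f t := by
  have main : ∀ t ∈ Icc a b, s < t → ¬ f t < θ := by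
    intro t ht hst hlt
    have hsub : Icc s t ⊆ Icc a b := Icc_subset_Icc hs.1 ht.2
    have hc : ContinuousOn f (Icc s t) := fun x hx => (hf x (hsub hx)).continuousAt.continuousWithinAt
    have hcpt : IsCompact (Icc s t ∩ f ⁻¹' (Ici θ)) :=
      isCompact_Icc.of_isClosed_subset (hc.preimage_isClosed_of_isClosed isClosed_Icc isClosed_Ici)
        inter_subset_left
    obtain ⟨r, ⟨hr1, hr2⟩, hrmax⟩ := hcpt.exists_isGreatest ⟨s, ⟨le_rfl, hst.le⟩, h⟩
    have hrt : r < t := lt_of_le_of_ne hr1.2 (by rintro rfl; exact absurd hlt (not_lt.2 hr2))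
    have hafter : ∀ x ∈ Ioc r t, f x < θ := by
      intro x hx
      by_contra! h'
      exact absurd (hrmax ⟨⟨by linarith [hr1.1, hx.1], hx.2⟩, h'⟩) (not_le.2 hx.1)
    have hreq : f r = θ := by
      refine le_antisymm ?_ hr2
      have hcr : ContinuousWithinAt f (Ioc r t) r := (hf r (hsub hr1)).continuousAt.continuousWithinAt
      have : r ∈ closure (Ioc r t) := by rw [closure_Ioc hrt.ne]; exact ⟨le_rfl, hrt.le⟩
      exact hcr.closure_le this continuousWithinAt_const (fun x hx => (hafter x hx).le)
    obtain ⟨x, hx, hfx⟩ := exists_lt_of_hasDerivAt_pos_right (hf r (hsub hr1)) (hp r (hsub hr1) hreq) hrt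
    have := hafter x ⟨hx.1, hx.2.le⟩
    linarith
  by_contra! h'
  have hte : f t = θ := le_antisymm h' (not_lt.1 (main t ht hst))
  obtain ⟨x, hx, hfx⟩ := exists_lt_of_hasDerivAt_pos_left (hf t ht) (hp t ht hte) hst
  exact main x ⟨by linarith [hs.1, hx.1], by linarith [ht.2, hx.2]⟩ hx.1 (by linarith)

/-- Angular velocity of the (clockwise) polar angle along a solution. -/
noncomputable def angVel (g h η v y : ℝ → ℝ) (t : ℝ) : ℝ :=
  (y t * g (y t) + v t * h (v t) + η t * (v t * y t)) / (v t ^ 2 + y t ^ 2)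

/-- The polar angle along a solution on `[ε, T]`. -/
noncomputable def angle (g h η v y : ℝ → ℝ) (ε T t : ℝ) : ℝ :=
  ∫ s in ε..t, angVel g h η v y (max ε (min T s))

section Angle

variable {q η g K h H v y : ℝ → ℝ} {C₁ C₂ P c m Fb ε T l : ℝ}

lemma Sol.continuousOn_angVel (s : Sol g h η ε T l v y) (w : Weight q η C₁ C₂) (k : Kinetic P c m g K)
    (p : Potential Fb h H) (hε : 0 < ε) (hne : ∀ t ∈ Icc ε T, 0 < v t ^ 2 + y t ^ 2) :
    ContinuousOn (angVel g h η v y) (Icc ε T) := by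
  have hv := s.continuousOn_v
  have hy := s.continuousOn_y
  have hη : ContinuousOn η (Icc ε T) := w.cont.mono fun t ht => lt_of_lt_of_le hε ht.1
  refine ContinuousOn.div ?_ ((hv.pow 2).add (hy.pow 2)) fun t ht => (hne t ht).ne'
  exact ((hy.mul (k.continuous.comp_continuousOn hy)).add (hv.mul (p.continuous.comp_continuousOn hv))).add
    (hη.mul (hv.mul hy))

lemma clamp_mem {ε T : ℝ} (h : ε ≤ T) (s : ℝ) : max ε (min T s) ∈ Icc ε T :=
  ⟨le_max_left _ _, max_le h (min_le_left _ _)⟩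

lemma clamp_eq {ε T s : ℝ} (h : s ∈ Icc ε T) : max ε (min T s) = s := by
  rw [min_eq_right h.2, max_eq_right h.1]

lemma Sol.hasDerivAt_angle (s : Sol g h η ε T l v y) (w : Weight q η C₁ C₂) (k : Kinetic P c m g K)
    (p : Potential Fb h H) (hε : 0 < ε) (hne : ∀ t ∈ Icc ε T, 0 < v t ^ 2 + y t ^ 2) {t : ℝ}
    (ht : t ∈ Icc ε T) : HasDerivAt (angle g h η v y ε T) (angVel g h η v y t) t := by
  have hT : ε ≤ T := ht.1.trans ht.2
  have hc : Continuous fun s => angVel g h η v y (max ε (min T s)) :=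
    (s.continuousOn_angVel w k p hε hne).comp_continuous (by fun_prop) (clamp_mem hT)
  have := intervalIntegral.integral_hasDerivAt_right (hc.intervalIntegrable ε t)
    (hc.stronglyMeasurableAtFilter _ _) hc.continuousAt
  rwa [clamp_eq ht] at this

@[simp] lemma angle_init (g h η v y : ℝ → ℝ) (ε T : ℝ) : angle g h η v y ε T ε = 0 := by
  simp [angle]

/-- Rotating the phase point by the integrated angle gives coordinates (A, B). The derivative of
B²/(v² + y²) vanishes by the choice of `angVel`, so B stays 0 as at ε. Then A cannot vanish because
the phase point does not, and it keeps the positive sign of A(ε) = l. -/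
lemma Sol.polar (s : Sol g h η ε T l v y) (w : Weight q η C₁ C₂) (k : Kinetic P c m g K)
    (p : Potential Fb h H) (hε : 0 < ε) (hl : 0 < l) (hne : ∀ t ∈ Icc ε T, 0 < v t ^ 2 + y t ^ 2) :
    ∀ t ∈ Icc ε T, v t = √(v t ^ 2 + y t ^ 2) * Real.cos (angle g h η v y ε T t) ∧
      y t = -√(v t ^ 2 + y t ^ 2) * Real.sin (angle g h η v y ε T t) := by
  set Θ := angle g h η v y ε T with hΘ
  have dΘ := fun t (ht : t ∈ Icc ε T) => s.hasDerivAt_angle w k p hε hne ht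
  set B : ℝ → ℝ := fun t => v t * Real.sin (Θ t) + y t * Real.cos (Θ t) with hB
  set A : ℝ → ℝ := fun t => v t * Real.cos (Θ t) - y t * Real.sin (Θ t) with hA
  have hAB : ∀ t, A t ^ 2 + B t ^ 2 = v t ^ 2 + y t ^ 2 := fun t => by
    simp only [hA, hB]
    linear_combination (v t ^ 2 + y t ^ 2) * Real.sin_sq_add_cos_sq (Θ t)
  have hd : ∀ t ∈ Icc ε T, HasDerivAt (fun t => B t ^ 2 / (v t ^ 2 + y t ^ 2)) 0 t := by
    intro t ht
    have dv := s.dv t ht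
    have dy := s.dy t ht
    have d0 := hne t ht
    have dB : HasDerivAt B (g (y t) * Real.sin (Θ t)
        + v t * (Real.cos (Θ t) * angVel g h η v y t)
        + ((-h (v t) - η t * y t) * Real.cos (Θ t)
        + y t * (-Real.sin (Θ t) * angVel g h η v y t))) t :=
      (dv.fun_mul (dΘ t ht).sin).fun_add (dy.fun_mul (dΘ t ht).cos)
    have dr : HasDerivAt (fun t => v t ^ 2 + y t ^ 2)
        ((2:ℕ) * v t ^ (2 - 1) * g (y t) + (2:ℕ) * y t ^ (2 - 1) * (-h (v t) - η t * y t)) t :=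
      (dv.fun_pow 2).fun_add (dy.fun_pow 2)
    have := (dB.fun_pow 2).fun_div dr d0.ne'
    refine this.congr_deriv ?_
    have hω : angVel g h η v y t * (v t ^ 2 + y t ^ 2)
      = y t * g (y t) + v t * h (v t) + η t * (v t * y t) := div_mul_cancel₀ _ d0.ne'
    have hsc := Real.sin_sq_add_cos_sq (Θ t)
    rw [div_eq_zero_iff]
    left
    simp only [hB]
    set ω := angVel g h η v y t
    set S := Real.sin (Θ t)
    set C := Real.cos (Θ t)
    push_cast
    linear_combination (2 * (v t * S + y t * C) * (v t * C - y t * S)) * hω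
  have hB0 : ∀ t ∈ Icc ε T, B t = 0 := by
    intro t ht
    have h1 := constant_of_derivWithin_zero (f := fun t => B t ^ 2 / (v t ^ 2 + y t ^ 2)) (a := ε) (b := T)
      (fun t ht => (hd t ht).differentiableAt.differentiableWithinAt) (fun t ht =>
        (hd t ⟨ht.1, ht.2.le⟩).hasDerivWithinAt.derivWithin
          (uniqueDiffOn_Icc (ht.1.trans_lt ht.2) t ⟨ht.1, ht.2.le⟩)) t ht
    have hBε : B ε = 0 := by simp [hB, hΘ, s.y_init]
    simp only [hBε] at h1
    rw [zero_pow two_ne_zero, zero_div, div_eq_zero_iff] at h1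
    rcases h1 with h1 | h1
    · exact pow_eq_zero_iff two_ne_zero |>.1 h1
    · exact absurd h1 (hne t ht).ne'
  have hApos : ∀ t ∈ Icc ε T, 0 < A t := by
    intro t ht
    by_contra! hcon
    have hc : ContinuousOn A (Icc ε t) := fun x hx => by
      have hx' : x ∈ Icc ε T := ⟨hx.1, hx.2.trans ht.2⟩
      have c1 := (s.dv x hx').continuousAt
      have c2 := (s.dy x hx').continuousAt
      have c3 := (dΘ x hx').continuousAt
      exact ((c1.mul (Real.continuous_cos.continuousAt.comp c3)).sub (c2.mul (Real.continuous_sin.continuousAt.comp c3))).continuousWithinAt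
    have hAε : A ε = l := by simp [hA, hΘ, s.y_init, s.v_init]
    obtain ⟨x, hx, hx0⟩ := intermediate_value_Icc' ht.1 hc
      (show (0:ℝ) ∈ Icc (A t) (A ε) from ⟨hcon, by rw [hAε]; exact hl.le⟩)
    have hx' : x ∈ Icc ε T := ⟨hx.1, hx.2.trans ht.2⟩
    have h1 := hAB x
    rw [hx0, hB0 x hx'] at h1
    have := hne x hx'
    simp at h1
    linarith
  intro t ht
  have h1 : √(v t ^ 2 + y t ^ 2) = A t := by
    rw [← hAB t, hB0 t ht]
    simp [Real.sqrt_sq (hApos t ht).le]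
  rw [h1]
  have h2 := hB0 t ht
  have hsc := Real.sin_sq_add_cos_sq (Θ t)
  simp only [hA, hB] at h2 ⊢
  constructor
  · linear_combination (-v t) * hsc + Real.sin (Θ t) * h2
  · linear_combination (-y t) * hsc + Real.cos (Θ t) * h2

lemma angVel_pos (k : Kinetic P c m g K)
    (hne : ∀ t ∈ Icc ε T, 0 < v t ^ 2 + y t ^ 2) {t : ℝ} (ht : t ∈ Icc ε T) (hv : v t = 0) :
    0 < angVel g h η v y t := by
  have h1 := hne t ht
  have hy : y t ≠ 0 := by
    intro h'
    rw [hv, h'] at h1; simp at h1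
  rw [angVel]
  refine div_pos ?_ h1
  rw [hv]
  simpa using k.mul_pos hy

/-- Trajectory with nonvanishing phase point and its angle. -/
structure IsAngle (g h η : ℝ → ℝ) (ε T : ℝ) (v y Θ : ℝ → ℝ) : Prop where
  init : Θ ε = 0
  deriv : ∀ t ∈ Icc ε T, HasDerivAt Θ (angVel g h η v y t) t
  pos : ∀ t ∈ Icc ε T, 0 < v t ^ 2 + y t ^ 2
  cos : ∀ t ∈ Icc ε T, v t = √(v t ^ 2 + y t ^ 2) * Real.cos (Θ t)
  sin : ∀ t ∈ Icc ε T, y t = -√(v t ^ 2 + y t ^ 2) * Real.sin (Θ t)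
  up : ∀ t ∈ Icc ε T, v t = 0 → 0 < angVel g h η v y t

lemma Sol.isAngle (s : Sol g h η ε T l v y) (w : Weight q η C₁ C₂) (k : Kinetic P c m g K)
    (p : Potential Fb h H) (hε : 0 < ε) (hl : 0 < l) (hne : ∀ t ∈ Icc ε T, 0 < v t ^ 2 + y t ^ 2) :
    IsAngle g h η ε T v y (angle g h η v y ε T) :=
  ⟨by simp, fun _ ht => s.hasDerivAt_angle w k p hε hne ht, hne,
    fun t ht => (s.polar w k p hε hl hne t ht).1, fun t ht => (s.polar w k p hε hl hne t ht).2,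
    fun _ ht => NodalRadial.angVel_pos k hne ht⟩

namespace IsAngle

variable {Θ : ℝ → ℝ}

lemma zero_iff (A : IsAngle g h η ε T v y Θ) {t : ℝ} (ht : t ∈ Icc ε T) :
    v t = 0 ↔ Real.cos (Θ t) = 0 := by
  have h1 := A.cos t ht
  have h2 := Real.sqrt_pos.2 (A.pos t ht)
  constructor
  · intro h; rw [h] at h1 h2
    rcases mul_eq_zero.1 h1.symm with h3 | h3
    · exact absurd h3 h2.ne'
    · exact h3
  · intro h; rw [h1, h, mul_zero]

/-- At a level π/2 + jπ the position v vanishes, so the angular velocity reduces to y g(y)/y² > 0.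
Levels are therefore passed only upwards and once, and the angle counts zeros even though it need
not be monotone in between. -/
lemma cross (A : IsAngle g h η ε T v y Θ) {s t : ℝ} (hs : s ∈ Icc ε T) (ht : t ∈ Icc ε T)
    (hst : s < t) (j : ℤ) (h : Real.pi / 2 + j * Real.pi ≤ Θ s) : Real.pi / 2 + j * Real.pi < Θ t := by
  refine lt_of_crosses_upward A.deriv (fun x hx hxe => A.up x hx ?_) hs ht hst h
  rw [A.zero_iff hx, hxe, Real.cos_add_int_mul_pi, Real.cos_pi_div_two, mul_zero]

lemma gt_neg (A : IsAngle g h η ε T v y Θ) {t : ℝ} (ht : t ∈ Icc ε T) : -(Real.pi / 2) < Θ t := by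
  have hpi := Real.pi_pos
  rcases ht.1.eq_or_lt with h | h
  · rw [← h, A.init]; linarith
  · have := A.cross ⟨le_rfl, ht.1.trans ht.2⟩ ht h (-1) (by rw [A.init]; push_cast; linarith)
    push_cast at this
    linarith

/-- A zero pushes the angle past the next level. -/
lemma le_of_zero (A : IsAngle g h η ε T v y Θ) {t : ℝ} (ht : t ∈ Icc ε T) (hv : v t = 0) (j : ℤ)
    (h : Real.pi / 2 + (j - 1) * Real.pi < Θ t) : Real.pi / 2 + j * Real.pi ≤ Θ t := by
  have hpi := Real.pi_pos
  obtain ⟨n, hn⟩ := Real.cos_eq_zero_iff.1 ((A.zero_iff ht).1 hv)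
  rw [hn] at h ⊢
  have h1 : ((j : ℝ) - 1) < n := by
    by_contra! h'
    nlinarith
  have h2 : j - 1 < n := by exact_mod_cast h1
  have h3 : (j : ℝ) ≤ n := by exact_mod_cast (by omega : j ≤ n)
  nlinarith

lemma exists_zero_eq (A : IsAngle g h η ε T v y Θ) {t : ℝ} (ht : t ∈ Icc ε T) (hv : v t = 0) :
    ∃ j : ℕ, Θ t = Real.pi / 2 + j * Real.pi := by
  have hpi := Real.pi_pos
  obtain ⟨n, hn⟩ := Real.cos_eq_zero_iff.1 ((A.zero_iff ht).1 hv)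
  have h0 := A.gt_neg ht
  rw [hn] at h0
  have h1 : (-1 : ℝ) < n := by
    by_contra! h'
    nlinarith
  have h2 : (-1 : ℤ) < n := by exact_mod_cast h1
  obtain ⟨j, rfl⟩ := Int.eq_ofNat_of_zero_le (by omega : 0 ≤ n)
  exact ⟨j, by rw [hn]; push_cast; ring⟩

/-- The zeros when the final angle is a level. -/
lemma exists_zeros (A : IsAngle g h η ε T v y Θ) (hεT : ε < T) {n : ℕ}
    (hT : Θ T = Real.pi / 2 + n * Real.pi) :
    ∃ z : ℕ → ℝ, (∀ j ≤ n, z j ∈ Ioc ε T ∧ v (z j) = 0) ∧ z n = T ∧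
      (∀ i j, i < j → j ≤ n → z i < z j) ∧ ∀ t ∈ Icc ε T, v t = 0 → ∃ j ≤ n, t = z j := by
  have hpi := Real.pi_pos
  have hc : ContinuousOn Θ (Icc ε T) := fun t ht => (A.deriv t ht).continuousAt.continuousWithinAt
  have hex : ∀ j : ℕ, ∃ t, j ≤ n → t ∈ Icc ε T ∧ Θ t = Real.pi / 2 + j * Real.pi := by
    intro j
    by_cases hj : j ≤ n
    · have hj' : (j : ℝ) ≤ n := by exact_mod_cast hj
      obtain ⟨t, ht, h⟩ := intermediate_value_Icc hεT.le hc
        (show Real.pi / 2 + j * Real.pi ∈ Icc (Θ ε) (Θ T) from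
          ⟨by rw [A.init]; positivity, by rw [hT]; nlinarith⟩)
      exact ⟨t, fun _ => ⟨ht, h⟩⟩
    · exact ⟨0, fun h => absurd h hj⟩
  choose z hz using hex
  -- After a level has been reached the angle is strictly above it, so each level corresponds to
  -- exactly one time.
  have huniq : ∀ (j : ℕ), ∀ s ∈ Icc ε T, ∀ t ∈ Icc ε T, Θ s = Real.pi / 2 + j * Real.pi →
      Real.pi / 2 + j * Real.pi ≤ Θ t → s ≤ t := by
    intro j s hs t ht h1 h2
    by_contra! h3
    have := A.cross ht hs h3 j (by exact_mod_cast h2)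
    push_cast at this
    linarith
  have hTm : T ∈ Icc ε T := ⟨hεT.le, le_rfl⟩
  refine ⟨z, fun j hj => ⟨⟨?_, (hz j hj).1.2⟩, ?_⟩, ?_, fun i j hij hj => ?_, fun t ht hv => ?_⟩
  · refine lt_of_le_of_ne (hz j hj).1.1 fun h => ?_
    have := (hz j hj).2
    rw [← h, A.init] at this
    have : 0 < Real.pi / 2 + j * Real.pi := by positivity
    linarith
  · rw [A.zero_iff (hz j hj).1, (hz j hj).2, Real.cos_add_nat_mul_pi, Real.cos_pi_div_two, mul_zero]
  · exact le_antisymm (hz n le_rfl).1.2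
      (huniq n T hTm _ (hz n le_rfl).1 hT (hz n le_rfl).2.ge)
  · have hij' : (i : ℝ) + 1 ≤ j := by exact_mod_cast hij
    refine lt_of_le_of_ne ?_ fun h => ?_
    · refine huniq i _ (hz i (hij.le.trans hj)).1 _ (hz j hj).1 (hz i (hij.le.trans hj)).2 ?_
      rw [(hz j hj).2]; nlinarith
    · have h1 := (hz i (hij.le.trans hj)).2
      rw [h, (hz j hj).2] at h1
      nlinarith
  · obtain ⟨j, hj⟩ := A.exists_zero_eq ht hv
    have hjn : j ≤ n := by
      by_contra! h'
      have h1 : (n : ℝ) + 1 ≤ j := by exact_mod_cast h'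
      rcases ht.2.eq_or_lt with h2 | h2
      · rw [h2, hT] at hj; nlinarith
      · have := A.cross ht hTm h2 j (by rw [hj]; push_cast; exact le_rfl)
        push_cast at this
        rw [hT] at this
        nlinarith
    exact ⟨j, hjn, le_antisymm (huniq j t ht _ (hz j hjn).1 hj (hz j hjn).2.ge)
      (huniq j _ (hz j hjn).1 t ht (hz j hjn).2 hj.ge)⟩

end IsAngle

end Angle

end NodalRadial

/-! ### Energy decay and the time between zeros. -/

namespace NodalRadial

open scoped NNReal

lemma Kinetic.le_rpow {P c m : ℝ} {g K : ℝ → ℝ} (k : Kinetic P c m g K) (y : ℝ) :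
    K y ≤ |y| ^ (P - 1) * |y| := by
  rw [← k.abs y]
  set z := |y| with hz
  have hz0 : 0 ≤ z := abs_nonneg y
  have h1 := (convex_Icc 0 z).norm_image_sub_le_of_norm_hasDerivWithin_le
    (f := K) (f' := g) (C := z ^ (P - 1)) (x := 0) (y := z)
    (fun t _ => (k.hasDeriv t).hasDerivWithinAt)
    (fun t ht => (k.abs_le t).trans (Real.rpow_le_rpow (abs_nonneg _)
      (by rw [abs_of_nonneg ht.1]; exact ht.2) (by linarith [k.one_lt]))) ⟨le_rfl, hz0⟩ ⟨hz0, le_rfl⟩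
  rw [k.zero, sub_zero, sub_zero, Real.norm_of_nonneg (k.nonneg z), Real.norm_of_nonneg hz0] at h1
  exact h1

/-- Solutions of the regularized system on `[a, b]`. -/
structure Orbit (g h η : ℝ → ℝ) (a b : ℝ) (v y : ℝ → ℝ) : Prop where
  dv : ∀ t ∈ Icc a b, HasDerivAt v (g (y t)) t
  dy : ∀ t ∈ Icc a b, HasDerivAt y (-h (v t) - η t * y t) t

lemma Sol.orbit {g h η v y : ℝ → ℝ} {ε T l : ℝ} (s : Sol g h η ε T l v y) : Orbit g h η ε T v y :=
  ⟨s.dv, s.dy⟩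

lemma Potential.reflect {Fb : ℝ} {h H : ℝ → ℝ} (p : Potential Fb h H) :
    Potential Fb (fun s => -h (-s)) (fun s => H (-s)) where
  Fb_nonneg := p.Fb_nonneg
  lip := by
    have h1 : LipschitzWith 1 (fun s : ℝ => -s) := LipschitzWith.of_dist_le_mul fun s t => by simp
    exact h1.locallyLipschitz.comp (p.lip.comp h1.locallyLipschitz)
  zero := by simp [p.zero]
  hasDeriv s := by
    have := (p.hasDeriv (-s)).scomp s (hasDerivAt_neg s)
    simpa [Function.comp_def] using this
  zero' := by simp [p.zero']
  lower s := p.lower (-s)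

namespace Orbit

variable {q η g K h H v y : ℝ → ℝ} {C₁ C₂ P c m Fb a b : ℝ}

lemma mono (o : Orbit g h η a b v y) {a' b' : ℝ} (ha : a ≤ a') (hb : b' ≤ b) :
    Orbit g h η a' b' v y :=
  ⟨fun t ht => o.dv t ⟨ha.trans ht.1, ht.2.trans hb⟩, fun t ht => o.dy t ⟨ha.trans ht.1, ht.2.trans hb⟩⟩

/-- The kinetic term is odd, so a change of sign of (v, y) is again an orbit, for the reflected
force. Statements about negative arcs follow from those about positive ones. -/
lemma reflect (o : Orbit g h η a b v y) (k : Kinetic P c m g K) :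
    Orbit g (fun s => -h (-s)) η a b (fun t => -v t) (fun t => -y t) :=
  ⟨fun t ht => ((o.dv t ht).fun_neg).congr_deriv (k.odd _).symm,
    fun t ht => ((o.dy t ht).fun_neg).congr_deriv (by simp only [neg_neg]; ring)⟩

lemma cont_v (o : Orbit g h η a b v y) : ContinuousOn v (Icc a b) := fun t ht =>
  (o.dv t ht).continuousAt.continuousWithinAt

lemma cont_y (o : Orbit g h η a b v y) : ContinuousOn y (Icc a b) := fun t ht =>
  (o.dy t ht).continuousAt.continuousWithinAt

lemma dE (o : Orbit g h η a b v y) (k : Kinetic P c m g K) (p : Potential Fb h H) {t : ℝ}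
    (ht : t ∈ Icc a b) : HasDerivAt (fun t => K (y t) + H (v t)) (-(η t * (y t * g (y t)))) t :=
  hasDerivAt_energy k p (o.dv t ht) (o.dy t ht)

lemma cont_E (o : Orbit g h η a b v y) (k : Kinetic P c m g K) (p : Potential Fb h H) :
    ContinuousOn (fun t => K (y t) + H (v t)) (Icc a b) := fun _ ht =>
  (o.dE k p ht).continuousAt.continuousWithinAt

lemma anti_E (o : Orbit g h η a b v y) (w : Weight q η C₁ C₂) (k : Kinetic P c m g K)
    (p : Potential Fb h H) (ha : 0 < a) : AntitoneOn (fun t => K (y t) + H (v t)) (Icc a b) :=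
  antitoneOn_energy k p (fun _ ht => (w.eta_pos (ha.trans_le ht.1)).le) o.cont_v o.cont_y
    (fun t ht => o.dv t ⟨ht.1.le, ht.2.le⟩) (fun t ht => o.dy t ⟨ht.1.le, ht.2.le⟩)

/-- The energy cannot decay faster than a power of the weight. -/
lemma mono_energy_mul_rpow (o : Orbit g h η a b v y) (w : Weight q η C₁ C₂) (k : Kinetic P c m g K)
    (p : Potential Fb h H) (ha : 0 < a) :
    MonotoneOn (fun t => (K (y t) + H (v t) + Fb + 1) * q t ^ P) (Icc a b) := by
  have hd : ∀ t ∈ Icc a b, HasDerivAt (fun t => (K (y t) + H (v t) + Fb + 1) * q t ^ P)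
      (η t * q t ^ P * (P * (K (y t) + H (v t) + Fb + 1) - y t * g (y t))) t := by
    intro t ht
    have ht0 : 0 < t := ha.trans_le ht.1
    have hq := w.pos t ht0
    have h1 := (((o.dE k p ht).add_const Fb).add_const 1).fun_mul
      ((w.deriv t ht0).rpow_const (p := P) (Or.inl hq.ne'))
    refine h1.congr_deriv ?_
    have : q t ^ P = q t ^ (P - 1) * q t := by
      rw [← Real.rpow_add_one hq.ne', sub_add_cancel]
    rw [this]; ring
  refine monotoneOn_of_hasDerivWithinAt_nonneg (convex_Icc a b)
    (fun t ht => (hd t ht).continuousAt.continuousWithinAt)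
    (fun t ht => (hd t (interior_subset ht)).hasDerivWithinAt) (fun t ht => ?_)
  have ht' := interior_subset ht
  have ht0 : 0 < t := ha.trans_le ht'.1
  have h1 := k.growth (y t)
  have h2 := p.lower (v t)
  have hP : 0 < P := by linarith [k.one_lt]
  have h3 : 0 ≤ P * (H (v t) + Fb) := mul_nonneg hP.le (by linarith)
  refine mul_nonneg (mul_nonneg (w.eta_pos ht0).le (Real.rpow_nonneg (w.pos t ht0).le _)) ?_
  linarith

/-- After time a the friction is at most C₂/a, and y g(y) is controlled by the energy. So energy is
lost at a rate O(1/a): late enough, it is nearly constant over any window of fixed length. -/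
lemma energy_ge (o : Orbit g h η a b v y) (w : Weight q η C₁ C₂) (k : Kinetic P c m g K)
    (p : Potential Fb h H) (ha : 0 < a) (hab : a ≤ b) {Em : ℝ} (hE : K (y a) + H (v a) ≤ Em) :
    K (y a) + H (v a) - C₂ * P * (Em + Fb + 1) / a * (b - a) ≤ K (y b) + H (v b) := by
  have hP : 0 < P := by linarith [k.one_lt]
  have hC₂ := w.C₂_pos
  set D := C₂ * P * (Em + Fb + 1) / a with hD
  have hm : MonotoneOn (fun t => K (y t) + H (v t) + D * (t - a)) (Icc a b) := by
    have hd : ∀ t ∈ Icc a b, HasDerivAt (fun t => K (y t) + H (v t) + D * (t - a))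
        (-(η t * (y t * g (y t))) + D * 1) t := fun t ht =>
      (o.dE k p ht).fun_add (((hasDerivAt_id t).sub_const a).const_mul D)
    refine monotoneOn_of_hasDerivWithinAt_nonneg (convex_Icc a b)
      (fun t ht => (hd t ht).continuousAt.continuousWithinAt)
      (fun t ht => (hd t (interior_subset ht)).hasDerivWithinAt) (fun t ht => ?_)
    have ht' := interior_subset ht
    have ht0 : 0 < t := ha.trans_le ht'.1
    have h1 := k.growth (y t)
    have h2 := p.lower (v t)
    have h3 := (o.anti_E w k p ha) ⟨le_rfl, hab⟩ ht' ht'.1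
    simp only at h3
    have h4 : y t * g (y t) ≤ P * (Em + Fb + 1) := h1.trans (mul_le_mul_of_nonneg_left (by linarith) hP.le)
    have h5 : η t ≤ C₂ / a := by
      rw [le_div_iff₀ ha]
      have := w.up t ht0
      nlinarith [w.eta_pos ht0, ht'.1]
    have h6 : η t * (y t * g (y t)) ≤ C₂ / a * (P * (Em + Fb + 1)) :=
      mul_le_mul h5 h4 (k.mul_nonneg _) (by positivity)
    have h7 : C₂ / a * (P * (Em + Fb + 1)) = D := by rw [hD]; ring
    linarith
  have := hm ⟨le_rfl, hab⟩ ⟨hab, le_rfl⟩ hab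
  simp only [sub_self, mul_zero, add_zero] at this
  linarith

end Orbit

/-- Quantitative confinement: sublevels of `H` are bounded, and `h` points inwards with a uniform
strength where `H` is between `e` and `Em`. -/
structure Window (h H : ℝ → ℝ) (e Em M c₀ : ℝ) : Prop where
  M_pos : 0 < M
  c₀_pos : 0 < c₀
  bound : ∀ s, H s ≤ Em → |s| ≤ M
  pos : ∀ s, 0 < s → e ≤ H s → H s ≤ Em → c₀ ≤ h s
  neg : ∀ s, s < 0 → e ≤ H s → H s ≤ Em → h s ≤ -c₀

lemma Window.reflect {h H : ℝ → ℝ} {e Em M c₀ : ℝ} (W : Window h H e Em M c₀) :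
    Window (fun s => -h (-s)) (fun s => H (-s)) e Em M c₀ where
  M_pos := W.M_pos
  c₀_pos := W.c₀_pos
  bound s hs := by simpa using W.bound (-s) hs
  pos s hs h1 h2 := by linarith [W.neg (-s) (by linarith) h1 h2]
  neg s hs h1 h2 := by linarith [W.pos (-s) (by linarith) h1 h2]

lemma le_of_barrier {f f' : ℝ → ℝ} {a b L s t : ℝ} (hf : ∀ t ∈ Icc a b, HasDerivAt f (f' t) t)
    (hp : ∀ t ∈ Icc a b, f t = L → f' t < 0) (hs : s ∈ Icc a b) (ht : t ∈ Icc a b) (hst : s ≤ t)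
    (h : f s ≤ L) : f t ≤ L := by
  rcases hst.eq_or_lt with rfl | hst
  · exact h
  · have := lt_of_crosses_upward (f := fun t => -f t) (f' := fun t => -f' t) (θ := -L)
      (fun t ht => (hf t ht).fun_neg) (fun t ht h => by
        have := hp t ht (neg_inj.1 h); linarith) hs ht hst (by linarith)
    linarith

lemma image_ge_of_deriv_ge {f f' : ℝ → ℝ} {a b D : ℝ} (hab : a ≤ b)
    (hf : ∀ t ∈ Icc a b, HasDerivAt f (f' t) t) (hD : ∀ t ∈ Icc a b, D ≤ f' t) :
    f a + D * (b - a) ≤ f b := by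
  have hm : MonotoneOn (fun t => f t - D * t) (Icc a b) := by
    have hd : ∀ t ∈ Icc a b, HasDerivAt (fun t => f t - D * t) (f' t - D * 1) t := fun t ht =>
      (hf t ht).fun_sub ((hasDerivAt_id t).const_mul D)
    refine monotoneOn_of_hasDerivWithinAt_nonneg (convex_Icc a b)
      (fun t ht => (hd t ht).continuousAt.continuousWithinAt)
      (fun t ht => (hd t (interior_subset ht)).hasDerivWithinAt) (fun t ht => ?_)
    have := hD t (interior_subset ht)
    linarith
  have := hm ⟨le_rfl, hab⟩ ⟨hab, le_rfl⟩ hab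
  simp only at this
  linarith

lemma image_le_of_deriv_le {f f' : ℝ → ℝ} {a b D : ℝ} (hab : a ≤ b)
    (hf : ∀ t ∈ Icc a b, HasDerivAt f (f' t) t) (hD : ∀ t ∈ Icc a b, f' t ≤ D) :
    f b ≤ f a + D * (b - a) := by
  have := image_ge_of_deriv_ge (f := fun t => -f t) (f' := fun t => -f' t) (D := -D) hab
    (fun t ht => (hf t ht).fun_neg) (fun t ht => by linarith [hD t ht])
  linarith

/-- Uniform bound on the duration of a positive arc with energy in `[e, Em]`. -/
lemma exists_swing_time {q η : ℝ → ℝ} {C₁ C₂ P c m e M c₀ : ℝ} (w : Weight q η C₁ C₂) (he : 0 < e)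
    (hM : 0 < M) (hc₀ : 0 < c₀) (hc : 0 < c) (hP : 1 < P) :
    ∃ D : ℝ, 0 < D ∧ ∀ (g K h H : ℝ → ℝ) (Fb Em : ℝ), Kinetic P c m g K → Potential Fb h H →
      Window h H (e / 2) Em M c₀ → ∀ (v y : ℝ → ℝ) (a b : ℝ), 1 ≤ a → Orbit g h η a b v y →
      (∀ t ∈ Icc a b, e ≤ K (y t) + H (v t) ∧ K (y t) + H (v t) ≤ Em) → a + D < b →
      ∃ t ∈ Icc a b, v t = 0 := by
  -- While |y| ≤ y₀ the kinetic energy is at most e/2, so H ≥ e/2 and the window gives a force of at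
  -- least c₀. Since times are at least 1, friction is at most C₂ y₀ ≤ c₀/2, hence y decreases at
  -- rate c₀/2. While |y| ≥ y₀ the position moves at speed at least γ.
  obtain ⟨y₀, hy₀, hy1, hy2, hy3⟩ : ∃ y₀ : ℝ, 0 < y₀ ∧ y₀ ≤ 1 ∧ y₀ ≤ e / 2 ∧ C₂ * y₀ ≤ c₀ / 2 := by
    refine ⟨min (min 1 (e / 2)) (c₀ / (2 * C₂)), ?_, ?_, ?_, ?_⟩
    · have := w.C₂_pos; positivity
    · exact (min_le_left _ _).trans (min_le_left _ _)
    · exact (min_le_left _ _).trans (min_le_right _ _)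
    · have h1 := min_le_right (min 1 (e / 2)) (c₀ / (2 * C₂))
      have := mul_le_mul_of_nonneg_left h1 w.C₂_pos.le
      refine this.trans (le_of_eq ?_)
      have := w.C₂_pos.ne'
      field_simp
  set γ := c * y₀ ^ m with hγ
  have hγ0 : 0 < γ := mul_pos hc (Real.rpow_pos_of_pos hy₀ _)
  have D1 : 0 < M / γ := div_pos hM hγ0
  have D2 : 0 < 4 * y₀ / c₀ := by positivity
  -- positive arcs
  have key : ∀ (g K h H : ℝ → ℝ) (Fb Em : ℝ), Kinetic P c m g K → Potential Fb h H →
      Window h H (e / 2) Em M c₀ → ∀ (v y : ℝ → ℝ) (a b : ℝ), 1 ≤ a → Orbit g h η a b v y →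
      (∀ t ∈ Icc a b, e ≤ K (y t) + H (v t) ∧ K (y t) + H (v t) ≤ Em) →
      a + (M / γ + 4 * y₀ / c₀ + M / γ) < b → (∀ t ∈ Icc a b, 0 < v t) → False := by
    intro g K h H Fb Em k p W v y a b ha o hE hD hv
    have hvM : ∀ t ∈ Icc a b, v t ≤ M := fun t ht =>
      (le_abs_self _).trans (W.bound _ (by have := k.nonneg (y t); linarith [(hE t ht).2]))
    have gle : ∀ z, y₀ ≤ z → γ ≤ g z := fun z hz => by
      refine le_trans (mul_le_mul_of_nonneg_left ?_ hc.le) (k.lb z (hy₀.le.trans hz))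
      exact Real.rpow_le_rpow hy₀.le (le_min hy1 hz) k.m_pos.le
    have small : ∀ t ∈ Icc a b, |y t| ≤ y₀ → -h (v t) - η t * y t ≤ -(c₀ / 2) := by
      intro t ht hy
      have hK : K (y t) ≤ e / 2 := by
        refine (k.le_rpow _).trans ?_
        have h1 : |y t| ^ (P - 1) ≤ 1 := Real.rpow_le_one (abs_nonneg _) (hy.trans hy1) (by linarith)
        nlinarith [abs_nonneg (y t), Real.rpow_nonneg (abs_nonneg (y t)) (P - 1)]
      have h2 := W.pos (v t) (hv t ht) (by linarith [(hE t ht).1])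
        (by have := k.nonneg (y t); linarith [(hE t ht).2])
      have ht1 : 1 ≤ t := ha.trans ht.1
      have hη : η t ≤ C₂ := by
        have := w.up t (by linarith)
        nlinarith [w.eta_pos (show 0 < t by linarith)]
      have h3 : |η t * y t| ≤ C₂ * y₀ := by
        rw [abs_mul, abs_of_pos (w.eta_pos (show 0 < t by linarith))]
        exact mul_le_mul hη hy (abs_nonneg _) w.C₂_pos.le
      have := neg_abs_le (η t * y t)
      linarith
    have bar : ∀ L, |L| ≤ y₀ → ∀ s ∈ Icc a b, ∀ t ∈ Icc a b, s ≤ t → y s ≤ L → y t ≤ L := by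
      intro L hL s hs t ht hst h1
      refine le_of_barrier o.dy (fun x hx hxe => ?_) hs ht hst h1
      have := small x hx (by rw [hxe]; exact hL)
      linarith
    -- A positive arc confined to (0, M] has three phases: y above y₀ for a time at most M/γ, then a
    -- passage from y₀ to -y₀ in a time at most 4y₀/c₀, then a fall of v at speed γ, which must
    -- reach 0 within M/γ.
    set a1 := a + M / γ with ha1
    set a2 := a1 + 4 * y₀ / c₀ with ha2
    have m1 : a1 ∈ Icc a b := ⟨by linarith, by linarith⟩
    have m2 : a2 ∈ Icc a b := ⟨by linarith, by linarith⟩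
    have m0 : a ∈ Icc a b := ⟨le_rfl, by linarith⟩
    have mb : b ∈ Icc a b := ⟨by linarith, le_rfl⟩
    have c1 : y a1 ≤ y₀ := by
      by_contra! hcon
      have h1 : ∀ t ∈ Icc a a1, γ ≤ g (y t) := fun t ht => by
        refine gle _ (not_lt.1 fun h' => ?_)
        have := bar y₀ (by rw [abs_of_pos hy₀]) t ⟨ht.1, ht.2.trans m1.2⟩ a1 m1 ht.2 h'.le
        linarith
      have h2 := image_ge_of_deriv_ge m1.1 (fun t ht => o.dv t ⟨ht.1, ht.2.trans m1.2⟩) h1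
      have h3 : γ * (a1 - a) = M := by rw [ha1]; field_simp; ring
      linarith [hv a m0, hvM a1 m1]
    have c2 : y a2 ≤ -y₀ := by
      by_contra! hcon
      have h1 : ∀ t ∈ Icc a1 a2, -h (v t) - η t * y t ≤ -(c₀ / 2) := fun t ht => by
        have htm : t ∈ Icc a b := ⟨by linarith [ht.1, m1.1], ht.2.trans m2.2⟩
        refine small t htm (abs_le.2 ⟨?_, ?_⟩)
        · by_contra! h'
          have := bar (-y₀) (by rw [abs_neg, abs_of_pos hy₀]) t htm a2 m2 ht.2 h'.le
          linarith
        · exact bar y₀ (by rw [abs_of_pos hy₀]) a1 m1 t htm ht.1 c1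
      have h2 := image_le_of_deriv_le (by linarith : a1 ≤ a2)
        (fun t ht => o.dy t ⟨by linarith [ht.1, m1.1], ht.2.trans m2.2⟩) h1
      have h3 : -(c₀ / 2) * (a2 - a1) = -(2 * y₀) := by rw [ha2]; field_simp; ring
      linarith
    have h1 : ∀ t ∈ Icc a2 b, g (y t) ≤ -γ := fun t ht => by
      have htm : t ∈ Icc a b := ⟨by linarith [ht.1, m2.1], ht.2⟩
      have h1 := bar (-y₀) (by rw [abs_neg, abs_of_pos hy₀]) a2 m2 t htm ht.1 c2
      have h2 := gle (-y t) (by linarith)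
      rw [k.odd] at h2
      linarith
    have h2 := image_le_of_deriv_le m2.2 (fun t ht => o.dv t ⟨by linarith [ht.1, m2.1], ht.2⟩) h1
    have h3 : M < γ * (b - a2) := by
      have : M / γ < b - a2 := by linarith
      rw [div_lt_iff₀ hγ0] at this
      linarith
    linarith [hv b mb, hvM a2 m2]
  refine ⟨M / γ + 4 * y₀ / c₀ + M / γ, by positivity, fun g K h H Fb Em k p W v y a b ha o hE hD => ?_⟩
  by_contra! hne
  have hab : a ≤ b := by linarith [add_pos (add_pos D1 D2) D1]
  have hsign : (∀ t ∈ Icc a b, 0 < v t) ∨ ∀ t ∈ Icc a b, v t < 0 := by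
    rcases lt_or_gt_of_ne (hne a ⟨le_rfl, hab⟩) with h0 | h0
    · right
      intro t ht
      by_contra! h1
      obtain ⟨x, hx, hx0⟩ := intermediate_value_Icc ht.1 (o.cont_v.mono (Icc_subset_Icc_right ht.2))
        (show (0:ℝ) ∈ Icc (v a) (v t) from ⟨h0.le, h1⟩)
      exact hne x ⟨hx.1, hx.2.trans ht.2⟩ hx0
    · left
      intro t ht
      by_contra! h1
      obtain ⟨x, hx, hx0⟩ := intermediate_value_Icc' ht.1 (o.cont_v.mono (Icc_subset_Icc_right ht.2))
        (show (0:ℝ) ∈ Icc (v t) (v a) from ⟨h1, h0.le⟩)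
      exact hne x ⟨hx.1, hx.2.trans ht.2⟩ hx0
  rcases hsign with h' | h'
  · exact key g K h H Fb Em k p W v y a b ha o hE hD h'
  · refine key g K _ _ Fb Em k p.reflect W.reflect _ _ a b ha (o.reflect k) (fun t ht => ?_) hD
      (fun t ht => by linarith [h' t ht])
    simp only [neg_neg, k.even]
    exact hE t ht

/-- Regularly spaced zeros force the angle up. -/
lemma IsAngle.lt_of_zeros {g h η v y Θ : ℝ → ℝ} {ε T : ℝ} (A : IsAngle g h η ε T v y Θ) {a D : ℝ}
    (ha : ε ≤ a) (hD : 0 < D) (N : ℕ) (hT : a + N * (D + 1) ≤ T)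
    (hz : ∀ s, a ≤ s → s + D ≤ a + N * (D + 1) → ∃ t ∈ Icc s (s + D), v t = 0) :
    Real.pi / 2 + (N - 1) * Real.pi < Θ (a + N * (D + 1)) := by
  -- Each step has length D + 1. A zero within the first D units lifts the angle to the next level,
  -- and the remaining unit makes the inequality strict.
  have key : ∀ j : ℕ, j ≤ N → Real.pi / 2 + (j - 1) * Real.pi < Θ (a + j * (D + 1)) := by
    intro j
    induction j with
    | zero =>
      intro _
      have h0 : 0 ≤ (N : ℝ) * (D + 1) := by positivity
      have := A.gt_neg (t := a) ⟨ha, by linarith⟩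
      simp only [Nat.cast_zero, zero_mul, add_zero]
      linarith
    | succ j ih =>
      intro hj
      have ih := ih (by omega)
      have hj' : (j : ℝ) + 1 ≤ N := by exact_mod_cast hj
      have h1 : 0 ≤ (j : ℝ) * (D + 1) := by positivity
      have h2 : ((j : ℝ) + 1) * (D + 1) ≤ N * (D + 1) := mul_le_mul_of_nonneg_right hj' (by linarith)
      obtain ⟨t, ht, hv⟩ := hz (a + j * (D + 1)) (by linarith) (by linarith)
      have m0 : a + j * (D + 1) ∈ Icc ε T := ⟨by linarith, by linarith⟩
      have mt : t ∈ Icc ε T := ⟨by linarith [ht.1], by linarith [ht.2]⟩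
      have h3 : Real.pi / 2 + ((j : ℤ) - 1) * Real.pi < Θ t := by
        rcases ht.1.eq_or_lt with h | h
        · rw [← h]; exact_mod_cast ih
        · have := A.cross m0 mt h ((j : ℤ) - 1) (by push_cast; exact ih.le)
          push_cast at this ⊢
          exact this
      have h4 := A.le_of_zero mt hv j h3
      have h5 := A.cross mt (t := a + ((j + 1 : ℕ) : ℝ) * (D + 1))
        ⟨by push_cast; linarith, by push_cast; linarith⟩ (by push_cast; linarith [ht.2]) j h4
      push_cast at h5 ⊢
      linarith
  exact key N le_rfl

/-- High energy at a late time forces many zeros in bounded time. -/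
lemma IsAngle.lt_of_energy {q η g K h H v y Θ : ℝ → ℝ} {C₁ C₂ P c m Fb ε T e Em τ D₀ D₁ : ℝ} {n : ℕ}
    (A : IsAngle g h η ε T v y Θ) (w : Weight q η C₁ C₂) (k : Kinetic P c m g K)
    (p : Potential Fb h H) (o : Orbit g h η ε T v y) (he : 0 < e) (hε : 0 < ε) (hετ : ε ≤ τ)
    (hτ1 : 1 ≤ τ) (hD₀ : 0 < D₀) (hD₁ : 0 < D₁)
    (z₁ : ∀ a b, 1 ≤ a → Orbit g h η a b v y →
      (∀ t ∈ Icc a b, e ≤ K (y t) + H (v t) ∧ K (y t) + H (v t) ≤ Em) → a + D₁ ≤ b →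
      ∃ t ∈ Icc a b, v t = 0)
    (z₀ : ∀ a b, 1 ≤ a → Orbit g h η a b v y →
      (∀ t ∈ Icc a b, e / 2 ≤ K (y t) + H (v t) ∧ K (y t) + H (v t) ≤ e) → a + D₀ ≤ b →
      ∃ t ∈ Icc a b, v t = 0)
    (hτ : C₂ * P * (e + Fb + 1) * ((n + 1) * (D₀ + 1)) ≤ e / 2 * τ)
    (hE : e ≤ K (y τ) + H (v τ)) (hEm : K (y τ) + H (v τ) ≤ Em)
    (hT : τ + (n + 1) * (D₁ + 1) + (n + 1) * (D₀ + 1) < T) : Real.pi / 2 + n * Real.pi < Θ T := by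
  have hn : (0:ℝ) ≤ n := Nat.cast_nonneg n
  have p1 : 0 < ((n:ℝ) + 1) * (D₁ + 1) := by positivity
  have p0 : 0 < ((n:ℝ) + 1) * (D₀ + 1) := by positivity
  have hanti := o.anti_E w k p hε
  have mT : T ∈ Icc ε T := ⟨by linarith, le_rfl⟩
  have mτ : τ ∈ Icc ε T := ⟨hετ, by linarith⟩
  set b := τ + (n + 1) * (D₁ + 1) with hb
  have mb : b ∈ Icc ε T := ⟨by linarith, by linarith⟩
  have fin : ∀ s ∈ Icc ε T, s < T → Real.pi / 2 + n * Real.pi < Θ s → Real.pi / 2 + n * Real.pi < Θ T := by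
    intro s hs hsT h1
    exact_mod_cast A.cross hs mT hsT n (by exact_mod_cast h1.le)
  -- Either the energy stays above e up to time b, and swings of duration D₁ fill [τ, b]. Or it
  -- equals e at some a in between; then `hτ` and `energy_ge` keep it above e/2 long enough for n +
  -- 1 swings of duration D₀.
  by_cases hcase : e ≤ K (y b) + H (v b)
  · refine fin b mb (by linarith) ?_
    have := A.lt_of_zeros (a := τ) hετ hD₁ (n + 1) (by push_cast; linarith) (fun s hs1 hs2 => by
      push_cast at hs2
      have hsub : ∀ t ∈ Icc s (s + D₁), t ∈ Icc ε T ∧ τ ≤ t ∧ t ≤ b := fun t ht =>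
        ⟨⟨by linarith [ht.1], by linarith [ht.2]⟩, by linarith [ht.1], by linarith [ht.2]⟩
      refine z₁ s (s + D₁) (by linarith) (o.mono (by linarith) (by linarith)) (fun t ht => ?_) le_rfl
      obtain ⟨h1, h2, h3⟩ := hsub t ht
      exact ⟨hcase.trans (hanti h1 mb h3), (hanti mτ h1 h2).trans hEm⟩)
    push_cast at this
    simpa [hb] using this
  · push Not at hcase
    obtain ⟨a, ha, hae⟩ := intermediate_value_Icc' (by linarith : τ ≤ b)
      ((o.cont_E k p).mono (Icc_subset_Icc mτ.1 mb.2)) (show e ∈ Icc _ _ from ⟨hcase.le, hE⟩)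
    simp only at hae
    have ma : a ∈ Icc ε T := ⟨by linarith [ha.1], by linarith [ha.2]⟩
    have ha0 : 0 < a := by linarith [ha.1]
    have hlow : ∀ t ∈ Icc a (a + (n + 1) * (D₀ + 1)), e / 2 ≤ K (y t) + H (v t) := by
      intro t ht
      have htT : t ≤ T := by linarith [ht.2, ha.2]
      have h1 := (o.mono (a' := a) (b' := t) ma.1 htT).energy_ge w k p ha0 ht.1 hae.le
      rw [hae] at h1
      have hX : 0 ≤ C₂ * P * (e + Fb + 1) := by
        have := w.C₂_pos
        have := k.one_lt
        have := p.Fb_nonneg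
        positivity
      have h2 : C₂ * P * (e + Fb + 1) / a * (t - a) ≤ e / 2 := by
        rw [div_mul_eq_mul_div, div_le_iff₀ ha0]
        have h3 : C₂ * P * (e + Fb + 1) * (t - a) ≤ C₂ * P * (e + Fb + 1) * ((n + 1) * (D₀ + 1)) :=
          mul_le_mul_of_nonneg_left (by linarith [ht.2]) hX
        have h4 : e / 2 * τ ≤ e / 2 * a := mul_le_mul_of_nonneg_left ha.1 (by linarith)
        linarith
      linarith
    refine fin (a + (n + 1) * (D₀ + 1)) ⟨by linarith [ha.1], by linarith [ha.2]⟩ (by linarith [ha.2]) ?_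
    have := A.lt_of_zeros (a := a) ma.1 hD₀ (n + 1) (by push_cast; linarith [ha.2]) (fun s hs1 hs2 => by
      push_cast at hs2
      refine z₀ s (s + D₀) (by linarith [ha.1]) (o.mono (by linarith [ha.1]) (by linarith [ha.2]))
        (fun t ht => ⟨hlow t ⟨by linarith [ht.1], by linarith [ht.2]⟩, ?_⟩) le_rfl
      have h1 := hanti ma (show t ∈ Icc ε T from ⟨by linarith [ht.1, ha.1], by linarith [ht.2, ha.2]⟩)
        (by linarith [ht.1])
      simp only at h1
      linarith)
    push_cast at this
    simpa using this

end NodalRadial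

/-! ### Weight estimates and Lipschitz dependence on the initial value. -/

namespace NodalRadial

open scoped NNReal

namespace Weight

variable {q η : ℝ → ℝ} {C₁ C₂ : ℝ}

lemma continuousOn (w : Weight q η C₁ C₂) : ContinuousOn q (Ioi 0) := fun t ht =>
  (w.deriv t ht).continuousAt.continuousWithinAt

lemma monotoneOn (w : Weight q η C₁ C₂) : MonotoneOn q (Ioi 0) := by
  refine monotoneOn_of_hasDerivWithinAt_nonneg (convex_Ioi 0) w.continuousOn
    (fun t ht => (w.deriv t (interior_subset ht)).hasDerivWithinAt) (fun t ht => ?_)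
  have ht : 0 < t := interior_subset ht
  exact mul_nonneg (w.eta_pos ht).le (w.pos t ht).le

lemma intervalIntegrable (w : Weight q η C₁ C₂) {a b : ℝ} (ha : 0 ≤ a) (hb : 0 ≤ b) :
    IntervalIntegrable q volume a b := by
  suffices H : ∀ t, 0 ≤ t → IntervalIntegrable q volume 0 t from (H a ha).symm.trans (H b hb)
  intro t ht
  rcases ht.eq_or_lt with rfl | ht
  · exact IntervalIntegrable.refl
  rw [intervalIntegrable_iff_integrableOn_Ioc_of_le ht.le]
  refine IntegrableOn.of_bound measure_Ioc_lt_top ?_ (q t) ?_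
  · exact (w.continuousOn.mono fun x hx => hx.1).aestronglyMeasurable measurableSet_Ioc
  · rw [ae_restrict_iff' measurableSet_Ioc]
    refine ae_of_all _ fun x hx => ?_
    rw [Real.norm_of_nonneg (w.pos x hx.1).le]
    exact w.monotoneOn hx.1 ht hx.2

lemma capB_sub (w : Weight q η C₁ C₂) {a b : ℝ} (ha : 0 ≤ a) (hb : 0 ≤ b) :
    capB q b - capB q a = ∫ t in a..b, q t := by
  rw [capB, capB, intervalIntegral.integral_interval_sub_left (w.intervalIntegrable le_rfl hb)
    (w.intervalIntegrable le_rfl ha)]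

lemma hasDerivAt_capB (w : Weight q η C₁ C₂) {t : ℝ} (ht : 0 < t) : HasDerivAt (capB q) (q t) t := by
  refine intervalIntegral.integral_hasDerivAt_right (w.intervalIntegrable le_rfl ht.le) ?_
    (w.deriv t ht).continuousAt
  exact w.continuousOn.stronglyMeasurableAtFilter isOpen_Ioi t ht

lemma le_capB_sub (w : Weight q η C₁ C₂) {a b : ℝ} (ha : 0 < a) (hab : a ≤ b) :
    (b - a) * q a ≤ capB q b - capB q a := by
  rw [w.capB_sub ha.le (ha.le.trans hab)]
  have := intervalIntegral.integral_mono_on hab (_root_.intervalIntegrable_const (c := q a))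
    (w.intervalIntegrable ha.le (ha.le.trans hab))
    (fun x hx => w.monotoneOn ha (ha.trans_le hx.1) hx.1)
  simpa using this

lemma capB_sub_le (w : Weight q η C₁ C₂) {a b : ℝ} (ha : 0 ≤ a) (hab : a < b) :
    capB q b - capB q a ≤ (b - a) * q b := by
  rw [w.capB_sub ha (ha.trans hab.le)]
  have := intervalIntegral.integral_mono_on_of_le_Ioo hab.le
    (w.intervalIntegrable ha (ha.trans hab.le)) (_root_.intervalIntegrable_const (c := q b))
    (fun x hx => w.monotoneOn (ha.trans_lt hx.1) (ha.trans_lt hab) hx.2.le)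
  simpa using this

lemma capB_zero : capB q 0 = 0 := by simp [capB]

lemma capB_le (w : Weight q η C₁ C₂) {t : ℝ} (ht : 0 < t) : capB q t ≤ t * q t := by
  have := w.capB_sub_le le_rfl ht
  rw [capB_zero] at this
  linarith

lemma capB_mono (w : Weight q η C₁ C₂) {a b : ℝ} (ha : 0 ≤ a) (hab : a ≤ b) :
    capB q a ≤ capB q b := by
  have h := w.capB_sub ha (ha.trans hab)
  have : 0 ≤ ∫ t in a..b, q t := by
    rw [intervalIntegral.integral_of_le hab]
    refine setIntegral_nonneg measurableSet_Ioc fun x hx => (w.pos x (ha.trans_lt hx.1)).le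
  linarith

lemma capB_pos (w : Weight q η C₁ C₂) {t : ℝ} (ht : 0 < t) : 0 < capB q t := by
  have h1 := w.le_capB_sub (half_pos ht) (by linarith : t / 2 ≤ t)
  have h2 := w.capB_mono le_rfl (half_pos ht).le
  rw [capB_zero] at h2
  have := mul_pos (by linarith : 0 < t - t / 2) (w.pos _ (half_pos ht))
  linarith

/-- Since tη(t) ≤ C₂, the function q(x) x^(-C₂) is nonincreasing. -/
lemma doubling (w : Weight q η C₁ C₂) {s t : ℝ} (hs : 0 < s) (hst : s ≤ t) :
    (s / t) ^ C₂ * q t ≤ q s := by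
  have ht := hs.trans_le hst
  have hd : ∀ x, 0 < x → HasDerivAt (fun x => q x * x ^ (-C₂))
      (η x * q x * x ^ (-C₂) + q x * (-C₂ * x ^ (-C₂ - 1))) x := fun x hx =>
    (w.deriv x hx).fun_mul (Real.hasDerivAt_rpow_const (Or.inl hx.ne'))
  have hm : AntitoneOn (fun x => q x * x ^ (-C₂)) (Ioi 0) := by
    refine antitoneOn_of_hasDerivWithinAt_nonpos (convex_Ioi 0)
      (fun x hx => (hd x hx).continuousAt.continuousWithinAt)
      (fun x hx => (hd x (interior_subset hx)).hasDerivWithinAt) (fun x hx => ?_)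
    have hx : 0 < x := interior_subset hx
    have e1 : x ^ (-C₂) = x ^ (-C₂ - 1) * x := by
      rw [← Real.rpow_add_one hx.ne', sub_add_cancel]
    rw [e1]
    have : η x * q x * (x ^ (-C₂ - 1) * x) + q x * (-C₂ * x ^ (-C₂ - 1))
      = -(q x * x ^ (-C₂ - 1) * (C₂ - x * η x)) := by ring
    rw [this, neg_nonpos]
    exact mul_nonneg (mul_nonneg (w.pos x hx).le (Real.rpow_nonneg hx.le _)) (by linarith [w.up x hx])
  have h1 := hm hs ht hst
  simp only at h1
  have h2 : 0 < s ^ C₂ := Real.rpow_pos_of_pos hs _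
  rw [Real.div_rpow hs.le ht.le]
  rw [Real.rpow_neg hs.le, Real.rpow_neg ht.le] at h1
  have h3 := mul_le_mul_of_nonneg_left h1 h2.le
  calc s ^ C₂ / t ^ C₂ * q t = s ^ C₂ * (q t * (t ^ C₂)⁻¹) := by ring
    _ ≤ s ^ C₂ * (q s * (s ^ C₂)⁻¹) := h3
    _ = q s := by field_simp

/-- The strict form of `B η < q`. -/
lemma exists_capB_mul_eta_le (w : Weight q η C₁ C₂) :
    ∃ δ > 0, ∀ t, 0 < t → capB q t * η t ≤ (1 - δ) * q t := by
  have hC := w.C₂_pos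
  -- As η is antitone, q - η(t)B is nondecreasing on [θt, t], so its value at t is at least its
  -- value at θt. There B ≤ θt q(θt), and θ is chosen with η(t)θt ≤ 1/2, which leaves half of q(θt).
  -- Doubling compares this with q(t).
  set θ := min (1 / 2) (1 / (2 * C₂)) with hθ
  have hθ0 : 0 < θ := by positivity
  have hθ1 : θ ≤ 1 / 2 := min_le_left _ _
  have hθ2 : C₂ * θ ≤ 1 / 2 := by
    have := mul_le_mul_of_nonneg_left (min_le_right (1 / 2) (1 / (2 * C₂))) hC.le
    refine this.trans (le_of_eq ?_); field_simp
  refine ⟨1 / 2 * θ ^ C₂, by positivity, fun t ht => ?_⟩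
  have hs : 0 < θ * t := by positivity
  have hst : θ * t ≤ t := by nlinarith
  have hm : MonotoneOn (fun s => q s - η t * capB q s) (Icc (θ * t) t) := by
    have hd : ∀ s ∈ Icc (θ * t) t, HasDerivAt (fun s => q s - η t * capB q s)
        (η s * q s - η t * q s) s := fun s hs' =>
      (w.deriv s (hs.trans_le hs'.1)).fun_sub ((w.hasDerivAt_capB (hs.trans_le hs'.1)).const_mul _)
    refine monotoneOn_of_hasDerivWithinAt_nonneg (convex_Icc _ _)
      (fun s h => (hd s h).continuousAt.continuousWithinAt)
      (fun s h => (hd s (interior_subset h)).hasDerivWithinAt) (fun s h => ?_)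
    have h' := interior_subset h
    have hs0 : 0 < s := hs.trans_le h'.1
    have := w.anti hs0 ht h'.2
    have := mul_nonneg (sub_nonneg.2 this) (w.pos s hs0).le
    linarith
  have h1 := hm ⟨le_rfl, hst⟩ ⟨hst, le_rfl⟩ hst
  simp only at h1
  have h2 := w.capB_le hs
  have h3 := w.doubling hs hst
  rw [mul_div_assoc, div_self ht.ne', mul_one] at h3
  have h4 : η t * capB q (θ * t) ≤ 1 / 2 * q (θ * t) := by
    have h5 : η t * (θ * t) ≤ 1 / 2 := by
      have := mul_le_mul_of_nonneg_left (w.up t ht) hθ0.le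
      nlinarith
    have h6 := mul_le_mul_of_nonneg_left h2 (w.eta_pos ht).le
    have h7 := mul_le_mul_of_nonneg_right h5 (w.pos _ hs).le
    linarith
  linarith

end Weight

/-- A flow of the regularized system, bi-Lipschitz in the initial value. -/
structure Flow (g h η : ℝ → ℝ) (ε T Λ L : ℝ) (V Y : ℝ → ℝ → ℝ) : Prop where
  L_pos : 0 < L
  sol : ∀ l ∈ Icc 0 Λ, Sol g h η ε T l (V l) (Y l)
  zero : ∀ t ∈ Icc ε T, V 0 t = 0 ∧ Y 0 t = 0
  bdd : ∀ l ∈ Icc 0 Λ, ∀ t ∈ Icc ε T, |V l t| ≤ L ∧ |Y l t| ≤ L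
  lip : ∀ l ∈ Icc 0 Λ, ∀ l' ∈ Icc 0 Λ, ∀ t ∈ Icc ε T,
    |V l t - V l' t| ≤ L * |l - l'| ∧ |Y l t - Y l' t| ≤ L * |l - l'| ∧
      |l - l'| ≤ L * (|V l t - V l' t| + |Y l t - Y l' t|)

lemma exists_flow' {q η g K h H : ℝ → ℝ} {C₁ C₂ P c m Fb ε T Λ : ℝ} (w : Weight q η C₁ C₂)
    (k : Kinetic P c m g K) (p : Potential Fb h H) (hε : 0 < ε) (hεT : ε < T) (hΛ : 0 ≤ Λ) :
    ∃ V Y L, Flow g h η ε T Λ L V Y := by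
  obtain ⟨V, Y, L, h1, h2, h3, h4, h5⟩ := exists_flow w k p hε hεT hΛ
  exact ⟨V, Y, L, h1, h2, h3, h4, h5⟩

lemma exists_lipschitz_bound {f : ℝ → ℝ} (hf : LocallyLipschitz f) {L : ℝ} (hL : 0 < L) :
    ∃ k : ℝ, 0 < k ∧ (∀ a b, |a| ≤ L → |b| ≤ L → |f a - f b| ≤ k * |a - b|) ∧ ∀ a, |a| ≤ L → |f a| ≤ k := by
  obtain ⟨k, hk⟩ := (hf.locallyLipschitzOn (s := Icc (-L) L)).exists_lipschitzOnWith_of_compact isCompact_Icc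
  obtain ⟨b, hb⟩ := (isCompact_Icc (a := -L) (b := L)).exists_bound_of_continuousOn hf.continuous.continuousOn
  have hb0 : 0 ≤ b := (norm_nonneg _).trans (hb 0 ⟨by linarith, hL.le⟩)
  have hk0 : (0:ℝ) ≤ k := k.2
  refine ⟨k + b + 1, by positivity, fun x z hx hz => ?_, fun x hx => ?_⟩
  · have := hk.dist_le_mul x (abs_le.1 hx) z (abs_le.1 hz)
    rw [Real.dist_eq, Real.dist_eq] at this
    nlinarith [abs_nonneg (x - z)]
  · have := hb x (abs_le.1 hx)
    rw [Real.norm_eq_abs] at this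
    linarith

lemma exists_lipschitz_bound_mul {f : ℝ → ℝ} (hf : LocallyLipschitz f) {L : ℝ} (hL : 0 < L) :
    ∃ k : ℝ, 0 < k ∧ (∀ a b, |a| ≤ L → |b| ≤ L → |a * f a - b * f b| ≤ k * |a - b|) ∧
      ∀ a, |a| ≤ L → |a * f a| ≤ k := by
  obtain ⟨k, hk0, hk1, hk2⟩ := exists_lipschitz_bound hf hL
  refine ⟨L * k + k, by positivity, fun a b ha hb => ?_, fun a ha => ?_⟩
  · rw [show a * f a - b * f b = a * (f a - f b) + (a - b) * f b by ring]
    refine (abs_add_le _ _).trans ?_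
    rw [abs_mul, abs_mul]
    have h1 := mul_le_mul ha (hk1 a b ha hb) (abs_nonneg _) hL.le
    have h2 := mul_le_mul_of_nonneg_left (hk2 b hb) (abs_nonneg (a - b))
    linarith
  · rw [abs_mul]
    have := mul_le_mul ha (hk2 a ha) (abs_nonneg _) hL.le
    linarith

lemma LocallyLipschitz.abs_taylor_le {f F : ℝ → ℝ} (hF : ∀ x, HasDerivAt F (f x) x) {k L : ℝ}
    (hk : 0 ≤ k) (hf : ∀ a b, |a| ≤ L → |b| ≤ L → |f a - f b| ≤ k * |a - b|) {a b : ℝ}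
    (ha : |a| ≤ L) (hb : |b| ≤ L) : |F b - F a - f a * (b - a)| ≤ k * |b - a| ^ 2 := by
  have hseg : ∀ x ∈ uIcc a b, |x| ≤ L ∧ |x - a| ≤ |b - a| := by
    intro x hx
    rw [abs_le] at ha hb ⊢
    refine ⟨⟨?_, ?_⟩, abs_sub_left_of_mem_uIcc hx⟩ <;> rcases mem_uIcc.1 hx with h | h <;> linarith [h.1, h.2]
  have := (convex_uIcc a b).norm_image_sub_le_of_norm_hasDerivWithin_le
    (f := fun x => F x - f a * x) (f' := fun x => f x - f a * 1) (C := k * |b - a|) (x := a) (y := b)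
    (fun x _ => ((hF x).fun_sub ((hasDerivAt_id x).const_mul (f a))).hasDerivWithinAt)
    (fun x hx => by
      rw [mul_one, Real.norm_eq_abs]
      exact (hf x a (hseg x hx).1 ha).trans (mul_le_mul_of_nonneg_left (hseg x hx).2 hk))
    left_mem_uIcc right_mem_uIcc
  rw [Real.norm_eq_abs, Real.norm_eq_abs] at this
  rw [show F b - F a - f a * (b - a) = F b - f a * b - (F a - f a * a) by ring]
  linarith [this, show k * |b - a| * |b - a| = k * |b - a| ^ 2 by ring]

namespace Flow

variable {q η g K h H : ℝ → ℝ} {C₁ C₂ P c m Fb ε T Λ L τ : ℝ} {V Y : ℝ → ℝ → ℝ}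

/-- Comparison with the zero solution through the backward Lipschitz estimate. It keeps orbits with
l > 0 away from the origin, so that their angle is defined and, for l bounded below, Lipschitz in l.
-/
lemma lower (F : Flow g h η ε T Λ L V Y) {l t : ℝ} (hl : l ∈ Icc 0 Λ) (ht : t ∈ Icc ε T) :
    l ^ 2 / (2 * L ^ 2) ≤ V l t ^ 2 + Y l t ^ 2 := by
  have hΛ : (0:ℝ) ∈ Icc 0 Λ := ⟨le_rfl, hl.1.trans hl.2⟩
  have h := (F.lip l hl 0 hΛ t ht).2.2
  rw [(F.zero t ht).1, (F.zero t ht).2, sub_zero, sub_zero, sub_zero, abs_of_nonneg hl.1] at h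
  have hL := F.L_pos
  rw [div_le_iff₀ (by positivity)]
  have h1 : l ^ 2 ≤ (L * (|V l t| + |Y l t|)) ^ 2 := pow_le_pow_left₀ hl.1 h 2
  have h2 : (|V l t| + |Y l t|) ^ 2 ≤ 2 * (V l t ^ 2 + Y l t ^ 2) := by
    have := sq_nonneg (|V l t| - |Y l t|)
    have e1 := sq_abs (V l t)
    have e2 := sq_abs (Y l t)
    nlinarith
  have h3 := mul_le_mul_of_nonneg_left h2 (sq_nonneg L)
  nlinarith

lemma pos (F : Flow g h η ε T Λ L V Y) {l : ℝ} (hl : l ∈ Ioc 0 Λ) :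
    ∀ t ∈ Icc ε T, 0 < V l t ^ 2 + Y l t ^ 2 := fun t ht => by
  have := F.lower ⟨hl.1.le, hl.2⟩ ht
  have hL := F.L_pos
  have hl0 := hl.1
  have : 0 < l ^ 2 / (2 * L ^ 2) := by positivity
  linarith

lemma upper (F : Flow g h η ε T Λ L V Y) {l t : ℝ} (hl : l ∈ Icc 0 Λ) (ht : t ∈ Icc ε T) :
    V l t ^ 2 + Y l t ^ 2 ≤ 2 * L ^ 2 * l ^ 2 := by
  have hΛ : (0:ℝ) ∈ Icc 0 Λ := ⟨le_rfl, hl.1.trans hl.2⟩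
  have h := F.lip l hl 0 hΛ t ht
  rw [(F.zero t ht).1, (F.zero t ht).2, sub_zero, sub_zero, sub_zero, abs_of_nonneg hl.1] at h
  have h1 := pow_le_pow_left₀ (abs_nonneg _) h.1 2
  have h2 := pow_le_pow_left₀ (abs_nonneg _) h.2.1 2
  rw [sq_abs, mul_pow] at h1 h2
  linarith

lemma isAngle (F : Flow g h η ε T Λ L V Y) (w : Weight q η C₁ C₂) (k : Kinetic P c m g K)
    (p : Potential Fb h H) (hε : 0 < ε) {l : ℝ} (hl : l ∈ Ioc 0 Λ) :
    IsAngle g h η ε T (V l) (Y l) (angle g h η (V l) (Y l) ε T) :=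
  (F.sol l ⟨hl.1.le, hl.2⟩).isAngle w k p hε hl.1 (F.pos hl)

/-- The angle is Lipschitz in the initial value away from `0`. -/
lemma exists_angle_lipschitz (F : Flow g h η ε T Λ L V Y) (w : Weight q η C₁ C₂)
    (k : Kinetic P c m g K) (p : Potential Fb h H) (hε : 0 < ε) {l₀ : ℝ} (hl₀ : 0 < l₀) :
    ∃ C : ℝ, 0 ≤ C ∧ ∀ l ∈ Icc l₀ Λ, ∀ l' ∈ Icc l₀ Λ, ∀ t ∈ Icc ε T,
      |angle g h η (V l) (Y l) ε T t - angle g h η (V l') (Y l') ε T t| ≤ C * |l - l'| := by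
  have hL := F.L_pos
  obtain ⟨a, ha0, ha1, ha2⟩ := exists_lipschitz_bound_mul k.lip hL
  obtain ⟨b, hb0, hb1, hb2⟩ := exists_lipschitz_bound_mul p.lip hL
  set e := η ε with he
  have he0 : 0 < e := w.eta_pos hε
  set d := l₀ ^ 2 / (2 * L ^ 2) with hd
  have hd0 : 0 < d := by positivity
  set n₁ := a * L + b * L + e * (2 * L ^ 2) with hn₁
  set n₂ := a + b + e * L ^ 2 with hn₂
  have hn₁0 : 0 ≤ n₁ := by positivity
  have hn₂0 : 0 ≤ n₂ := by positivity
  set C := n₁ / d + n₂ * (4 * L ^ 2) / d ^ 2 with hC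
  have hC0 : 0 ≤ C := by positivity
  have vel : ∀ l ∈ Icc l₀ Λ, ∀ l' ∈ Icc l₀ Λ, ∀ t ∈ Icc ε T,
      |angVel g h η (V l) (Y l) t - angVel g h η (V l') (Y l') t| ≤ C * |l - l'| := by
    intro l hl l' hl' t ht
    have hlm : l ∈ Icc 0 Λ := ⟨hl₀.le.trans hl.1, hl.2⟩
    have hlm' : l' ∈ Icc 0 Λ := ⟨hl₀.le.trans hl'.1, hl'.2⟩
    obtain ⟨bv, by_⟩ := F.bdd l hlm t ht
    obtain ⟨bv', by'⟩ := F.bdd l' hlm' t ht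
    obtain ⟨dv, dy, -⟩ := F.lip l hlm l' hlm' t ht
    have hD : d ≤ V l t ^ 2 + Y l t ^ 2 := le_trans (by
      rw [hd]; gcongr; exact hl.1) (F.lower hlm ht)
    have hD' : d ≤ V l' t ^ 2 + Y l' t ^ 2 := le_trans (by
      rw [hd]; gcongr; exact hl'.1) (F.lower hlm' ht)
    have hη : |η t| ≤ e := by
      have ht0 : 0 < t := hε.trans_le ht.1
      rw [abs_of_pos (w.eta_pos ht0)]
      exact w.anti hε ht0 ht.1
    simp only [angVel]
    set v := V l t
    set y := Y l t
    set v' := V l' t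
    set y' := Y l' t
    set δ := |l - l'|
    have hδ : 0 ≤ δ := abs_nonneg _
    have e1 := (ha1 y y' by_ by').trans (mul_le_mul_of_nonneg_left dy ha0.le)
    have e2 := (hb1 v v' bv bv').trans (mul_le_mul_of_nonneg_left dv hb0.le)
    have e3 : |η t * (v * y) - η t * (v' * y')| ≤ e * (2 * L ^ 2 * δ) := by
      rw [← mul_sub, abs_mul]
      refine mul_le_mul hη ?_ (abs_nonneg _) he0.le
      rw [show v * y - v' * y' = v * (y - y') + (v - v') * y' by ring]
      refine (abs_add_le _ _).trans ?_
      rw [abs_mul, abs_mul]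
      have h1 := mul_le_mul bv dy (abs_nonneg _) hL.le
      have h2 := mul_le_mul dv by' (abs_nonneg _) (by positivity)
      nlinarith
    have e4 : |η t * (v' * y')| ≤ e * L ^ 2 := by
      rw [abs_mul]
      refine mul_le_mul hη ?_ (abs_nonneg _) he0.le
      rw [abs_mul, sq]
      exact mul_le_mul bv' by' (abs_nonneg _) hL.le
    have e5 := ha2 y' by'
    have e6 := hb2 v' bv'
    have N1 : |y * g y + v * h v + η t * (v * y) - (y' * g y' + v' * h v' + η t * (v' * y'))| ≤ n₁ * δ := by
      rw [show y * g y + v * h v + η t * (v * y) - (y' * g y' + v' * h v' + η t * (v' * y'))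
        = (y * g y - y' * g y') + (v * h v - v' * h v') + (η t * (v * y) - η t * (v' * y')) by ring]
      refine (abs_add_le _ _).trans ((add_le_add_left (abs_add_le _ _) _).trans ?_)
      rw [hn₁]; linarith
    have N2 : |y' * g y' + v' * h v' + η t * (v' * y')| ≤ n₂ := by
      refine (abs_add_le _ _).trans ((add_le_add_left (abs_add_le _ _) _).trans ?_)
      rw [hn₂]; linarith
    have Dd : |(v' ^ 2 + y' ^ 2) - (v ^ 2 + y ^ 2)| ≤ 4 * L ^ 2 * δ := by
      rw [show (v' ^ 2 + y' ^ 2) - (v ^ 2 + y ^ 2) = -((v - v') * (v + v') + (y - y') * (y + y')) by ring,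
        abs_neg]
      refine (abs_add_le _ _).trans ?_
      rw [abs_mul, abs_mul]
      have h1 := mul_le_mul dv ((abs_add_le v v').trans (add_le_add bv bv')) (abs_nonneg _) (by positivity)
      have h2 := mul_le_mul dy ((abs_add_le y y').trans (add_le_add by_ by')) (abs_nonneg _) (by positivity)
      nlinarith
    set N := y * g y + v * h v + η t * (v * y)
    set N' := y' * g y' + v' * h v' + η t * (v' * y')
    set D := v ^ 2 + y ^ 2
    set D' := v' ^ 2 + y' ^ 2
    have hDp : 0 < D := hd0.trans_le hD
    have hDp' : 0 < D' := hd0.trans_le hD'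
    have : N / D - N' / D' = (N - N') / D + N' * (D' - D) / (D * D') := by field_simp; ring
    rw [this]
    refine (abs_add_le _ _).trans ?_
    rw [abs_div, abs_div, abs_mul, abs_mul, abs_of_pos hDp, abs_of_pos hDp']
    have f1 : |N - N'| / D ≤ n₁ * δ / d := div_le_div₀ (by positivity) N1 hd0 hD
    have f2 : |N'| * |D' - D| / (D * D') ≤ n₂ * (4 * L ^ 2 * δ) / d ^ 2 := by
      refine div_le_div₀ (by positivity) (mul_le_mul N2 Dd (abs_nonneg _) hn₂0) (by positivity) ?_
      rw [sq]; exact mul_le_mul hD hD' hd0.le hDp.le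
    have : C * δ = n₁ * δ / d + n₂ * (4 * L ^ 2 * δ) / d ^ 2 := by rw [hC]; ring
    linarith
  refine ⟨C * |T - ε|, by positivity, fun l hl l' hl' t ht => ?_⟩
  have hεT : ε ≤ T := ht.1.trans ht.2
  have cont : ∀ l ∈ Icc l₀ Λ, Continuous fun s => angVel g h η (V l) (Y l) (max ε (min T s)) := by
    intro l hl
    have hlm : l ∈ Ioc 0 Λ := ⟨hl₀.trans_le hl.1, hl.2⟩
    exact ((F.sol l ⟨hlm.1.le, hlm.2⟩).continuousOn_angVel w k p hε (F.pos hlm)).comp_continuous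
      (by fun_prop) (clamp_mem hεT)
  rw [angle, angle, ← intervalIntegral.integral_sub ((cont l hl).intervalIntegrable _ _)
    ((cont l' hl').intervalIntegrable _ _)]
  have := intervalIntegral.norm_integral_le_of_norm_le_const (a := ε) (b := t) (C := C * |l - l'|)
    (f := fun s => angVel g h η (V l) (Y l) (max ε (min T s)) - angVel g h η (V l') (Y l') (max ε (min T s)))
    (fun s _ => vel l hl l' hl' _ (clamp_mem hεT s))
  refine this.trans ?_
  rw [abs_of_nonneg (by linarith [ht.1] : 0 ≤ t - ε), abs_of_nonneg (by linarith : 0 ≤ T - ε)]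
  have : 0 ≤ C * |l - l'| := by positivity
  nlinarith [ht.2]

end Flow

end NodalRadial

/-! ### The action, and the first initial value with a large endpoint. -/

namespace NodalRadial

open scoped NNReal

/-- The action of a trajectory. -/
noncomputable def action (q g K H v y : ℝ → ℝ) (ε τ : ℝ) : ℝ :=
  ∫ t in ε..τ, q t * (y t * g (y t) - K (y t) - H (v t))

lemma hasDerivAt_zero_of_sq_bound {R : ℝ → ℝ} {C l : ℝ}
    (h : ∀ᶠ x in 𝓝 l, |R x - R l| ≤ C * |x - l| ^ 2) : HasDerivAt R 0 l := by
  rw [hasDerivAt_iff_isLittleO]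
  simp only [smul_zero, sub_zero]
  refine Asymptotics.IsBigO.trans_isLittleO (g := fun x => ‖x - l‖ ^ 2) ?_
    (Asymptotics.isLittleO_pow_sub_sub l one_lt_two)
  refine Asymptotics.IsBigO.of_bound C ?_
  filter_upwards [h] with x hx
  simpa using hx

namespace Flow

variable {q η g K h H : ℝ → ℝ} {C₁ C₂ P c m Fb ε T Λ L τ : ℝ} {V Y : ℝ → ℝ → ℝ}

/-- First variation of the action. -/
lemma exists_action_taylor (F : Flow g h η ε T Λ L V Y) (w : Weight q η C₁ C₂)
    (k : Kinetic P c m g K) (p : Potential Fb h H) (hε : 0 < ε) (hτ : τ ∈ Icc ε T) :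
    ∃ C : ℝ, 0 ≤ C ∧ ∀ l ∈ Icc 0 Λ, ∀ l' ∈ Icc 0 Λ,
      |action q g K H (V l') (Y l') ε τ - action q g K H (V l) (Y l) ε τ
        - q τ * Y l τ * (V l' τ - V l τ)| ≤ C * |l' - l| ^ 2 := by
  have hL := F.L_pos
  obtain ⟨a, ha0, ha1, -⟩ := exists_lipschitz_bound k.lip hL
  obtain ⟨b, hb0, hb1, -⟩ := exists_lipschitz_bound p.lip hL
  have hτ0 : 0 < τ := hε.trans_le hτ.1
  have hqτ := w.pos τ hτ0
  refine ⟨q τ * ((a + b) * L ^ 2) * |τ - ε|, by positivity, fun l hl l' hl' => ?_⟩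
  have hsub : Icc ε τ ⊆ Icc ε T := Icc_subset_Icc_right hτ.2
  have hpos : ∀ t ∈ Icc ε τ, 0 < t := fun t ht => hε.trans_le ht.1
  have hqc : ContinuousOn q (Icc ε τ) := w.continuousOn.mono hpos
  have hvc : ∀ l ∈ Icc 0 Λ, ContinuousOn (V l) (Icc ε τ) := fun l hl => (F.sol l hl).continuousOn_v.mono hsub
  have hyc : ∀ l ∈ Icc 0 Λ, ContinuousOn (Y l) (Icc ε τ) := fun l hl => (F.sol l hl).continuousOn_y.mono hsub
  have kc : ∀ l ∈ Icc 0 Λ, ContinuousOn (fun t => q t * (Y l t * g (Y l t) - K (Y l t) - H (V l t))) (Icc ε τ) :=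
    fun l hl => hqc.mul ((((hyc l hl).mul (k.continuous.comp_continuousOn (hyc l hl))).sub
      (k.continuous'.comp_continuousOn (hyc l hl))).sub (p.continuous'.comp_continuousOn (hvc l hl)))
  have ki : ∀ l ∈ Icc 0 Λ, IntervalIntegrable
      (fun t => q t * (Y l t * g (Y l t) - K (Y l t) - H (V l t))) volume ε τ := fun l hl =>
    (kc l hl).intervalIntegrable_of_Icc hτ.1
  -- D is the derivative of q y (v' - v), with v, y the orbit at l and v' the position at l'.
  -- Subtracting it from the difference of the integrands leaves q times two Taylor remainders, of K
  -- and of H, both quadratic in l' - l. The boundary term at ε vanishes because y = 0 there.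
  set D : ℝ → ℝ := fun t => -(q t * h (V l t)) * (V l' t - V l t) + q t * Y l t * (g (Y l' t) - g (Y l t)) with hD
  have hDd : ∀ t ∈ Icc ε τ, HasDerivAt (fun t => q t * Y l t * (V l' t - V l t)) (D t) t := by
    intro t ht
    have h1 := ((w.deriv t (hpos t ht)).fun_mul ((F.sol l hl).dy t (hsub ht))).fun_mul
      (((F.sol l' hl').dv t (hsub ht)).fun_sub ((F.sol l hl).dv t (hsub ht)))
    refine h1.congr_deriv ?_
    rw [hD]; ring
  have hDc : ContinuousOn D (Icc ε τ) :=
    (((hqc.mul (p.continuous.comp_continuousOn (hvc l hl))).neg).mul ((hvc l' hl').sub (hvc l hl))).add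
      ((hqc.mul (hyc l hl)).mul ((k.continuous.comp_continuousOn (hyc l' hl')).sub
        (k.continuous.comp_continuousOn (hyc l hl))))
  have hDi := hDc.intervalIntegrable_of_Icc hτ.1 (μ := volume)
  have hFTC := intervalIntegral.integral_eq_sub_of_hasDerivAt (a := ε) (b := τ)
    (fun t ht => hDd t (by rwa [uIcc_of_le hτ.1] at ht)) hDi
  rw [(F.sol l hl).y_init, mul_zero, zero_mul, sub_zero] at hFTC
  rw [← hFTC, action, action, ← intervalIntegral.integral_sub (ki l' hl') (ki l hl),
    ← intervalIntegral.integral_sub ((ki l' hl').sub (ki l hl)) hDi]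
  have key := intervalIntegral.norm_integral_le_of_norm_le_const (a := ε) (b := τ)
    (C := q τ * ((a + b) * L ^ 2) * |l' - l| ^ 2)
    (f := fun t => q t * (Y l' t * g (Y l' t) - K (Y l' t) - H (V l' t))
      - q t * (Y l t * g (Y l t) - K (Y l t) - H (V l t)) - D t) (fun t ht => by
    rw [uIoc_of_le hτ.1] at ht
    have ht' : t ∈ Icc ε τ := ⟨ht.1.le, ht.2⟩
    have htT := hsub ht'
    have hq0 := w.pos t (hpos t ht')
    have hqt : q t ≤ q τ := w.monotoneOn (hpos t ht') hτ0 ht.2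
    have e1 := LocallyLipschitz.abs_taylor_le k.hasDeriv ha0.le ha1 (F.bdd l' hl' t htT).2 (F.bdd l hl t htT).2
    have e2 := LocallyLipschitz.abs_taylor_le p.hasDeriv hb0.le hb1 (F.bdd l hl t htT).1 (F.bdd l' hl' t htT).1
    obtain ⟨d1, d2, -⟩ := F.lip l hl l' hl' t htT
    rw [abs_sub_comm (V l t), abs_sub_comm l] at d1
    rw [abs_sub_comm l] at d2
    have f1 := pow_le_pow_left₀ (abs_nonneg _) d1 2
    have f2 := pow_le_pow_left₀ (abs_nonneg _) d2 2
    have : q t * (Y l' t * g (Y l' t) - K (Y l' t) - H (V l' t))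
        - q t * (Y l t * g (Y l t) - K (Y l t) - H (V l t)) - D t
        = q t * ((K (Y l t) - K (Y l' t) - g (Y l' t) * (Y l t - Y l' t))
          - (H (V l' t) - H (V l t) - h (V l t) * (V l' t - V l t))) := by
      rw [hD]; ring
    rw [this, norm_mul, Real.norm_of_nonneg hq0.le, mul_assoc]
    refine mul_le_mul hqt ?_ (norm_nonneg _) hqτ.le
    rw [Real.norm_eq_abs]
    refine (abs_sub _ _).trans ?_
    have g1 := mul_le_mul_of_nonneg_left f1 hb0.le
    have g2 := mul_le_mul_of_nonneg_left f2 ha0.le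
    rw [mul_pow] at g1 g2
    nlinarith)
  rw [Real.norm_eq_abs] at key
  refine key.trans (le_of_eq ?_)
  ring

set_option maxHeartbeats 1000000 in
/-- The first initial value at which the angle or the amplitude at time `τ` is large has bounded
action. -/
theorem exists_first (F : Flow g h η ε T Λ L V Y) (w : Weight q η C₁ C₂) (k : Kinetic P c m g K)
    (p : Potential Fb h H) (hε : 0 < ε) (hτ : τ ∈ Icc ε T) (hΛ : 0 < Λ) {θ Im lb A : ℝ}
    (hθ : Real.pi / 2 ≤ θ) (hIm : 0 < Im) (hlb : 0 < lb)
    (hsmall : ∀ l ∈ Ioc 0 Λ, l ≤ lb → ∀ t ∈ Icc ε T, 0 < V l t)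
    (hend : θ ≤ angle g h η (V Λ) (Y Λ) ε T τ ∨ Im ≤ (V Λ τ ^ 2 + Y Λ τ ^ 2) / 2)
    (hA : ∀ l ∈ Ioc 0 Λ, l ≤ 1 → action q g K H (V l) (Y l) ε τ ≤ A) :
    ∃ l₁ ∈ Ioc 0 Λ, (θ ≤ angle g h η (V l₁) (Y l₁) ε T τ ∨ Im ≤ (V l₁ τ ^ 2 + Y l₁ τ ^ 2) / 2) ∧
      (V l₁ τ ^ 2 + Y l₁ τ ^ 2) / 2 ≤ Im ∧
      (1 < l₁ → action q g K H (V l₁) (Y l₁) ε τ ≤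
        A + q τ * (Im + (1 + 8 * Real.pi) * (θ + Im) ^ 2)) := by
  have hpi := Real.pi_pos
  have hL := F.L_pos
  have hτ0 : 0 < τ := hε.trans_le hτ.1
  have hqτ := w.pos τ hτ0
  set Θ : ℝ → ℝ := fun l => angle g h η (V l) (Y l) ε T τ with hΘ
  set I : ℝ → ℝ := fun l => (V l τ ^ 2 + Y l τ ^ 2) / 2 with hI
  set S : ℝ → ℝ := fun l => action q g K H (V l) (Y l) ε τ with hS
  have hang : ∀ l ∈ Ioc 0 Λ, IsAngle g h η ε T (V l) (Y l) (angle g h η (V l) (Y l) ε T) :=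
    fun l hl => F.isAngle w k p hε hl
  -- At l₀ the orbit has no zero and the amplitude is below both `Im` and 1/(4L²). The second bound
  -- is used to locate the last minimum of the amplitude before l = 1.
  obtain ⟨l₀, hl₀, h0b, h01, h0Λ, h0I, h0L⟩ : ∃ l₀ : ℝ, 0 < l₀ ∧ l₀ ≤ lb ∧ l₀ ≤ 1 ∧ l₀ ≤ Λ ∧
      l₀ ≤ Im / (L ^ 2 + 1) ∧ l₀ ≤ 1 / (4 * L ^ 2) / (L ^ 2 + 1) := by
    refine ⟨min (min lb 1) (min (min Λ (Im / (L ^ 2 + 1))) (1 / (4 * L ^ 2) / (L ^ 2 + 1))), ?_,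
      ?_, ?_, ?_, ?_, ?_⟩
    · have : 0 < L ^ 2 + 1 := by positivity
      positivity
    · exact (min_le_left _ _).trans (min_le_left _ _)
    · exact (min_le_left _ _).trans (min_le_right _ _)
    · exact (min_le_right _ _).trans ((min_le_left _ _).trans (min_le_left _ _))
    · exact (min_le_right _ _).trans ((min_le_left _ _).trans (min_le_right _ _))
    · exact (min_le_right _ _).trans (min_le_right _ _)
  have hI0 : I l₀ < Im ∧ I l₀ < 1 / (4 * L ^ 2) := by
    have h1 := F.upper (l := l₀) ⟨hl₀.le, h0Λ⟩ hτ
    have h2 : I l₀ ≤ L ^ 2 * l₀ := by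
      simp only [hI]
      have : l₀ ^ 2 ≤ l₀ := by nlinarith
      nlinarith [sq_nonneg L, mul_le_mul_of_nonneg_left this (sq_nonneg L)]
    have hL1 : 0 < L ^ 2 + 1 := by positivity
    rw [le_div_iff₀ hL1] at h0I h0L
    constructor <;> nlinarith
  have hΘ0 : Θ l₀ < Real.pi / 2 := by
    by_contra! hcon
    have hlm : l₀ ∈ Ioc 0 Λ := ⟨hl₀, h0Λ⟩
    have A0 := hang l₀ hlm
    obtain ⟨t, ht, hte⟩ := intermediate_value_Icc hτ.1
      (f := angle g h η (V l₀) (Y l₀) ε T) (fun t ht => (A0.deriv t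
        ⟨ht.1, ht.2.trans hτ.2⟩).continuousAt.continuousWithinAt)
      (show Real.pi / 2 ∈ Icc _ _ from ⟨by rw [A0.init]; positivity, hcon⟩)
    have ht' : t ∈ Icc ε T := ⟨ht.1, ht.2.trans hτ.2⟩
    have := hsmall l₀ hlm h0b t ht'
    rw [(A0.zero_iff ht').2 (by rw [hte, Real.cos_pi_div_two])] at this
    exact lt_irrefl _ this
  obtain ⟨CΘ, hCΘ, hΘL⟩ := F.exists_angle_lipschitz w k p hε hl₀
  have hIL : ∀ l ∈ Icc 0 Λ, ∀ l' ∈ Icc 0 Λ, |I l - I l'| ≤ 2 * L ^ 2 * |l - l'| := by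
    intro l hl l' hl'
    obtain ⟨dv, dy, -⟩ := F.lip l hl l' hl' τ hτ
    obtain ⟨bv, by_⟩ := F.bdd l hl τ hτ
    obtain ⟨bv', by'⟩ := F.bdd l' hl' τ hτ
    simp only [hI]
    rw [show (V l τ ^ 2 + Y l τ ^ 2) / 2 - (V l' τ ^ 2 + Y l' τ ^ 2) / 2
      = ((V l τ - V l' τ) * (V l τ + V l' τ) + (Y l τ - Y l' τ) * (Y l τ + Y l' τ)) / 2 by ring,
      abs_div, abs_two, div_le_iff₀ two_pos]
    refine (abs_add_le _ _).trans ?_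
    rw [abs_mul, abs_mul]
    have h0 := abs_nonneg (l - l')
    have h1 := mul_le_mul dv ((abs_add_le (V l τ) (V l' τ)).trans (add_le_add bv bv')) (abs_nonneg _)
      (by positivity)
    have h2 := mul_le_mul dy ((abs_add_le (Y l τ) (Y l' τ)).trans (add_le_add by_ by')) (abs_nonneg _)
      (by positivity)
    nlinarith
  have sub0 : Icc l₀ Λ ⊆ Icc 0 Λ := Icc_subset_Icc_left hl₀.le
  have contΘ : ContinuousOn Θ (Icc l₀ Λ) := by
    refine (LipschitzOnWith.of_dist_le_mul (K := ⟨CΘ, hCΘ⟩) fun l hl l' hl' => ?_).continuousOn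
    exact hΘL l hl l' hl' τ hτ
  have contI : ContinuousOn I (Icc l₀ Λ) := by
    refine (LipschitzOnWith.of_dist_le_mul (K := ⟨2 * L ^ 2, by positivity⟩) fun l hl l' hl' => ?_).continuousOn
    exact hIL l (sub0 hl) l' (sub0 hl')
  -- the first bad initial value
  have hcpt : IsCompact (Icc l₀ Λ ∩ (Icc l₀ Λ ∩ Θ ⁻¹' (Ici θ) ∪ Icc l₀ Λ ∩ I ⁻¹' (Ici Im))) :=
    isCompact_Icc.inter_right ((contΘ.preimage_isClosed_of_isClosed isClosed_Icc isClosed_Ici).union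
      (contI.preimage_isClosed_of_isClosed isClosed_Icc isClosed_Ici))
  have hΛm : Λ ∈ Icc l₀ Λ := ⟨h0Λ, le_rfl⟩
  obtain ⟨l₁, ⟨hl₁, hl₁'⟩, hmin⟩ := hcpt.exists_isLeast ⟨Λ, hΛm, by
    rcases hend with h | h
    · exact Or.inl ⟨hΛm, h⟩
    · exact Or.inr ⟨hΛm, h⟩⟩
  have hbad : θ ≤ Θ l₁ ∨ Im ≤ I l₁ := by
    rcases hl₁' with h | h
    · exact Or.inl h.2
    · exact Or.inr h.2
  have hgood : ∀ l ∈ Ico l₀ l₁, Θ l < θ ∧ I l < Im := by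
    intro l hl
    have hlm : l ∈ Icc l₀ Λ := ⟨hl.1, hl.2.le.trans hl₁.2⟩
    constructor
    · by_contra! h'
      exact absurd (hmin ⟨hlm, Or.inl ⟨hlm, h'⟩⟩) (not_le.2 hl.2)
    · by_contra! h'
      exact absurd (hmin ⟨hlm, Or.inr ⟨hlm, h'⟩⟩) (not_le.2 hl.2)
  have h01' : l₀ < l₁ := lt_of_le_of_ne hl₁.1 (by
    rintro rfl
    rcases hbad with h | h
    · linarith
    · linarith [hI0.1])
  have hcl : l₁ ∈ closure (Ico l₀ l₁) := by
    rw [closure_Ico h01'.ne]; exact ⟨h01'.le, le_rfl⟩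
  have subI : Ico l₀ l₁ ⊆ Icc l₀ Λ := fun x hx => ⟨hx.1, hx.2.le.trans hl₁.2⟩
  have hI1 : I l₁ ≤ Im := ((contI l₁ hl₁).mono subI).closure_le hcl continuousWithinAt_const
    (fun x hx => (hgood x hx).2.le)
  have hΘ1 : Θ l₁ ≤ θ := ((contΘ l₁ hl₁).mono subI).closure_le hcl continuousWithinAt_const
    (fun x hx => (hgood x hx).1.le)
  refine ⟨l₁, ⟨hl₀.trans h01', hl₁.2⟩, hbad, hI1, fun h1 => ?_⟩
  -- the last minimum of the amplitude
  have sub1 : Icc l₀ l₁ ⊆ Icc l₀ Λ := Icc_subset_Icc_right hl₁.2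
  obtain ⟨lm, hlm, hlmin⟩ := isCompact_Icc.exists_isMinOn ⟨l₀, le_rfl, h01'.le⟩ (contI.mono sub1)
  have hcpt2 : IsCompact (Icc l₀ l₁ ∩ I ⁻¹' (Iic (I lm))) := isCompact_Icc.of_isClosed_subset
    ((contI.mono sub1).preimage_isClosed_of_isClosed isClosed_Icc isClosed_Iic) inter_subset_left
  obtain ⟨ls, ⟨hls, hls'⟩, hlsmax⟩ := hcpt2.exists_isGreatest ⟨lm, hlm, (le_refl (I lm) : I lm ≤ I lm)⟩
  -- Starting the arc at the last minimum of the amplitude leaves the half line below its lower end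
  -- free, as the area bound requires.
  have hlsI : ∀ l ∈ Ioc ls l₁, I ls < I l := by
    intro l hl
    by_contra! h'
    exact absurd (hlsmax ⟨⟨hls.1.trans hl.1.le, hl.2⟩, h'.trans hls'⟩) (not_le.2 hl.1)
  -- By `lower` the amplitude at any l ≥ 1 is at least 1/(4L²), more than at l₀. So the minimum lies
  -- at some l < 1, where the action is at most A by hypothesis.
  have hls1 : ls < 1 := by
    by_contra! h'
    have h2 : I ls ≤ I l₀ := hls'.trans (hlmin ⟨le_rfl, h01'.le⟩)
    have h3 := F.lower (sub0 (sub1 hls)) hτ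
    have h4 : 1 / (4 * L ^ 2) ≤ I ls := by
      simp only [hI]
      rw [le_div_iff₀ two_pos]
      refine le_trans ?_ h3
      rw [div_mul_eq_mul_div, div_le_div_iff₀ (by positivity) (by positivity)]
      nlinarith [sq_nonneg L, mul_le_mul_of_nonneg_left (one_le_pow₀ h' : 1 ≤ ls ^ 2) (sq_nonneg L)]
    linarith [hI0.2]
  have hls0 : 0 < ls := hl₀.trans_le hls.1
  have hab : ls < l₁ := hls1.trans h1
  have sub2 : Icc ls l₁ ⊆ Icc l₀ Λ := Icc_subset_Icc hls.1 hl₁.2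
  have sub3 : Icc ls l₁ ⊆ Ioc 0 Λ := fun x hx => ⟨hls0.trans_le hx.1, hx.2.trans hl₁.2⟩
  obtain ⟨CS, hCS, hST⟩ := F.exists_action_taylor w k p hε hτ
  -- From dS = q(τ) y dv one gets dW = (y dv - v dy)/2, which in polar coordinates is I dΘ. So W
  -- plays the role of the area primitive for the arc (Θ, I).
  set W : ℝ → ℝ := fun l => S l / q τ - V l τ * Y l τ / 2 with hW
  have hVY : ∀ l ∈ Icc 0 Λ, ∀ l' ∈ Icc 0 Λ, |V l τ * Y l τ - V l' τ * Y l' τ| ≤ 2 * L ^ 2 * |l - l'| := by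
    intro l hl l' hl'
    obtain ⟨dv, dy, -⟩ := F.lip l hl l' hl' τ hτ
    rw [show V l τ * Y l τ - V l' τ * Y l' τ = V l τ * (Y l τ - Y l' τ) + (V l τ - V l' τ) * Y l' τ by ring]
    refine (abs_add_le _ _).trans ?_
    rw [abs_mul, abs_mul]
    have h0 := abs_nonneg (l - l')
    have h1 := mul_le_mul (F.bdd l hl τ hτ).1 dy (abs_nonneg _) hL.le
    have h2 := mul_le_mul dv (F.bdd l' hl' τ hτ).2 (abs_nonneg _) (by positivity)
    nlinarith
  have hSL : ∀ l ∈ Icc 0 Λ, ∀ l' ∈ Icc 0 Λ, |S l - S l'| ≤ (CS * Λ + q τ * L ^ 2) * |l - l'| := by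
    intro l hl l' hl'
    have e1 := hST l' hl' l hl
    have e2 : |q τ * Y l' τ * (V l τ - V l' τ)| ≤ q τ * L ^ 2 * |l - l'| := by
      rw [abs_mul, abs_mul, abs_of_pos hqτ]
      have h1 := mul_le_mul (F.bdd l' hl' τ hτ).2 (F.lip l hl l' hl' τ hτ).1 (abs_nonneg _) hL.le
      nlinarith [mul_le_mul_of_nonneg_left h1 hqτ.le]
    have e3 : |l - l'| ≤ Λ := abs_sub_le_iff.2 ⟨by linarith [hl.2, hl'.1], by linarith [hl'.2, hl.1]⟩
    have e4 : CS * |l - l'| ^ 2 ≤ CS * Λ * |l - l'| := by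
      rw [sq, ← mul_assoc]
      exact mul_le_mul_of_nonneg_right (mul_le_mul_of_nonneg_left e3 hCS) (abs_nonneg _)
    rw [abs_le] at e1 e2 ⊢
    simp only [hS]
    rw [add_mul]
    constructor <;> linarith [e1.1, e1.2, e2.1, e2.2]
  obtain ⟨C, hC, hC1, hC2, hC3⟩ : ∃ C : ℝ, 0 ≤ C ∧ CΘ ≤ C ∧ 2 * L ^ 2 ≤ C ∧
      (CS * Λ + q τ * L ^ 2) / q τ + L ^ 2 ≤ C := by
    refine ⟨CΘ + 2 * L ^ 2 + ((CS * Λ + q τ * L ^ 2) / q τ + L ^ 2), by positivity, ?_, ?_, ?_⟩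
    · have : 0 ≤ 2 * L ^ 2 + ((CS * Λ + q τ * L ^ 2) / q τ + L ^ 2) := by positivity
      linarith
    · have : 0 ≤ ((CS * Λ + q τ * L ^ 2) / q τ + L ^ 2) := by positivity
      linarith
    · have : 0 ≤ 2 * L ^ 2 := by positivity
      linarith
  have lipmk : ∀ f : ℝ → ℝ, (∀ l ∈ Icc ls l₁, ∀ l' ∈ Icc ls l₁, |f l - f l'| ≤ C * |l - l'|) →
      LipschitzOnWith ⟨C, hC⟩ f (Icc ls l₁) := fun f hf =>
    LipschitzOnWith.of_dist_le_mul fun l hl l' hl' => hf l hl l' hl'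
  have hbound := abs_sub_le_of_arc (X := Θ) (Z := I) (W := W) (ρ := θ + Im) (C := ⟨C, hC⟩) hab
    (lipmk _ fun l hl l' hl' => (hΘL l (sub2 hl) l' (sub2 hl') τ hτ).trans
      (mul_le_mul_of_nonneg_right hC1 (abs_nonneg _)))
    (lipmk _ fun l hl l' hl' => (hIL l (sub0 (sub2 hl)) l' (sub0 (sub2 hl'))).trans
      (mul_le_mul_of_nonneg_right hC2 (abs_nonneg _)))
    (lipmk _ fun l hl l' hl' => by
      refine le_trans ?_ (mul_le_mul_of_nonneg_right hC3 (abs_nonneg _))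
      have e1 := hSL l (sub0 (sub2 hl)) l' (sub0 (sub2 hl'))
      have e2 := hVY l (sub0 (sub2 hl)) l' (sub0 (sub2 hl'))
      simp only [hW]
      rw [show S l / q τ - V l τ * Y l τ / 2 - (S l' / q τ - V l' τ * Y l' τ / 2)
        = (S l - S l') / q τ - (V l τ * Y l τ - V l' τ * Y l' τ) / 2 by ring]
      refine (abs_sub _ _).trans ?_
      rw [abs_div, abs_div, abs_of_pos hqτ, abs_two]
      have e3 := div_le_div_of_nonneg_right e1 hqτ.le
      have e4 : (CS * Λ + q τ * L ^ 2) * |l - l'| / q τ = (CS * Λ + q τ * L ^ 2) / q τ * |l - l'| := by ring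
      linarith)
    -- Equal angle and amplitude mean equal endpoints, and the backward Lipschitz estimate then
    -- forces l = l': the arc is simple.
    (fun l hl l' hl' hll h1 h2 => by
      have hτm := hτ
      have a1 := (hang l (sub3 hl)).cos τ hτ
      have a2 := (hang l (sub3 hl)).sin τ hτ
      have b1 := (hang l' (sub3 hl')).cos τ hτ
      have b2 := (hang l' (sub3 hl')).sin τ hτ
      simp only [hI] at h2
      simp only [hΘ] at h1
      have h3 : V l τ ^ 2 + Y l τ ^ 2 = V l' τ ^ 2 + Y l' τ ^ 2 := by linarith
      rw [h1, h3] at a1 a2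
      have := (F.lip l (sub0 (sub2 hl)) l' (sub0 (sub2 hl')) τ hτ).2.2
      rw [a1.trans b1.symm, a2.trans b2.symm] at this
      simp only [sub_self, abs_zero, add_zero, mul_zero] at this
      have := abs_nonpos_iff.1 this
      linarith)
    hlsI
    (by
      -- At the first bad value either the angle or the amplitude exceeds strictly all its earlier
      -- values, so the arc can be continued to the right or upwards.
      rcases hbad with h | h
      · exact Or.inl fun l hl => (hgood l ⟨hls.1.trans hl.1, hl.2⟩).1.trans_le h
      · exact Or.inr fun l hl => (hgood l ⟨hls.1.trans hl.1, hl.2⟩).2.trans_le h)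
    (fun l hl => by
      have h2 := (hang l (sub3 hl)).gt_neg hτ
      have h3 : Θ l ≤ θ := by
        rcases hl.2.eq_or_lt with h | h
        · rw [h]; exact hΘ1
        · exact (hgood l ⟨hls.1.trans hl.1, h⟩).1.le
      rw [abs_le]; constructor
      · simp only [hΘ]; linarith
      · linarith)
    (fun l hl => by
      have h3 : I l ≤ Im := by
        rcases hl.2.eq_or_lt with h | h
        · rw [h]; exact hI1
        · exact (hgood l ⟨hls.1.trans hl.1, h⟩).2.le
      have h4 : 0 ≤ I l := by simp only [hI]; positivity
      rw [abs_of_nonneg h4]; linarith)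
    (by linarith)
    (fun l hl x z hx hz => by
      have hlm : l ∈ Icc ls l₁ := ⟨hl.1.le, hl.2.le⟩
      have hev : ∀ᶠ s in 𝓝 l, s ∈ Ioo ls l₁ := Ioo_mem_nhds hl.1 hl.2
      have hIpos : 0 < I l := by
        have := F.pos (sub3 hlm) τ hτ
        simp only [hI]; linarith
      set ρ := √(2 * I l) with hρ
      have hρ0 : 0 < ρ := Real.sqrt_pos.2 (by linarith)
      have hρ2 : ρ ^ 2 = 2 * I l := Real.sq_sqrt (by linarith)
      have dρ : HasDerivAt (fun l => √(2 * I l)) (2 * z / (2 * ρ)) l :=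
        (hz.const_mul 2).sqrt (by linarith)
      set r' := 2 * z / (2 * ρ) with hr'
      have e2I : ∀ l, 2 * I l = V l τ ^ 2 + Y l τ ^ 2 := fun l => by simp only [hI]; ring
      have dV : HasDerivAt (fun l => V l τ) (r' * Real.cos (Θ l) + ρ * (-Real.sin (Θ l) * x)) l := by
        refine (dρ.fun_mul hx.cos).congr_of_eventuallyEq ?_
        filter_upwards [hev] with s hs
        have := (hang s (sub3 ⟨hs.1.le, hs.2.le⟩)).cos τ hτ
        rw [← e2I] at this
        exact this
      have dY : HasDerivAt (fun l => Y l τ) (-(r' * Real.sin (Θ l) + ρ * (Real.cos (Θ l) * x))) l := by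
        refine ((dρ.fun_mul hx.sin).fun_neg).congr_of_eventuallyEq ?_
        filter_upwards [hev] with s hs
        have := (hang s (sub3 ⟨hs.1.le, hs.2.le⟩)).sin τ hτ
        rw [← e2I, neg_mul] at this
        exact this
      -- The remainder of the first variation is quadratic, so S is differentiable wherever v is,
      -- although no differentiability of the flow in l is assumed.
      have dR : HasDerivAt (fun s => S s - q τ * Y l τ * V s τ) 0 l := by
        refine hasDerivAt_zero_of_sq_bound (C := CS) ?_
        filter_upwards [hev] with s hs
        have := hST l (sub0 (sub2 hlm)) s (sub0 (sub2 ⟨hs.1.le, hs.2.le⟩))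
        simp only [hS]
        convert this using 2
        ring
      have dS := dR.fun_add (dV.const_mul (q τ * Y l τ))
      have dS' : HasDerivAt S (0 + q τ * Y l τ * (r' * Real.cos (Θ l) + ρ * (-Real.sin (Θ l) * x))) l := by
        refine dS.congr_of_eventuallyEq (Eventually.of_forall fun s => ?_)
        simp
      have dW := (dS'.div_const (q τ)).fun_sub ((dV.fun_mul dY).div_const 2)
      refine dW.congr_deriv ?_
      have a1 := (hang l (sub3 hlm)).cos τ hτ
      have a2 := (hang l (sub3 hlm)).sin τ hτ
      rw [← e2I, ← hρ] at a1 a2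
      have hsc := Real.sin_sq_add_cos_sq (Θ l)
      have hIe : I l = ρ ^ 2 / 2 := by linarith
      rw [hIe]
      have h5 : (0 + q τ * Y l τ * (r' * Real.cos (Θ l) + ρ * (-Real.sin (Θ l) * x))) / q τ
        = Y l τ * (r' * Real.cos (Θ l) + ρ * (-Real.sin (Θ l) * x)) := by
        field_simp; ring
      rw [h5, a1, a2]
      simp only [hΘ] at hsc ⊢
      linear_combination (ρ ^ 2 * x / 2) * hsc)
  have hvy : ∀ l ∈ Icc ls l₁, |V l τ * Y l τ / 2| ≤ Im / 2 := by
    intro l hl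
    have h3 : I l ≤ Im := by
      rcases hl.2.eq_or_lt with h | h
      · rw [h]; exact hI1
      · exact (hgood l ⟨hls.1.trans hl.1, h⟩).2.le
    simp only [hI] at h3
    rw [abs_le]
    constructor <;> nlinarith [sq_nonneg (V l τ + Y l τ), sq_nonneg (V l τ - Y l τ)]
  have v1 := hvy l₁ ⟨hab.le, le_rfl⟩
  have v2 := hvy ls ⟨le_rfl, hab.le⟩
  have hAs := hA ls (sub3 ⟨le_rfl, hab.le⟩) hls1.le
  have hAs' : S ls ≤ A := hAs
  rw [abs_le] at hbound v1 v2
  have h6 : S l₁ / q τ - S ls / q τ ≤ Im + (1 + 8 * Real.pi) * (θ + Im) ^ 2 := by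
    have := hbound.2
    simp only [hW] at this
    linarith [v1.2, v2.1]
  rw [← sub_div, div_le_iff₀ hqτ] at h6
  change S l₁ ≤ _
  linarith

end Flow

end NodalRadial

/-! ### Dissipation and energy bounds from the action; the travel time. -/

namespace NodalRadial

namespace Orbit

variable {q η g K h H v y : ℝ → ℝ} {C₁ C₂ P c m Fb ε τ : ℝ}

lemma hasDerivAt_capB_mul_energy (o : Orbit g h η ε τ v y) (w : Weight q η C₁ C₂)
    (k : Kinetic P c m g K) (p : Potential Fb h H) (hε : 0 < ε) {t : ℝ} (ht : t ∈ Icc ε τ) :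
    HasDerivAt (fun t => capB q t * (K (y t) + H (v t)))
      (q t * (K (y t) + H (v t)) - capB q t * η t * (y t * g (y t))) t :=
  ((w.hasDerivAt_capB (hε.trans_le ht.1)).fun_mul (o.dE k p ht)).congr_deriv (by ring)

lemma hasDerivAt_momentum (o : Orbit g h η ε τ v y) (w : Weight q η C₁ C₂) (hε : 0 < ε) {t : ℝ}
    (ht : t ∈ Icc ε τ) : HasDerivAt (fun t => q t * y t) (-(q t * h (v t))) t :=
  ((w.deriv t (hε.trans_le ht.1)).fun_mul (o.dy t ht)).congr_deriv (by ring)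

/-- A bound on the action bounds the dissipation and the energy. -/
lemma bounds_of_action (o : Orbit g h η ε τ v y) (w : Weight q η C₁ C₂)
    (k : Kinetic P c m g K) (p : Potential Fb h H) (hε : 0 < ε) (hετ : ε ≤ τ) {δ Em A : ℝ}
    (hδ : 0 < δ) (hδq : ∀ t, 0 < t → capB q t * η t ≤ (1 - δ) * q t)
    (hEm : K (y τ) + H (v τ) ≤ Em) (hA : action q g K H v y ε τ ≤ A) :
    (∫ t in ε..τ, q t * (y t * g (y t))) ≤ (A + capB q τ * (Em + Fb)) / δ ∧
    ∀ t ∈ Icc ε τ, capB q t * (K (y t) + H (v t)) ≤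
      capB q τ * (Em + Fb) + (A + capB q τ * (Em + Fb)) / δ := by
  have hpos : ∀ t ∈ Icc ε τ, 0 < t := fun t ht => hε.trans_le ht.1
  have hqc : ContinuousOn q (Icc ε τ) := w.continuousOn.mono hpos
  have hηc : ContinuousOn η (Icc ε τ) := w.cont.mono hpos
  have hBc : ContinuousOn (capB q) (Icc ε τ) := fun t ht =>
    (w.hasDerivAt_capB (hpos t ht)).continuousAt.continuousWithinAt
  have hyg : ContinuousOn (fun t => y t * g (y t)) (Icc ε τ) :=
    o.cont_y.mul (k.continuous.comp_continuousOn o.cont_y)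
  have hE := o.cont_E k p
  have sub : ∀ s ∈ Icc ε τ, Icc s τ ⊆ Icc ε τ := fun s hs => Icc_subset_Icc_left hs.1
  have i1 : ∀ s ∈ Icc ε τ, IntervalIntegrable (fun t => q t * (y t * g (y t))) volume s τ := fun s hs =>
    ((hqc.mul hyg).mono (sub s hs)).intervalIntegrable_of_Icc hs.2
  have i2 : ∀ s ∈ Icc ε τ, IntervalIntegrable (fun t => q t * (K (y t) + H (v t))) volume s τ := fun s hs =>
    ((hqc.mul hE).mono (sub s hs)).intervalIntegrable_of_Icc hs.2
  have i3 : ∀ s ∈ Icc ε τ, IntervalIntegrable (fun t => capB q t * η t * (y t * g (y t))) volume s τ :=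
    fun s hs => (((hBc.mul hηc).mul hyg).mono (sub s hs)).intervalIntegrable_of_Icc hs.2
  have hft : ∀ s ∈ Icc ε τ, (∫ t in s..τ, q t * (K (y t) + H (v t)))
      - (∫ t in s..τ, capB q t * η t * (y t * g (y t)))
      = capB q τ * (K (y τ) + H (v τ)) - capB q s * (K (y s) + H (v s)) := by
    intro s hs
    rw [← intervalIntegral.integral_sub (i2 s hs) (i3 s hs)]
    exact intervalIntegral.integral_eq_sub_of_hasDerivAt
      (fun t ht => o.hasDerivAt_capB_mul_energy w k p hε (sub s hs (by rwa [uIcc_of_le hs.2] at ht)))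
      ((i2 s hs).sub (i3 s hs))
  have hεm : ε ∈ Icc ε τ := ⟨le_rfl, hετ⟩
  have hact : action q g K H v y ε τ = (∫ t in ε..τ, q t * (y t * g (y t)))
      - ∫ t in ε..τ, q t * (K (y t) + H (v t)) := by
    rw [action, ← intervalIntegral.integral_sub (i1 ε hεm) (i2 ε hεm)]
    congr 1; ext t; ring
  have hBη : ∀ s ∈ Icc ε τ, (∫ t in s..τ, capB q t * η t * (y t * g (y t))) ≤
      (1 - δ) * ∫ t in s..τ, q t * (y t * g (y t)) := by
    intro s hs
    rw [← intervalIntegral.integral_const_mul]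
    refine intervalIntegral.integral_mono_on hs.2 (i3 s hs) ((i1 s hs).const_mul _) fun t ht => ?_
    have := mul_le_mul_of_nonneg_right (hδq t (hpos t (sub s hs ht))) (k.mul_nonneg (y t))
    linarith
  have hElow : ∀ t, -Fb ≤ K (y t) + H (v t) := fun t => by
    have := k.nonneg (y t); have := p.lower (v t); linarith
  have hBτ := w.capB_pos (hε.trans_le hετ)
  -- The action is ∫ q y g(y) - ∫ qE. By `hft` the second integral is a boundary term plus ∫ Bη y
  -- g(y), which is at most (1 - δ)∫ q y g(y). A fraction δ of the dissipation therefore remains on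
  -- the left.
  have hQ : (∫ t in ε..τ, q t * (y t * g (y t))) ≤ (A + capB q τ * (Em + Fb)) / δ := by
    rw [le_div_iff₀ hδ]
    have e1 := hft ε hεm
    have e2 := hBη ε hεm
    have e3 := mul_le_mul_of_nonneg_left hEm hBτ.le
    have e4 : capB q ε * -Fb ≤ capB q ε * (K (y ε) + H (v ε)) :=
      mul_le_mul_of_nonneg_left (hElow ε) (w.capB_pos hε).le
    have e5 := mul_le_mul_of_nonneg_right (w.capB_mono hε.le hετ) p.Fb_nonneg
    nlinarith
  refine ⟨hQ, fun t ht => ?_⟩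
  have e1 := hft t ht
  have e2 := hBη t ht
  have e3 := mul_le_mul_of_nonneg_left hEm hBτ.le
  have htp := hpos t ht
  have nonneg : ∀ s ∈ Icc ε τ, 0 ≤ q s * (y s * g (y s)) := fun s hs =>
    mul_nonneg (w.pos s (hpos s hs)).le (k.mul_nonneg _)
  have e4 : (∫ s in t..τ, q s * (y s * g (y s))) ≤ ∫ s in ε..τ, q s * (y s * g (y s)) := by
    refine intervalIntegral.integral_mono_interval ht.1 ht.2 le_rfl ?_ (i1 ε hεm)
    rw [EventuallyLE, ae_restrict_iff' measurableSet_Ioc]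
    exact ae_of_all _ fun s hs => nonneg s ⟨hs.1.le, hs.2⟩
  have e5 : -(capB q τ * Fb) ≤ ∫ s in t..τ, q s * (K (y s) + H (v s)) := by
    have h1 : (∫ s in t..τ, q s * -Fb) ≤ ∫ s in t..τ, q s * (K (y s) + H (v s)) := by
      refine intervalIntegral.integral_mono_on ht.2 ((w.intervalIntegrable htp.le (hε.trans_le hετ).le).mul_const _)
        (i2 t ht) fun s hs => mul_le_mul_of_nonneg_left (hElow s) (w.pos s (hpos s (sub t ht hs))).le
    rw [intervalIntegral.integral_mul_const, ← w.capB_sub htp.le (hε.trans_le hετ).le] at h1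
    have := mul_nonneg (w.capB_pos htp).le p.Fb_nonneg
    linarith
  have e6 : 0 ≤ ∫ s in t..τ, q s * (y s * g (y s)) :=
    intervalIntegral.integral_nonneg ht.2 fun s hs => nonneg s (sub t ht hs)
  nlinarith

/-- An a priori bound on the action in terms of the initial energy. -/
lemma action_le (o : Orbit g h η ε τ v y) (w : Weight q η C₁ C₂)
    (k : Kinetic P c m g K) (p : Potential Fb h H) (hε : 0 < ε) (hετ : ε ≤ τ) {Em : ℝ}
    (hE0 : K (y ε) + H (v ε) ≤ Em) :
    action q g K H v y ε τ ≤ (P * (Em + Fb + 1) + Fb) * capB q τ := by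
  have hpos : ∀ t ∈ Icc ε τ, 0 < t := fun t ht => hε.trans_le ht.1
  have hqc : ContinuousOn q (Icc ε τ) := w.continuousOn.mono hpos
  have hyg : ContinuousOn (fun t => y t * g (y t)) (Icc ε τ) :=
    o.cont_y.mul (k.continuous.comp_continuousOn o.cont_y)
  have hP : 0 < P := by linarith [k.one_lt]
  have hb : ∀ t ∈ Icc ε τ, y t * g (y t) - K (y t) - H (v t) ≤ P * (Em + Fb + 1) + Fb := by
    intro t ht
    have h1 := o.anti_E w k p hε ⟨le_rfl, hετ⟩ ht ht.1
    simp only at h1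
    have h2 := k.growth (y t)
    have h3 := k.nonneg (y t)
    have h4 := p.lower (v t)
    have h5 : P * (K (y t) + 1) ≤ P * (Em + Fb + 1) := mul_le_mul_of_nonneg_left (by linarith) hP.le
    linarith
  have hn : 0 ≤ P * (Em + Fb + 1) + Fb := by
    have h3 := k.nonneg (y ε)
    have h4 := p.lower (v ε)
    have h5 := p.Fb_nonneg
    have : 0 ≤ P * (Em + Fb + 1) := mul_nonneg hP.le (by linarith)
    linarith
  have hτ0 : 0 < τ := hε.trans_le hετ
  have h1 : action q g K H v y ε τ ≤ ∫ t in ε..τ, q t * (P * (Em + Fb + 1) + Fb) := by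
    refine intervalIntegral.integral_mono_on hετ ?_ ((w.intervalIntegrable hε.le hτ0.le).mul_const _)
      fun t ht => mul_le_mul_of_nonneg_left (hb t ht) (w.pos t (hpos t ht)).le
    exact (hqc.mul ((hyg.sub (k.continuous'.comp_continuousOn o.cont_y)).sub
      (p.continuous'.comp_continuousOn o.cont_v))).intervalIntegrable_of_Icc hετ
  rw [intervalIntegral.integral_mul_const, ← w.capB_sub hε.le hτ0.le] at h1
  have := mul_nonneg (w.capB_pos hε).le hn
  linarith

end Orbit

/-- A continuous function descending from above `c` to below `c` has a first time at level `c`. -/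
lemma exists_first_le {v : ℝ → ℝ} {a b c : ℝ} (hab : a ≤ b) (hv : ContinuousOn v (Icc a b))
    (ha : c < v a) (hb : v b ≤ c) : ∃ t ∈ Ioc a b, v t = c ∧ ∀ s ∈ Icc a t, c ≤ v s := by
  have hK : IsCompact (Icc a b ∩ v ⁻¹' (Iic c)) := isCompact_Icc.of_isClosed_subset
    (hv.preimage_isClosed_of_isClosed isClosed_Icc isClosed_Iic) inter_subset_left
  obtain ⟨t, ⟨ht, htc⟩, hmin⟩ := hK.exists_isLeast ⟨b, ⟨hab, le_rfl⟩, hb⟩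
  have hlt : ∀ s ∈ Ico a t, c < v s := by
    intro s hs
    by_contra! h'
    exact absurd (hmin ⟨⟨hs.1, hs.2.le.trans ht.2⟩, h'⟩) (not_le.2 hs.2)
  have hat : a < t := lt_of_le_of_ne ht.1 (by rintro rfl; exact absurd htc (not_le.2 ha))
  have hcl : c ≤ v t := by
    have h1 : t ∈ closure (Ico a t) := by rw [closure_Ico hat.ne]; exact ⟨hat.le, le_rfl⟩
    exact continuousWithinAt_const.closure_le h1
      ((hv t ht).mono fun x hx => ⟨hx.1, hx.2.le.trans ht.2⟩) (fun x hx => (hlt x hx).le)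
  refine ⟨t, ⟨hat, ht.2⟩, le_antisymm htc hcl, fun s hs => ?_⟩
  rcases hs.2.eq_or_lt with rfl | h
  · exact hcl
  · exact (hlt s ⟨hs.1, h⟩).le

/-- The function `∫_0^ρ (B/q)^(P-1)`. -/
noncomputable def travel (q : ℝ → ℝ) (P ρ : ℝ) : ℝ := ∫ t in (0:ℝ)..ρ, (capB q t / q t) ^ (P - 1)

namespace Weight

variable {q η : ℝ → ℝ} {C₁ C₂ P : ℝ}

lemma continuousOn_travel_integrand (w : Weight q η C₁ C₂) (hP : 1 < P) :
    ContinuousOn (fun t => (capB q t / q t) ^ (P - 1)) (Ioi 0) := by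
  have hB : ContinuousOn (capB q) (Ioi 0) := fun t ht => (w.hasDerivAt_capB ht).continuousAt.continuousWithinAt
  exact (hB.div w.continuousOn fun t ht => (w.pos t ht).ne').rpow_const fun t ht => Or.inr (by linarith)

lemma travel_intervalIntegrable (w : Weight q η C₁ C₂) (hP : 1 < P) {t : ℝ} (ht : 0 ≤ t) :
    IntervalIntegrable (fun t => (capB q t / q t) ^ (P - 1)) volume 0 t := by
  rw [intervalIntegrable_iff_integrableOn_Ioc_of_le ht]
  refine IntegrableOn.of_bound measure_Ioc_lt_top ?_ (t ^ (P - 1)) ?_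
  · exact ((w.continuousOn_travel_integrand hP).mono fun x hx => hx.1).aestronglyMeasurable measurableSet_Ioc
  · rw [ae_restrict_iff' measurableSet_Ioc]
    refine ae_of_all _ fun x hx => ?_
    have h1 := w.capB_le hx.1
    have h2 := w.pos x hx.1
    have h3 := w.capB_pos hx.1
    have h4 : capB q x / q x ≤ x := by rwa [div_le_iff₀ h2]
    rw [Real.norm_of_nonneg (by positivity)]
    exact Real.rpow_le_rpow (by positivity) (h4.trans hx.2) (by linarith)

lemma hasDerivAt_travel (w : Weight q η C₁ C₂) (hP : 1 < P) {t : ℝ} (ht : 0 < t) :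
    HasDerivAt (travel q P) ((capB q t / q t) ^ (P - 1)) t := by
  have hc := w.continuousOn_travel_integrand hP
  exact intervalIntegral.integral_hasDerivAt_right (w.travel_intervalIntegrable hP ht.le)
    (hc.stronglyMeasurableAtFilter isOpen_Ioi t ht) (hc.continuousAt (Ioi_mem_nhds ht))

lemma travel_nonneg (w : Weight q η C₁ C₂) {t : ℝ} (ht : 0 ≤ t) : 0 ≤ travel q P t := by
  rw [travel, intervalIntegral.integral_of_le ht]
  refine setIntegral_nonneg measurableSet_Ioc fun x hx => ?_
  have h2 := w.pos x hx.1
  have h3 := w.capB_pos hx.1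
  positivity

end Weight

end NodalRadial

/-! ### The Pohozaev argument. -/

namespace NodalRadial

namespace Orbit

variable {q η g K h H f F v y : ℝ → ℝ} {C₁ C₂ P c m Fb ε τ : ℝ}

/-- While the force is nonnegative, an orbit starting at rest descends. -/
lemma descent (o : Orbit g h η ε τ v y) (w : Weight q η C₁ C₂) (k : Kinetic P c m g K)
    (hε : 0 < ε) (hετ : ε ≤ τ) (hy : y ε = 0) (hh : ∀ t ∈ Icc ε τ, 0 ≤ h (v t)) :
    AntitoneOn (fun t => q t * y t) (Icc ε τ) ∧ (∀ t ∈ Icc ε τ, y t ≤ 0) ∧ AntitoneOn v (Icc ε τ) := by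
  have hz : AntitoneOn (fun t => q t * y t) (Icc ε τ) :=
    antitoneOn_of_hasDerivWithinAt_nonpos (convex_Icc ε τ)
      (fun t ht => (o.hasDerivAt_momentum w hε ht).continuousAt.continuousWithinAt)
      (fun t ht => (o.hasDerivAt_momentum w hε (interior_subset ht)).hasDerivWithinAt)
      (fun t ht => by
        have := mul_nonneg (w.pos t (hε.trans_le (interior_subset ht).1)).le (hh t (interior_subset ht))
        linarith)
  have hy0 : ∀ t ∈ Icc ε τ, y t ≤ 0 := by
    intro t ht
    have := hz ⟨le_rfl, hετ⟩ ht ht.1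
    simp only [hy, mul_zero] at this
    exact nonpos_of_mul_nonpos_right this (w.pos t (hε.trans_le ht.1))
  refine ⟨hz, hy0, antitoneOn_of_hasDerivWithinAt_nonpos (convex_Icc ε τ) o.cont_v
    (fun t ht => (o.dv t (interior_subset ht)).hasDerivWithinAt) fun t ht => ?_⟩
  rcases (hy0 t (interior_subset ht)).eq_or_lt with h0 | h0
  · rw [h0, k.map_zero]
  · exact (k.neg h0).le

/-- The time needed to descend under a bounded force. -/
lemma drop_le_travel (o : Orbit g h η ε τ v y) (w : Weight q η C₁ C₂) (k : Kinetic P c m g K)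
    (hε : 0 < ε) (hετ : ε ≤ τ) (hy : y ε = 0) {M : ℝ} (hM : 0 ≤ M) (hh : ∀ t ∈ Icc ε τ, 0 ≤ h (v t))
    (hhM : ∀ t ∈ Icc ε τ, h (v t) ≤ M) : v ε - v τ ≤ M ^ (P - 1) * travel q P τ := by
  have hP := k.one_lt
  have hy0 := (o.descent w k hε hετ hy hh).2.1
  have hpos : ∀ t ∈ Icc ε τ, 0 < t := fun t ht => hε.trans_le ht.1
  -- The momentum satisfies (q y)' = -q h ≥ -Mq, so q|y| ≤ M B. Integrating the resulting bound on
  -- v' produces exactly `travel`.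
  have hbd : ∀ t ∈ Icc ε τ, |y t| ≤ M * (capB q t / q t) := by
    intro t ht
    have hm : MonotoneOn (fun t => q t * y t + M * capB q t) (Icc ε τ) := by
      have hd : ∀ t ∈ Icc ε τ, HasDerivAt (fun t => q t * y t + M * capB q t)
          (-(q t * h (v t)) + M * q t) t := fun t ht =>
        (o.hasDerivAt_momentum w hε ht).fun_add ((w.hasDerivAt_capB (hpos t ht)).const_mul M)
      refine monotoneOn_of_hasDerivWithinAt_nonneg (convex_Icc ε τ)
        (fun t ht => (hd t ht).continuousAt.continuousWithinAt)
        (fun t ht => (hd t (interior_subset ht)).hasDerivWithinAt) (fun t ht => ?_)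
      have := mul_le_mul_of_nonneg_left (hhM t (interior_subset ht)) (w.pos t (hpos t (interior_subset ht))).le
      linarith
    have h1 := hm ⟨le_rfl, hετ⟩ ht ht.1
    simp only [hy, mul_zero, zero_add] at h1
    have h2 := mul_nonneg hM (w.capB_pos hε).le
    have hq := w.pos t (hpos t ht)
    rw [abs_of_nonpos (hy0 t ht), ← mul_div_assoc, le_div_iff₀ hq]
    linarith
  have hm : MonotoneOn (fun t => v t + M ^ (P - 1) * travel q P t) (Icc ε τ) := by
    have hd : ∀ t ∈ Icc ε τ, HasDerivAt (fun t => v t + M ^ (P - 1) * travel q P t)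
        (g (y t) + M ^ (P - 1) * (capB q t / q t) ^ (P - 1)) t := fun t ht =>
      (o.dv t ht).fun_add ((w.hasDerivAt_travel hP (hpos t ht)).const_mul _)
    refine monotoneOn_of_hasDerivWithinAt_nonneg (convex_Icc ε τ)
      (fun t ht => (hd t ht).continuousAt.continuousWithinAt)
      (fun t ht => (hd t (interior_subset ht)).hasDerivWithinAt) (fun t ht => ?_)
    have ht' := interior_subset ht
    have h1 := k.abs_le (y t)
    have hq := w.pos t (hpos t ht')
    have hB := w.capB_pos (hpos t ht')
    have h2 := Real.rpow_le_rpow (abs_nonneg _) (hbd t ht') (by linarith : 0 ≤ P - 1)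
    rw [Real.mul_rpow hM (by positivity)] at h2
    have := (abs_le.1 (h1.trans h2)).1
    linarith
  have h1 := hm ⟨le_rfl, hετ⟩ ⟨hετ, le_rfl⟩ hετ
  simp only at h1
  have h2 : 0 ≤ M ^ (P - 1) * travel q P ε := mul_nonneg (Real.rpow_nonneg hM _) (w.travel_nonneg hε.le)
  linarith

set_option maxHeartbeats 1000000 in
/-- Sub-criticality excludes large initial values with bounded action. -/
lemma lt_of_subcritical (o : Orbit g h η ε τ v y) (w : Weight q η C₁ C₂) (k : Kinetic P c m g K)
    (p : Potential Fb h H) (hε : 0 < ε) (hετ : ε < τ) {τ₁ l α μ Q R N : ℝ}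
    (hτ₁ : ε ≤ τ₁) (hτ₁τ : τ₁ ≤ τ) (hv : v ε = l) (hy : y ε = 0) (hl : 0 < l) (hα : α ∈ Ioo (0:ℝ) 1)
    (hf : Continuous f) (hF : ∀ s, HasDerivAt F (f s) s)
    (heq : ∀ s, α * l / 2 ≤ s → h s = f s) (hclose : ∀ s, |H s - F s| ≤ 1)
    (hf0 : ∀ s, α * l / 2 ≤ s → 0 < f s) (hF0 : 0 ≤ F (α * l))
    (hμ : ∀ t ∈ Icc ε τ₁, capB q t * η t ≤ (μ + 1 / P) * q t)
    (hQ : (∫ t in ε..τ, q t * (y t * g (y t))) ≤ Q)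
    (hR : ∀ t ∈ Icc ε τ, capB q t * (K (y t) + H (v t)) ≤ R)
    (hbig : ∀ s, α * l / 2 ≤ s → R < capB q τ₁ * H s)
    (hN : 2 * capB q τ₁ ≤ N)
    (hSC : ∀ s₁ ∈ Icc (α * l) l, ∀ s₂ ∈ Icc (α * l) l, ∀ ρ, 0 < ρ →
      (1 - α) * l ≤ f s₁ ^ (P - 1) * travel q P ρ → N ≤ (F s₂ - μ * s₂ * f s₂) * capB q ρ) :
    N ≤ (4 + 2 * (1 + |μ| / (1 - α))) * (R + capB q τ₁ + 2 * |μ| * Q) := by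
  obtain ⟨hα0, hα1⟩ := hα
  have hP := k.one_lt
  have hαl : 0 < α * l := mul_pos hα0 hl
  have hαl' : α * l < l := by nlinarith
  have o1 : Orbit g h η ε τ₁ v y := o.mono le_rfl hτ₁τ
  have hτ₁0 : 0 < τ₁ := hε.trans_le hτ₁
  -- the orbit descends to half of the level
  have hvτ : v τ₁ ≤ α * l / 2 := by
    by_contra! hcon
    have h1 := hbig (v τ₁) hcon.le
    have h2 := hR τ₁ ⟨hτ₁, hτ₁τ⟩
    have h3 := mul_nonneg (w.capB_pos hτ₁0).le (k.nonneg (y τ₁))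
    nlinarith
  obtain ⟨r₂, hr₂, hvr₂, hge₂⟩ := exists_first_le hτ₁ o1.cont_v (by rw [hv]; linarith) hvτ
  have o2 : Orbit g h η ε r₂ v y := o1.mono le_rfl hr₂.2
  obtain ⟨r₁, hr₁, hvr₁, hge₁⟩ := exists_first_le (c := α * l) hr₂.1.le o2.cont_v (by rw [hv]; linarith)
    (by linarith)
  have o3 : Orbit g h η ε r₁ v y := o2.mono le_rfl hr₁.2
  have hh2 : ∀ t ∈ Icc ε r₂, 0 ≤ h (v t) := fun t ht => by
    rw [heq _ (hge₂ t ht)]; exact (hf0 _ (hge₂ t ht)).le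
  obtain ⟨hz, hy0, hanti⟩ := o2.descent w k hε hr₂.1.le hy hh2
  have hpos : ∀ t ∈ Icc ε r₂, 0 < t := fun t ht => hε.trans_le ht.1
  have sub1 : Icc ε r₁ ⊆ Icc ε r₂ := Icc_subset_Icc_right hr₁.2
  have hr₁m : r₁ ∈ Icc ε r₂ := ⟨hr₁.1.le, hr₁.2⟩
  have hr₁0 := hpos r₁ hr₁m
  have hle : ∀ t ∈ Icc ε r₁, v t ∈ Icc (α * l) l := fun t ht =>
    ⟨hge₁ t ht, by rw [← hv]; exact hanti ⟨le_rfl, hr₂.1.le⟩ (sub1 ht) ht.1⟩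
  -- sub-criticality applies at the first time at level `α l`
  obtain ⟨s₁, hs₁, hs₁max⟩ := isCompact_Icc.exists_isMaxOn (nonempty_Icc.2 hαl'.le) hf.continuousOn
  have hfs₁ : 0 < f s₁ := hf0 s₁ (by linarith [hs₁.1])
  -- Up to r₁ the position lies in [αl, l], so f(s₁) bounds the force. The drop from l to αl then
  -- makes r₁ an admissible ρ in `hSC`.
  have htrav := o3.drop_le_travel w k hε hr₁.1.le hy hfs₁.le (fun t ht => hh2 t (sub1 ht))
    (fun t ht => by
      rw [heq _ (by linarith [(hle t ht).1])]
      exact hs₁max (hle t ht))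
  rw [hv, hvr₁] at htrav
  have hSC' : ∀ s₂ ∈ Icc (α * l) l, N ≤ (F s₂ - μ * s₂ * f s₂) * capB q r₁ := fun s₂ hs₂ =>
    hSC s₁ hs₁ s₂ hs₂ r₁ hr₁0 (by linarith)
  have hB₁ := w.capB_pos hr₁0
  have hBτ₁ := w.capB_pos hτ₁0
  have hB₁τ : capB q r₁ ≤ capB q τ₁ := w.capB_mono hr₁0.le (hr₁.2.trans hr₂.2)
  set m' := N / capB q r₁ with hm'
  have hmN : m' * capB q r₁ = N := div_mul_cancel₀ _ hB₁.ne'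
  have hm2 : 2 ≤ m' := by
    rw [hm', le_div_iff₀ hB₁]; linarith
  have hm'F : ∀ s₂ ∈ Icc (α * l) l, m' ≤ F s₂ - μ * s₂ * f s₂ := fun s₂ hs₂ => by
    rw [hm', div_le_iff₀ hB₁]; exact hSC' s₂ hs₂
  -- the Pohozaev function
  set Φ : ℝ → ℝ := fun t => capB q t * (K (y t) + H (v t)) + capB q t + μ * (q t * y t * v t) with hΦ
  have hdΦ : ∀ t ∈ Icc ε r₁, HasDerivAt Φ (q t * (K (y t) + H (v t))
      - capB q t * η t * (y t * g (y t)) + q t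
      + μ * (-(q t * h (v t)) * v t + q t * y t * g (y t))) t := fun t ht =>
    ((o3.hasDerivAt_capB_mul_energy w k p hε ht).fun_add (w.hasDerivAt_capB (hpos t (sub1 ht)))).fun_add
      (((o3.hasDerivAt_momentum w hε ht).fun_mul (o3.dv t ht)).const_mul μ)
  -- By `hμ` and the growth bound y g(y)/P ≤ K + 1, the kinetic terms of the derivative are
  -- nonnegative once the added term B has offset the 1. What remains is q (H - μ v f - m'/2) ≥ q
  -- (m' - 1 - m'/2), where the 1 is the error between H and F; it is nonnegative as m' ≥ 2.
  have hmono : MonotoneOn (fun t => Φ t - m' / 2 * capB q t) (Icc ε r₁) := by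
    have hd : ∀ t ∈ Icc ε r₁, HasDerivAt (fun t => Φ t - m' / 2 * capB q t) _ t := fun t ht =>
      (hdΦ t ht).fun_sub ((w.hasDerivAt_capB (hpos t (sub1 ht))).const_mul (m' / 2))
    refine monotoneOn_of_hasDerivWithinAt_nonneg (convex_Icc ε r₁)
      (fun t ht => (hd t ht).continuousAt.continuousWithinAt)
      (fun t ht => (hd t (interior_subset ht)).hasDerivWithinAt) (fun t ht => ?_)
    have ht' := interior_subset ht
    have hq := w.pos t (hpos t (sub1 ht'))
    have h1 := hμ t ⟨ht'.1, ht'.2.trans (hr₁.2.trans hr₂.2)⟩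
    have h2 := k.growth (y t)
    have h2' : y t * g (y t) / P ≤ K (y t) + 1 := by rw [div_le_iff₀ (by linarith)]; linarith
    have h3 := mul_le_mul_of_nonneg_right h1 (k.mul_nonneg (y t))
    have h4 := hm'F (v t) (hle t ht')
    have h5 := (abs_le.1 (hclose (v t))).1
    rw [heq (v t) (by linarith [(hle t ht').1])]
    have h6 : 0 ≤ F (v t) - 1 - μ * v t * f (v t) - m' / 2 := by linarith
    have h7 := mul_nonneg hq.le h6
    have h8 := mul_le_mul_of_nonneg_left h2' hq.le
    have h9 := mul_le_mul_of_nonneg_left h5 hq.le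
    have h10 : (μ + 1 / P) * q t * (y t * g (y t)) = μ * (q t * y t * g (y t)) + q t * (y t * g (y t) / P) := by
      ring
    rw [h10] at h3
    nlinarith
  have hmn := hmono ⟨le_rfl, hr₁.1.le⟩ ⟨hr₁.1.le, le_rfl⟩ hr₁.1.le
  simp only [hΦ, hy, hv, k.zero, mul_zero, zero_mul, add_zero, zero_add] at hmn
  have hBε := w.capB_pos hε
  have hHl : F l ≤ H l + 1 := by linarith [(abs_le.1 (hclose l)).1]
  have hstart : capB q ε * F l ≤ capB q ε * H l + capB q ε := by nlinarith
  -- comparison of the potential with `m'`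
  have hFm : m' ≤ F l * (1 + |μ| / (1 - α)) := by
    obtain ⟨s, hs, hse⟩ := exists_hasDerivAt_eq_slope F f hαl'
      (fun s _ => (hF s).continuousAt.continuousWithinAt) (fun s _ => hF s)
    have hFmono : MonotoneOn F (Icc (α * l) l) :=
      monotoneOn_of_hasDerivWithinAt_nonneg (convex_Icc _ _)
        (fun s _ => (hF s).continuousAt.continuousWithinAt) (fun s _ => (hF s).hasDerivWithinAt)
        (fun s hs => (hf0 s (by linarith [(interior_subset hs).1])).le)
    have hs' : s ∈ Icc (α * l) l := ⟨hs.1.le, hs.2.le⟩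
    have h1 := hm'F s hs'
    have h2 : F s ≤ F l := hFmono hs' ⟨hαl'.le, le_rfl⟩ hs.2.le
    have h3 : f s * ((1 - α) * l) ≤ F l := by
      have h5 : f s * ((1 - α) * l) = F l - F (α * l) := by
        rw [hse, show (1 - α) * l = l - α * l by ring]
        exact div_mul_cancel₀ _ (by linarith)
      linarith
    have hfs := hf0 s (by linarith [hs.1])
    have h4 : -(μ * s * f s) ≤ |μ| / (1 - α) * F l := by
      have e1 : -(μ * s * f s) ≤ |μ| * (s * f s) := by
        have := mul_le_mul_of_nonneg_right (neg_abs_le μ) (mul_pos (hαl.trans hs.1) hfs).le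
        linarith
      have e2 : s * f s ≤ F l / (1 - α) := by
        rw [le_div_iff₀ (by linarith)]
        have : s * f s ≤ l * f s := mul_le_mul_of_nonneg_right hs.2.le hfs.le
        have h5 := mul_le_mul_of_nonneg_right this (by linarith : 0 ≤ 1 - α)
        linarith
      calc _ ≤ |μ| * (s * f s) := e1
        _ ≤ |μ| * (F l / (1 - α)) := mul_le_mul_of_nonneg_left e2 (abs_nonneg _)
        _ = _ := by ring
    linarith
  -- the boundary term is controlled by the dissipation
  set Z := -(q r₁ * y r₁) with hZ
  have hZ0 : 0 ≤ Z := by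
    have := mul_nonpos_of_nonneg_of_nonpos (w.pos r₁ hr₁0).le (hy0 r₁ hr₁m)
    linarith
  -- Between r₁ and r₂ the orbit falls by αl/2 while its momentum -q y stays at least Z, so this
  -- stretch alone dissipates at least Zαl/2.
  have hdiss : Z * (α * l) ≤ 2 * Q := by
    have hsub : Icc r₁ r₂ ⊆ Icc ε r₂ := Icc_subset_Icc_left hr₁.1.le
    have hyg : ContinuousOn (fun t => q t * (y t * g (y t))) (Icc ε τ) :=
      (w.continuousOn.mono fun t ht => hε.trans_le ht.1).mul
        (o.cont_y.mul (k.continuous.comp_continuousOn o.cont_y))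
    have hi := hyg.intervalIntegrable_of_Icc hετ.le (μ := volume)
    have e1 : (∫ t in r₁..r₂, q t * (y t * g (y t))) ≤ ∫ t in ε..τ, q t * (y t * g (y t)) := by
      refine intervalIntegral.integral_mono_interval hr₁.1.le hr₁.2 (hr₂.2.trans hτ₁τ) ?_ hi
      rw [EventuallyLE, ae_restrict_iff' measurableSet_Ioc]
      exact ae_of_all _ fun s hs => mul_nonneg (w.pos s (hε.trans hs.1)).le (k.mul_nonneg _)
    have hgc : ContinuousOn (fun t => g (y t)) (Icc r₁ r₂) :=
      (k.continuous.comp_continuousOn o2.cont_y).mono hsub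
    have hgi := hgc.intervalIntegrable_of_Icc hr₁.2 (μ := volume)
    have e2 : (∫ t in r₁..r₂, -Z * g (y t)) ≤ ∫ t in r₁..r₂, q t * (y t * g (y t)) := by
      refine intervalIntegral.integral_mono_on hr₁.2 (hgi.const_mul _) ?_ fun t ht => ?_
      · exact (hyg.mono fun t ht => ⟨hr₁.1.le.trans ht.1, ht.2.trans (hr₂.2.trans hτ₁τ)⟩).intervalIntegrable_of_Icc hr₁.2
      · have h1 := hz hr₁m (hsub ht) ht.1
        simp only at h1
        have h2 : g (y t) ≤ 0 := by
          rcases (hy0 t (hsub ht)).eq_or_lt with h0 | h0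
          · rw [h0, k.map_zero]
          · exact (k.neg h0).le
        have h3 := mul_le_mul_of_nonpos_right h1 h2
        rw [hZ, neg_neg]
        linarith
    have e3 : (∫ t in r₁..r₂, g (y t)) = v r₂ - v r₁ :=
      intervalIntegral.integral_eq_sub_of_hasDerivAt
        (fun t ht => o2.dv t (hsub (by rwa [uIcc_of_le hr₁.2] at ht))) hgi
    rw [intervalIntegral.integral_const_mul, e3, hvr₁, hvr₂] at e2
    linarith
  have hend := hR r₁ ⟨hr₁.1.le, hr₁.2.trans (hr₂.2.trans hτ₁τ)⟩
  have hterm : μ * (q r₁ * y r₁ * v r₁) ≤ 2 * |μ| * Q := by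
    have e1 : μ * (q r₁ * y r₁ * v r₁) = -μ * (Z * (α * l)) := by rw [hvr₁, hZ]; ring
    rw [e1]
    have e2 := mul_le_mul_of_nonneg_right (neg_le_abs μ) (mul_nonneg hZ0 hαl.le)
    have e3 := mul_le_mul_of_nonneg_left hdiss (abs_nonneg μ)
    linarith
  set S := R + capB q τ₁ + 2 * |μ| * Q with hS
  have hlow : capB q ε * F l + m' / 2 * (capB q r₁ - capB q ε) ≤ S := by
    nlinarith
  have hμα : 0 ≤ |μ| / (1 - α) := div_nonneg (abs_nonneg _) (by linarith)
  have hBε1 : capB q ε ≤ capB q r₁ := w.capB_mono hε.le hr₁.1.le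
  have hFl0 : 0 ≤ F l := by
    have : 0 ≤ F l * (1 + |μ| / (1 - α)) := by linarith
    exact nonneg_of_mul_nonneg_left this (by linarith)
  have hS0 : 0 ≤ S := by
    have e1 := mul_nonneg hBε.le hFl0
    have e2 := mul_nonneg (by linarith : 0 ≤ m' / 2) (sub_nonneg.2 hBε1)
    linarith
  -- If B(ε) is at most half of B(r₁), the growth of Φ over [ε, r₁] gives the bound. Otherwise there
  -- may be little growth, but the initial term B(ε)F(l) is comparable with B(r₁)m' = N by `hFm`.
  rcases le_total (capB q ε) (capB q r₁ / 2) with hcase | hcase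
  · have e1 : N ≤ 4 * S := by
      have h1 := mul_nonneg hBε.le hFl0
      have h2 : m' / 2 * (capB q r₁ / 2) ≤ m' / 2 * (capB q r₁ - capB q ε) :=
        mul_le_mul_of_nonneg_left (by linarith) (by linarith)
      linarith
    have := mul_nonneg hμα hS0
    nlinarith
  · have e1 : capB q r₁ / 2 * F l ≤ S := by
      have h1 := mul_le_mul_of_nonneg_right hcase hFl0
      have e2 := mul_nonneg (by linarith : 0 ≤ m' / 2) (sub_nonneg.2 hBε1)
      linarith
    have e2 : N ≤ 2 * (1 + |μ| / (1 - α)) * S := by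
      have h1 := mul_le_mul_of_nonneg_right hFm hB₁.le
      rw [hmN] at h1
      have h2 := mul_le_mul_of_nonneg_left e1 (by linarith : 0 ≤ 2 * (1 + |μ| / (1 - α)))
      nlinarith
    linarith

end Orbit

end NodalRadial

/-! ### The force, its approximations, and constants uniform in them. -/

namespace NodalRadial

/-- The sign conditions on the force `f` and its primitive `F`. -/
structure Force (f F : ℝ → ℝ) (βm βp : ℝ) (L : EReal) : Prop where
  cont : Continuous f
  lip : LocallyLipschitzOn {0}ᶜ f
  zero : f 0 = 0
  hasDeriv : ∀ s, HasDerivAt F (f s) s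
  zero' : F 0 = 0
  βm_neg : βm < 0
  βp_pos : 0 < βp
  neg : ∀ s ∈ Ioo βm βp, s ≠ 0 → F s < 0
  map_βm : F βm = 0
  map_βp : F βp = 0
  pos : ∀ s, βp ≤ s → 0 < f s
  neg' : ∀ s, s ≤ βm → f s < 0
  top : Tendsto (fun s => (F s : EReal)) atTop (𝓝 L)
  bot : Tendsto (fun s => (F s : EReal)) atBot (𝓝 L)

/-- A Lipschitz force `h` with potential `H` approximating `f` and `F`. -/
structure Approx (f F : ℝ → ℝ) (d₁ d₂ cH Fb ω : ℝ) (h H : ℝ → ℝ) : Prop extends Potential Fb h H where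
  eq : ∀ s, d₁ ≤ |s| → h s = f s
  close : ∀ s, |H s - F s| ≤ ω
  close' : ∀ s, |h s - f s| ≤ ω
  nonpos : ∀ s, |s| ≤ d₂ → H s ≤ 0
  neg : ∀ s, d₁ ≤ |s| → |s| ≤ d₂ → H s ≤ -cH

namespace Force

variable {f F : ℝ → ℝ} {βm βp : ℝ} {L : EReal}

lemma reflect (X : Force f F βm βp L) :
    Force (fun s => -f (-s)) (fun s => F (-s)) (-βp) (-βm) L where
  cont := by have := X.cont; fun_prop
  lip := by
    intro s hs
    obtain ⟨K, t, ht, hK⟩ := X.lip (x := -s) (by simpa using hs)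
    refine ⟨K, Neg.neg ⁻¹' t, ?_, ?_⟩
    · have h1 : Tendsto (Neg.neg : ℝ → ℝ) (𝓝[{0}ᶜ] s) (𝓝[{0}ᶜ] (-s)) := by
        refine tendsto_nhdsWithin_of_tendsto_nhds_of_eventually_within _
          (continuous_neg.tendsto s |>.mono_left nhdsWithin_le_nhds) ?_
        filter_upwards [self_mem_nhdsWithin] with x hx
        simpa using hx
      exact h1 ht
    · refine LipschitzOnWith.of_dist_le_mul fun x hx z hz => ?_
      have := hK.dist_le_mul (-x) hx (-z) hz
      simpa [dist_neg_neg] using this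
  zero := by simp [X.zero]
  hasDeriv s := by
    have := (X.hasDeriv (-s)).scomp s (hasDerivAt_neg s)
    simpa [Function.comp_def] using this
  zero' := by simp [X.zero']
  βm_neg := by linarith [X.βp_pos]
  βp_pos := by linarith [X.βm_neg]
  neg s hs h0 := X.neg (-s) ⟨by linarith [hs.2], by linarith [hs.1]⟩ (by simpa using h0)
  map_βm := by simp [X.map_βp]
  map_βp := by simp [X.map_βm]
  pos s hs := by linarith [X.neg' (-s) (by linarith)]
  neg' s hs := by linarith [X.pos (-s) (by linarith)]
  top := X.bot.comp tendsto_neg_atTop_atBot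
  bot := X.top.comp tendsto_neg_atBot_atTop

lemma cont' (X : Force f F βm βp L) : Continuous F :=
  continuous_iff_continuousAt.2 fun s => (X.hasDeriv s).continuousAt

lemma strictMonoOn (X : Force f F βm βp L) : StrictMonoOn F (Ici βp) :=
  strictMonoOn_of_hasDerivWithinAt_pos (convex_Ici βp) X.cont'.continuousOn
    (fun s _ => (X.hasDeriv s).hasDerivWithinAt) (fun s hs => X.pos s (interior_subset hs))

lemma lt_lim_of_le (X : Force f F βm βp L) {s : ℝ} (hs : βp ≤ s) : (F s : EReal) < L := by
  have h1 : F s < F (s + 1) := X.strictMonoOn hs (mem_Ici.2 (by linarith)) (by linarith)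
  refine lt_of_lt_of_le (EReal.coe_lt_coe_iff.2 h1) (ge_of_tendsto X.top ?_)
  filter_upwards [eventually_ge_atTop (s + 1)] with x hx
  exact EReal.coe_le_coe_iff.2 (X.strictMonoOn.monotoneOn (mem_Ici.2 (by linarith))
    (mem_Ici.2 (by linarith)) hx)

lemma nonpos (X : Force f F βm βp L) {s : ℝ} (h1 : βm ≤ s) (h2 : s ≤ βp) : F s ≤ 0 := by
  rcases h1.eq_or_lt with rfl | h1
  · exact X.map_βm.le
  rcases h2.eq_or_lt with rfl | h2
  · exact X.map_βp.le
  by_cases h0 : s = 0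
  · rw [h0, X.zero']
  · exact (X.neg s ⟨h1, h2⟩ h0).le

lemma lim_pos (X : Force f F βm βp L) : 0 < L := by
  have := X.lt_lim_of_le le_rfl
  rwa [X.map_βp, EReal.coe_zero] at this

/-- F increases beyond βp, decreases before βm and is nonpositive in between, so its common limit at
both infinities is never attained. Hence sublevels at any level attained by F are bounded on both
sides; this is what confines orbits when F is bounded. -/
lemma lt_lim (X : Force f F βm βp L) (s : ℝ) : (F s : EReal) < L := by
  rcases le_total βp s with h | h
  · exact X.lt_lim_of_le h
  rcases le_total s βm with h' | h'
  · have := X.reflect.lt_lim_of_le (s := -s) (by linarith)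
    simpa using this
  · refine lt_of_le_of_lt ?_ X.lim_pos
    exact_mod_cast X.nonpos h' h

lemma exists_lower (X : Force f F βm βp L) : ∃ Fb : ℝ, 0 ≤ Fb ∧ ∀ s, -Fb ≤ F s := by
  obtain ⟨b, hb⟩ := (isCompact_Icc (a := βm) (b := βp)).exists_bound_of_continuousOn X.cont'.continuousOn
  refine ⟨|b|, abs_nonneg b, fun s => ?_⟩
  have hp : ∀ {f F : ℝ → ℝ} {βm βp : ℝ}, Force f F βm βp L → ∀ s, βp ≤ s → 0 ≤ F s :=
    fun X s hs => by
      have := X.strictMonoOn.monotoneOn self_mem_Ici hs hs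
      rwa [X.map_βp] at this
  rcases le_total βp s with h | h
  · linarith [hp X s h, abs_nonneg b]
  rcases le_total s βm with h' | h'
  · have := hp X.reflect (-s) (by linarith)
    simp only [neg_neg] at this
    linarith [abs_nonneg b]
  · have := hb s ⟨h', h⟩
    rw [Real.norm_eq_abs] at this
    linarith [(abs_le.1 (this.trans (le_abs_self b))).1]

lemma exists_gt (X : Force f F βm βp L) {a : ℝ} (ha : (a : EReal) < L) :
    ∃ M : ℝ, 0 < M ∧ ∀ s, M ≤ |s| → a < F s := by
  obtain ⟨M₁, h1⟩ := eventually_atTop.1 (X.top.eventually (lt_mem_nhds ha))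
  obtain ⟨M₂, h2⟩ := eventually_atBot.1 (X.bot.eventually (lt_mem_nhds ha))
  refine ⟨max 1 (max M₁ (-M₂)), by positivity, fun s hs => ?_⟩
  have e1 := (le_max_left M₁ (-M₂)).trans ((le_max_right 1 _).trans hs)
  have e2 := (le_max_right M₁ (-M₂)).trans ((le_max_right 1 _).trans hs)
  rcases le_total 0 s with h | h
  · rw [abs_of_nonneg h] at e1
    exact EReal.coe_lt_coe_iff.1 (h1 s e1)
  · rw [abs_of_nonpos h] at e2
    exact EReal.coe_lt_coe_iff.1 (h2 s (by linarith))

/-- A margin below the limit of F that later absorbs the distance between H and F. -/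
lemma exists_room {a : ℝ} (ha : (a : EReal) < L) : ∃ ω : ℝ, 0 < ω ∧ ((a + ω : ℝ) : EReal) < L := by
  obtain ⟨b, h1, h2⟩ := EReal.lt_iff_exists_real_btwn.1 ha
  exact ⟨b - a, sub_pos.2 (EReal.coe_lt_coe_iff.1 h1), by rwa [add_sub_cancel]⟩

lemma exists_pos_bound (X : Force f F βm βp L) (M : ℝ) : ∃ c₀ > 0, ∀ s, βp ≤ s → s ≤ M → c₀ ≤ f s := by
  rcases (Icc βp M).eq_empty_or_nonempty with h | h
  · exact ⟨1, one_pos, fun s h1 h2 => absurd (show s ∈ Icc βp M from ⟨h1, h2⟩) (h ▸ notMem_empty s)⟩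
  · obtain ⟨s, hs, hmin⟩ := isCompact_Icc.exists_isMinOn h X.cont.continuousOn
    exact ⟨f s, X.pos s hs.1, fun t h1 h2 => hmin ⟨h1, h2⟩⟩

/-- The force is bounded away from zero between two energy levels, uniformly for nearby forces. -/
lemma exists_window (X : Force f F βm βp L) {d₁ d₂ cH Fb e Em ω₀ : ℝ} (hd : d₁ ≤ βp) (hd' : d₁ ≤ -βm)
    (he : 0 < e) (hω : ω₀ ≤ e / 2) (hEm : ((Em + ω₀ : ℝ) : EReal) < L) :
    ∃ M c₀ : ℝ, 0 < M ∧ 0 < c₀ ∧ ∀ h H ω, ω ≤ ω₀ → Approx f F d₁ d₂ cH Fb ω h H → Window h H e Em M c₀ := by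
  obtain ⟨M, hM, hMF⟩ := X.exists_gt hEm
  obtain ⟨c₁, hc₁, h1⟩ := X.exists_pos_bound M
  obtain ⟨c₂, hc₂, h2⟩ := X.reflect.exists_pos_bound M
  refine ⟨M, min c₁ c₂, hM, lt_min hc₁ hc₂, fun h H ω hωω A => ?_⟩
  have hbound : ∀ s, H s ≤ Em → |s| ≤ M := by
    intro s hs
    by_contra! h'
    have := hMF s h'.le
    have := (abs_le.1 (A.close s)).1
    linarith
  refine ⟨hM, lt_min hc₁ hc₂, hbound, fun s hs h3 h4 => ?_, fun s hs h3 h4 => ?_⟩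
  · have hs' : βp ≤ s := by
      by_contra! h'
      have := X.neg s ⟨X.βm_neg.trans hs, h'⟩ hs.ne'
      have := (abs_le.1 (A.close s)).2
      linarith
    rw [A.eq s (by rw [abs_of_pos hs]; linarith)]
    exact (min_le_left _ _).trans (h1 s hs' ((le_abs_self s).trans (hbound s h4)))
  · have hs' : -βm ≤ -s := by
      by_contra! h'
      have := X.neg s ⟨by linarith, hs.trans X.βp_pos⟩ hs.ne
      have := (abs_le.1 (A.close s)).2
      linarith
    rw [A.eq s (by rw [abs_of_neg hs]; linarith)]
    have := h2 (-s) hs' ((neg_le_abs s).trans (hbound s h4))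
    simp only [neg_neg] at this
    linarith [min_le_right c₁ c₂]

variable {P c m d₁ d₂ cH Fb : ℝ}

lemma exists_potential_bound (X : Force f F βm βp L) (M : ℝ) :
    ∃ b : ℝ, 0 ≤ b ∧ (b : EReal) < L ∧ ∀ s, |s| ≤ M → F s ≤ b := by
  obtain ⟨s, hs, hmax⟩ := (isCompact_Icc (a := -|M|) (b := |M|)).exists_isMaxOn
    ⟨0, by simp⟩ X.cont'.continuousOn
  refine ⟨F s, ?_, X.lt_lim s, fun t ht => hmax (abs_le.1 (ht.trans (le_abs_self M)))⟩
  rw [← X.zero']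
  exact hmax (abs_le.1 (by simp : |(0:ℝ)| ≤ |M|))

lemma exists_energy_bound (X : Force f F βm βp L) (hP : 1 < P) (Im : ℝ) :
    ∃ Em : ℝ, 0 ≤ Em ∧ ∀ g K h H ω, ω ≤ 1 → Kinetic P c m g K → Approx f F d₁ d₂ cH Fb ω h H →
      ∀ v y : ℝ, (v ^ 2 + y ^ 2) / 2 ≤ Im → K y + H v ≤ Em := by
  obtain ⟨b, hb0, -, hb⟩ := X.exists_potential_bound √(2 * Im)
  set R := √(2 * Im) with hR
  refine ⟨R ^ (P - 1) * R + b + 1, by positivity, fun g K h H ω hω k A v y hI => ?_⟩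
  have hv : |v| ≤ R := Real.abs_le_sqrt (by nlinarith [sq_nonneg y])
  have hy : |y| ≤ R := Real.abs_le_sqrt (by nlinarith [sq_nonneg v])
  have h1 := k.le_rpow y
  have h2 := hb v hv
  have h3 := (abs_le.1 (A.close v)).2
  have h4 : |y| ^ (P - 1) * |y| ≤ R ^ (P - 1) * R :=
    mul_le_mul (Real.rpow_le_rpow (abs_nonneg _) hy (by linarith)) hy (abs_nonneg _) (by positivity)
  linarith

/-- A large amplitude means either |v| large, where the potential is close to its limit, or |y|
large, where the coercive kinetic term compensates the lower bound of H. -/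
lemma exists_amplitude (X : Force f F βm βp L) (hc : 0 < c) {e ω₀ : ℝ} (he : ((e + ω₀ : ℝ) : EReal) < L) :
    ∃ Im : ℝ, 0 < Im ∧ ∀ g K h H ω, ω ≤ ω₀ → Kinetic P c m g K → Approx f F d₁ d₂ cH Fb ω h H →
      ∀ v y : ℝ, Im ≤ (v ^ 2 + y ^ 2) / 2 → e ≤ K y + H v := by
  obtain ⟨M, hM, hMF⟩ := X.exists_gt he
  set R := max M (|e + Fb| / c + 1) with hR
  have hR0 : 0 < R := lt_max_of_lt_left hM
  refine ⟨R ^ 2, by positivity, fun g K h H ω hω k A v y hI => ?_⟩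
  rcases le_total R |v| with h | h
  · have h1 := hMF v ((le_max_left _ _).trans h)
    have h2 := (abs_le.1 (A.close v)).1
    linarith [k.nonneg y]
  · have hy : R ≤ |y| := by
      have h1 := pow_le_pow_left₀ (abs_nonneg v) h 2
      rw [sq_abs] at h1
      refine le_of_sq_le_sq ?_ (abs_nonneg y)
      rw [sq_abs]; linarith
    have h1 := k.linear_le y
    have h2 : |e + Fb| / c ≤ |y| - 1 := by linarith [(le_max_right M (|e + Fb| / c + 1)).trans hy]
    rw [div_le_iff₀ hc] at h2
    linarith [A.lower v, le_abs_self (e + Fb)]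

end Force

end NodalRadial

/-! ### Uniform bound on the initial values and selection by the angle. -/

namespace NodalRadial

/-- Descent from a high level: a bound from below for the position. -/
lemma Orbit.ge_of_speed {g h η v y : ℝ → ℝ} {a b D : ℝ} (o : Orbit g h η a b v y) (hab : a ≤ b)
    (hD : ∀ t ∈ Icc a b, |g (y t)| ≤ D) : v a - D * (b - a) ≤ v b := by
  have := image_ge_of_deriv_ge (D := -D) hab o.dv fun t ht => (abs_le.1 (hD t ht)).1
  linarith

lemma IsAngle.lt_of_pos {g h η v y Θ : ℝ → ℝ} {ε T : ℝ} (A : IsAngle g h η ε T v y Θ) (hεT : ε ≤ T)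
    (hv : ∀ t ∈ Icc ε T, v t ≠ 0) : Θ T < Real.pi / 2 := by
  by_contra! hcon
  obtain ⟨t, ht, hte⟩ := intermediate_value_Icc hεT
    (fun t ht => (A.deriv t ht).continuousAt.continuousWithinAt)
    (show Real.pi / 2 ∈ Icc _ _ from ⟨by rw [A.init]; positivity, hcon⟩)
  exact hv t ht ((A.zero_iff ht).2 (by rw [hte, Real.cos_pi_div_two]))

/-- In the well the initial energy H(l) is nonpositive and it can only decrease, whereas at a zero
of v the energy is K(y) > 0. -/
lemma Flow.pos_of_small {q η g K h H : ℝ → ℝ} {C₁ C₂ P c m Fb ε T Λ L d : ℝ} {V Y : ℝ → ℝ → ℝ}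
    (F : Flow g h η ε T Λ L V Y) (w : Weight q η C₁ C₂) (k : Kinetic P c m g K) (p : Potential Fb h H)
    (hε : 0 < ε) (hH : ∀ s, |s| ≤ d → H s ≤ 0) {l : ℝ} (hl : l ∈ Ioc 0 Λ) (hld : l ≤ d) :
    ∀ t ∈ Icc ε T, 0 < V l t := by
  have S := F.sol l ⟨hl.1.le, hl.2⟩
  have hne : ∀ t ∈ Icc ε T, V l t ≠ 0 := by
    intro t ht h0
    have h1 := S.orbit.anti_E w k p hε ⟨le_rfl, ht.1.trans ht.2⟩ ht ht.1
    simp only [S.y_init, S.v_init, k.zero, h0, p.zero', add_zero, zero_add] at h1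
    have h2 := hH l (by rwa [abs_of_pos hl.1])
    have hy : Y l t = 0 := by
      by_contra hy
      linarith [k.zero_lt hy]
    have := F.pos hl t ht
    rw [h0, hy] at this
    simp at this
  intro t ht
  by_contra! hcon
  obtain ⟨s, hs, hse⟩ := intermediate_value_Icc' ht.1
    (S.continuousOn_v.mono (Icc_subset_Icc_right ht.2)) ⟨hcon, by rw [S.v_init]; exact hl.1.le⟩
  exact hne s ⟨hs.1, hs.2.trans ht.2⟩ hse

variable {q η f F : ℝ → ℝ} {C₁ C₂ P c m d₁ d₂ cH Fb βm βp : ℝ} {L : EReal}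

set_option maxHeartbeats 1000000 in
/-- A uniform range of initial values reaching a large angle or amplitude at time `τ`. -/
theorem exists_uniform_first (w : Weight q η C₁ C₂) (hP : 1 < P) (hc : 0 < c) (X : Force f F βm βp L)
    (hd₂ : 0 < d₂) (hdβ : d₁ ≤ βp) {α μ t₀ : ℝ} (hα : α ∈ Ioo (0:ℝ) 1) (ht₀ : 0 < t₀)
    (hμ : ∀ t ∈ Ioc 0 t₀, capB q t * η t ≤ (μ + 1 / P) * q t)
    (hSC : ∀ N : ℝ, ∃ s₀, ∀ l ≥ s₀, ∀ s₁ ∈ Icc (α * l) l, ∀ s₂ ∈ Icc (α * l) l, ∀ ρ, 0 < ρ →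
      (1 - α) * l ≤ f s₁ ^ (P - 1) * travel q P ρ → N ≤ (F s₂ - μ * s₂ * f s₂) * capB q ρ)
    {τ θ Im : ℝ} (hτ : t₀ < τ) (hθ : Real.pi / 2 ≤ θ) (hIm : 0 < Im) :
    ∃ Λ : ℝ, 0 < Λ ∧ ∀ g K h H ε T ω, Kinetic P c m g K → Approx f F d₁ d₂ cH Fb ω h H → ω ≤ 1 →
      0 < ε → ε ≤ t₀ → τ < T → ∃ l₁ ∈ Ioc 0 Λ, ∃ Λ' L' V Y, l₁ ≤ Λ' ∧ Flow g h η ε T Λ' L' V Y ∧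
        (θ ≤ angle g h η (V l₁) (Y l₁) ε T τ ∨ Im ≤ (V l₁ τ ^ 2 + Y l₁ τ ^ 2) / 2) := by
  have hτ0 : 0 < τ := ht₀.trans hτ
  obtain ⟨b₁, hb₁0, -, hb₁⟩ := X.exists_potential_bound 1
  set A : ℝ := (P * (b₁ + 1 + Fb + 1) + Fb) * capB q τ with hA
  -- the action of orbits with small initial value
  have hact : ∀ {g K h H : ℝ → ℝ} {ε T ω Λ' L' : ℝ} {V Y : ℝ → ℝ → ℝ}, Kinetic P c m g K →
      Approx f F d₁ d₂ cH Fb ω h H → ω ≤ 1 → 0 < ε → ε ≤ t₀ → τ < T → Flow g h η ε T Λ' L' V Y →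
      ∀ l ∈ Ioc 0 Λ', l ≤ 1 → action q g K H (V l) (Y l) ε τ ≤ A := by
    intro g K h H ε T ω Λ' L' V Y k a hω hε hεt hT Fl l hl hl1
    have S := Fl.sol l ⟨hl.1.le, hl.2⟩
    refine (S.orbit.mono le_rfl hT.le).action_le w k a.toPotential hε (hεt.trans hτ.le) ?_
    rw [S.v_init, S.y_init, k.zero, zero_add]
    have := hb₁ l (by rwa [abs_of_pos hl.1])
    linarith [(abs_le.1 (a.close l)).2]
  by_cases hL : L = ⊤
  · -- unbounded potential
    subst hL
    obtain ⟨Em, hEm0, hEm⟩ := X.exists_energy_bound (c := c) (m := m) (d₁ := d₁) (d₂ := d₂) (cH := cH)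
      (Fb := Fb) hP Im
    obtain ⟨δ, hδ, hδq⟩ := w.exists_capB_mul_eta_le
    set A' := A + q τ * (Im + (1 + 8 * Real.pi) * (θ + Im) ^ 2) with hA'
    set Q := (A' + capB q τ * (Em + Fb)) / δ with hQ
    set R := capB q τ * (Em + Fb) + Q with hR
    -- The second entry is one more than the upper bound for N furnished by `lt_of_subcritical`, so
    -- the two are incompatible.
    set N := max (2 * capB q t₀)
      ((4 + 2 * (1 + |μ| / (1 - α))) * (R + capB q t₀ + 2 * |μ| * Q) + 1) with hN
    obtain ⟨s₀, hs₀⟩ := hSC N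
    have hBt₀ := w.capB_pos ht₀
    obtain ⟨M, hM, hMF⟩ := X.exists_gt (a := |R| / capB q t₀ + 1) (EReal.coe_lt_top _)
    set Λ := max (max 1 s₀) (max (2 * βp / α) (2 * M / α)) with hΛ
    have hΛ1 : 1 ≤ Λ := (le_max_left _ _).trans (le_max_left _ _)
    refine ⟨Λ, by linarith, fun g K h H ε T ω k a hω hε hεt hT => ?_⟩
    have hετ : ε ≤ τ := hεt.trans hτ.le
    have hqε := w.pos ε hε
    have hqτ := w.pos τ hτ0
    -- M' depends on ε. It is so large that, the energy decaying no faster than q^(-P), the orbit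
    -- still has amplitude at least `Im` at τ. It only guarantees that a first bad initial value
    -- exists; the bound on that value comes from the action.
    obtain ⟨M', hM', hMF'⟩ := X.exists_gt
      (a := (|Em| + |Fb| + 2) * (q τ ^ P / q ε ^ P) + 1) (EReal.coe_lt_top _)
    obtain ⟨V, Y, L', Fl⟩ := exists_flow' w k a.toPotential hε (hετ.trans_lt hT) hM'.le
    have S' := Fl.sol M' ⟨hM'.le, le_rfl⟩
    have hend : Im ≤ (V M' τ ^ 2 + Y M' τ ^ 2) / 2 := by
      by_contra! hcon
      have h1 := hEm g K h H ω hω k a _ _ hcon.le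
      have h2 := S'.orbit.mono_energy_mul_rpow w k a.toPotential hε ⟨le_rfl, hετ.trans hT.le⟩ ⟨hετ, hT.le⟩ hετ
      simp only [S'.v_init, S'.y_init, k.zero, zero_add] at h2
      have h3 := hMF' M' (le_abs_self M')
      have h4 := (abs_le.1 (a.close M')).1
      have hqεP : 0 < q ε ^ P := Real.rpow_pos_of_pos hqε _
      have hqτP : 0 < q τ ^ P := Real.rpow_pos_of_pos hqτ _
      have h5 : (|Em| + |Fb| + 2) * (q τ ^ P / q ε ^ P) < H M' + Fb + 1 := by
        linarith [a.Fb_nonneg]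
      have h6 := mul_lt_mul_of_pos_right h5 hqεP
      rw [mul_assoc, div_mul_cancel₀ _ hqεP.ne'] at h6
      have h7 := lt_of_mul_lt_mul_right (h6.trans_le h2) hqτP.le
      linarith [le_abs_self Em, le_abs_self Fb]
    obtain ⟨l₁, hl₁, hbad, hIl, hS⟩ := Fl.exists_first w k a.toPotential hε ⟨hετ, hT.le⟩ hM' hθ hIm hd₂
      (fun l hl hld => Fl.pos_of_small w k a.toPotential hε a.nonpos hl hld) (Or.inr hend)
      (hact k a hω hε hεt hT Fl)
    refine ⟨l₁, ⟨hl₁.1, ?_⟩, M', L', V, Y, hl₁.2, Fl, hbad⟩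
    by_contra! hgt
    have S := Fl.sol l₁ ⟨hl₁.1.le, hl₁.2⟩
    have o : Orbit g h η ε τ (V l₁) (Y l₁) := S.orbit.mono le_rfl hT.le
    obtain ⟨b1, b2⟩ := o.bounds_of_action w k a.toPotential hε hετ hδ hδq (hEm g K h H ω hω k a _ _ hIl)
      (hS (hΛ1.trans_lt hgt))
    have e1 : βp ≤ α * l₁ / 2 := by
      have := ((le_max_left _ _).trans (le_max_right _ _)).trans hgt.le
      rw [div_le_iff₀ hα.1] at this; linarith
    have e2 : M ≤ α * l₁ / 2 := by
      have := ((le_max_right _ _).trans (le_max_right _ _)).trans hgt.le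
      rw [div_le_iff₀ hα.1] at this; linarith
    have e3 : s₀ ≤ l₁ := ((le_max_right _ _).trans (le_max_left _ _)).trans hgt.le
    have hαl : 0 < α * l₁ := mul_pos hα.1 hl₁.1
    have key := o.lt_of_subcritical w k a.toPotential (f := f) (F := F) (α := α) (μ := μ) (Q := Q) (R := R)
      (N := N) (l := l₁) (τ₁ := t₀) hε (hεt.trans_lt hτ) hεt hτ.le
      S.v_init S.y_init hl₁.1 hα X.cont X.hasDeriv
      (fun s hs => a.eq s ((hdβ.trans (e1.trans hs)).trans (le_abs_self s)))
      (fun s => (a.close s).trans hω) (fun s hs => X.pos s (e1.trans hs))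
      (by
        have := X.strictMonoOn.monotoneOn self_mem_Ici (mem_Ici.2 (by linarith : βp ≤ α * l₁)) (by linarith)
        rwa [X.map_βp] at this)
      (fun t ht => hμ t ⟨hε.trans_le ht.1, ht.2⟩) b1 b2
      (fun s hs => by
        have h1 := hMF s ((e2.trans hs).trans (le_abs_self s))
        have h2 := (abs_le.1 (a.close s)).1
        have h3 : |R| / capB q t₀ < H s := by linarith
        rw [div_lt_iff₀ hBt₀] at h3
        linarith [le_abs_self R])
      (le_max_left _ _) (hs₀ l₁ e3)
    have := le_max_right (2 * capB q t₀)
      ((4 + 2 * (1 + |μ| / (1 - α))) * (R + capB q t₀ + 2 * |μ| * Q) + 1)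
    linarith
  · -- bounded potential: the speed is bounded
    obtain ⟨Lr, rfl⟩ : ∃ r : ℝ, L = (r : EReal) := by
      refine ⟨L.toReal, (EReal.coe_toReal hL ?_).symm⟩
      exact (bot_lt_iff_ne_bot.1 (bot_le.trans_lt X.lim_pos))
    -- The energy is at most Lr + 1, so coercivity bounds |y| and D bounds the speed. An orbit
    -- starting at Λ is then still above √(2 Im) at time τ.
    set D := ((Lr + 1 + Fb) / c + 1) ^ (P - 1) with hD
    set Λ := |D| * τ + √(2 * Im) + 1 with hΛ
    have hΛ0 : 0 < Λ := by positivity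
    refine ⟨Λ, hΛ0, fun g K h H ε T ω k a hω hε hεt hT => ?_⟩
    have hετ : ε ≤ τ := hεt.trans hτ.le
    obtain ⟨V, Y, L', Fl⟩ := exists_flow' w k a.toPotential hε (hετ.trans_lt hT) hΛ0.le
    have S := Fl.sol Λ ⟨hΛ0.le, le_rfl⟩
    have o : Orbit g h η ε τ (V Λ) (Y Λ) := S.orbit.mono le_rfl hT.le
    have hend : Im ≤ (V Λ τ ^ 2 + Y Λ τ ^ 2) / 2 := by
      have hsp : ∀ t ∈ Icc ε τ, |g (Y Λ t)| ≤ |D| := by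
        intro t ht
        have h1 := o.anti_E w k a.toPotential hε ⟨le_rfl, hετ⟩ ht ht.1
        simp only [S.v_init, S.y_init, k.zero, zero_add] at h1
        have h2 := (abs_le.1 (a.close Λ)).2
        have h3 := EReal.coe_lt_coe_iff.1 (X.lt_lim Λ)
        have h4 := k.linear_le (Y Λ t)
        have h5 := a.lower (V Λ t)
        have h6 : |Y Λ t| - 1 ≤ (Lr + 1 + Fb) / c := by
          rw [le_div_iff₀ hc]; linarith
        refine (k.abs_le _).trans (le_trans ?_ (le_abs_self D))
        exact Real.rpow_le_rpow (abs_nonneg _) (by linarith) (by linarith)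
      have h1 := o.ge_of_speed hετ hsp
      rw [S.v_init] at h1
      have h2 : |D| * (τ - ε) ≤ |D| * τ := mul_le_mul_of_nonneg_left (by linarith) (abs_nonneg _)
      have h3 : √(2 * Im) ≤ V Λ τ := by linarith
      have h4 := pow_le_pow_left₀ (Real.sqrt_nonneg _) h3 2
      rw [Real.sq_sqrt (by linarith)] at h4
      nlinarith [sq_nonneg (Y Λ τ)]
    exact ⟨Λ, ⟨hΛ0, le_rfl⟩, Λ, L', V, Y, le_rfl, Fl, Or.inr hend⟩

/-- Solutions of the regularized problems with a prescribed number of zeros and uniformly bounded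
initial values. -/
theorem exists_selection (w : Weight q η C₁ C₂) (hP : 1 < P) (hc : 0 < c) (X : Force f F βm βp L)
    (hd₂ : 0 < d₂) (hdβ : d₁ ≤ βp) (hdβ' : d₁ ≤ -βm) {α μ t₀ : ℝ} (hα : α ∈ Ioo (0:ℝ) 1)
    (ht₀ : 0 < t₀) (hμ : ∀ t ∈ Ioc 0 t₀, capB q t * η t ≤ (μ + 1 / P) * q t)
    (hSC : ∀ N : ℝ, ∃ s₀, ∀ l ≥ s₀, ∀ s₁ ∈ Icc (α * l) l, ∀ s₂ ∈ Icc (α * l) l, ∀ ρ, 0 < ρ →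
      (1 - α) * l ≤ f s₁ ^ (P - 1) * travel q P ρ → N ≤ (F s₂ - μ * s₂ * f s₂) * capB q ρ) (n : ℕ) :
    ∃ Λ ω₀ T₀ : ℝ, 0 < Λ ∧ 0 < ω₀ ∧ ∀ g K h H ε T ω, Kinetic P c m g K →
      Approx f F d₁ d₂ cH Fb ω h H → ω ≤ ω₀ → 0 < ε → ε ≤ t₀ → T₀ < T →
      ∃ l ∈ Ioc 0 Λ, ∃ v y Θ, Sol g h η ε T l v y ∧ IsAngle g h η ε T v y Θ ∧
        Θ T = Real.pi / 2 + n * Real.pi := by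
  have hpi := Real.pi_pos
  have hC₂ := w.C₂_pos
  set e := F (βp + 1) with he
  have he0 : 0 < e := by
    have := X.strictMonoOn self_mem_Ici (mem_Ici.2 (by linarith : βp ≤ βp + 1)) (by linarith : βp < βp + 1)
    rwa [X.map_βp] at this
  obtain ⟨ω₁, hω₁, hω₁L⟩ := Force.exists_room (X.lt_lim (βp + 1))
  rw [← he] at hω₁L
  have hmono : ∀ a b : ℝ, a ≤ b → (b : EReal) < L → (a : EReal) < L := fun a b hab hb =>
    (EReal.coe_le_coe_iff.2 hab).trans_lt hb
  obtain ⟨M₀, c₀, hM₀, hc₀, W₀⟩ := X.exists_window (d₁ := d₁) (d₂ := d₂) (cH := cH) (Fb := Fb)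
    (e := e / 2 / 2) (Em := e)
    (ω₀ := min ω₁ (e / 8)) hdβ hdβ' (by positivity) (by linarith [min_le_right ω₁ (e / 8)])
    (hmono _ _ (by linarith [min_le_left ω₁ (e / 8)]) hω₁L)
  obtain ⟨D₀, hD₀, swing₀⟩ := exists_swing_time (m := m) w (half_pos he0) hM₀ hc₀ hc hP
  obtain ⟨Im, hIm, hIe⟩ := X.exists_amplitude (P := P) (m := m) (d₁ := d₁) (d₂ := d₂) (cH := cH) (Fb := Fb)
    hc hω₁L
  -- τ is so late that an orbit of energy e keeps at least e/2 during n + 1 swings. The constants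
  -- are fixed in a definite order: D₀ and `Im` depend on e alone, τ on D₀, Λ on τ and `Im`, and
  -- only then the energy cap `Em` and the swing time D₁ on Λ.
  set τ := max (max 1 (t₀ + 1)) (C₂ * P * (e + Fb + 1) * ((n + 1) * (D₀ + 1 + 1)) / (e / 2)) with hτ
  have hτ1 : 1 ≤ τ := (le_max_left _ _).trans (le_max_left _ _)
  have hτt : t₀ < τ := lt_of_lt_of_le (by linarith) ((le_max_right 1 (t₀ + 1)).trans (le_max_left _ _))
  have hτe : C₂ * P * (e + Fb + 1) * ((n + 1) * (D₀ + 1 + 1)) ≤ e / 2 * τ := by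
    have := le_max_right (max 1 (t₀ + 1)) (C₂ * P * (e + Fb + 1) * ((n + 1) * (D₀ + 1 + 1)) / (e / 2))
    rw [← hτ, div_le_iff₀ (by positivity)] at this
    linarith
  set θ : ℝ := Real.pi / 2 + n * Real.pi with hθ
  have hθ0 : Real.pi / 2 ≤ θ := by rw [hθ]; linarith [mul_nonneg (Nat.cast_nonneg n : (0:ℝ) ≤ n) hpi.le]
  obtain ⟨Λ, hΛ, first⟩ := exists_uniform_first (m := m) (d₂ := d₂) (cH := cH) (Fb := Fb) w hP hc X hd₂ hdβ
    hα ht₀ hμ hSC hτt hθ0 hIm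
  obtain ⟨b, hb0, hbL, hb⟩ := X.exists_potential_bound Λ
  obtain ⟨ω₂, hω₂, hω₂L⟩ := Force.exists_room (L := L) (a := max b e)
    (by rcases max_cases b e with h | h <;> rw [h.1]
        · exact hbL
        · exact X.lt_lim _)
  set Em := max b e + ω₂ / 2 with hEm
  obtain ⟨M₁, c₁, hM₁, hc₁, W₁⟩ := X.exists_window (d₁ := d₁) (d₂ := d₂) (cH := cH) (Fb := Fb)
    (e := e / 2) (Em := Em)
    (ω₀ := min (ω₂ / 2) (e / 8)) hdβ hdβ' (by positivity) (by linarith [min_le_right (ω₂ / 2) (e / 8)])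
    (hmono _ _ (by rw [hEm]; linarith [min_le_left (ω₂ / 2) (e / 8)]) hω₂L)
  obtain ⟨D₁, hD₁, swing₁⟩ := exists_swing_time (m := m) w he0 hM₁ hc₁ hc hP
  refine ⟨Λ, min (min 1 (e / 8)) (min ω₁ (ω₂ / 2)), τ + (n + 1) * (D₁ + 1 + 1) + (n + 1) * (D₀ + 1 + 1), hΛ,
    by positivity, fun g K h H ε T ω k a hω hε hεt hT => ?_⟩
  have hω1 : ω ≤ 1 := hω.trans ((min_le_left _ _).trans (min_le_left _ _))
  have hωe : ω ≤ e / 8 := hω.trans ((min_le_left _ _).trans (min_le_right _ _))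
  have hωω₁ : ω ≤ ω₁ := hω.trans ((min_le_right _ _).trans (min_le_left _ _))
  have hωω₂ : ω ≤ ω₂ / 2 := hω.trans ((min_le_right _ _).trans (min_le_right _ _))
  have hn0 : (0:ℝ) ≤ n := Nat.cast_nonneg n
  have hτT : τ < T := by
    have h1 : 0 ≤ (n + 1) * (D₁ + 1 + 1) := by positivity
    have h2 : 0 ≤ (n + 1) * (D₀ + 1 + 1) := by positivity
    linarith
  have hετ : ε ≤ τ := hεt.trans hτt.le
  have hεT : ε ≤ T := hετ.trans hτT.le
  obtain ⟨l₁, hl₁, Λ', L', V, Y, hlΛ', Fl, hbad⟩ := first g K h H ε T ω k a hω1 hε hεt hτT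
  have hl₁' : l₁ ∈ Ioc 0 Λ' := ⟨hl₁.1, hlΛ'⟩
  have S₁ := Fl.sol l₁ ⟨hl₁.1.le, hlΛ'⟩
  have A₁ := Fl.isAngle w k a.toPotential hε hl₁'
  -- the angle at the final time
  have hfinal : θ ≤ angle g h η (V l₁) (Y l₁) ε T T := by
    rcases hbad with hb1 | hb1
    · have := A₁.cross ⟨hετ, hτT.le⟩ ⟨hεT, le_rfl⟩ hτT n (by push_cast; exact hb1)
      push_cast at this
      exact this.le
    · have hE := hIe g K h H ω hωω₁ k a _ _ hb1
      have hE' : K (Y l₁ τ) + H (V l₁ τ) ≤ Em := by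
        have h1 := S₁.orbit.anti_E w k a.toPotential hε ⟨le_rfl, hεT⟩ ⟨hετ, hτT.le⟩ hετ
        simp only [S₁.v_init, S₁.y_init, k.zero, zero_add] at h1
        have h2 := hb l₁ (by rw [abs_of_pos hl₁.1]; exact hl₁.2)
        have h3 := (abs_le.1 (a.close l₁)).2
        rw [hEm]
        linarith [le_max_left b e]
      refine (A₁.lt_of_energy (n := n) (D₀ := D₀ + 1) (D₁ := D₁ + 1) w k a.toPotential S₁.orbit he0 hε hετ hτ1
        (by linarith) (by linarith) ?_ ?_ hτe hE hE' hT).le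
      · exact fun x z hx ho hz hxz => swing₁ g K h H Fb Em k a.toPotential
          (W₁ h H ω (le_min hωω₂ hωe) a) _ _ x z hx ho hz (by linarith)
      · exact fun x z hx ho hz hxz => swing₀ g K h H Fb e k a.toPotential
          (W₀ h H ω (le_min hωω₁ hωe) a) _ _ x z hx ho hz (by linarith)
  -- the angle for small initial values
  set l₀ := min d₂ l₁ with hl₀
  have hl₀0 : 0 < l₀ := lt_min hd₂ hl₁.1
  have hl₀1 : l₀ ≤ l₁ := min_le_right _ _
  have hl₀' : l₀ ∈ Ioc 0 Λ' := ⟨hl₀0, hl₀1.trans hlΛ'⟩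
  have hsmall : angle g h η (V l₀) (Y l₀) ε T T ≤ θ :=
    ((Fl.isAngle w k a.toPotential hε hl₀').lt_of_pos hεT fun t ht =>
      (Fl.pos_of_small w k a.toPotential hε a.nonpos hl₀' (min_le_left _ _) t ht).ne').le.trans hθ0
  obtain ⟨CΘ, hCΘ, hlip⟩ := Fl.exists_angle_lipschitz w k a.toPotential hε hl₀0
  have hcont : ContinuousOn (fun l => angle g h η (V l) (Y l) ε T T) (Icc l₀ l₁) := by
    refine (LipschitzOnWith.of_dist_le_mul (K := ⟨CΘ, hCΘ⟩) fun l hl l' hl' => ?_).continuousOn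
    exact hlip l ⟨hl.1, hl.2.trans hlΛ'⟩ l' ⟨hl'.1, hl'.2.trans hlΛ'⟩ T ⟨hεT, le_rfl⟩
  -- Between an initial value in the well, whose angle stays below π/2, and l₁, whose final angle is
  -- at least θ, some l has final angle exactly θ.
  obtain ⟨l, hl, hle⟩ := intermediate_value_Icc hl₀1 hcont ⟨hsmall, hfinal⟩
  have hl' : l ∈ Ioc 0 Λ' := ⟨hl₀0.trans_le hl.1, hl.2.trans hlΛ'⟩
  exact ⟨l, ⟨hl'.1, hl.2.trans hl₁.2⟩, V l, Y l, _, Fl.sol l ⟨hl'.1.le, hl'.2⟩,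
    Fl.isAngle w k a.toPotential hε hl', hle⟩

end NodalRadial

/-! ### Crossing the well of the potential. -/

namespace NodalRadial

/-- Sublinear growth bounds its argument. -/
lemma exists_bound_of_sublinear {σ : ℝ} (hσ : σ < 1) (A B κ : ℝ) (hκ : 0 < κ) :
    ∃ R : ℝ, 0 < R ∧ ∀ t, 0 < t → t ≤ A + B * (1 + (t / κ) ^ σ) → t ≤ R := by
  have h1 : Tendsto (fun t : ℝ => A * t⁻¹ + B * (t⁻¹ + (κ ^ σ)⁻¹ * t ^ (-(1 - σ)))) atTop
      (𝓝 (A * 0 + B * (0 + (κ ^ σ)⁻¹ * 0))) :=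
    (tendsto_inv_atTop_zero.const_mul A).add
      ((tendsto_inv_atTop_zero.add ((tendsto_rpow_neg_atTop (by linarith)).const_mul _)).const_mul B)
  rw [mul_zero, mul_zero, zero_add, add_zero, mul_zero] at h1
  obtain ⟨R, hR⟩ := eventually_atTop.1 (h1.eventually (gt_mem_nhds one_pos))
  refine ⟨max R 1, by positivity, fun t ht h => ?_⟩
  by_contra! hcon
  have h2 := hR t ((le_max_left _ _).trans hcon.le)
  have h3 := mul_lt_mul_of_pos_right h2 ht
  rw [one_mul] at h3
  have h4 : (A * t⁻¹ + B * (t⁻¹ + (κ ^ σ)⁻¹ * t ^ (-(1 - σ)))) * t = A + B * (1 + (t / κ) ^ σ) := by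
    rw [Real.div_rpow ht.le hκ.le]
    have e1 : t ^ σ = t ^ (-(1 - σ)) * t := by
      rw [← Real.rpow_add_one ht.ne']; congr 1; ring
    rw [e1]
    field_simp
  linarith

section Drop

variable {q η : ℝ → ℝ} {C₁ C₂ P c m d₁ d₂ cH : ℝ}

lemma Kinetic.le_of_lt_one {P c m : ℝ} {g K : ℝ → ℝ} (k : Kinetic P c m g K) {y x : ℝ} (hy : 0 ≤ y)
    (hx : 0 < x) (hx1 : x ≤ 1) (h : x ^ P ≤ K y) : x ≤ y := by
  by_contra! hlt
  have h1 := k.le_rpow y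
  have hP := k.one_lt
  rw [abs_of_nonneg hy] at h1
  rcases hy.eq_or_lt with rfl | hy0
  · rw [mul_zero] at h1
    have := Real.rpow_pos_of_pos hx P
    linarith
  · rw [← Real.rpow_add_one hy0.ne', sub_add_cancel] at h1
    have := Real.rpow_lt_rpow hy hlt (by linarith : 0 < P)
    linarith

/-- While crossing the well of the potential with positive energy, an orbit loses a definite amount of
energy, and the crossing takes a bounded time. -/
lemma exists_drop_aux (w : Weight q η C₁ C₂) (hP : 1 < P) (hc : 0 < c) (hm : 0 < m) (hmP : m < P)
    (hd : d₁ < d₂) (hcH : 0 < cH) (R : ℝ) :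
    ∃ R' c' : ℝ, 0 < c' ∧ ∀ g K h H Fb, Kinetic P c m g K → Potential Fb h H →
      (∀ s, |s| ≤ d₂ → H s ≤ 0) → (∀ s, d₁ ≤ |s| → |s| ≤ d₂ → H s ≤ -cH) →
      ∀ (a b : ℝ) (v y : ℝ → ℝ), 0 < a → a ≤ R → Orbit g h η a b v y →
      (∀ t ∈ Icc a b, 0 < K (y t) + H (v t)) → |v a| ≤ d₁ → 0 < y a → (∃ s ∈ Icc a b, y s = 0) →
      c' ≤ K (y a) + H (v a) ∧ ∃ t₂ ∈ Ioc a b, t₂ ≤ R' ∧ |v t₂| = d₂ := by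
  have hC₁ := w.C₁_pos
  -- In the strip d₁ ≤ |v| ≤ d₂ the potential is at most -cH, so positive energy forces K(y) ≥ cH
  -- and hence |y| ≥ yc. The strip is crossed at speed at least s₁.
  set yc := min 1 cH with hyc
  have hyc0 : 0 < yc := lt_min one_pos hcH
  have hyc1 : yc ≤ 1 := min_le_left _ _
  have hycP : yc ^ P ≤ cH := by
    refine le_trans ?_ (min_le_right 1 cH)
    calc yc ^ P ≤ yc ^ (1:ℝ) := Real.rpow_le_rpow_of_exponent_ge hyc0 hyc1 hP.le
      _ = yc := Real.rpow_one _
  set κ := C₁ * (yc * (d₂ - d₁)) with hκ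
  have hκ0 : 0 < κ := mul_pos hC₁ (mul_pos hyc0 (by linarith))
  set s₁ := c * yc ^ m with hs₁
  have hs₁0 : 0 < s₁ := mul_pos hc (Real.rpow_pos_of_pos hyc0 _)
  have hP0 : 0 < P := by linarith
  have hσ : m / P < 1 := by rw [div_lt_one hP0]; exact hmP
  have hσ0 : 0 < m / P := div_pos hm hP0
  -- The exit time t₂ satisfies a self-bounding inequality: the energy before the strip is at least
  -- κ/t₂, so the inner part |v| ≤ d₁ takes a time of order 1 + (t₂/κ)^(m/P). Since m < P this is
  -- sublinear in t₂, which bounds t₂.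
  obtain ⟨R', hR', hbd⟩ := exists_bound_of_sublinear hσ (R + (d₂ - d₁) / s₁) (2 * d₁ / c) κ hκ0
  refine ⟨R', κ / R', by positivity, ?_⟩
  intro g K h H Fb k p hH0 hHc a b v y ha haR o hE hva hya ⟨s, hs, hys⟩
  have hy_ne : ∀ t ∈ Icc a b, |v t| ≤ d₂ → y t ≠ 0 := by
    intro t ht hvt h0
    have := hE t ht
    rw [h0, k.zero, zero_add] at this
    exact absurd (hH0 _ hvt) (not_le.2 this)
  -- At rest the energy is H(v), which is nonpositive in the well. So the momentum keeps its sign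
  -- inside, and a later zero of y shows that the orbit does leave.
  have hvs : d₂ < |v s| := by
    by_contra! h'
    exact hy_ne s hs h' hys
  obtain ⟨t₂, ht₂, hvt₂, hle₂⟩ := exists_first_le (v := fun t => -|v t|) (c := -d₂) hs.1
    ((o.cont_v.mono (Icc_subset_Icc_right hs.2)).abs.neg) (by linarith) (by linarith)
  have hvt₂' : |v t₂| = d₂ := by simpa using hvt₂
  have ht₂b : t₂ ≤ b := ht₂.2.trans hs.2
  have hle : ∀ t ∈ Icc a t₂, |v t| ≤ d₂ := fun t ht => by have := hle₂ t ht; linarith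
  have o₂ : Orbit g h η a t₂ v y := o.mono le_rfl ht₂b
  have sub₂ : Icc a t₂ ⊆ Icc a b := Icc_subset_Icc_right ht₂b
  have hypos : ∀ t ∈ Icc a t₂, 0 < y t := by
    intro t ht
    by_contra! hcon
    obtain ⟨x, hx, hxe⟩ := intermediate_value_Icc' ht.1 (o₂.cont_y.mono (Icc_subset_Icc_right ht.2))
      ⟨hcon, hya.le⟩
    have hx' : x ∈ Icc a t₂ := ⟨hx.1, hx.2.trans ht.2⟩
    exact hy_ne x (sub₂ hx') (hle x hx') hxe
  have hpos : ∀ t ∈ Icc a t₂, 0 < t := fun t ht => ha.trans_le ht.1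
  have hvmono : MonotoneOn v (Icc a t₂) := monotoneOn_of_hasDerivWithinAt_nonneg (convex_Icc _ _) o₂.cont_v
    (fun t ht => (o₂.dv t (interior_subset ht)).hasDerivWithinAt)
    (fun t ht => (k.pos (hypos t (interior_subset ht))).le)
  have ham : a ∈ Icc a t₂ := ⟨le_rfl, ht₂.1.le⟩
  have ht₂m : t₂ ∈ Icc a t₂ := ⟨ht₂.1.le, le_rfl⟩
  have hva' := abs_le.1 hva
  have hvt₂d : v t₂ = d₂ := by
    have h1 := hvmono ham ht₂m ht₂.1.le
    rcases abs_choice (v t₂) with h2 | h2 <;> linarith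
  obtain ⟨t₁, ht₁, hvt₁⟩ := intermediate_value_Icc ht₂.1.le o₂.cont_v
    (show d₁ ∈ Icc (v a) (v t₂) from ⟨hva'.2, by linarith⟩)
  have hanti := o₂.anti_E w k p ha
  have ht₂0 := hpos t₂ ht₂m
  have o₁₂ : Orbit g h η t₁ t₂ v y := o₂.mono ht₁.1 le_rfl
  have sub₁ : Icc t₁ t₂ ⊆ Icc a t₂ := Icc_subset_Icc_left ht₁.1
  have hyge : ∀ t ∈ Icc t₁ t₂, yc ≤ y t := by
    intro t ht
    refine k.le_of_lt_one (hypos t (sub₁ ht)).le hyc0 hyc1 (hycP.trans ?_)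
    have h1 := hvmono ht₁ (sub₁ ht) ht.1
    have h2 := hE t (sub₂ (sub₁ ht))
    have h3 := hHc (v t) (by rw [← hvt₁]; exact h1.trans (le_abs_self _)) (hle t (sub₁ ht))
    linarith
  -- the energy lost
  have hloss : κ / t₂ ≤ K (y t₁) + H (v t₁) := by
    -- As η decreases, friction before t₂ removes at least η(t₂) yc ≥ C₁ yc/t₂ of energy per unit of
    -- distance. The energy is still positive at t₂, so before the strip it was at least κ/t₂.
    have hm : AntitoneOn (fun t => K (y t) + H (v t) + η t₂ * yc * v t) (Icc t₁ t₂) := by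
      have hder : ∀ t ∈ Icc t₁ t₂, HasDerivAt (fun t => K (y t) + H (v t) + η t₂ * yc * v t)
          (-(η t * (y t * g (y t))) + η t₂ * yc * g (y t)) t := fun t ht =>
        (o₁₂.dE k p ht).fun_add ((o₁₂.dv t ht).const_mul _)
      refine antitoneOn_of_hasDerivWithinAt_nonpos (convex_Icc _ _)
        (fun t ht => (hder t ht).continuousAt.continuousWithinAt)
        (fun t ht => (hder t (interior_subset ht)).hasDerivWithinAt) (fun t ht => ?_)
      have ht' := interior_subset ht
      have h1 := w.anti (hpos t (sub₁ ht')) ht₂0 ht'.2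
      have h2 := mul_le_mul h1 (hyge t ht') hyc0.le (w.eta_pos (hpos t (sub₁ ht'))).le
      have h3 := mul_le_mul_of_nonneg_right h2 (k.pos (hypos t (sub₁ ht'))).le
      linarith
    have h1 := hm ⟨le_rfl, ht₁.2⟩ ⟨ht₁.2, le_rfl⟩ ht₁.2
    simp only [hvt₁, hvt₂d] at h1
    have h2 := hE t₂ (sub₂ ht₂m)
    rw [hvt₂d] at h2
    have h3 : C₁ / t₂ ≤ η t₂ := by
      rw [div_le_iff₀ ht₂0, mul_comm]; exact w.low t₂ ht₂0
    have h4 := mul_le_mul_of_nonneg_right h3 (mul_pos hyc0 (by linarith : 0 < d₂ - d₁)).le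
    have h5 : κ / t₂ = C₁ / t₂ * (yc * (d₂ - d₁)) := by rw [hκ]; ring
    rw [hvt₁, h5]
    linarith
  -- crossing times
  have htime₁ : t₂ - t₁ ≤ (d₂ - d₁) / s₁ := by
    have h1 := image_ge_of_deriv_ge (D := s₁) ht₁.2 o₁₂.dv (fun t ht => by
      refine le_trans ?_ (k.lb (y t) (hypos t (sub₁ ht)).le)
      refine mul_le_mul_of_nonneg_left (Real.rpow_le_rpow hyc0.le (le_min hyc1 (hyge t ht)) hm.le) hc.le)
    rw [hvt₁, hvt₂d] at h1
    rw [le_div_iff₀ hs₁0]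
    linarith
  set x := min 1 (κ / t₂) with hx
  have hx0 : 0 < x := lt_min one_pos (by positivity)
  have htime₀ : t₁ - a ≤ 2 * d₁ / c * (1 + (t₂ / κ) ^ (m / P)) := by
    have o₀ : Orbit g h η a t₁ v y := o₂.mono le_rfl ht₁.2
    have sub₀ : Icc a t₁ ⊆ Icc a t₂ := Icc_subset_Icc_right ht₁.2
    have h1 := image_ge_of_deriv_ge (D := c * x ^ (m / P)) ht₁.1 o₀.dv (fun t ht => by
      refine le_trans ?_ (k.lb (y t) (hypos t (sub₀ ht)).le)
      refine mul_le_mul_of_nonneg_left ?_ hc.le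
      have h2 : x ^ (1 / P) ≤ min 1 (y t) := by
        have hx1 : x ^ (1 / P) ≤ 1 := Real.rpow_le_one hx0.le (min_le_left _ _) (by positivity)
        refine le_min hx1 (k.le_of_lt_one (hypos t (sub₀ ht)).le (Real.rpow_pos_of_pos hx0 _) hx1 ?_)
        rw [← Real.rpow_mul hx0.le, one_div_mul_cancel hP0.ne', Real.rpow_one]
        have h3 := hanti (sub₀ ht) ht₁ ht.2
        simp only at h3
        have h4 := hH0 _ (hle t (sub₀ ht))
        linarith [min_le_right 1 (κ / t₂)]
      calc x ^ (m / P) = (x ^ (1 / P)) ^ m := by rw [← Real.rpow_mul hx0.le]; congr 1; ring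
        _ ≤ _ := Real.rpow_le_rpow (Real.rpow_nonneg hx0.le _) h2 hm.le)
    rw [hvt₁] at h1
    have h2 : c * x ^ (m / P) * (t₁ - a) ≤ 2 * d₁ := by linarith [hva'.1]
    have hxσ := Real.rpow_pos_of_pos hx0 (m / P)
    have h3 : 1 ≤ x ^ (m / P) * (1 + (t₂ / κ) ^ (m / P)) := by
      have hn : 0 ≤ (t₂ / κ) ^ (m / P) := by positivity
      rcases min_cases 1 (κ / t₂) with h4 | h4
      · rw [hx, h4.1, Real.one_rpow]; linarith
      · rw [hx, h4.1, mul_add, ← Real.mul_rpow (by positivity) (by positivity),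
          div_mul_div_cancel₀ ht₂0.ne', div_self hκ0.ne', Real.one_rpow]
        have : 0 ≤ (κ / t₂) ^ (m / P) := by positivity
        linarith
    have h5 : 0 ≤ t₁ - a := sub_nonneg.2 ht₁.1
    have h6 : c * (t₁ - a) ≤ 2 * d₁ * (1 + (t₂ / κ) ^ (m / P)) := by
      have e1 := mul_le_mul_of_nonneg_left h3 (mul_nonneg hc.le h5)
      have e2 : 0 ≤ 1 + (t₂ / κ) ^ (m / P) := by positivity
      have e3 := mul_le_mul_of_nonneg_right h2 e2
      nlinarith
    rw [div_mul_eq_mul_div, le_div_iff₀ hc]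
    linarith
  have ht₂R := hbd t₂ ht₂0 (by linarith)
  refine ⟨?_, t₂, ⟨ht₂.1, ht₂b⟩, ht₂R, hvt₂'⟩
  have h1 := hanti ham ht₁ ht₁.1
  simp only at h1
  have h2 : κ / R' ≤ κ / t₂ := div_le_div_of_nonneg_left hκ0.le ht₂0 ht₂R
  linarith

/-- The sign condition on the momentum in `exists_drop_aux` is removed by reflection; rest inside
the well is incompatible with positive energy. -/
lemma exists_drop (w : Weight q η C₁ C₂) (hP : 1 < P) (hc : 0 < c) (hm : 0 < m) (hmP : m < P)
    (hd : d₁ < d₂) (hcH : 0 < cH) (R : ℝ) :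
    ∃ R' c' : ℝ, 0 < c' ∧ ∀ g K h H Fb, Kinetic P c m g K → Potential Fb h H →
      (∀ s, |s| ≤ d₂ → H s ≤ 0) → (∀ s, d₁ ≤ |s| → |s| ≤ d₂ → H s ≤ -cH) →
      ∀ (a b : ℝ) (v y : ℝ → ℝ), 0 < a → a ≤ R → Orbit g h η a b v y →
      (∀ t ∈ Icc a b, 0 < K (y t) + H (v t)) → |v a| ≤ d₁ → (∃ s ∈ Icc a b, y s = 0) →
      c' ≤ K (y a) + H (v a) ∧ ∃ t₂ ∈ Ioc a b, t₂ ≤ R' ∧ |v t₂| = d₂ := by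
  obtain ⟨R', c', hc', key⟩ := exists_drop_aux w hP hc hm hmP hd hcH R
  refine ⟨R', c', hc', fun g K h H Fb k p hH0 hHc a b v y ha haR o hE hva hs => ?_⟩
  have hab : a ≤ b := by obtain ⟨s, hs, -⟩ := hs; exact hs.1.trans hs.2
  rcases lt_trichotomy (y a) 0 with h0 | h0 | h0
  · obtain ⟨h1, t₂, ht₂, h2, h3⟩ := key g K _ _ Fb k p.reflect (fun s hs => hH0 (-s) (by rwa [abs_neg]))
      (fun s h1 h2 => hHc (-s) (by rwa [abs_neg]) (by rwa [abs_neg])) a b _ _ ha haR (o.reflect k)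
      (fun t ht => by simpa only [neg_neg, k.even] using hE t ht) (by rwa [abs_neg]) (by linarith)
      (by obtain ⟨s, hs, h⟩ := hs; exact ⟨s, hs, by rw [h, neg_zero]⟩)
    simp only [neg_neg, k.even] at h1
    exact ⟨h1, t₂, ht₂, h2, by rwa [abs_neg] at h3⟩
  · have := hE a ⟨le_rfl, hab⟩
    rw [h0, k.zero, zero_add] at this
    exact absurd (hH0 _ (hva.trans hd.le)) (not_le.2 this)
  · exact key g K h H Fb k p hH0 hHc a b v y ha haR o hE hva h0 hs

variable {g K h H v y : ℝ → ℝ} {a b : ℝ}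

/-- A critical point between two zeros of an orbit with positive energy lies outside the well. -/
lemma Orbit.exists_hill (o : Orbit g h η a b v y) (k : Kinetic P c m g K) (hab : a < b)
    (hH0 : ∀ s, |s| ≤ d₂ → H s ≤ 0) (hE : ∀ t ∈ Icc a b, 0 < K (y t) + H (v t)) (hva : v a = 0)
    (hvb : v b = 0) : ∃ s ∈ Ioo a b, y s = 0 ∧ d₂ < |v s| := by
  obtain ⟨s, hs, hs'⟩ := exists_hasDerivAt_eq_zero (f' := fun t => g (y t)) hab o.cont_v (hva.trans hvb.symm)
    (fun t ht => o.dv t ⟨ht.1.le, ht.2.le⟩)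
  have hys : y s = 0 := by
    by_contra h0
    have := k.mul_pos h0
    rw [hs', mul_zero] at this
    exact lt_irrefl _ this
  refine ⟨s, hs, hys, ?_⟩
  by_contra! h'
  have := hE s ⟨hs.1.le, hs.2.le⟩
  rw [hys, k.zero, zero_add] at this
  exact absurd (hH0 _ h') (not_le.2 this)

/-- An orbit with positive energy entering and leaving the well has a zero. -/
lemma Orbit.exists_zero_of_valley (o : Orbit g h η a b v y) (k : Kinetic P c m g K)
    (hH0 : ∀ s, |s| ≤ d₂ → H s ≤ 0) (hE : ∀ t ∈ Icc a b, 0 < K (y t) + H (v t)) (hva : d₂ ≤ |v a|)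
    (hvb : d₂ ≤ |v b|) {x : ℝ} (hx : x ∈ Icc a b) (hvx : |v x| < d₂) : ∃ t ∈ Icc a b, v t = 0 := by
  by_contra! hne
  obtain ⟨s, hs, hmin⟩ := isCompact_Icc.exists_isMinOn ⟨x, hx⟩ o.cont_v.abs
  have hsx : |v s| < d₂ := (hmin hx).trans_lt hvx
  have hs' : s ∈ Ioo a b := by
    refine ⟨lt_of_le_of_ne hs.1 ?_, lt_of_le_of_ne hs.2 ?_⟩
    · rintro rfl; linarith
    · rintro rfl; linarith
  have hloc : IsLocalMin (fun t => |v t|) s := hmin.isLocalMin (Icc_mem_nhds hs'.1 hs'.2)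
  have hys : y s = 0 := by
    by_contra h0
    have hg : g (y s) ≠ 0 := by
      intro h'
      have := k.mul_pos h0
      rw [h', mul_zero] at this
      exact lt_irrefl _ this
    have hcont := (o.dv s hs).continuousAt
    rcases lt_or_gt_of_ne (hne s hs) with h1 | h1
    · have h2 : IsLocalMax v s := by
        filter_upwards [hloc, hcont.eventually (gt_mem_nhds h1)] with t ht ht'
        rw [abs_of_neg h1, abs_of_neg ht'] at ht
        linarith
      exact hg (h2.hasDerivAt_eq_zero (o.dv s hs))
    · have h2 : IsLocalMin v s := by
        filter_upwards [hloc, hcont.eventually (lt_mem_nhds h1)] with t ht ht'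
        rwa [abs_of_pos h1, abs_of_pos ht'] at ht
      exact hg (h2.hasDerivAt_eq_zero (o.dv s hs))
  have := hE s hs
  rw [hys, k.zero, zero_add] at this
  exact absurd (hH0 _ hsx.le) (not_le.2 this)

end Drop

end NodalRadial

/-! ### The limiting system: rest at the origin and decay at infinity. -/

namespace NodalRadial

lemma phi_neg (p s : ℝ) : phi p (-s) = -phi p s := by simp [phi]

lemma abs_phi (p s : ℝ) (hp : 1 < p) : |phi p s| = |s| ^ (p - 1) := by
  by_cases h : s = 0
  · rw [h, phi]; simp [Real.zero_rpow (by linarith : p - 1 ≠ 0)]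
  · rw [phi, abs_mul, abs_of_nonneg (by positivity), ← Real.rpow_add_one (abs_ne_zero.2 h)]
    congr 1; ring

lemma mul_phi (p s : ℝ) (hp : 1 < p) : s * phi p s = |s| ^ p := by
  by_cases h : s = 0
  · rw [h]; simp [Real.zero_rpow (by linarith : p ≠ 0)]
  · have h0 : 0 < |s| := abs_pos.2 h
    have : |s| ^ p = |s| ^ (p - 2) * s ^ 2 := by
      rw [← sq_abs s, ← Real.rpow_natCast |s| 2, ← Real.rpow_add h0]; congr 1; push_cast; ring
    rw [phi, this]; ring

lemma phi_eq_zero {p s : ℝ} (hp : 1 < p) : phi p s = 0 ↔ s = 0 := by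
  constructor
  · intro h
    have h1 := abs_phi p s hp
    rw [h, abs_zero] at h1
    exact abs_eq_zero.1 ((Real.rpow_eq_zero (abs_nonneg s) (by linarith)).1 h1.symm)
  · rintro rfl; simp [phi]

lemma phi_pos {p s : ℝ} (hs : 0 < s) : 0 < phi p s := by
  rw [phi, abs_of_pos hs]; positivity

lemma phi_of_pos {p s : ℝ} (hs : 0 < s) : phi p s = s ^ (p - 1) := by
  rw [phi, abs_of_pos hs, ← Real.rpow_add_one hs.ne']; congr 1; ring

lemma hasDerivAt_abs_rpow_div {p : ℝ} (hp : 1 < p) (s : ℝ) :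
    HasDerivAt (fun s => |s| ^ p / p) (phi p s) s := by
  have := (hasDerivAt_abs_rpow s hp).div_const p
  refine this.congr_deriv ?_
  rw [phi]
  have : p ≠ 0 := by linarith
  field_simp

/-- The slopes of a convergent function do not stay away from zero. -/
lemma eq_zero_of_tendsto_abs_deriv {v v' : ℝ → ℝ} {a l r : ℝ} (hd : ∀ t, a < t → HasDerivAt v (v' t) t)
    (hv : Tendsto v atTop (𝓝 l)) (hr : Tendsto (fun t => |v' t|) atTop (𝓝 r)) : r = 0 := by
  have hex : ∀ t, ∃ x, a < t → x ∈ Ioo t (t + 1) ∧ v' x = v (t + 1) - v t := by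
    intro t
    by_cases h : a < t
    · obtain ⟨x, hx, hxe⟩ := exists_hasDerivAt_eq_slope v v' (by linarith : t < t + 1)
        (fun s hs => (hd s (h.trans_le hs.1)).continuousAt.continuousWithinAt)
        (fun s hs => hd s (h.trans hs.1))
      exact ⟨x, fun _ => ⟨hx, by rw [hxe]; simp⟩⟩
    · exact ⟨0, fun h' => absurd h' h⟩
  choose x hx using hex
  have hxt : Tendsto x atTop atTop := by
    refine tendsto_atTop_mono' atTop ?_ tendsto_id
    filter_upwards [eventually_gt_atTop a] with t ht
    exact (hx t ht).1.1.le
  have h1 : Tendsto (fun t => |v (t + 1) - v t|) atTop (𝓝 0) := by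
    have := ((hv.comp (tendsto_atTop_add_const_right _ 1 tendsto_id)).sub hv).abs
    simpa using this
  refine tendsto_nhds_unique (hr.comp hxt) (h1.congr' ?_)
  filter_upwards [eventually_gt_atTop a] with t ht
  simp only [Function.comp, (hx t ht).2]

/-- Solutions of the limiting system on the half line with nonnegative energy. -/
structure LimitSol (P : ℝ) (η f F v y : ℝ → ℝ) : Prop where
  dv : ∀ t, 0 < t → HasDerivAt v (phi P (y t)) t
  dy : ∀ t, 0 < t → HasDerivAt y (-f (v t) - η t * y t) t
  energy : ∀ t, 0 < t → 0 ≤ |y t| ^ P / P + F (v t)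
  bdd : ∃ M, ∀ t, 0 < t → |v t| ≤ M

namespace LimitSol

variable {q η f F v y : ℝ → ℝ} {C₁ C₂ P βm βp : ℝ} {L : EReal}

lemma reflect (S : LimitSol P η f F v y) :
    LimitSol P η (fun s => -f (-s)) (fun s => F (-s)) (fun t => -v t) (fun t => -y t) where
  dv t ht := by rw [phi_neg]; exact (S.dv t ht).fun_neg
  dy t ht := ((S.dy t ht).fun_neg).congr_deriv (by simp only [neg_neg]; ring)
  energy t ht := by simpa only [neg_neg, abs_neg] using S.energy t ht
  bdd := by simpa only [abs_neg] using S.bdd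

lemma hasDerivAt_energy (S : LimitSol P η f F v y) (hP : 1 < P) (hF : ∀ s, HasDerivAt F (f s) s) {t : ℝ}
    (ht : 0 < t) : HasDerivAt (fun t => |y t| ^ P / P + F (v t)) (-(η t * |y t| ^ P)) t := by
  have h1 : HasDerivAt (fun t => |y t| ^ P / P) (phi P (y t) * (-f (v t) - η t * y t)) t :=
    (hasDerivAt_abs_rpow_div hP (y t)).comp t (S.dy t ht)
  have h2 : HasDerivAt (fun t => F (v t)) (f (v t) * phi P (y t)) t := (hF (v t)).comp t (S.dv t ht)
  refine (h1.fun_add h2).congr_deriv ?_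
  rw [← mul_phi P (y t) hP]; ring

lemma antitoneOn_energy (S : LimitSol P η f F v y) (w : Weight q η C₁ C₂) (hP : 1 < P)
    (hF : ∀ s, HasDerivAt F (f s) s) : AntitoneOn (fun t => |y t| ^ P / P + F (v t)) (Ioi 0) := by
  refine antitoneOn_of_hasDerivWithinAt_nonpos (convex_Ioi 0)
    (fun t ht => (S.hasDerivAt_energy hP hF ht).continuousAt.continuousWithinAt)
    (fun t ht => (S.hasDerivAt_energy hP hF (interior_subset ht)).hasDerivWithinAt) (fun t ht => ?_)
  have ht' : 0 < t := interior_subset ht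
  have := mul_nonneg (w.eta_pos ht').le (Real.rpow_nonneg (abs_nonneg (y t)) P)
  linarith

/-- A solution reaching rest at the origin stays there. -/
lemma eq_zero_after (S : LimitSol P η f F v y) (w : Weight q η C₁ C₂) (hP : 1 < P)
    (hF : ∀ s, HasDerivAt F (f s) s) (hF0 : F 0 = 0) {t₀ : ℝ} (ht₀ : 0 < t₀) (hv : v t₀ = 0)
    (hy : y t₀ = 0) : ∀ t, t₀ ≤ t → v t = 0 := by
  -- This replaces uniqueness, which may fail at 0: the energy is nonincreasing, nonnegative, and
  -- zero at t₀, so it stays zero. Hence nothing is dissipated afterwards, y vanishes and v is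
  -- constant.
  have hE : ∀ t, t₀ ≤ t → |y t| ^ P / P + F (v t) = 0 := by
    intro t ht
    have h1 := S.antitoneOn_energy w hP hF ht₀ (mem_Ioi.2 (ht₀.trans_le ht)) ht
    simp only [hv, hy, hF0, abs_zero, Real.zero_rpow (by linarith : P ≠ 0), zero_div, add_zero] at h1
    exact le_antisymm h1 (S.energy t (ht₀.trans_le ht))
  have hy0 : ∀ t, t₀ < t → y t = 0 := by
    intro t ht
    have h1 := S.hasDerivAt_energy hP hF (ht₀.trans ht)
    have h2 : HasDerivAt (fun t => |y t| ^ P / P + F (v t)) 0 t :=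
      (hasDerivAt_const t (0:ℝ)).congr_of_eventuallyEq (by
        filter_upwards [Ioi_mem_nhds ht] with s hs
        exact hE s (le_of_lt hs))
    have h3 := h1.unique h2
    have h4 := w.eta_pos (ht₀.trans ht)
    have h5 : |y t| ^ P = 0 := by
      rcases mul_eq_zero.1 (neg_eq_zero.1 h3) with h | h
      · exact absurd h h4.ne'
      · exact h
    exact abs_eq_zero.1 ((Real.rpow_eq_zero (abs_nonneg _) (by linarith)).1 h5)
  intro t ht
  rcases ht.eq_or_lt with rfl | ht
  · exact hv
  obtain ⟨x, hx, hxe⟩ := exists_hasDerivAt_eq_slope v (fun t => phi P (y t)) ht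
    (fun s hs => (S.dv s (ht₀.trans_le hs.1)).continuousAt.continuousWithinAt)
    (fun s hs => S.dv s (ht₀.trans hs.1))
  rw [hy0 x hx.1, (phi_eq_zero hP).2 rfl, hv, sub_zero, eq_comm, div_eq_zero_iff] at hxe
  rcases hxe with h | h
  · exact h
  · linarith

/-- Solutions that are eventually nonnegative tend to zero. -/
lemma tendsto_zero_of_nonneg (S : LimitSol P η f F v y) (w : Weight q η C₁ C₂) (hP : 1 < P)
    (X : Force f F βm βp L) {R : ℝ} (hv : ∀ t, R < t → 0 ≤ v t) : Tendsto v atTop (𝓝 0) := by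
  obtain ⟨M, hM⟩ := S.bdd
  have hPne : P ≠ 0 := by linarith
  set R₁ := max R 1 with hR₁
  have hR₁0 : 0 < R₁ := by positivity
  have hv' : ∀ t, R₁ < t → 0 ≤ v t := fun t ht => hv t ((le_max_left _ _).trans_lt ht)
  by_cases hz : ∃ t₀, R₁ < t₀ ∧ v t₀ = 0
  · obtain ⟨t₀, ht₀, hv₀⟩ := hz
    have ht₀0 := hR₁0.trans ht₀
    have hmin : IsLocalMin v t₀ := by
      filter_upwards [Ioi_mem_nhds ht₀] with t ht
      rw [hv₀]; exact hv' t ht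
    have hy₀ := (phi_eq_zero hP).1 (hmin.hasDerivAt_eq_zero (S.dv t₀ ht₀0))
    have := S.eq_zero_after w hP X.hasDeriv X.zero' ht₀0 hv₀ hy₀
    refine tendsto_const_nhds.congr' ?_
    filter_upwards [eventually_ge_atTop t₀] with t ht
    exact (this t ht).symm
  push Not at hz
  have hvpos : ∀ t, R₁ < t → 0 < v t := fun t ht => lt_of_le_of_ne (hv' t ht) (hz t ht).symm
  -- critical points are maxima
  have hcrit : ∀ t, R₁ < t → y t = 0 → 0 < f (v t) := by
    intro t ht hy
    have h1 := S.energy t (hR₁0.trans ht)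
    rw [hy, abs_zero, Real.zero_rpow hPne, zero_div, zero_add] at h1
    refine X.pos _ ?_
    by_contra! h2
    have := X.neg (v t) ⟨X.βm_neg.trans (hvpos t ht), h2⟩ (hvpos t ht).ne'
    linarith
  -- At a positive critical point the energy F(v) ≥ 0 gives v ≥ βp, so the force is positive and y
  -- crosses 0 only downwards. After its first nonpositive value y is negative, and v is eventually
  -- monotone.
  have hsign : ∀ s t, R₁ < s → s < t → y s ≤ 0 → y t < 0 := by
    intro s t hs hst hy
    have := lt_of_crosses_upward (f := fun t => -y t) (f' := fun t => -(-f (v t) - η t * y t)) (a := s) (b := t)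
      (θ := 0) (fun x hx => (S.dy x (hR₁0.trans (hs.trans_le hx.1))).fun_neg) (fun x hx h0 => by
        have hy0 : y x = 0 := neg_eq_zero.1 h0
        have := hcrit x (hs.trans_le hx.1) hy0
        rw [hy0]; linarith) ⟨le_rfl, hst.le⟩ ⟨hst.le, le_rfl⟩ hst (by linarith)
    linarith
  have hvc : ∀ s, R₁ < s → ContinuousOn v (Ici s) := fun s hs t ht =>
    (S.dv t (hR₁0.trans (hs.trans_le ht))).continuousAt.continuousWithinAt
  -- the solution converges
  obtain ⟨l, hl⟩ : ∃ l, Tendsto v atTop (𝓝 l) := by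
    by_cases hs : ∃ s, R₁ < s ∧ y s ≤ 0
    · obtain ⟨s, hs, hys⟩ := hs
      have hanti : AntitoneOn v (Ici s) := antitoneOn_of_hasDerivWithinAt_nonpos (convex_Ici s) (hvc s hs)
        (fun t ht => (S.dv t (hR₁0.trans (hs.trans_le (interior_subset ht)))).hasDerivWithinAt) (fun t ht => by
          rw [interior_Ici] at ht
          have := phi_pos (p := P) (neg_pos.2 (hsign s t hs ht hys))
          rw [phi_neg] at this; linarith)
      have h1 : Antitone fun t => v (max s t) := fun x z hxz =>
        hanti (le_max_left s x) (le_max_left s z) (max_le_max le_rfl hxz)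
      have h2 : BddBelow (range fun t => v (max s t)) :=
        ⟨0, by rintro _ ⟨t, rfl⟩; exact hv' _ (hs.trans_le (le_max_left _ _))⟩
      refine ⟨_, (tendsto_atTop_ciInf h1 h2).congr' ?_⟩
      filter_upwards [eventually_ge_atTop s] with t ht
      rw [max_eq_right ht]
    · push Not at hs
      set s := R₁ + 1 with hsd
      have hs1 : R₁ < s := by linarith
      have hmono : MonotoneOn v (Ici s) := monotoneOn_of_hasDerivWithinAt_nonneg (convex_Ici s) (hvc s hs1)
        (fun t ht => (S.dv t (hR₁0.trans (hs1.trans_le (interior_subset ht)))).hasDerivWithinAt) (fun t ht => by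
          rw [interior_Ici] at ht
          exact (phi_pos (hs t (hs1.trans ht))).le)
      have h1 : Monotone fun t => v (max s t) := fun x z hxz =>
        hmono (le_max_left s x) (le_max_left s z) (max_le_max le_rfl hxz)
      have h2 : BddAbove (range fun t => v (max s t)) :=
        ⟨M, by
          rintro _ ⟨t, rfl⟩
          exact (le_abs_self _).trans (hM _ (hR₁0.trans (hs1.trans_le (le_max_left _ _))))⟩
      refine ⟨_, (tendsto_atTop_ciSup h1 h2).congr' ?_⟩
      filter_upwards [eventually_ge_atTop s] with t ht
      rw [max_eq_right ht]
  -- the energy converges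
  obtain ⟨e, he⟩ : ∃ e, Tendsto (fun t => |y t| ^ P / P + F (v t)) atTop (𝓝 e) := by
    have ha := S.antitoneOn_energy w hP X.hasDeriv
    have h1 : Antitone fun t => (fun t => |y t| ^ P / P + F (v t)) (max 1 t) := fun x z hxz =>
      ha (mem_Ioi.2 (by positivity)) (mem_Ioi.2 (by positivity)) (max_le_max le_rfl hxz)
    have h2 : BddBelow (range fun t => (fun t => |y t| ^ P / P + F (v t)) (max 1 t)) :=
      ⟨0, by rintro _ ⟨t, rfl⟩; exact S.energy _ (by positivity)⟩
    refine ⟨_, (tendsto_atTop_ciInf h1 h2).congr' ?_⟩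
    filter_upwards [eventually_ge_atTop 1] with t ht
    simp only [max_eq_right ht]
  have hFl : Tendsto (fun t => F (v t)) atTop (𝓝 (F l)) := (X.cont'.tendsto l).comp hl
  have hyP : Tendsto (fun t => |y t| ^ P) atTop (𝓝 (P * (e - F l))) := by
    refine ((he.sub hFl).const_mul P).congr fun t => ?_
    field_simp; ring
  have hφ : Tendsto (fun t => |phi P (y t)|) atTop (𝓝 ((P * (e - F l)) ^ ((P - 1) / P))) := by
    have h2 : 0 ≤ (P - 1) / P := div_nonneg (by linarith) (by linarith)
    refine (hyP.rpow_const (Or.inr h2)).congr fun t => ?_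
    rw [abs_phi _ _ hP, ← Real.rpow_mul (abs_nonneg _)]; congr 1; field_simp
  -- Both the energy and F(v) converge, hence so does the speed |φ_P(y)|; a convergent v allows only
  -- the limit 0.
  have h0 := eq_zero_of_tendsto_abs_deriv S.dv hl hφ
  have hn : 0 ≤ P * (e - F l) := ge_of_tendsto' hyP fun t => by positivity
  have h1 : P * (e - F l) = 0 := by
    refine (Real.rpow_eq_zero hn ?_).1 h0
    have : P - 1 ≠ 0 := by linarith
    positivity
  rw [h1] at hyP
  have hy0 : Tendsto y atTop (𝓝 0) := by
    rw [tendsto_zero_iff_abs_tendsto_zero]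
    have h2 : 0 ≤ 1 / P := div_nonneg zero_le_one (by linarith)
    have := hyP.rpow_const (p := 1 / P) (Or.inr h2)
    rw [Real.zero_rpow (by positivity)] at this
    refine this.congr fun t => ?_
    rw [← Real.rpow_mul (abs_nonneg _), mul_one_div_cancel hPne, Real.rpow_one]; rfl
  have heF : e = F l := by
    rcases mul_eq_zero.1 h1 with h | h
    · exact absurd h hPne
    · linarith
  have he0 : 0 ≤ e := by
    refine ge_of_tendsto he ?_
    filter_upwards [eventually_gt_atTop 0] with t ht using S.energy t ht
  have hl0 : 0 ≤ l := by
    refine ge_of_tendsto hl ?_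
    filter_upwards [eventually_gt_atTop R₁] with t ht using hv' t ht
  rcases hl0.eq_or_lt with h | h
  · rwa [← h] at hl
  -- A positive limit l has F(l) = e ≥ 0, so l ≥ βp and f(l) > 0. Then y' tends to -f(l) ≠ 0,
  -- although y tends to 0.
  exfalso
  have hlβ : βp ≤ l := by
    by_contra! h2
    have := X.neg l ⟨X.βm_neg.trans h, h2⟩ h.ne'
    linarith
  have hηy : Tendsto (fun t => η t * y t) atTop (𝓝 0) := by
    refine squeeze_zero_norm' (a := fun t => C₂ * |y t|) ?_ ?_
    · filter_upwards [eventually_ge_atTop 1] with t ht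
      have ht0 : 0 < t := by linarith
      have h2 := w.up t ht0
      have h3 := w.eta_pos ht0
      rw [Real.norm_eq_abs, abs_mul, abs_of_pos h3]
      refine mul_le_mul_of_nonneg_right ?_ (abs_nonneg _)
      nlinarith
    · have := hy0.abs.const_mul C₂
      simpa using this
  have hfl : Tendsto (fun t => |-f (v t) - η t * y t|) atTop (𝓝 |-f l - 0|) :=
    ((((X.cont.tendsto l).comp hl).neg).sub hηy).abs
  have h2 := eq_zero_of_tendsto_abs_deriv S.dy hy0 hfl
  have := X.pos l hlβ
  rw [sub_zero, abs_neg, abs_eq_zero] at h2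
  linarith

/-- Solutions that eventually do not change sign tend to zero. -/
lemma tendsto_zero (S : LimitSol P η f F v y) (w : Weight q η C₁ C₂) (hP : 1 < P)
    (X : Force f F βm βp L) {R : ℝ} (hv : ∀ s t, R < s → R < t → 0 ≤ v s * v t) :
    Tendsto v atTop (𝓝 0) := by
  by_cases h : ∀ t, R < t → 0 ≤ v t
  · exact S.tendsto_zero_of_nonneg w hP X h
  · push Not at h
    obtain ⟨s, hs, hvs⟩ := h
    have := S.reflect.tendsto_zero_of_nonneg w hP X.reflect (R := R) fun t ht => by
      have := hv s t hs ht
      simp only [Left.nonneg_neg_iff]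
      by_contra! h'
      nlinarith
    simpa using this.neg

end LimitSol

end NodalRadial

/-! ### Compactness along an ultrafilter. -/

namespace NodalRadial

lemma continuous_phi {p : ℝ} (hp : 1 < p) : Continuous (phi p) := by
  rw [continuous_iff_continuousAt]
  intro s
  rcases eq_or_ne s 0 with rfl | h
  · rw [ContinuousAt, (phi_eq_zero hp).2 rfl]
    refine squeeze_zero_norm (a := fun s => |s| ^ (p - 1)) (fun s => (abs_phi p s hp).le) ?_
    have : Continuous fun s : ℝ => |s| ^ (p - 1) :=
      continuous_abs.rpow_const fun s => Or.inr (by linarith)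
    have h1 := this.tendsto 0
    rwa [abs_zero, Real.zero_rpow (by linarith : p - 1 ≠ 0)] at h1
  · unfold phi
    exact (continuous_abs.continuousAt.rpow_const (Or.inl (abs_ne_zero.2 h))).mul continuousAt_id

lemma exists_tendsto_ultrafilter {ι : Type*} (𝒰 : Ultrafilter ι) {u : ι → ℝ} {M : ℝ}
    (h : ∀ᶠ n in 𝒰, |u n| ≤ M) : ∃ x, |x| ≤ M ∧ Tendsto u 𝒰 (𝓝 x) := by
  obtain ⟨x, hx, hx'⟩ := (isCompact_Icc (a := -M) (b := M)).ultrafilter_le_nhds (𝒰.map u) (by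
    rw [Ultrafilter.coe_map, le_principal_iff, mem_map]
    filter_upwards [h] with n hn using abs_le.1 hn)
  exact ⟨x, abs_le.2 hx, hx'⟩

/-- Pointwise convergence of functions that are Lipschitz near a point is continuous convergence. -/
lemma tendsto_prod_of_lipschitz {ι : Type*} {𝒰 : Filter ι} {u : ι → ℝ → ℝ} {t x C : ℝ} {U : Set ℝ}
    (hU : U ∈ 𝓝 t) (hL : ∀ᶠ n in 𝒰, ∀ s ∈ U, |u n s - u n t| ≤ C * |s - t|)
    (hx : Tendsto (fun n => u n t) 𝒰 (𝓝 x)) : Tendsto (fun p : ι × ℝ => u p.1 p.2) (𝒰 ×ˢ 𝓝 t) (𝓝 x) := by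
  have h1 : Tendsto (fun p : ι × ℝ => u p.1 t) (𝒰 ×ˢ 𝓝 t) (𝓝 x) := hx.comp tendsto_fst
  have h2 : Tendsto (fun p : ι × ℝ => u p.1 p.2 - u p.1 t) (𝒰 ×ˢ 𝓝 t) (𝓝 0) := by
    refine squeeze_zero_norm' (a := fun p : ι × ℝ => C * |p.2 - t|) ?_ ?_
    · filter_upwards [hL.prod_mk hU] with p hp using hp.1 p.2 hp.2
    · have : Tendsto (fun s : ℝ => C * |s - t|) (𝓝 t) (𝓝 (C * |t - t|)) :=
        (by fun_prop : Continuous fun s : ℝ => C * |s - t|).tendsto t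
      rw [sub_self, abs_zero, mul_zero] at this
      exact this.comp tendsto_snd
  simpa using h1.add h2

/-- Continuous convergence of the derivatives at t, together with continuity of the limit, is
uniform convergence along the product filter, so differentiation passes to the limit. -/
lemma hasDerivAt_of_tendsto_prod {ι : Type*} {𝒰 : Filter ι} [𝒰.NeBot] {u u' : ι → ℝ → ℝ} {U U' : ℝ → ℝ} {t : ℝ}
    (hU' : ContinuousAt U' t) (h' : Tendsto (fun p : ι × ℝ => u' p.1 p.2) (𝒰 ×ˢ 𝓝 t) (𝓝 (U' t)))
    (hd : ∀ᶠ p : ι × ℝ in 𝒰 ×ˢ 𝓝 t, HasDerivAt (u p.1) (u' p.1 p.2) p.2)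
    (hu : ∀ᶠ s in 𝓝 t, Tendsto (fun n => u n s) 𝒰 (𝓝 (U s))) : HasDerivAt U (U' t) t := by
  refine hasDerivAt_of_tendstoUniformlyOnFilter (f := u) (f' := u') (g' := U') (l := 𝒰) ?_ hd hu
  rw [tendstoUniformlyOnFilter_iff_tendsto]
  exact ((hU'.tendsto.comp tendsto_snd).prodMk_nhds h').mono_right (nhds_le_uniformity _)

/-- Regularized solutions with a fixed number of zeros along an ultrafilter of parameters. -/
structure Family (f F η : ℝ → ℝ) (P c m d₁ d₂ cH Fb Λ : ℝ) (N : ℕ) (𝒰 : Ultrafilter ℕ)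
    (g K h H : ℕ → ℝ → ℝ) (ε T ω l : ℕ → ℝ) (v y Θ : ℕ → ℝ → ℝ) : Prop where
  kin : ∀ n, Kinetic P c m (g n) (K n)
  app : ∀ n, Approx f F d₁ d₂ cH Fb (ω n) (h n) (H n)
  ω_lim : Tendsto ω 𝒰 (𝓝 0)
  ε_pos : ∀ n, 0 < ε n
  ε_lim : Tendsto ε 𝒰 (𝓝 0)
  lt : ∀ n, ε n < T n
  T_lim : Tendsto T 𝒰 atTop
  mem : ∀ n, l n ∈ Ioc 0 Λ
  sol : ∀ n, Sol (g n) (h n) η (ε n) (T n) (l n) (v n) (y n)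
  ang : ∀ n, IsAngle (g n) (h n) η (ε n) (T n) (v n) (y n) (Θ n)
  fin : ∀ n, Θ n (T n) = Real.pi / 2 + N * Real.pi
  g_lim : ∀ s, Tendsto (fun p : ℕ × ℝ => g p.1 p.2) (𝒰 ×ˢ 𝓝 s) (𝓝 (phi P s))
  K_lim : ∀ s, Tendsto (fun p : ℕ × ℝ => K p.1 p.2) (𝒰 ×ˢ 𝓝 s) (𝓝 (|s| ^ P / P))

namespace Family

variable {q η f F : ℝ → ℝ} {C₁ C₂ P c m d₁ d₂ cH Fb Λ βm βp : ℝ} {L : EReal} {N : ℕ} {𝒰 : Ultrafilter ℕ}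
  {g K h H : ℕ → ℝ → ℝ} {ε T ω l : ℕ → ℝ} {v y Θ : ℕ → ℝ → ℝ}

/-- The prescribed final angle makes v vanish at T, where y cannot; the energy is positive there and
was larger before. -/
lemma energy_pos (S : Family f F η P c m d₁ d₂ cH Fb Λ N 𝒰 g K h H ε T ω l v y Θ) (w : Weight q η C₁ C₂)
    (n : ℕ) : ∀ t ∈ Icc (ε n) (T n), 0 < K n (y n t) + H n (v n t) := by
  intro t ht
  have h1 := (S.sol n).orbit.anti_E w (S.kin n) (S.app n).toPotential (S.ε_pos n) ht
    ⟨(S.lt n).le, le_rfl⟩ ht.2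
  have hT : T n ∈ Icc (ε n) (T n) := ⟨(S.lt n).le, le_rfl⟩
  have hv : v n (T n) = 0 := by
    rw [(S.ang n).zero_iff hT, S.fin n, Real.cos_add_nat_mul_pi, Real.cos_pi_div_two, mul_zero]
  have hy : y n (T n) ≠ 0 := by
    intro h0
    have := (S.ang n).pos _ hT
    rw [hv, h0] at this; simp at this
  simp only [hv, (S.app n).zero', add_zero] at h1
  exact ((S.kin n).zero_lt hy).trans_le h1

/-- Positive energy excludes initial values in the well. The bound passes to the limit and makes it
nontrivial. -/
lemma lt_init (S : Family f F η P c m d₁ d₂ cH Fb Λ N 𝒰 g K h H ε T ω l v y Θ) (w : Weight q η C₁ C₂)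
    (n : ℕ) : d₂ < l n := by
  have h1 := S.energy_pos w n (ε n) ⟨le_rfl, (S.lt n).le⟩
  rw [(S.sol n).y_init, (S.sol n).v_init, (S.kin n).zero, zero_add] at h1
  by_contra! h2
  exact absurd ((S.app n).nonpos (l n) (by rwa [abs_of_pos (S.mem n).1])) (not_le.2 h1)

/-- The bound l ≤ Λ caps the energy strictly below the limit of F, which bounds v, and coercivity
bounds y. Integrating (q y)' = -q h bounds the momentum by a multiple of B; in the limit this gives
the vanishing flux at the origin. -/
lemma exists_bounds (S : Family f F η P c m d₁ d₂ cH Fb Λ N 𝒰 g K h H ε T ω l v y Θ)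
    (w : Weight q η C₁ C₂) (hP : 1 < P) (hc : 0 < c) (X : Force f F βm βp L) :
    ∃ M : ℝ, 0 < M ∧ ∀ᶠ n in 𝒰, ∀ t ∈ Icc (ε n) (T n), |v n t| ≤ M ∧ |y n t| ≤ M ∧ |g n (y n t)| ≤ M ∧
      |h n (v n t)| ≤ M ∧ |q t * y n t| ≤ M * capB q t := by
  obtain ⟨b, hb0, hbL, hb⟩ := X.exists_potential_bound Λ
  obtain ⟨r, hr, hrL⟩ := Force.exists_room hbL
  obtain ⟨M₁, hM₁, hM₁F⟩ := X.exists_gt hrL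
  obtain ⟨M₂, hM₂⟩ := (isCompact_Icc (a := -M₁) (b := M₁)).exists_bound_of_continuousOn X.cont.continuousOn
  set M₃ := |(b + 1 + Fb) / c + 1| with hM₃
  set M := M₁ + (|M₂| + 1) + M₃ + M₃ ^ (P - 1) with hM
  have hn3 : 0 ≤ M₃ := abs_nonneg _
  have hn4 : 0 ≤ M₃ ^ (P - 1) := Real.rpow_nonneg hn3 _
  have hn2 : 0 ≤ |M₂| := abs_nonneg _
  refine ⟨M, by linarith, ?_⟩
  filter_upwards [S.ω_lim.eventually (gt_mem_nhds (lt_min one_pos (half_pos hr)))] with n hn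
  have hω1 : ω n ≤ 1 := hn.le.trans (min_le_left _ _)
  have hωr : ω n ≤ r / 2 := hn.le.trans (min_le_right _ _)
  have k := S.kin n
  have A := S.app n
  have o := (S.sol n).orbit
  have hεm : ε n ∈ Icc (ε n) (T n) := ⟨le_rfl, (S.lt n).le⟩
  have hE : ∀ t ∈ Icc (ε n) (T n), K n (y n t) + H n (v n t) ≤ b + ω n := by
    intro t ht
    have h1 := o.anti_E w k A.toPotential (S.ε_pos n) hεm ht ht.1
    simp only [(S.sol n).v_init, (S.sol n).y_init, k.zero, zero_add] at h1
    have h2 := hb (l n) (by rw [abs_of_pos (S.mem n).1]; exact (S.mem n).2)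
    linarith [(abs_le.1 (A.close (l n))).2]
  have hv : ∀ t ∈ Icc (ε n) (T n), |v n t| ≤ M₁ := by
    intro t ht
    by_contra! h'
    have h1 := hM₁F _ h'.le
    linarith [hE t ht, k.nonneg (y n t), (abs_le.1 (A.close (v n t))).1]
  have hy : ∀ t ∈ Icc (ε n) (T n), |y n t| ≤ M₃ := by
    intro t ht
    have h1 := k.linear_le (y n t)
    have h2 : |y n t| - 1 ≤ (b + 1 + Fb) / c := by
      rw [le_div_iff₀ hc]
      linarith [hE t ht, A.lower (v n t)]
    linarith [le_abs_self ((b + 1 + Fb) / c + 1)]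
  have hh : ∀ t ∈ Icc (ε n) (T n), |h n (v n t)| ≤ |M₂| + 1 := by
    intro t ht
    have h1 := hM₂ (v n t) (abs_le.1 (hv t ht))
    rw [Real.norm_eq_abs] at h1
    have h2 := A.close' (v n t)
    have h3 := abs_sub_abs_le_abs_sub (h n (v n t)) (f (v n t))
    linarith [le_abs_self M₂]
  intro t ht
  have hpos : ∀ t ∈ Icc (ε n) (T n), 0 < t := fun t ht => (S.ε_pos n).trans_le ht.1
  refine ⟨by linarith [hv t ht], by linarith [hy t ht], ?_, by linarith [hh t ht], ?_⟩
  · have h1 := (k.abs_le (y n t)).trans (Real.rpow_le_rpow (abs_nonneg _) (hy t ht) (by linarith))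
    linarith
  · have hB := (w.capB_pos (S.ε_pos n)).le
    have hMn : 0 ≤ M := by linarith
    have hhM : ∀ x ∈ Icc (ε n) (T n), |h n (v n x)| ≤ M := fun x hx => by linarith [hh x hx]
    have d1 : ∀ σ : ℝ, |σ| = 1 → 0 ≤ σ * (q t * y n t) + M * capB q t := by
      intro σ hσ
      have hd : ∀ x ∈ Icc (ε n) (T n), HasDerivAt (fun x => σ * (q x * y n x) + M * capB q x)
          (σ * -(q x * h n (v n x)) + M * q x) x := fun x hx =>
        ((o.hasDerivAt_momentum w (S.ε_pos n) hx).const_mul σ).fun_add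
          ((w.hasDerivAt_capB (hpos x hx)).const_mul M)
      have hm : MonotoneOn (fun x => σ * (q x * y n x) + M * capB q x) (Icc (ε n) (T n)) := by
        refine monotoneOn_of_hasDerivWithinAt_nonneg (convex_Icc _ _)
          (fun x hx => (hd x hx).continuousAt.continuousWithinAt)
          (fun x hx => (hd x (interior_subset hx)).hasDerivWithinAt) (fun x hx => ?_)
        have hx' := interior_subset hx
        have h1 : σ * h n (v n x) ≤ M := by
          refine (le_abs_self _).trans ?_
          rw [abs_mul, hσ, one_mul]; exact hhM x hx'
        have h2 := mul_le_mul_of_nonneg_left h1 (w.pos x (hpos x hx')).le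
        linarith
      have h1 := hm hεm ht ht.1
      simp only [(S.sol n).y_init, mul_zero, zero_add] at h1
      linarith [mul_nonneg hMn hB]
    rw [abs_le]
    constructor
    · linarith [d1 1 (by simp)]
    · linarith [d1 (-1) (by simp)]

/-- The regularized solutions converge. -/
theorem exists_limit (S : Family f F η P c m d₁ d₂ cH Fb Λ N 𝒰 g K h H ε T ω l v y Θ)
    (w : Weight q η C₁ C₂) (hP : 1 < P) (hc : 0 < c) (X : Force f F βm βp L) :
    ∃ V Y : ℝ → ℝ, ∃ M : ℝ, LimitSol P η f F V Y ∧ (∀ s t, |V s - V t| ≤ M * |s - t|) ∧ d₂ ≤ V 0 ∧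
      (∀ t, 0 < t → |q t * Y t| ≤ M * capB q t) ∧ 0 < M ∧
      (∀ᶠ n in 𝒰, ∀ s ∈ Icc (ε n) (T n), ∀ t ∈ Icc (ε n) (T n), |v n s - v n t| ≤ M * |s - t|) ∧
      (∀ t, 0 < t → Tendsto (fun p : ℕ × ℝ => v p.1 p.2) (𝒰 ×ˢ 𝓝 t) (𝓝 (V t))) ∧
      ∀ t, 0 < t → Tendsto (fun p : ℕ × ℝ => y p.1 p.2) (𝒰 ×ˢ 𝓝 t) (𝓝 (Y t)) := by
  obtain ⟨M, hM, hb⟩ := S.exists_bounds w hP hc X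
  have hlip : ∀ᶠ n in 𝒰, ∀ s ∈ Icc (ε n) (T n), ∀ t ∈ Icc (ε n) (T n), |v n s - v n t| ≤ M * |s - t| := by
    filter_upwards [hb] with n hn s hs t ht
    exact (convex_Icc (ε n) (T n)).norm_image_sub_le_of_norm_hasDerivWithin_le
      (fun x hx => ((S.sol n).dv x hx).hasDerivWithinAt) (fun x hx => (hn x hx).2.2.1) ht hs
  have hin : ∀ a b : ℝ, 0 < a → ∀ᶠ n in 𝒰, Icc a b ⊆ Icc (ε n) (T n) := fun a b ha => by
    filter_upwards [S.ε_lim.eventually (gt_mem_nhds ha), S.T_lim.eventually_ge_atTop b] with n h1 h2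
    exact Icc_subset_Icc h1.le h2
  -- pointwise limits
  set κ : ℕ → ℝ → ℝ := fun n t => max (ε n) (min (T n) t) with hκ
  have hκm : ∀ n t, κ n t ∈ Icc (ε n) (T n) := fun n t => clamp_mem (S.lt n).le t
  have hV : ∀ t, ∃ x, |x| ≤ M ∧ Tendsto (fun n => v n (κ n t)) 𝒰 (𝓝 x) := fun t =>
    exists_tendsto_ultrafilter 𝒰 (by filter_upwards [hb] with n hn using (hn _ (hκm n t)).1)
  choose V hVM hVlim using hV
  have hY : ∀ t, ∃ x, |x| ≤ M ∧ Tendsto (fun n => y n (κ n t)) 𝒰 (𝓝 x) := fun t =>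
    exists_tendsto_ultrafilter 𝒰 (by filter_upwards [hb] with n hn using (hn _ (hκm n t)).2.1)
  choose Y hYM hYlim using hY
  have hκe : ∀ t, 0 < t → ∀ᶠ n in 𝒰, κ n t = t := fun t ht => by
    filter_upwards [hin t t ht] with n hn using clamp_eq (hn ⟨le_rfl, le_rfl⟩)
  have hVt : ∀ t, 0 < t → Tendsto (fun n => v n t) 𝒰 (𝓝 (V t)) := fun t ht =>
    (hVlim t).congr' (by filter_upwards [hκe t ht] with n hn; rw [hn])
  have hYt : ∀ t, 0 < t → Tendsto (fun n => y n t) 𝒰 (𝓝 (Y t)) := fun t ht =>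
    (hYlim t).congr' (by filter_upwards [hκe t ht] with n hn; rw [hn])
  have hVlip : ∀ s t, |V s - V t| ≤ M * |s - t| := by
    intro s t
    refine le_of_tendsto ((hVlim s).sub (hVlim t)).abs ?_
    filter_upwards [hlip] with n hn
    refine (hn _ (hκm n s) _ (hκm n t)).trans (mul_le_mul_of_nonneg_left ?_ hM.le)
    simp only [hκ]
    refine (abs_max_sub_max_le_max _ _ _ _).trans (max_le (by simp) ?_)
    exact (abs_min_sub_min_le_max _ _ _ _).trans (max_le (by simp) le_rfl)
  -- continuous convergence
  have hnear : ∀ t, 0 < t → ∀ᶠ n in 𝒰, Icc (t / 2) (2 * t) ⊆ Icc (ε n) (T n) := fun t ht =>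
    hin _ _ (half_pos ht)
  have hmem : ∀ t : ℝ, 0 < t → Icc (t / 2) (2 * t) ∈ 𝓝 t := fun t ht =>
    Icc_mem_nhds (by linarith) (by linarith)
  have hmid : ∀ t : ℝ, 0 < t → t ∈ Icc (t / 2) (2 * t) := fun t ht => ⟨by linarith, by linarith⟩
  have hVp : ∀ t, 0 < t → Tendsto (fun p : ℕ × ℝ => v p.1 p.2) (𝒰 ×ˢ 𝓝 t) (𝓝 (V t)) := fun t ht => by
    refine tendsto_prod_of_lipschitz (C := M) (hmem t ht) ?_ (hVt t ht)
    filter_upwards [hlip, hnear t ht] with n hn hs s hs'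
    exact hn s (hs hs') t (hs (hmid t ht))
  have hYlip : ∀ t, 0 < t → ∀ᶠ n in 𝒰, ∀ s ∈ Icc (t / 2) (2 * t),
      |y n s - y n t| ≤ (M + η (t / 2) * M) * |s - t| := by
    intro t ht
    filter_upwards [hb, hnear t ht] with n hn hs s hs'
    refine (convex_Icc (t / 2) (2 * t)).norm_image_sub_le_of_norm_hasDerivWithin_le
      (fun x hx => ((S.sol n).dy x (hs hx)).hasDerivWithinAt) (fun x hx => ?_) (hmid t ht) hs'
    have hx0 : 0 < x := (half_pos ht).trans_le hx.1
    have h1 := w.anti (half_pos ht) hx0 hx.1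
    have h2 := w.eta_pos hx0
    obtain ⟨-, b1, -, b2, -⟩ := hn x (hs hx)
    rw [Real.norm_eq_abs]
    refine (abs_sub _ _).trans ?_
    rw [abs_neg, abs_mul, abs_of_pos h2]
    have := mul_le_mul h1 b1 (abs_nonneg _) (h2.le.trans h1)
    linarith
  have hYp : ∀ t, 0 < t → Tendsto (fun p : ℕ × ℝ => y p.1 p.2) (𝒰 ×ˢ 𝓝 t) (𝓝 (Y t)) := fun t ht =>
    tendsto_prod_of_lipschitz (hmem t ht) (hYlip t ht) (hYt t ht)
  have hVc : Continuous V :=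
    (LipschitzWith.of_dist_le_mul (K := ⟨M, hM.le⟩) fun s t => hVlip s t).continuous
  have hYc : ∀ t, 0 < t → ContinuousAt Y t := by
    intro t ht
    have hle : ∀ s ∈ Icc (t / 2) (2 * t), |Y s - Y t| ≤ (M + η (t / 2) * M) * |s - t| := by
      intro s hs
      refine le_of_tendsto ((hYt s ((half_pos ht).trans_le hs.1)).sub (hYt t ht)).abs ?_
      filter_upwards [hYlip t ht] with n hn using hn s hs
    rw [ContinuousAt, tendsto_iff_dist_tendsto_zero]
    refine squeeze_zero' (g := fun s => (M + η (t / 2) * M) * |s - t|) (Eventually.of_forall fun s => dist_nonneg) ?_ ?_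
    · filter_upwards [hmem t ht] with s hs using hle s hs
    · have : Tendsto (fun s : ℝ => (M + η (t / 2) * M) * |s - t|) (𝓝 t) (𝓝 ((M + η (t / 2) * M) * |t - t|)) :=
        (by fun_prop : Continuous fun s : ℝ => (M + η (t / 2) * M) * |s - t|).tendsto t
      rwa [sub_self, abs_zero, mul_zero] at this
  have hgp : ∀ t, 0 < t → Tendsto (fun p : ℕ × ℝ => g p.1 (y p.1 p.2)) (𝒰 ×ˢ 𝓝 t) (𝓝 (phi P (Y t))) := fun t ht =>
    (S.g_lim (Y t)).comp (tendsto_fst.prodMk (hYp t ht))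
  have hhp : ∀ t, 0 < t → Tendsto (fun p : ℕ × ℝ => h p.1 (v p.1 p.2)) (𝒰 ×ˢ 𝓝 t) (𝓝 (f (V t))) := by
    intro t ht
    have h1 : Tendsto (fun p : ℕ × ℝ => f (v p.1 p.2)) (𝒰 ×ˢ 𝓝 t) (𝓝 (f (V t))) :=
      (X.cont.tendsto _).comp (hVp t ht)
    have h2 : Tendsto (fun p : ℕ × ℝ => h p.1 (v p.1 p.2) - f (v p.1 p.2)) (𝒰 ×ˢ 𝓝 t) (𝓝 0) :=
      squeeze_zero_norm (fun p => (S.app p.1).close' _) (S.ω_lim.comp tendsto_fst)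
    simpa using h1.add h2
  have hpos : ∀ t : ℝ, 0 < t → ∀ᶠ s in 𝓝 t, 0 < s := fun t ht => lt_mem_nhds ht
  have hder : ∀ t, 0 < t → ∀ᶠ p : ℕ × ℝ in (𝒰 : Filter ℕ) ×ˢ 𝓝 t, p.2 ∈ Icc (ε p.1) (T p.1) := fun t ht => by
    filter_upwards [(hnear t ht).prod_mk (hmem t ht)] with p hp using hp.1 hp.2
  refine ⟨V, Y, M, ⟨fun t ht => ?_, fun t ht => ?_, fun t ht => ?_, M, fun t _ => hVM t⟩, hVlip, ?_, fun t ht => ?_,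
    hM, hlip, hVp, hYp⟩
  · refine hasDerivAt_of_tendsto_prod (𝒰 := (𝒰 : Filter ℕ)) (u := v) (u' := fun n t => g n (y n t))
      (U' := fun t => phi P (Y t)) ?_ (hgp t ht) ?_ ?_
    · exact (continuous_phi hP).continuousAt.comp (hYc t ht)
    · filter_upwards [hder t ht] with p hp using (S.sol p.1).dv _ hp
    · filter_upwards [hpos t ht] with s hs using hVt s hs
  · have hηc : ContinuousAt η t := w.cont.continuousAt (Ioi_mem_nhds ht)
    refine hasDerivAt_of_tendsto_prod (𝒰 := (𝒰 : Filter ℕ)) (u := y)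
      (u' := fun n t => -h n (v n t) - η t * y n t) (U' := fun t => -f (V t) - η t * Y t) ?_ ?_ ?_ ?_
    · exact ((X.cont.comp hVc).continuousAt.neg).sub (hηc.mul (hYc t ht))
    · exact (hhp t ht).neg.sub ((hηc.tendsto.comp tendsto_snd).mul (hYp t ht))
    · filter_upwards [hder t ht] with p hp using (S.sol p.1).dy _ hp
    · filter_upwards [hpos t ht] with s hs using hYt s hs
  · have h1 : Tendsto (fun n => K n (y n t)) 𝒰 (𝓝 (|Y t| ^ P / P)) :=
      (S.K_lim (Y t)).comp (tendsto_id.prodMk (hYt t ht))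
    have h2 : Tendsto (fun n => H n (v n t)) 𝒰 (𝓝 (F (V t))) := by
      have h3 : Tendsto (fun n => F (v n t)) 𝒰 (𝓝 (F (V t))) := (X.cont'.tendsto _).comp (hVt t ht)
      have h4 : Tendsto (fun n => H n (v n t) - F (v n t)) 𝒰 (𝓝 0) :=
        squeeze_zero_norm (fun n => (S.app n).close _) S.ω_lim
      simpa using h3.add h4
    refine ge_of_tendsto (h1.add h2) ?_
    filter_upwards [hnear t ht] with n hn using (S.energy_pos w n t (hn (hmid t ht))).le
  · refine ge_of_tendsto (hVlim 0) ?_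
    filter_upwards [S.T_lim.eventually_ge_atTop 0] with n hn
    simp only [hκ]
    rw [min_eq_right hn, max_eq_left (S.ε_pos n).le, (S.sol n).v_init]
    exact (S.lt_init w n).le
  · refine le_of_tendsto ((hYt t ht).const_mul (q t)).abs ?_
    filter_upwards [hb, hnear t ht] with n hn hs using (hn t (hs (hmid t ht))).2.2.2.2

end Family

end NodalRadial

/-! ### Zeros of the limit. -/

namespace NodalRadial

namespace Family

variable {q η f F : ℝ → ℝ} {C₁ C₂ P c m d₁ d₂ cH Fb Λ βm βp : ℝ} {L : EReal} {N : ℕ} {𝒰 : Ultrafilter ℕ}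
  {g K h H : ℕ → ℝ → ℝ} {ε T ω l : ℕ → ℝ} {v y Θ : ℕ → ℝ → ℝ} {V Y : ℝ → ℝ}

/-- A zero preceded by a visit outside the well at a bounded time occurs at a bounded time. -/
lemma exists_zero_bound (S : Family f F η P c m d₁ d₂ cH Fb Λ N 𝒰 g K h H ε T ω l v y Θ)
    (w : Weight q η C₁ C₂) (hP : 1 < P) (hc : 0 < c) (hm : 0 < m) (hmP : m < P) (hd₁ : 0 < d₁)
    (hd : d₁ < d₂) (hcH : 0 < cH) (X : Force f F βm βp L) (hS : LimitSol P η f F V Y) (hV : Continuous V)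
    (hlim : ∀ t, 0 < t → Tendsto (fun p : ℕ × ℝ => v p.1 p.2) (𝒰 ×ˢ 𝓝 t) (𝓝 (V t)))
    {z z' : ℕ → ℝ} (hz : ∀ n, z n ∈ Icc (ε n) (T n) ∧ v n (z n) = 0)
    (hz' : ∀ n, z' n ∈ Icc (ε n) (T n) ∧ v n (z' n) = 0) (hzz : ∀ n, z n < z' n) {R₀ : ℝ}
    (ha : ∀ᶠ n in 𝒰, ∃ a, ε n ≤ a ∧ a ≤ R₀ ∧ d₂ ≤ |v n a| ∧ ∀ t ∈ Icc a (T n), v n t = 0 → z n ≤ t) :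
    ∃ R, ∀ᶠ n in 𝒰, z n ≤ R := by
  by_contra! hcon
  -- Suppose that the zeros escape and the limit enters the inner well at some late t. The rest
  -- point between the two zeros forces the approximations out of the well, by a bounded time R'.
  -- Being outside at a and at t₂ and inside at t, they would have a zero after a and before R',
  -- earlier than z.
  have hge : ∀ t, max R₀ 0 < t → d₁ ≤ |V t| := by
    intro t ht
    by_contra! hlt
    have ht0 : 0 < t := (le_max_right _ _).trans_lt ht
    have htR : R₀ < t := (le_max_left _ _).trans_lt ht
    obtain ⟨R', c', hc', drop⟩ := exists_drop (c := c) w hP hc hm hmP hd hcH t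
    have hvt : Tendsto (fun n => v n t) 𝒰 (𝓝 (V t)) := (hlim t ht0).comp (tendsto_id.prodMk tendsto_const_nhds)
    obtain ⟨n, ⟨⟨a, ha1, ha2, ha3, ha4⟩, h1⟩, h2, h3⟩ := ((ha.and (hvt.abs.eventually (gt_mem_nhds hlt))).and
      ((hcon t).and (hcon R'))).exists
    have k := S.kin n
    have A := S.app n
    have o := (S.sol n).orbit
    have hE := S.energy_pos w n
    have ht' : ε n ≤ t := ha1.trans (ha2.trans htR.le)
    have hHneg : ∀ s, d₁ ≤ |s| → |s| ≤ d₂ → H n s ≤ -cH := A.neg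
    obtain ⟨s, hs, hys, -⟩ := (o.mono (hz n).1.1 (hz' n).1.2).exists_hill k (hzz n) A.nonpos
      (fun x hx => hE x ⟨(hz n).1.1.trans hx.1, hx.2.trans (hz' n).1.2⟩) (hz n).2 (hz' n).2
    obtain ⟨-, t₂, ht₂, ht₂R, hvt₂⟩ := drop _ _ _ _ _ k A.toPotential A.nonpos hHneg t (T n) _ _ ht0 le_rfl
      (o.mono ht' le_rfl) (fun x hx => hE x ⟨ht'.trans hx.1, hx.2⟩) h1.le
      ⟨s, ⟨h2.le.trans hs.1.le, hs.2.le.trans (hz' n).1.2⟩, hys⟩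
    obtain ⟨x, hx, hx0⟩ := (o.mono ha1 ht₂.2).exists_zero_of_valley k A.nonpos
      (fun x hx => hE x ⟨ha1.trans hx.1, hx.2.trans ht₂.2⟩) ha3 hvt₂.ge
      (x := t) ⟨ha2.trans htR.le, ht₂.1.le⟩ (h1.trans hd)
    have := ha4 x ⟨hx.1, hx.2.trans ht₂.2⟩ hx0
    linarith [hx.2]
  have hsign : ∀ s t, max R₀ 0 < s → max R₀ 0 < t → 0 ≤ V s * V t := by
    have main : ∀ s t, max R₀ 0 < s → s ≤ t → 0 ≤ V s * V t := by
      intro s t hs hst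
      by_contra! hneg
      have : (0:ℝ) ∈ V '' Icc s t := by
        rcases le_total (V s) (V t) with h | h
        · exact intermediate_value_Icc hst hV.continuousOn ⟨by nlinarith, by nlinarith⟩
        · exact intermediate_value_Icc' hst hV.continuousOn ⟨by nlinarith, by nlinarith⟩
      obtain ⟨x, hx, hx0⟩ := this
      have := hge x (hs.trans_le hx.1)
      rw [hx0, abs_zero] at this
      linarith
    intro s t hs ht
    rcases le_total s t with h | h
    · exact main s t hs h
    · rw [mul_comm]; exact main t s ht h
  -- A limit that stays outside the inner well has constant sign, so it tends to 0, which the lower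
  -- bound d₁ forbids.
  have h0 := hS.tendsto_zero w hP X hsign
  have h1 := h0.abs
  rw [abs_zero] at h1
  have h2 : d₁ ≤ 0 := by
    refine ge_of_tendsto h1 ?_
    filter_upwards [eventually_gt_atTop (max R₀ 0)] with t ht using hge t ht
  linarith

/-- The limit has the prescribed number of nondegenerate zeros and tends to zero. -/
theorem exists_solution (S : Family f F η P c m d₁ d₂ cH Fb Λ N 𝒰 g K h H ε T ω l v y Θ)
    (w : Weight q η C₁ C₂) (hP : 1 < P) (hc : 0 < c) (hm : 0 < m) (hmP : m < P) (hd₁ : 0 < d₁)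
    (hd : d₁ < d₂) (hcH : 0 < cH) (X : Force f F βm βp L) :
    ∃ V Y : ℝ → ℝ, ∃ M : ℝ, LimitSol P η f F V Y ∧ (∀ s t, |V s - V t| ≤ M * |s - t|) ∧ 0 < V 0 ∧
      (∀ t, 0 < t → |q t * Y t| ≤ M * capB q t) ∧ Tendsto V atTop (𝓝 0) ∧
      {t | 0 < t ∧ V t = 0 ∧ Y t ≠ 0}.encard = N := by
  obtain ⟨V, Y, M, hS, hlip, hV0, hbd, hM, hnlip, hVp, hYp⟩ := S.exists_limit w hP hc X
  have hVc : Continuous V :=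
    (LipschitzWith.of_dist_le_mul (K := ⟨M, hM.le⟩) fun s t => hlip s t).continuous
  have hd₂ : 0 < d₂ := hd₁.trans hd
  have hVt : ∀ t, 0 < t → Tendsto (fun n => v n t) 𝒰 (𝓝 (V t)) := fun t ht =>
    (hVp t ht).comp (tendsto_id.prodMk tendsto_const_nhds)
  -- There are N + 1 zeros, indexed from 0; the last one is T and escapes, the first N will be shown
  -- to converge.
  choose z hz hzN hzlt hzall using fun n => (S.ang n).exists_zeros (S.lt n) (S.fin n)
  have hzm : ∀ n j, j ≤ N → z n j ∈ Icc (ε n) (T n) := fun n j hj =>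
    ⟨((hz n j hj).1).1.le, ((hz n j hj).1).2⟩
  have hzle : ∀ n i j, i ≤ j → j ≤ N → z n i ≤ z n j := fun n i j hij hj => by
    rcases hij.eq_or_lt with rfl | h
    · exact le_rfl
    · exact (hzlt n i j h hj).le
  have hhill : ∀ n j, j < N → ∃ s ∈ Ioo (z n j) (z n (j + 1)), y n s = 0 ∧ d₂ < |v n s| := fun n j hj =>
    ((S.sol n).orbit.mono (hzm n j hj.le).1 (hzm n (j + 1) hj).2).exists_hill (S.kin n)
      (hzlt n j (j + 1) (Nat.lt_succ_self j) hj) (S.app n).nonpos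
      (fun x hx => S.energy_pos w n x ⟨(hzm n j hj.le).1.trans hx.1, hx.2.trans (hzm n (j + 1) hj).2⟩)
      (hz n j hj.le).2 (hz n (j + 1) hj).2
  -- energy and position after a zero at a bounded time
  have hdrop : ∀ j, j < N → ∀ R, (∀ᶠ n in 𝒰, z n j ≤ R) → ∃ R' c', 0 < c' ∧ ∀ᶠ n in 𝒰,
      c' ≤ K n (y n (z n j)) ∧ ∃ t₂ ∈ Ioo (z n j) (z n (j + 1)), t₂ ≤ R' ∧ |v n t₂| = d₂ := by
    intro j hj R hR
    obtain ⟨R', c', hc', drop⟩ := exists_drop (c := c) w hP hc hm hmP hd hcH R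
    refine ⟨R', c', hc', ?_⟩
    filter_upwards [hR] with n hn
    obtain ⟨s, hs, hys, -⟩ := hhill n j hj
    have hzj := hzm n j hj.le
    have hzj' := hzm n (j + 1) hj
    have hHneg : ∀ s, d₁ ≤ |s| → |s| ≤ d₂ → H n s ≤ -cH := (S.app n).neg
    obtain ⟨h1, t₂, ht₂, h2, h3⟩ := drop _ _ _ _ _ (S.kin n) (S.app n).toPotential (S.app n).nonpos hHneg
      (z n j) s _ _ ((S.ε_pos n).trans_le hzj.1) hn ((S.sol n).orbit.mono hzj.1 (hs.2.le.trans hzj'.2))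
      (fun x hx => S.energy_pos w n x ⟨hzj.1.trans hx.1, hx.2.trans (hs.2.le.trans hzj'.2)⟩)
      (by rw [(hz n j hj.le).2, abs_zero]; exact hd₁.le) ⟨s, ⟨hs.1.le, le_rfl⟩, hys⟩
    rw [(hz n j hj.le).2, (S.app n).zero', add_zero] at h1
    exact ⟨h1, t₂, ⟨ht₂.1, ht₂.2.trans_lt hs.2⟩, h2, h3⟩
  -- the zeros stay bounded
  have hbounded : ∀ j, j < N → ∃ R, ∀ᶠ n in 𝒰, z n j ≤ R := by
    intro j
    induction j with
    | zero =>
      intro hj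
      refine S.exists_zero_bound w hP hc hm hmP hd₁ hd hcH X hS hVc hVp (z := fun n => z n 0)
        (z' := fun n => z n 1) (fun n => ⟨hzm n 0 hj.le, (hz n 0 hj.le).2⟩)
        (fun n => ⟨hzm n 1 hj, (hz n 1 hj).2⟩) (fun n => hzlt n 0 1 Nat.zero_lt_one hj) (R₀ := 1) ?_
      filter_upwards [S.ε_lim.eventually (gt_mem_nhds one_pos)] with n hn
      refine ⟨ε n, le_rfl, hn.le, ?_, fun t ht h0 => ?_⟩
      · rw [(S.sol n).v_init, abs_of_pos (S.mem n).1]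
        exact (S.lt_init w n).le
      · obtain ⟨i, hi, rfl⟩ := hzall n t ht h0
        exact hzle n 0 i (Nat.zero_le i) hi
    | succ j ih =>
      intro hj
      have hj' : j < N := (Nat.lt_succ_self j).trans hj
      obtain ⟨R, hR⟩ := ih hj'
      obtain ⟨R', c', -, hd'⟩ := hdrop j hj' R hR
      refine S.exists_zero_bound w hP hc hm hmP hd₁ hd hcH X hS hVc hVp (z := fun n => z n (j + 1))
        (z' := fun n => z n (j + 1 + 1)) (fun n => ⟨hzm n _ hj.le, (hz n _ hj.le).2⟩)
        (fun n => ⟨hzm n _ hj, (hz n _ hj).2⟩) (fun n => hzlt n _ _ (Nat.lt_succ_self _) hj) (R₀ := R') ?_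
      filter_upwards [hd'] with n hn
      obtain ⟨-, t₂, ht₂, ht₂R, hvt₂⟩ := hn
      refine ⟨t₂, (hzm n j hj'.le).1.trans ht₂.1.le, ht₂R, hvt₂.ge, fun t ht h0 => ?_⟩
      obtain ⟨i, hi, rfl⟩ := hzall n t ⟨(hzm n j hj'.le).1.trans (ht₂.1.le.trans ht.1), ht.2⟩ h0
      refine hzle n _ i ?_ hi
      by_contra! h'
      have := hzle n i j (Nat.lt_succ_iff.1 h') hj'.le
      linarith [ht₂.1, ht.1]
  -- their limits
  have hζ : ∀ j, ∃ x, j < N → Tendsto (fun n => z n j) 𝒰 (𝓝 x) := by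
    intro j
    by_cases hj : j < N
    · obtain ⟨R, hR⟩ := hbounded j hj
      obtain ⟨x, -, hx⟩ := exists_tendsto_ultrafilter 𝒰 (u := fun n => z n j) (M := R) (by
        filter_upwards [hR] with n hn
        rw [abs_of_pos ((S.ε_pos n).trans_le (hzm n j hj.le).1)]
        exact hn)
      exact ⟨x, fun _ => hx⟩
    · exact ⟨0, fun h => absurd h hj⟩
  choose ζ hζ using hζ
  -- Speeds are at most M and |v| exceeds d₂ at the start and at a rest point between consecutive
  -- zeros. So zeros keep a distance at least d₂/M from 0 and from each other, also in the limit.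
  have hζ0 : ∀ j, j < N → 0 < ζ j := by
    intro j hj
    have h1 : d₂ / M ≤ ζ j := by
      refine ge_of_tendsto (hζ j hj) ?_
      filter_upwards [hnlip] with n hn
      have h1 := hn (ε n) ⟨le_rfl, (S.lt n).le⟩ (z n j) (hzm n j hj.le)
      rw [(S.sol n).v_init, (hz n j hj.le).2, sub_zero, abs_of_pos (S.mem n).1, abs_sub_comm,
        abs_of_nonneg (sub_nonneg.2 (hzm n j hj.le).1)] at h1
      rw [div_le_iff₀ hM]
      nlinarith [S.lt_init w n, S.ε_pos n]
    exact (div_pos hd₂ hM).trans_le h1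
  have hζlt : ∀ i j, i < j → j < N → ζ i < ζ j := by
    intro i j hij hj
    have h1 : d₂ / M ≤ ζ j - ζ i := by
      refine ge_of_tendsto ((hζ j hj).sub (hζ i (hij.trans hj))) ?_
      filter_upwards [hnlip] with n hn
      obtain ⟨s, hs, -, hvs⟩ := hhill n i (hij.trans hj)
      have hi := hzm n i (hij.trans hj).le
      have hi' := hzm n (i + 1) (hij.trans_le hj.le)
      have h1 := hn s ⟨hi.1.trans hs.1.le, hs.2.le.trans hi'.2⟩ (z n i) hi
      rw [(hz n i (hij.trans hj).le).2, sub_zero, abs_of_nonneg (sub_nonneg.2 hs.1.le)] at h1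
      have h2 := hzle n (i + 1) j hij hj.le
      rw [div_le_iff₀ hM]
      nlinarith [hs.2]
    linarith [div_pos hd₂ hM]
  have hζV : ∀ j, j < N → V (ζ j) = 0 ∧ Y (ζ j) ≠ 0 := by
    intro j hj
    have htend : Tendsto (fun n => (n, z n j)) 𝒰 ((𝒰 : Filter ℕ) ×ˢ 𝓝 (ζ j)) := tendsto_id.prodMk (hζ j hj)
    refine ⟨?_, fun h0 => ?_⟩
    · have h1 := (hVp (ζ j) (hζ0 j hj)).comp htend
      refine tendsto_nhds_unique h1 (tendsto_const_nhds.congr fun n => ?_)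
      simp only [Function.comp, (hz n j hj.le).2]
    -- At a zero the whole energy is kinetic, and crossing the well afterwards requires at least c'.
    -- So y cannot vanish in the limit.
    · obtain ⟨R, hR⟩ := hbounded j hj
      obtain ⟨R', c', hc', hd'⟩ := hdrop j hj R hR
      have h1 : Tendsto (fun n => y n (z n j)) 𝒰 (𝓝 (Y (ζ j))) := (hYp (ζ j) (hζ0 j hj)).comp htend
      have h2 : Tendsto (fun n => K n (y n (z n j))) 𝒰 (𝓝 (|Y (ζ j)| ^ P / P)) :=
        (S.K_lim (Y (ζ j))).comp (tendsto_id.prodMk h1)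
      rw [h0, abs_zero, Real.zero_rpow (by linarith), zero_div] at h2
      have : c' ≤ 0 := ge_of_tendsto h2 (by filter_upwards [hd'] with n hn using hn.1)
      linarith
  -- every nondegenerate zero is one of these limits
  have hsub : ∀ t, 0 < t → V t = 0 → Y t ≠ 0 → ∃ j < N, t = ζ j := by
    intro t ht hVt0 hY0
    by_contra! hne
    obtain ⟨δ, hδ, hδ0, hδt⟩ : ∃ δ, (∀ j ∈ Finset.range N, δ < |ζ j - t|) ∧ 0 < δ ∧ δ < t := by
      have h1 : ∀ᶠ δ in 𝓝[>] (0:ℝ), ∀ j ∈ Finset.range N, δ < |ζ j - t| := by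
        rw [Filter.eventually_all_finset]
        intro j hj
        refine nhdsWithin_le_nhds (gt_mem_nhds ?_)
        exact abs_pos.2 (sub_ne_zero.2 (hne j (Finset.mem_range.1 hj)).symm)
      obtain ⟨δ, h2, h3⟩ := (h1.and (Ioo_mem_nhdsGT ht)).exists
      exact ⟨δ, h2, h3.1, h3.2⟩
    have hfar : ∀ᶠ n in 𝒰, ∀ j ∈ Finset.range N, δ < |z n j - t| := by
      rw [Filter.eventually_all_finset]
      intro j hj
      exact ((hζ j (Finset.mem_range.1 hj)).sub_const t).abs.eventually (lt_mem_nhds (hδ j hj))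
    -- A nondegenerate zero is a change of sign, which the approximations inherit. Their zero near t
    -- is not the last one, since T exceeds s₂, and so it is close to some ζ j.
    obtain ⟨s₁, hs₁, s₂, hs₂, hs⟩ : ∃ s₁ ∈ Ioo (t - δ) t, ∃ s₂ ∈ Ioo t (t + δ), V s₁ * V s₂ < 0 := by
      have hd := hS.dv t ht
      have hp : phi P (Y t) ≠ 0 := fun h => hY0 ((phi_eq_zero hP).1 h)
      rcases lt_or_gt_of_ne hp with h | h
      · obtain ⟨s₁, h1, h2⟩ := exists_lt_of_hasDerivAt_pos_left hd.fun_neg (neg_pos.2 h) (by linarith : t - δ < t)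
        obtain ⟨s₂, h3, h4⟩ := exists_lt_of_hasDerivAt_pos_right hd.fun_neg (neg_pos.2 h) (by linarith : t < t + δ)
        rw [hVt0] at h2 h4
        exact ⟨s₁, h1, s₂, h3, mul_neg_of_pos_of_neg (by linarith) (by linarith)⟩
      · obtain ⟨s₁, h1, h2⟩ := exists_lt_of_hasDerivAt_pos_left hd h (by linarith : t - δ < t)
        obtain ⟨s₂, h3, h4⟩ := exists_lt_of_hasDerivAt_pos_right hd h (by linarith : t < t + δ)
        rw [hVt0] at h2 h4
        exact ⟨s₁, h1, s₂, h3, mul_neg_of_neg_of_pos h2 h4⟩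
    have hs₁0 : 0 < s₁ := by linarith [hs₁.1]
    have hneg : ∀ᶠ n in 𝒰, v n s₁ * v n s₂ < 0 :=
      ((hVt s₁ hs₁0).mul (hVt s₂ (ht.trans hs₂.1))).eventually (gt_mem_nhds hs)
    obtain ⟨n, ⟨h1, h2⟩, h3, h4⟩ := ((hfar.and hneg).and ((S.ε_lim.eventually (gt_mem_nhds hs₁0)).and
      (S.T_lim.eventually_gt_atTop s₂))).exists
    have hle : s₁ ≤ s₂ := hs₁.2.le.trans hs₂.1.le
    have hcont : ContinuousOn (v n) (Icc s₁ s₂) := (S.sol n).continuousOn_v.mono (Icc_subset_Icc h3.le h4.le)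
    have : (0:ℝ) ∈ v n '' Icc s₁ s₂ := by
      rcases le_total (v n s₁) (v n s₂) with h | h
      · exact intermediate_value_Icc hle hcont ⟨by nlinarith, by nlinarith⟩
      · exact intermediate_value_Icc' hle hcont ⟨by nlinarith, by nlinarith⟩
    obtain ⟨x, hx, hx0⟩ := this
    obtain ⟨j, hj, rfl⟩ := hzall n x ⟨h3.le.trans hx.1, hx.2.trans h4.le⟩ hx0
    have hjN : j < N := lt_of_le_of_ne hj (by
      rintro rfl
      rw [hzN n] at hx
      linarith [hx.2])
    have := h1 j (Finset.mem_range.2 hjN)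
    rw [lt_abs] at this
    rcases this with h | h <;> linarith [hx.1, hx.2, hs₁.1, hs₂.2]
  -- decay
  have hRall : ∃ R, 0 < R ∧ ∀ j, j < N → ∀ᶠ n in 𝒰, z n j ≤ R := by
    have h1 : ∀ j, ∃ R, j < N → ∀ᶠ n in 𝒰, z n j ≤ R := fun j => by
      by_cases hj : j < N
      · obtain ⟨R, hR⟩ := hbounded j hj
        exact ⟨R, fun _ => hR⟩
      · exact ⟨0, fun h => absurd h hj⟩
    choose R hR using h1
    refine ⟨1 + ∑ j ∈ Finset.range N, |R j|, by positivity, fun j hj => ?_⟩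
    filter_upwards [hR j hj] with n hn
    have := Finset.single_le_sum (f := fun j => |R j|) (fun i _ => abs_nonneg _) (Finset.mem_range.2 hj)
    linarith [le_abs_self (R j)]
  obtain ⟨R, hR0, hR⟩ := hRall
  have hsign : ∀ s t, R < s → R < t → 0 ≤ V s * V t := by
    have main : ∀ s t, R < s → s ≤ t → 0 ≤ V s * V t := by
      intro s t hs hst
      have hs0 := hR0.trans hs
      have hall : ∀ᶠ n in 𝒰, ∀ j ∈ Finset.range N, z n j ≤ R := by
        rw [Filter.eventually_all_finset]
        exact fun j hj => hR j (Finset.mem_range.1 hj)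
      -- Past R the only zero of the approximations is T, which eventually exceeds t; so they do not
      -- change sign between s and t.
      refine ge_of_tendsto ((hVt s hs0).mul (hVt t (hs0.trans_le hst))) ?_
      filter_upwards [hall, S.ε_lim.eventually (gt_mem_nhds hs0), S.T_lim.eventually_gt_atTop t] with n h1 h2 h3
      by_contra! hneg
      have hcont : ContinuousOn (v n) (Icc s t) := (S.sol n).continuousOn_v.mono (Icc_subset_Icc h2.le h3.le)
      have : (0:ℝ) ∈ v n '' Icc s t := by
        rcases le_total (v n s) (v n t) with h | h
        · exact intermediate_value_Icc hst hcont ⟨by nlinarith, by nlinarith⟩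
        · exact intermediate_value_Icc' hst hcont ⟨by nlinarith, by nlinarith⟩
      obtain ⟨x, hx, hx0⟩ := this
      obtain ⟨j, hj, rfl⟩ := hzall n x ⟨h2.le.trans hx.1, hx.2.trans h3.le⟩ hx0
      have hjN : j < N := lt_of_le_of_ne hj (by
        rintro rfl
        rw [hzN n] at hx
        linarith [hx.2])
      linarith [h1 j (Finset.mem_range.2 hjN), hx.1]
    intro s t hs ht
    rcases le_total s t with h | h
    · exact main s t hs h
    · rw [mul_comm]; exact main t s ht h
  refine ⟨V, Y, M, hS, hlip, hd₂.trans_le hV0, hbd, hS.tendsto_zero w hP X hsign, ?_⟩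
  have himg : {t | 0 < t ∧ V t = 0 ∧ Y t ≠ 0} = ζ '' (Finset.range N : Set ℕ) := by
    ext t
    constructor
    · rintro ⟨h1, h2, h3⟩
      obtain ⟨j, hj, rfl⟩ := hsub t h1 h2 h3
      exact ⟨j, Finset.mem_coe.2 (Finset.mem_range.2 hj), rfl⟩
    · rintro ⟨j, hj, rfl⟩
      have hj := Finset.mem_range.1 (Finset.mem_coe.1 hj)
      exact ⟨hζ0 j hj, hζV j hj⟩
  have hinj : InjOn ζ (Finset.range N : Set ℕ) := by
    intro i hi j hj hij
    have hi := Finset.mem_range.1 (Finset.mem_coe.1 hi)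
    have hj := Finset.mem_range.1 (Finset.mem_coe.1 hj)
    rcases lt_trichotomy i j with h | h | h
    · exact absurd hij (hζlt i j h hj).ne
    · exact h
    · exact absurd hij (hζlt j i h hi).ne'
  rw [himg, hinj.encard_image, Set.encard_coe_eq_coe_finsetCard, Finset.card_range]

end Family

end NodalRadial

/-! ### Construction of the regularized powers and forces. -/

namespace NodalRadial

section Kinetic

lemma locallyLipschitz_phi {P : ℝ} (hP : 2 ≤ P) : LocallyLipschitz (phi P) := by
  have h1 : LocallyLipschitz fun x : ℝ => x ^ (P - 1) :=
    (Real.contDiff_rpow_const_of_le (n := 1) (by push_cast; linarith)).locallyLipschitz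
  have h2 : LocallyLipschitz fun x : ℝ => (max x 0) ^ (P - 1) := h1.comp (LocallyLipschitz.id.max_const 0)
  have h3 : LocallyLipschitz fun x : ℝ => (max (-x) 0) ^ (P - 1) :=
    h2.comp (LipschitzWith.of_dist_le_mul (K := 1) fun s t => by simp : LipschitzWith 1 fun x : ℝ => -x).locallyLipschitz
  have h4 : phi P = fun x => (max x 0) ^ (P - 1) - (max (-x) 0) ^ (P - 1) := by
    have h0 : (0:ℝ) ^ (P - 1) = 0 := Real.zero_rpow (by linarith)
    ext x
    rcases lt_trichotomy x 0 with h | rfl | h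
    · rw [max_eq_right h.le, max_eq_left (by linarith), h0, zero_sub, ← phi_of_pos (by linarith : 0 < -x),
        phi_neg, neg_neg]
    · simp [phi]
    · rw [max_eq_left h.le, max_eq_right (by linarith), h0, sub_zero, phi_of_pos h]
  rw [h4]
  exact h2.sub h3

lemma kinetic_phi {P : ℝ} (hP : 2 ≤ P) : Kinetic P 1 (P - 1) (phi P) (fun s => |s| ^ P / P) where
  one_lt := by linarith
  c_pos := one_pos
  m_pos := by linarith
  lip := locallyLipschitz_phi hP
  odd y := phi_neg P y
  hasDeriv y := hasDerivAt_abs_rpow_div (by linarith) y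
  zero := by rw [abs_zero, Real.zero_rpow (by linarith), zero_div]
  ub y hy := by
    have := abs_phi P y (by linarith)
    rw [abs_of_nonneg hy] at this
    exact (le_abs_self _).trans this.le
  lb y hy := by
    rw [one_mul]
    rcases hy.eq_or_lt with rfl | hy
    · simp [phi, Real.zero_rpow (by linarith : P - 1 ≠ 0)]
    · rw [phi_of_pos hy]
      exact Real.rpow_le_rpow (by positivity) (min_le_right _ _) (by linarith)
  growth y := by
    rw [mul_phi P y (by linarith), mul_add, mul_div_cancel₀ _ (by linarith : P ≠ 0)]
    linarith

/-- For P < 2 the power φ_P is not Lipschitz at 0 and y² is replaced by ν² + y² in its primitive.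
The subtracted constant ν^P ≤ 1 is the reason for the `+ 1` in the growth bound. Near 0 the function
is at least linear, with a slope independent of ν, so the exponent m = 1 < P is available. -/
lemma kinetic_regularized {P ν : ℝ} (hP : 1 < P) (hP2 : P < 2) (hν : 0 < ν) (hν1 : ν ≤ 1) :
    Kinetic P (2 ^ ((P - 2) / 2)) 1 (fun y => y * (ν ^ 2 + y ^ 2) ^ ((P - 2) / 2))
      (fun y => ((ν ^ 2 + y ^ 2) ^ (P / 2) - (ν ^ 2) ^ (P / 2)) / P) where
  one_lt := hP
  c_pos := by positivity
  m_pos := one_pos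
  lip := by
    refine ContDiff.locallyLipschitz (𝕂 := ℝ) (contDiff_id.mul (ContDiff.rpow_const_of_ne (by fun_prop) fun y => ?_))
    positivity
  odd y := by rw [neg_sq, neg_mul]
  hasDeriv y := by
    have h0 : 0 < ν ^ 2 + y ^ 2 := by positivity
    have h1 : HasDerivAt (fun y : ℝ => ν ^ 2 + y ^ 2) (2 * y) y := by
      have := (hasDerivAt_pow 2 y).const_add (ν ^ 2)
      simpa using this
    have h2 := ((h1.rpow_const (p := P / 2) (Or.inl h0.ne')).sub_const ((ν ^ 2) ^ (P / 2))).div_const P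
    refine h2.congr_deriv ?_
    rw [show P / 2 - 1 = (P - 2) / 2 by ring]
    have : P ≠ 0 := by linarith
    field_simp
  zero := by simp
  ub y hy := by
    rcases hy.eq_or_lt with rfl | hy
    · rw [zero_mul]; exact Real.rpow_nonneg le_rfl _
    · have h1 : (ν ^ 2 + y ^ 2) ^ ((P - 2) / 2) ≤ (y ^ 2) ^ ((P - 2) / 2) :=
        Real.rpow_le_rpow_of_nonpos (by positivity) (by nlinarith) (by linarith)
      have h2 : (y ^ 2) ^ ((P - 2) / 2) * y = y ^ (P - 1) := by
        rw [← Real.rpow_natCast y 2, ← Real.rpow_mul hy.le, ← Real.rpow_add_one hy.ne']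
        congr 1; push_cast; ring
      rw [← h2, mul_comm]
      exact mul_le_mul_of_nonneg_right h1 hy.le
  lb y hy := by
    rw [Real.rpow_one]
    rcases le_total y 1 with h | h
    · rw [min_eq_right h, mul_comm]
      refine mul_le_mul_of_nonneg_left ?_ hy
      exact Real.rpow_le_rpow_of_nonpos (by positivity) (by nlinarith) (by linarith)
    · rw [min_eq_left h, mul_one]
      have hy0 : 0 < y := by linarith
      have h1 : (2 * y ^ 2) ^ ((P - 2) / 2) ≤ (ν ^ 2 + y ^ 2) ^ ((P - 2) / 2) :=
        Real.rpow_le_rpow_of_nonpos (by positivity) (by nlinarith) (by linarith)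
      have h2 : (y ^ 2) ^ ((P - 2) / 2) * y = y ^ (P - 1) := by
        rw [← Real.rpow_natCast y 2, ← Real.rpow_mul hy0.le, ← Real.rpow_add_one hy0.ne']
        congr 1; push_cast; ring
      have h3 : 1 ≤ y ^ (P - 1) := Real.one_le_rpow h (by linarith)
      have h4 : (0:ℝ) < 2 ^ ((P - 2) / 2) := by positivity
      rw [Real.mul_rpow (by norm_num) (by positivity)] at h1
      have h5 := mul_le_mul_of_nonneg_left h1 hy0.le
      have h6 := mul_le_mul_of_nonneg_left h3 h4.le
      rw [← h2] at h6
      linarith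
  growth y := by
    have h0 : 0 < ν ^ 2 + y ^ 2 := by positivity
    have hP0 : P ≠ 0 := by linarith
    have h1 : (ν ^ 2 + y ^ 2) ^ (P / 2) = (ν ^ 2 + y ^ 2) ^ ((P - 2) / 2) * (ν ^ 2 + y ^ 2) := by
      rw [← Real.rpow_add_one h0.ne']; congr 1; ring
    have h2 : (ν ^ 2) ^ (P / 2) ≤ 1 := Real.rpow_le_one (by positivity) (by nlinarith) (by linarith)
    have h3 : 0 < (ν ^ 2 + y ^ 2) ^ ((P - 2) / 2) := by positivity
    rw [mul_add, mul_div_cancel₀ _ hP0, h1]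
    have h4 : 0 ≤ (ν ^ 2 + y ^ 2) ^ ((P - 2) / 2) * ν ^ 2 := by positivity
    linarith

/-- Regularized powers converging to `φ_P`. -/
lemma exists_kinetic {P : ℝ} (hP : 1 < P) : ∃ c m : ℝ, 0 < c ∧ 0 < m ∧ m < P ∧ ∃ g K : ℕ → ℝ → ℝ,
    (∀ n, Kinetic P c m (g n) (K n)) ∧
    (∀ s, Tendsto (fun p : ℕ × ℝ => g p.1 p.2) (atTop ×ˢ 𝓝 s) (𝓝 (phi P s))) ∧
    ∀ s, Tendsto (fun p : ℕ × ℝ => K p.1 p.2) (atTop ×ˢ 𝓝 s) (𝓝 (|s| ^ P / P)) := by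
  rcases le_or_gt 2 P with h | h
  · refine ⟨1, P - 1, one_pos, by linarith, by linarith, fun _ => phi P, fun _ s => |s| ^ P / P,
      fun _ => kinetic_phi h, fun s => ?_, fun s => ?_⟩
    · exact ((continuous_phi hP).tendsto s).comp tendsto_snd
    · exact (hasDerivAt_abs_rpow_div hP s).continuousAt.tendsto.comp tendsto_snd
  · have hν : ∀ n : ℕ, 0 < 1 / ((n:ℝ) + 1) ∧ 1 / ((n:ℝ) + 1) ≤ 1 := fun n => by
      have : (0:ℝ) ≤ n := Nat.cast_nonneg n
      exact ⟨by positivity, by rw [div_le_one (by linarith)]; linarith⟩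
    have hkin := fun n : ℕ => kinetic_regularized hP h (hν n).1 (hν n).2
    refine ⟨_, 1, by positivity, one_pos, hP, _, _, hkin, fun s => ?_, fun s => ?_⟩
    · have hlim : Tendsto (fun p : ℕ × ℝ => (1 / ((p.1:ℝ) + 1)) ^ 2 + p.2 ^ 2) (atTop ×ˢ 𝓝 s) (𝓝 (0 ^ 2 + s ^ 2)) :=
        ((tendsto_one_div_add_atTop_nhds_zero_nat.comp tendsto_fst).pow 2).add (tendsto_snd.pow 2)
      rcases eq_or_ne s 0 with rfl | hs
      · rw [(phi_eq_zero hP).2 rfl]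
        refine squeeze_zero_norm (a := fun p : ℕ × ℝ => |p.2| ^ (P - 1)) (fun p => (hkin p.1).abs_le p.2) ?_
        have h1 : Continuous fun s : ℝ => |s| ^ (P - 1) :=
          continuous_abs.rpow_const fun s => Or.inr (by linarith)
        have h2 := h1.tendsto 0
        rw [abs_zero, Real.zero_rpow (by linarith : P - 1 ≠ 0)] at h2
        exact h2.comp tendsto_snd
      · have hs2 : 0 < s ^ 2 := by positivity
        have h1 := (tendsto_snd (f := (atTop : Filter ℕ)) (g := 𝓝 s)).mul (hlim.rpow_const (p := (P - 2) / 2)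
          (Or.inl (by simpa using hs)))
        have h2 : phi P s = s * (0 ^ 2 + s ^ 2) ^ ((P - 2) / 2) := by
          rw [phi, zero_pow two_ne_zero, zero_add, ← sq_abs s, ← Real.rpow_natCast |s| 2,
            ← Real.rpow_mul (abs_nonneg s), mul_comm]
          congr 2; push_cast; ring
        rw [h2]
        exact h1
    · have hν0 : Tendsto (fun p : ℕ × ℝ => (1 / ((p.1:ℝ) + 1)) ^ 2) (atTop ×ˢ 𝓝 s) (𝓝 (0 ^ 2)) :=
        (tendsto_one_div_add_atTop_nhds_zero_nat.comp tendsto_fst).pow 2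
      have hP2 : 0 ≤ P / 2 := by linarith
      have h1 := (((hν0.add (tendsto_snd.pow 2)).rpow_const (p := P / 2) (Or.inr hP2)).sub
        (hν0.rpow_const (p := P / 2) (Or.inr hP2))).div_const P
      have h2 : |s| ^ P / P = (((0:ℝ) ^ 2 + s ^ 2) ^ (P / 2) - ((0:ℝ) ^ 2) ^ (P / 2)) / P := by
        rw [zero_pow two_ne_zero, zero_add, Real.zero_rpow (by linarith), sub_zero, ← sq_abs s,
          ← Real.rpow_natCast |s| 2, ← Real.rpow_mul (abs_nonneg s)]
        congr 2; push_cast; ring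
      rw [h2]
      exact h1

end Kinetic

section Approx

variable {f F : ℝ → ℝ} {d₁ d₂ cH : ℝ}

lemma locallyLipschitz_comp_max (hf : LocallyLipschitzOn {0}ᶜ f) {δ : ℝ} (hδ : 0 < δ) :
    LocallyLipschitz fun s => f (max s δ) := by
  intro x
  have hx : max x δ ≠ 0 := (lt_max_of_lt_right hδ).ne'
  obtain ⟨K, t, ht, hK⟩ := hf (x := max x δ) hx
  rw [isOpen_compl_singleton.nhdsWithin_eq hx] at ht
  refine ⟨K, (fun s => max s δ) ⁻¹' t, (by fun_prop : Continuous fun s : ℝ => max s δ).continuousAt.preimage_mem_nhds ht,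
    LipschitzOnWith.of_dist_le_mul fun a ha b hb => ?_⟩
  refine (hK.dist_le_mul _ ha _ hb).trans (mul_le_mul_of_nonneg_left ?_ K.2)
  rw [Real.dist_eq, Real.dist_eq]
  exact (abs_max_sub_max_le_max _ _ _ _).trans (max_le le_rfl (by simp))

/-- Linearization of the force near the origin on the right half line. -/
lemma exists_half_approx (hc : Continuous f) (hlip : LocallyLipschitzOn {0}ᶜ f) (hf0 : f 0 = 0)
    (hF : ∀ s, HasDerivAt F (f s) s) (hF0 : F 0 = 0) (hneg : ∀ s, 0 < s → s ≤ d₂ → F s < 0)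
    (hd₁ : 0 < d₁) (hd : d₁ < d₂) (hcH : 0 < cH) (hFc : ∀ s, d₁ ≤ s → s ≤ d₂ → F s ≤ -(2 * cH)) {ω : ℝ}
    (hω : 0 < ω) : ∃ h H : ℝ → ℝ, LocallyLipschitz h ∧ (∀ s, HasDerivAt H (h s) s) ∧
      (∀ s, s ≤ 0 → h s = 0 ∧ H s = 0) ∧ (∀ s, d₁ ≤ s → h s = f s) ∧
      (∀ s, 0 ≤ s → |h s - f s| ≤ ω ∧ |H s - F s| ≤ ω) ∧ (∀ s, 0 ≤ s → s ≤ d₂ → H s ≤ 0) ∧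
      ∀ s, d₁ ≤ s → s ≤ d₂ → H s ≤ -cH := by
  set ω' := min ω cH with hω'
  have hω'0 : 0 < ω' := lt_min hω hcH
  have hFcont : Continuous F := continuous_iff_continuousAt.2 fun s => (hF s).continuousAt
  obtain ⟨r, hr, hrf⟩ := Metric.continuousAt_iff.1 hc.continuousAt (ω' / 2) (half_pos hω'0)
  set ρ₀ := min (min 1 (r / 2)) (d₁ / 2) with hρ₀
  have hρ₀0 : 0 < ρ₀ := by positivity
  have hρ₀1 : ρ₀ ≤ 1 := (min_le_left _ _).trans (min_le_left _ _)
  have hρ₀r : ρ₀ < r := ((min_le_left _ _).trans (min_le_right _ _)).trans_lt (half_lt_self hr)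
  have hρ₀d : ρ₀ < d₁ := (min_le_right _ _).trans_lt (half_lt_self hd₁)
  have hfsmall : ∀ s, 0 ≤ s → s ≤ ρ₀ → |f s| ≤ ω' / 2 := fun s h0 h1 => by
    have := hrf (x := s) (by rw [Real.dist_eq, sub_zero, abs_of_nonneg h0]; linarith)
    rw [Real.dist_eq, hf0, sub_zero] at this
    exact this.le
  obtain ⟨x₀, hx₀, hx₀max⟩ := isCompact_Icc.exists_isMaxOn (nonempty_Icc.2 (hρ₀d.trans hd).le) hFcont.continuousOn
  have hm : F x₀ < 0 := hneg x₀ (hρ₀0.trans_le hx₀.1) hx₀.2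
  obtain ⟨ρ, ⟨hρ0, hρρ⟩, hFρ⟩ : ∃ ρ, ρ ∈ Ioo 0 ρ₀ ∧ F x₀ < F ρ := by
    have h1 : ∀ᶠ s in 𝓝[>] (0:ℝ), F x₀ < F s :=
      nhdsWithin_le_nhds ((hFcont.tendsto 0).eventually (lt_mem_nhds (by rwa [hF0])))
    obtain ⟨ρ, h2, h3⟩ := (h1.and (Ioo_mem_nhdsGT hρ₀0)).exists
    exact ⟨ρ, h3, h2⟩
  have hρd : ρ ≤ d₂ := (hρρ.trans (hρ₀d.trans hd)).le
  -- By the choice of ρ the maximum of F over [ρ, d₂] is attained below ρ₀, so δ is small, and f(δ)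
  -- ≤ 0. Replacing f by its chord on [0, δ] makes H nonincreasing there. Beyond δ one has H(s) =
  -- F(s) - F(δ) + H(δ) ≤ 0 by maximality, so H stays nonpositive in the well.
  obtain ⟨δ, hδ, hδmax⟩ := isCompact_Icc.exists_isMaxOn (nonempty_Icc.2 hρd) hFcont.continuousOn
  have hδ0 : 0 < δ := hρ0.trans_le hδ.1
  have hδρ : δ < ρ₀ := by
    by_contra! h'
    have h1 := hδmax (⟨le_rfl, hρd⟩ : ρ ∈ Icc ρ d₂)
    have h2 := hx₀max (⟨h', hδ.2⟩ : δ ∈ Icc ρ₀ d₂)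
    exact absurd (hFρ.trans_le (h1.trans h2)) (lt_irrefl _)
  have hδd : δ < d₁ := hδρ.trans hρ₀d
  have hfδ : f δ ≤ 0 := by
    by_contra! h'
    obtain ⟨s, hs, hs'⟩ := exists_lt_of_hasDerivAt_pos_right (hF δ) h' (hδd.trans hd)
    exact absurd (hδmax (⟨hδ.1.trans hs.1.le, hs.2.le⟩ : s ∈ Icc ρ d₂)) (not_le.2 hs')
  -- The chord from (0, 0) to (δ, f(δ)), continued by f on the right and by 0 on the left, written
  -- with truncations so that the local Lipschitz property is visible.
  set h : ℝ → ℝ := fun s => f (max s δ) - f δ + f δ / δ * max 0 (min s δ) with hh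
  have hlin : LipschitzWith (Real.nnabs (f δ / δ)) fun s => f δ / δ * max 0 (min s δ) := by
    refine LipschitzWith.of_dist_le_mul fun s t => ?_
    rw [Real.dist_eq, Real.dist_eq, ← mul_sub, abs_mul, Real.coe_nnabs]
    refine mul_le_mul_of_nonneg_left ?_ (abs_nonneg _)
    refine (abs_max_sub_max_le_max _ _ _ _).trans (max_le (by simp) ?_)
    exact (abs_min_sub_min_le_max _ _ _ _).trans (max_le le_rfl (by simp))
  have hhlip : LocallyLipschitz h :=
    ((locallyLipschitz_comp_max hlip hδ0).sub (LocallyLipschitz.const _)).add hlin.locallyLipschitz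
  have hhneg : ∀ s, s ≤ 0 → h s = 0 := fun s hs => by
    simp only [hh]
    rw [max_eq_right (hs.trans hδ0.le), min_eq_left (hs.trans hδ0.le), max_eq_left hs]; ring
  have hhmid : ∀ s, 0 ≤ s → s ≤ δ → h s = f δ / δ * s := fun s h0 h1 => by
    simp only [hh]
    rw [max_eq_right h1, min_eq_left h1, max_eq_right h0]; ring
  have hhbig : ∀ s, δ ≤ s → h s = f s := fun s hs => by
    simp only [hh]
    rw [max_eq_left hs, min_eq_right hs, max_eq_right hδ0.le, div_mul_cancel₀ _ hδ0.ne']; ring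
  set H : ℝ → ℝ := fun s => ∫ t in (0:ℝ)..s, h t with hH
  have hHd : ∀ s, HasDerivAt H (h s) s := fun s => hhlip.continuous.integral_hasStrictDerivAt 0 s |>.hasDerivAt
  have hH0 : H 0 = 0 := by simp [hH]
  have hHcont : Continuous H := continuous_iff_continuousAt.2 fun s => (hHd s).continuousAt
  have hHneg : ∀ s, s ≤ 0 → H s = 0 := by
    intro s hs
    have := (convex_Iic (0:ℝ)).norm_image_sub_le_of_norm_hasDerivWithin_le (C := 0)
      (fun x _ => (hHd x).hasDerivWithinAt) (fun x hx => by rw [hhneg x hx, norm_zero])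
      (mem_Iic.2 le_rfl) (mem_Iic.2 hs)
    rw [hH0, sub_zero, zero_mul] at this
    exact norm_le_zero_iff.1 this
  have hclose' : ∀ s, 0 ≤ s → |h s - f s| ≤ ω' := by
    intro s hs
    rcases le_total s δ with h1 | h1
    · have e1 := hfsmall s hs (h1.trans hδρ.le)
      have e2 := hfsmall δ hδ0.le hδρ.le
      have e3 : |h s| ≤ |f δ| := by
        rw [hhmid s hs h1, abs_mul, abs_div, abs_of_pos hδ0, abs_of_nonneg hs, div_mul_eq_mul_div,
          div_le_iff₀ hδ0]
        exact mul_le_mul_of_nonneg_left h1 (abs_nonneg _)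
      linarith [abs_sub (h s) (f s)]
    · rw [hhbig s h1, sub_self, abs_zero]; exact hω'0.le
  have hDd : ∀ s, HasDerivAt (fun s => H s - F s) (h s - f s) s := fun s => (hHd s).fun_sub (hF s)
  have hDbig : ∀ s, δ ≤ s → H s - F s = H δ - F δ := by
    intro s hs
    have := (convex_Ici δ).norm_image_sub_le_of_norm_hasDerivWithin_le (C := 0)
      (fun x _ => (hDd x).hasDerivWithinAt) (fun x hx => by rw [hhbig x hx, sub_self, norm_zero])
      self_mem_Ici (mem_Ici.2 hs)
    rw [zero_mul] at this
    linarith [norm_le_zero_iff.1 this]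
  have hclose : ∀ s, 0 ≤ s → |H s - F s| ≤ ω' := by
    have hmid : ∀ s, 0 ≤ s → s ≤ δ → |H s - F s| ≤ ω' := by
      intro s hs h1
      have := (convex_Icc 0 δ).norm_image_sub_le_of_norm_hasDerivWithin_le (C := ω')
        (fun x _ => (hDd x).hasDerivWithinAt) (fun x hx => hclose' x hx.1)
        (⟨le_rfl, hδ0.le⟩ : (0:ℝ) ∈ Icc 0 δ) ⟨hs, h1⟩
      rw [hH0, hF0, sub_zero, sub_zero, sub_zero, Real.norm_eq_abs, Real.norm_of_nonneg hs] at this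
      nlinarith
    intro s hs
    rcases le_total s δ with h1 | h1
    · exact hmid s hs h1
    · rw [hDbig s h1]; exact hmid δ hδ0.le le_rfl
  have hHnp : ∀ s, 0 ≤ s → s ≤ δ → H s ≤ 0 := by
    intro s hs h1
    have hm : AntitoneOn H (Icc 0 δ) := antitoneOn_of_hasDerivWithinAt_nonpos (convex_Icc 0 δ) hHcont.continuousOn
      (fun x _ => (hHd x).hasDerivWithinAt) (fun x hx => by
        have hx' := interior_subset hx
        rw [hhmid x hx'.1 hx'.2]
        exact mul_nonpos_of_nonpos_of_nonneg (div_nonpos_of_nonpos_of_nonneg hfδ hδ0.le) hx'.1)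
    have := hm ⟨le_rfl, hδ0.le⟩ ⟨hs, h1⟩ hs
    rwa [hH0] at this
  refine ⟨h, H, hhlip, hHd, fun s hs => ⟨hhneg s hs, hHneg s hs⟩, fun s hs => hhbig s (hδd.le.trans hs),
    fun s hs => ⟨(hclose' s hs).trans (min_le_left _ _), (hclose s hs).trans (min_le_left _ _)⟩,
    fun s hs h1 => ?_, fun s hs h1 => ?_⟩
  · rcases le_total s δ with h2 | h2
    · exact hHnp s hs h2
    · have e1 := hDbig s h2
      have e2 := hHnp δ hδ0.le le_rfl
      have e3 : F s ≤ F δ := hδmax (⟨hδ.1.trans h2, h1⟩ : s ∈ Icc ρ d₂)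
      linarith
  · have e1 := (abs_le.1 (hclose s (hd₁.le.trans hs))).2
    linarith [hFc s hs h1, min_le_right ω cH]

/-- Lipschitz approximations of the force. -/
lemma Force.exists_approx {βm βp : ℝ} {L : EReal} (X : Force f F βm βp L) {Fb : ℝ}
    (hFb : 0 ≤ Fb) (hFbF : ∀ s, -Fb ≤ F s) (hd₁ : 0 < d₁) (hd : d₁ < d₂) (hdp : d₂ < βp) (hdm : d₂ < -βm)
    (hcH : 0 < cH) (hFc : ∀ s, d₁ ≤ |s| → |s| ≤ d₂ → F s ≤ -(2 * cH)) {ω : ℝ} (hω : 0 < ω) (hω1 : ω ≤ 1) :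
    ∃ h H : ℝ → ℝ, Approx f F d₁ d₂ cH (Fb + 1) ω h H := by
  have hd₂ := hd₁.trans hd
  obtain ⟨h₁, H₁, l1, D1, z1, e1, c1, n1, m1⟩ := exists_half_approx X.cont X.lip X.zero X.hasDeriv X.zero'
    (fun s h0 h1 => X.neg s ⟨X.βm_neg.trans h0, by linarith⟩ h0.ne') hd₁ hd hcH
    (fun s h0 h1 => hFc s (by rwa [abs_of_pos (by linarith)]) (by rwa [abs_of_pos (by linarith)])) hω
  have Z := X.reflect
  obtain ⟨h₂, H₂, l2, D2, z2, e2, c2, n2, m2⟩ := exists_half_approx Z.cont Z.lip Z.zero Z.hasDeriv Z.zero'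
    (fun s h0 h1 => Z.neg s ⟨Z.βm_neg.trans h0, by linarith⟩ h0.ne') hd₁ hd hcH
    (fun s h0 h1 => hFc (-s) (by rwa [abs_neg, abs_of_pos (by linarith)])
      (by rwa [abs_neg, abs_of_pos (by linarith)])) hω
  have hp : ∀ s, 0 ≤ s → h₁ s - h₂ (-s) = h₁ s ∧ H₁ s + H₂ (-s) = H₁ s := fun s hs => by
    rw [(z2 (-s) (by linarith)).1, (z2 (-s) (by linarith)).2, sub_zero, add_zero]; exact ⟨rfl, rfl⟩
  have hn : ∀ s, s ≤ 0 → h₁ s - h₂ (-s) = -h₂ (-s) ∧ H₁ s + H₂ (-s) = H₂ (-s) := fun s hs => by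
    rw [(z1 s hs).1, (z1 s hs).2, zero_sub, zero_add]; exact ⟨rfl, rfl⟩
  have hclose : ∀ s, |H₁ s + H₂ (-s) - F s| ≤ ω := fun s => by
    rcases le_total 0 s with hs | hs
    · rw [(hp s hs).2]; exact (c1 s hs).2
    · rw [(hn s hs).2]
      have := (c2 (-s) (by linarith)).2
      rwa [neg_neg] at this
  refine ⟨fun s => h₁ s - h₂ (-s), fun s => H₁ s + H₂ (-s), ⟨⟨by linarith, ?_, ?_, fun s => ?_, ?_, fun s => ?_⟩,
    fun s hs => ?_, hclose, fun s => ?_, fun s hs => ?_, fun s hs hs' => ?_⟩⟩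
  · exact l1.sub (l2.comp
      (LipschitzWith.of_dist_le_mul (K := 1) fun s t => by simp : LipschitzWith 1 fun x : ℝ => -x).locallyLipschitz)
  · simp only [neg_zero, (z1 0 le_rfl).1, (z2 0 le_rfl).1, sub_zero]
  · have h1 : HasDerivAt (fun s => H₂ (-s)) (-h₂ (-s)) s := by
      have := (D2 (-s)).scomp s (hasDerivAt_neg s)
      simpa [Function.comp_def] using this
    exact ((D1 s).fun_add h1).congr_deriv (by ring)
  · simp only [neg_zero, (z1 0 le_rfl).2, (z2 0 le_rfl).2, add_zero]
  · have := (abs_le.1 (hclose s)).1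
    linarith [hFbF s]
  · rcases le_total 0 s with h0 | h0
    · rw [abs_of_nonneg h0] at hs
      simp only [(hp s h0).1]; exact e1 s hs
    · rw [abs_of_nonpos h0] at hs
      show h₁ s - h₂ (-s) = f s
      rw [(hn s h0).1, e2 (-s) hs, neg_neg, neg_neg]
  · rcases le_total 0 s with h0 | h0
    · simp only [(hp s h0).1]; exact (c1 s h0).1
    · simp only [(hn s h0).1]
      have := (c2 (-s) (by linarith)).1
      rw [neg_neg] at this
      rw [abs_sub_comm]
      convert this using 2
      ring
  · rcases le_total 0 s with h0 | h0
    · rw [abs_of_nonneg h0] at hs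
      simp only [(hp s h0).2]; exact n1 s h0 hs
    · rw [abs_of_nonpos h0] at hs
      simp only [(hn s h0).2]; exact n2 (-s) (by linarith) hs
  · rcases le_total 0 s with h0 | h0
    · rw [abs_of_nonneg h0] at hs hs'
      simp only [(hp s h0).2]; exact m1 s hs hs'
    · rw [abs_of_nonpos h0] at hs hs'
      simp only [(hn s h0).2]; exact m2 (-s) hs hs'

end Approx

/-- Solutions of the limiting system with a prescribed number of nondegenerate zeros. -/
theorem exists_limitSol {q η f F : ℝ → ℝ} {C₁ C₂ P βm βp : ℝ} {L : EReal} (w : Weight q η C₁ C₂) (hP : 1 < P)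
    (X : Force f F βm βp L) {α μ t₀ : ℝ} (hα : α ∈ Ioo (0:ℝ) 1) (ht₀ : 0 < t₀)
    (hμ : ∀ t ∈ Ioc 0 t₀, capB q t * η t ≤ (μ + 1 / P) * q t)
    (hSC : ∀ N : ℝ, ∃ s₀, ∀ l ≥ s₀, ∀ s₁ ∈ Icc (α * l) l, ∀ s₂ ∈ Icc (α * l) l, ∀ ρ, 0 < ρ →
      (1 - α) * l ≤ f s₁ ^ (P - 1) * travel q P ρ → N ≤ (F s₂ - μ * s₂ * f s₂) * capB q ρ) (N : ℕ) :
    ∃ V Y : ℝ → ℝ, ∃ M : ℝ, LimitSol P η f F V Y ∧ (∀ s t, |V s - V t| ≤ M * |s - t|) ∧ 0 < V 0 ∧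
      (∀ t, 0 < t → |q t * Y t| ≤ M * capB q t) ∧ Tendsto V atTop (𝓝 0) ∧
      {t | 0 < t ∧ V t = 0 ∧ Y t ≠ 0}.encard = N := by
  obtain ⟨Fb, hFb, hFbF⟩ := X.exists_lower
  have hβp := X.βp_pos
  have hβm := X.βm_neg
  obtain ⟨d₂, hd₂, hdp, hdm⟩ : ∃ d₂ : ℝ, 0 < d₂ ∧ d₂ < βp ∧ d₂ < -βm := by
    obtain ⟨d, h0, h1⟩ := exists_between (lt_min hβp (neg_pos.2 hβm))
    exact ⟨d, h0, h1.trans_le (min_le_left _ _), h1.trans_le (min_le_right _ _)⟩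
  set d₁ := d₂ / 2 with hd₁d
  have hd₁ : 0 < d₁ := half_pos hd₂
  have hd : d₁ < d₂ := half_lt_self hd₂
  obtain ⟨cH, hcH, hFc⟩ : ∃ cH > 0, ∀ s, d₁ ≤ |s| → |s| ≤ d₂ → F s ≤ -(2 * cH) := by
    have hcpt : IsCompact (Icc (-d₂) d₂ ∩ (fun s => |s|) ⁻¹' Ici d₁) :=
      isCompact_Icc.inter_right (isClosed_Ici.preimage continuous_abs)
    obtain ⟨x, hx, hmax⟩ := hcpt.exists_isMaxOn ⟨d₂, ⟨by linarith, le_rfl⟩, by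
      simp only [mem_preimage, mem_Ici, abs_of_pos hd₂]; exact hd.le⟩ X.cont'.continuousOn
    have hx0 : x ≠ 0 := by
      rintro rfl
      have := hx.2
      simp only [mem_preimage, mem_Ici, abs_zero] at this
      linarith
    have hFx := X.neg x ⟨by linarith [hx.1.1], by linarith [hx.1.2]⟩ hx0
    refine ⟨-F x / 2, by linarith, fun s h1 h2 => ?_⟩
    have : F s ≤ F x := hmax ⟨abs_le.1 h2, h1⟩
    linarith
  obtain ⟨c, m, hc, hm, hmP, g, K, hkin, hg, hK⟩ := exists_kinetic hP
  obtain ⟨Λ, ω₀, T₀, hΛ, hω₀, hsel⟩ := exists_selection (m := m) (d₁ := d₁) (d₂ := d₂) (cH := cH) (Fb := Fb + 1)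
    w hP hc X hd₂ (hd.trans hdp).le (hd.trans hdm).le hα ht₀ hμ hSC N
  set δ : ℕ → ℝ := fun n => 1 / ((n:ℝ) + 1) with hδ
  have hδ0 : ∀ n, 0 < δ n := fun n => by simp only [hδ]; positivity
  have hδlim : Tendsto δ atTop (𝓝 0) := tendsto_one_div_add_atTop_nhds_zero_nat
  set ω : ℕ → ℝ := fun n => min (min 1 ω₀) (δ n) with hω
  set ε : ℕ → ℝ := fun n => min t₀ (δ n) with hε
  set T : ℕ → ℝ := fun n => max T₀ t₀ + ((n:ℝ) + 1) with hT
  have happ : ∀ n, ∃ h H : ℝ → ℝ, Approx f F d₁ d₂ cH (Fb + 1) (ω n) h H := fun n =>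
    X.exists_approx hFb hFbF hd₁ hd hdp hdm hcH hFc (lt_min (lt_min one_pos hω₀) (hδ0 n))
      ((min_le_left _ _).trans (min_le_left _ _))
  choose h H happ using happ
  have hε0 : ∀ n, 0 < ε n := fun n => lt_min ht₀ (hδ0 n)
  have hTn : ∀ n, max T₀ t₀ < T n := fun n => by
    have : (0:ℝ) ≤ n := Nat.cast_nonneg n
    simp only [hT]; linarith
  choose l hl v y Θ hsol hang hfin using fun n => hsel (g n) (K n) (h n) (H n) (ε n) (T n) (ω n) (hkin n) (happ n)
    ((min_le_left _ _).trans (min_le_right _ _)) (hε0 n) (min_le_left _ _) ((le_max_left _ _).trans_lt (hTn n))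
  set 𝒰 : Ultrafilter ℕ := Ultrafilter.of atTop with h𝒰
  have hle : (𝒰 : Filter ℕ) ≤ atTop := Ultrafilter.of_le atTop
  have S : Family f F η P c m d₁ d₂ cH (Fb + 1) Λ N 𝒰 g K h H ε T ω l v y Θ :=
    { kin := hkin
      app := happ
      ω_lim := (squeeze_zero (fun n => (lt_min (lt_min one_pos hω₀) (hδ0 n)).le) (fun n => min_le_right _ _)
        hδlim).mono_left hle
      ε_pos := hε0
      ε_lim := (squeeze_zero (fun n => (hε0 n).le) (fun n => min_le_right _ _) hδlim).mono_left hle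
      lt := fun n => (min_le_left _ _).trans_lt ((le_max_right _ _).trans_lt (hTn n))
      T_lim := (tendsto_atTop_add_const_left _ _ (tendsto_atTop_add_const_right _ _
        tendsto_natCast_atTop_atTop)).mono_left hle
      mem := hl
      sol := hsol
      ang := hang
      fin := hfin
      g_lim := fun s => (hg s).mono_left (Filter.prod_mono hle le_rfl)
      K_lim := fun s => (hK s).mono_left (Filter.prod_mono hle le_rfl) }
  exact S.exists_solution w hP hc hm hmP hd₁ hd hcH X

end NodalRadial

/-! ### The change of variable t = χ(r). -/

namespace NodalRadial

section Powers

variable {p A B C : ℝ}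

/-- With positive numbers written as exponentials, this and the similar identities below are linear
identities between exponents. -/
lemma rpow_mul_rpow_mul_div_rpow (hp : 1 < p) (hA : 0 < A) (hB : 0 < B) :
    A ^ (1 / p) * B ^ (1 / p.conjExponent) * (B / A) ^ (1 / p) = B := by
  obtain ⟨x, rfl⟩ : ∃ x, Real.exp x = A := ⟨_, Real.exp_log hA⟩
  obtain ⟨y, rfl⟩ : ∃ y, Real.exp y = B := ⟨_, Real.exp_log hB⟩
  have h1 : p - 1 ≠ 0 := by linarith
  have h2 : p ≠ 0 := by linarith
  simp only [← Real.exp_sub, ← Real.exp_mul, ← Real.exp_add, Real.conjExponent]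
  congr 1; field_simp; ring

lemma div_rpow_mul_div_rpow (hA : 0 < A) (hB : 0 < B) : (A / B) ^ (1 / p) * (B / A) ^ (1 / p) = 1 := by
  rw [← Real.mul_rpow (by positivity) (by positivity), div_mul_div_cancel₀ hB.ne', div_self hA.ne',
    Real.one_rpow]

lemma div_rpow_mul_div_rpow_conj (hp : 1 < p) (hA : 0 < A) (hB : 0 < B) (hC : 0 < C) :
    (C / (A ^ (1 / p) * B ^ (1 / p.conjExponent))) ^ (p.conjExponent - 1) * (B / A) ^ (1 / p)
      = (C / A) ^ (p.conjExponent - 1) := by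
  obtain ⟨x, rfl⟩ : ∃ x, Real.exp x = A := ⟨_, Real.exp_log hA⟩
  obtain ⟨y, rfl⟩ : ∃ y, Real.exp y = B := ⟨_, Real.exp_log hB⟩
  obtain ⟨z, rfl⟩ : ∃ z, Real.exp z = C := ⟨_, Real.exp_log hC⟩
  have h1 : p - 1 ≠ 0 := by linarith
  have h2 : p ≠ 0 := by linarith
  simp only [← Real.exp_sub, ← Real.exp_mul, ← Real.exp_add, Real.conjExponent]
  congr 1; field_simp; ring

lemma mul_div_rpow_rpow (hp : 1 < p) (hA : 0 < A) (hB : 0 < B) :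
    A * ((B / A) ^ (1 / p)) ^ (p - 1) = A ^ (1 / p) * B ^ (1 / p.conjExponent) := by
  obtain ⟨x, rfl⟩ : ∃ x, Real.exp x = A := ⟨_, Real.exp_log hA⟩
  obtain ⟨y, rfl⟩ : ∃ y, Real.exp y = B := ⟨_, Real.exp_log hB⟩
  have h1 : p - 1 ≠ 0 := by linarith
  have h2 : p ≠ 0 := by linarith
  simp only [← Real.exp_sub, ← Real.exp_mul, ← Real.exp_add, Real.conjExponent]
  congr 1; field_simp; ring

lemma one_lt_conjExponent (hp : 1 < p) : 1 < p.conjExponent := by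
  rw [Real.conjExponent, one_lt_div (by linarith)]; linarith

lemma phi_mul_of_pos {s c : ℝ} (hc : 0 < c) : phi p (s * c) = phi p s * c ^ (p - 1) := by
  rw [phi, phi, abs_mul, abs_of_pos hc, Real.mul_rpow (abs_nonneg _) hc.le,
    show p - 1 = p - 2 + 1 by ring, Real.rpow_add_one hc.ne']
  ring

lemma phi_phi_conjExponent (hp : 1 < p) (s : ℝ) : phi p (phi p.conjExponent s) = s := by
  have key : ∀ s, 0 < s → phi p (phi p.conjExponent s) = s := fun s hs => by
    have h1 : p - 1 ≠ 0 := by linarith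
    rw [phi_of_pos (phi_pos hs), phi_of_pos hs, ← Real.rpow_mul hs.le, Real.conjExponent]
    convert Real.rpow_one s using 2
    field_simp
    ring
  rcases lt_trichotomy s 0 with h | rfl | h
  · have := key (-s) (by linarith)
    rw [phi_neg, phi_neg] at this
    linarith
  · simp [phi]
  · exact key s h

end Powers

section Primitives

variable {g G : ℝ → ℝ}

lemma continuousOn_primitive_Ici (hg : ∀ t, 0 ≤ t → IntervalIntegrable g volume 0 t) :
    ContinuousOn (fun r => ∫ t in (0:ℝ)..r, g t) (Ici 0) := by
  intro r hr
  have hr' : (0:ℝ) ≤ r + 1 := by linarith [mem_Ici.1 hr]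
  have h1 : IntegrableOn g (uIcc 0 (r + 1)) := by
    rw [uIcc_of_le hr', integrableOn_Icc_iff_integrableOn_Ioc]
    exact (intervalIntegrable_iff_integrableOn_Ioc_of_le hr').1 (hg _ hr')
  have h2 := intervalIntegral.continuousOn_primitive_interval h1
  rw [uIcc_of_le hr'] at h2
  refine (h2 r ⟨hr, by linarith⟩).mono_of_mem_nhdsWithin ?_
  rw [← Ici_inter_Iic]
  exact inter_mem self_mem_nhdsWithin (mem_nhdsWithin_of_mem_nhds (Iic_mem_nhds (by linarith)))

/-- A nonnegative derivative of a continuous function is automatically integrable, so nothing has to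
be assumed about g at the possibly singular end 0. -/
lemma integral_eq_of_hasDerivAt_of_nonneg (hG : ContinuousOn G (Ici 0)) (h0 : G 0 = 0)
    (hd : ∀ t, 0 < t → HasDerivAt G (g t) t) (hg : ∀ t, 0 < t → 0 ≤ g t) {r : ℝ} (hr : 0 ≤ r) :
    ∫ t in (0:ℝ)..r, g t = G r := by
  have hc : ContinuousOn G (Icc 0 r) := hG.mono fun x hx => hx.1
  rw [intervalIntegral.integral_eq_sub_of_hasDerivAt_of_le hr hc (fun x hx => hd x hx.1), h0, sub_zero]
  rw [intervalIntegrable_iff_integrableOn_Ioc_of_le hr]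
  exact intervalIntegral.integrableOn_deriv_of_nonneg hc (fun x hx => hd x hx.1) fun x hx => hg x hx.1

lemma contDiffOn_one_of_hasDerivAt (hd : ∀ t, 0 < t → HasDerivAt G (g t) t) (hg : ContinuousOn g (Ioi 0)) :
    ContDiffOn ℝ 1 G (Ioi 0) := by
  rw [contDiffOn_one_iff_derivWithin isOpen_Ioi.uniqueDiffOn]
  refine ⟨fun t ht => (hd t ht).differentiableAt.differentiableWithinAt, hg.congr fun t ht => ?_⟩
  rw [derivWithin_of_isOpen isOpen_Ioi ht]
  exact (hd t ht).deriv

end Primitives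

/-- The inverse of `χ` on `[0, ∞)`. -/
noncomputable def chiInv (p : ℝ) (a b : ℝ → ℝ) : ℝ → ℝ := Function.invFunOn (chi p a b) (Ici 0)

/-- The function `a^(1/p) b^(1/p')`. -/
noncomputable def wt (p : ℝ) (a b : ℝ → ℝ) (r : ℝ) : ℝ := a r ^ (1 / p) * b r ^ (1 / p.conjExponent)

namespace CondW1

variable {p : ℝ} {a b : ℝ → ℝ}

lemma hasDerivAt_a (W : CondW1 p a b) {r : ℝ} (hr : 0 < r) : HasDerivAt a (deriv a r) r :=
  ((W.smooth_a.differentiableOn one_ne_zero).differentiableAt (Ioi_mem_nhds hr)).hasDerivAt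

lemma hasDerivAt_b (W : CondW1 p a b) {r : ℝ} (hr : 0 < r) : HasDerivAt b (deriv b r) r :=
  ((W.smooth_b.differentiableOn one_ne_zero).differentiableAt (Ioi_mem_nhds hr)).hasDerivAt

lemma rpow_pos (W : CondW1 p a b) {r : ℝ} (hr : 0 < r) : 0 < (b r / a r) ^ (1 / p) :=
  Real.rpow_pos_of_pos (div_pos (W.pos_b r hr) (W.pos_a r hr)) _

lemma continuousOn_rpow (W : CondW1 p a b) : ContinuousOn (fun r => (b r / a r) ^ (1 / p)) (Ioi 0) :=
  (W.smooth_b.continuousOn.div W.smooth_a.continuousOn fun r hr => (W.pos_a r hr).ne').rpow_const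
    fun r hr => Or.inl (div_pos (W.pos_b r hr) (W.pos_a r hr)).ne'

lemma intervalIntegrable_rpow (W : CondW1 p a b) {r : ℝ} (hr : 0 ≤ r) :
    IntervalIntegrable (fun r => (b r / a r) ^ (1 / p)) volume 0 r := by
  rw [intervalIntegrable_iff_integrableOn_Ioc_of_le hr]
  exact (W.locInt.integrableOn_compact_subset (fun x hx => hx.1) isCompact_Icc).mono_set Ioc_subset_Icc_self

lemma hasDerivAt_chi (W : CondW1 p a b) {r : ℝ} (hr : 0 < r) :
    HasDerivAt (chi p a b) ((b r / a r) ^ (1 / p)) r :=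
  intervalIntegral.integral_hasDerivAt_right (W.intervalIntegrable_rpow hr.le)
    (W.continuousOn_rpow.stronglyMeasurableAtFilter isOpen_Ioi r hr)
    (W.continuousOn_rpow.continuousAt (Ioi_mem_nhds hr))

lemma continuousOn_chi (W : CondW1 p a b) : ContinuousOn (chi p a b) (Ici 0) :=
  continuousOn_primitive_Ici fun _ => W.intervalIntegrable_rpow

lemma chi_zero : chi p a b 0 = 0 := by simp [chi]

lemma strictMonoOn_chi (W : CondW1 p a b) : StrictMonoOn (chi p a b) (Ici 0) := by
  refine strictMonoOn_of_hasDerivWithinAt_pos (f' := fun r => (b r / a r) ^ (1 / p)) (convex_Ici 0)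
    W.continuousOn_chi (fun r hr => ?_) (fun r hr => ?_)
  all_goals rw [interior_Ici] at hr
  · exact (W.hasDerivAt_chi hr).hasDerivWithinAt
  · exact W.rpow_pos hr

lemma chi_pos (W : CondW1 p a b) {r : ℝ} (hr : 0 < r) : 0 < chi p a b r := by
  rw [← chi_zero (p := p) (a := a) (b := b)]
  exact W.strictMonoOn_chi self_mem_Ici hr.le hr

lemma chi_nonneg (W : CondW1 p a b) {r : ℝ} (hr : 0 ≤ r) : 0 ≤ chi p a b r := by
  rw [← chi_zero (p := p) (a := a) (b := b)]
  exact W.strictMonoOn_chi.monotoneOn self_mem_Ici hr hr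

lemma exists_chi_eq (W : CondW1 p a b) {t : ℝ} (ht : 0 ≤ t) : ∃ r ∈ Ici (0:ℝ), chi p a b r = t := by
  obtain ⟨R, hR, hR0⟩ := ((W.tendsto_chi.eventually_ge_atTop t).and (eventually_ge_atTop 0)).exists
  obtain ⟨r, hr, h⟩ := intermediate_value_Icc hR0 (W.continuousOn_chi.mono fun x hx => hx.1)
    (show t ∈ Icc _ _ from ⟨by rwa [chi_zero], hR⟩)
  exact ⟨r, hr.1, h⟩

lemma chiInv_nonneg (W : CondW1 p a b) {t : ℝ} (ht : 0 ≤ t) : 0 ≤ chiInv p a b t :=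
  Function.invFunOn_mem (W.exists_chi_eq ht)

lemma chi_chiInv (W : CondW1 p a b) {t : ℝ} (ht : 0 ≤ t) : chi p a b (chiInv p a b t) = t :=
  Function.invFunOn_eq (W.exists_chi_eq ht)

lemma chiInv_chi (W : CondW1 p a b) {r : ℝ} (hr : 0 ≤ r) : chiInv p a b (chi p a b r) = r :=
  W.strictMonoOn_chi.injOn.leftInvOn_invFunOn hr

lemma chiInv_pos (W : CondW1 p a b) {t : ℝ} (ht : 0 < t) : 0 < chiInv p a b t := by
  refine (W.chiInv_nonneg ht.le).lt_of_ne fun h => ?_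
  have := W.chi_chiInv ht.le
  rw [← h, chi_zero] at this
  exact ht.ne this

lemma strictMonoOn_chiInv (W : CondW1 p a b) : StrictMonoOn (chiInv p a b) (Ici 0) := by
  intro s hs t ht hst
  rw [← W.strictMonoOn_chi.lt_iff_lt (W.chiInv_nonneg hs) (W.chiInv_nonneg ht), W.chi_chiInv hs,
    W.chi_chiInv ht]
  exact hst

lemma continuousAt_chiInv (W : CondW1 p a b) {t : ℝ} (ht : 0 < t) : ContinuousAt (chiInv p a b) t := by
  refine (W.strictMonoOn_chiInv.mono Ioi_subset_Ici_self).continuousAt_of_image_mem_nhds (Ioi_mem_nhds ht) ?_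
  refine mem_of_superset (Ioi_mem_nhds (W.chiInv_pos ht)) fun r hr => ?_
  exact ⟨chi p a b r, W.chi_pos hr, W.chiInv_chi (mem_Ioi.1 hr).le⟩

lemma hasDerivAt_chiInv (W : CondW1 p a b) {t : ℝ} (ht : 0 < t) :
    HasDerivAt (chiInv p a b) ((a (chiInv p a b t) / b (chiInv p a b t)) ^ (1 / p)) t := by
  have h0 := W.chiInv_pos ht
  refine ((W.hasDerivAt_chi h0).of_local_left_inverse (W.continuousAt_chiInv ht) (W.rpow_pos h0).ne'
    ?_).congr_deriv ?_
  · filter_upwards [Ioi_mem_nhds ht] with s hs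
    exact W.chi_chiInv (mem_Ioi.1 hs).le
  · exact inv_eq_of_mul_eq_one_left (div_rpow_mul_div_rpow (W.pos_a _ h0) (W.pos_b _ h0))

lemma wt_pos (W : CondW1 p a b) {r : ℝ} (hr : 0 < r) : 0 < wt p a b r :=
  mul_pos (Real.rpow_pos_of_pos (W.pos_a r hr) _) (Real.rpow_pos_of_pos (W.pos_b r hr) _)

lemma wt_mul_rpow (W : CondW1 p a b) (hp : 1 < p) {r : ℝ} (hr : 0 < r) :
    wt p a b r * (b r / a r) ^ (1 / p) = b r :=
  rpow_mul_rpow_mul_div_rpow hp (W.pos_a r hr) (W.pos_b r hr)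

lemma hasDerivAt_wt (W : CondW1 p a b) {r : ℝ} (hr : 0 < r) : HasDerivAt (wt p a b)
    (wt p a b r * (1 / p * (deriv a r / a r) + 1 / p.conjExponent * (deriv b r / b r))) r := by
  have ha := (W.pos_a r hr).ne'
  have hb := (W.pos_b r hr).ne'
  refine (((W.hasDerivAt_a hr).rpow_const (p := 1 / p) (Or.inl ha)).fun_mul
    ((W.hasDerivAt_b hr).rpow_const (p := 1 / p.conjExponent) (Or.inl hb))).congr_deriv ?_
  rw [Real.rpow_sub_one ha, Real.rpow_sub_one hb, wt]
  ring

lemma continuousOn_psi (W : CondW1 p a b) : ContinuousOn (psi p a b) (Ioi 0) := by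
  have h1 := W.smooth_a.continuousOn_deriv_of_isOpen isOpen_Ioi le_rfl
  have h2 := W.smooth_b.continuousOn_deriv_of_isOpen isOpen_Ioi le_rfl
  have ha := W.smooth_a.continuousOn
  have hb := W.smooth_b.continuousOn
  have hab : ContinuousOn (fun r => (a r / b r) ^ (1 / p)) (Ioi 0) :=
    (ha.div hb fun r hr => (W.pos_b r hr).ne').rpow_const
      fun r hr => Or.inl (div_pos (W.pos_a r hr) (W.pos_b r hr)).ne'
  exact ((continuousOn_const.mul (h1.div ha fun r hr => (W.pos_a r hr).ne')).add
    (continuousOn_const.mul (h2.div hb fun r hr => (W.pos_b r hr).ne'))).mul hab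

/-- ψ is the logarithmic derivative of a^(1/p) b^(1/p') with respect to χ, so it becomes η, and the
conditions on ψ are those required of η. -/
lemma weight (W : CondW1 p a b) (W2 : CondW2 p a b) {C₁ C₂ : ℝ} (h₁ : 0 < C₁) (h₂ : 0 < C₂)
    (W3 : ∀ r, 0 < r → C₁ ≤ chi p a b r * psi p a b r ∧ chi p a b r * psi p a b r ≤ C₂) :
    Weight (fun t => wt p a b (chiInv p a b t)) (fun t => psi p a b (chiInv p a b t)) C₁ C₂ where
  C₁_pos := h₁
  C₂_pos := h₂
  pos t ht := W.wt_pos (W.chiInv_pos ht)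
  deriv t ht := ((W.hasDerivAt_wt (W.chiInv_pos ht)).comp t (W.hasDerivAt_chiInv ht)).congr_deriv
    (by rw [psi]; ring)
  cont := W.continuousOn_psi.comp (fun t ht => (W.continuousAt_chiInv ht).continuousWithinAt)
    fun t ht => W.chiInv_pos ht
  anti := fun s hs t ht hst => W2.2.antitoneOn (W.chiInv_pos hs) (W.chiInv_pos ht)
    (W.strictMonoOn_chiInv.monotoneOn (mem_Ioi.1 hs).le (mem_Ioi.1 ht).le hst)
  low t ht := by
    have := (W3 _ (W.chiInv_pos ht)).1
    rwa [W.chi_chiInv ht.le] at this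
  up t ht := by
    have := (W3 _ (W.chiInv_pos ht)).2
    rwa [W.chi_chiInv ht.le] at this

variable {q η : ℝ → ℝ} {C₁ C₂ : ℝ}

/-- The Jacobian identity `wt_mul_rpow` says that b dr = q dt, so B is the same function in both
variables. -/
lemma capB_eq (W : CondW1 p a b) (hp : 1 < p) (w : Weight q η C₁ C₂)
    (hq : ∀ r, 0 < r → q (chi p a b r) = wt p a b r) {r : ℝ} (hr : 0 ≤ r) :
    capB b r = capB q (chi p a b r) := by
  refine integral_eq_of_hasDerivAt_of_nonneg (G := fun r => capB q (chi p a b r)) ?_ ?_ (fun t ht => ?_)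
    (fun t ht => (W.pos_b t ht).le) hr
  · exact (continuousOn_primitive_Ici fun t ht => w.intervalIntegrable le_rfl ht).comp W.continuousOn_chi
      fun r hr => W.chi_nonneg hr
  · simp only [chi_zero, Weight.capB_zero]
  · refine ((w.hasDerivAt_capB (W.chi_pos ht)).comp t (W.hasDerivAt_chi ht)).congr_deriv ?_
    rw [hq t ht, W.wt_mul_rpow hp ht]

lemma capT_eq (W : CondW1 p a b) (hp : 1 < p) (w : Weight q η C₁ C₂)
    (hq : ∀ r, 0 < r → q (chi p a b r) = wt p a b r) {r : ℝ} (hr : 0 ≤ r) :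
    capT p a b r = travel q p.conjExponent (chi p a b r) := by
  have hP := one_lt_conjExponent hp
  have hB : ∀ t, 0 < t → 0 < capB b t := fun t ht => by
    rw [W.capB_eq hp w hq ht.le]; exact w.capB_pos (W.chi_pos ht)
  refine integral_eq_of_hasDerivAt_of_nonneg (G := fun r => travel q p.conjExponent (chi p a b r)) ?_ ?_
    (fun t ht => ?_) (fun t ht => (phi_pos (div_pos (hB t ht) (W.pos_a t ht))).le) hr
  · exact (continuousOn_primitive_Ici fun t ht => w.travel_intervalIntegrable hP ht).comp W.continuousOn_chi
      fun r hr => W.chi_nonneg hr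
  · simp only [chi_zero, travel, intervalIntegral.integral_same]
  · refine ((w.hasDerivAt_travel hP (W.chi_pos ht)).comp t (W.hasDerivAt_chi ht)).congr_deriv ?_
    rw [hq t ht, ← W.capB_eq hp w hq ht.le, wt, phi_of_pos (div_pos (hB t ht) (W.pos_a t ht)),
      div_rpow_mul_div_rpow_conj hp (W.pos_a t ht) (W.pos_b t ht) (hB t ht)]

/-- T_W is strictly increasing on [0, ∞), being `travel` composed with χ. Thus a lower bound on
T_W(r) becomes an upper bound on the inverse, which is the quantity occurring in the sub-criticality
condition. -/
lemma capTInv_mem (W : CondW1 p a b) (hp : 1 < p) (w : Weight q η C₁ C₂)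
    (hq : ∀ r, 0 < r → q (chi p a b r) = wt p a b r) {r z : ℝ} (hr : 0 ≤ r) (hz : 0 ≤ z)
    (h : z ≤ capT p a b r) : capTInv p a b z ∈ Icc 0 r := by
  have hP := one_lt_conjExponent hp
  have hd : ∀ t, 0 < t → HasDerivAt (fun r => travel q p.conjExponent (chi p a b r))
      ((capB q (chi p a b t) / q (chi p a b t)) ^ (p.conjExponent - 1) * (b t / a t) ^ (1 / p)) t :=
    fun t ht => (w.hasDerivAt_travel hP (W.chi_pos ht)).comp t (W.hasDerivAt_chi ht)
  have hc : ContinuousOn (fun r => travel q p.conjExponent (chi p a b r)) (Ici 0) :=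
    (continuousOn_primitive_Ici fun t ht => w.travel_intervalIntegrable hP ht).comp W.continuousOn_chi
      fun r hr => W.chi_nonneg hr
  have hm : StrictMonoOn (fun r => travel q p.conjExponent (chi p a b r)) (Ici 0) := by
    refine strictMonoOn_of_hasDerivWithinAt_pos (convex_Ici 0) hc
      (fun t ht => (hd t (by rwa [interior_Ici] at ht)).hasDerivWithinAt) (fun t ht => ?_)
    rw [interior_Ici] at ht
    exact mul_pos (Real.rpow_pos_of_pos (div_pos (w.capB_pos (W.chi_pos ht)) (w.pos _ (W.chi_pos ht))) _)
      (W.rpow_pos ht)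
  have he : EqOn (capT p a b) (fun r => travel q p.conjExponent (chi p a b r)) (Ici 0) :=
    fun r hr => W.capT_eq hp w hq hr
  replace hc := hc.congr he
  replace hm := hm.congr he.symm
  obtain ⟨x, hx, hxz⟩ := intermediate_value_Icc hr (hc.mono fun x hx => hx.1)
    (show z ∈ Icc _ _ from ⟨by simpa [capT] using hz, h⟩)
  have h1 : capTInv p a b z ∈ Ici 0 := Function.invFunOn_mem ⟨x, hx.1, hxz⟩
  have h2 : capT p a b (capTInv p a b z) = z := Function.invFunOn_eq (s := Ici 0) ⟨x, hx.1, hxz⟩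
  refine ⟨h1, ?_⟩
  rw [← hm.le_iff_le h1 (mem_Ici.2 hr), h2]
  exact h

/-- The terms in a'/a and b'/b combine into ψ, and B' = b contributes 1/p - 1 = -1/p'. So the slope
condition on μ is Bη ≤ (μ + 1/P)q, the form used in the Pohozaev argument. -/
lemma critFun_eq (W : CondW1 p a b) (hp : 1 < p) {r : ℝ} (hr : 0 < r)
    (hB : HasDerivAt (capB b) (b r) r) :
    critFun p a b r = capB b r * psi p a b r / wt p a b r - 1 / p.conjExponent := by
  have ha := W.pos_a r hr
  have hb := W.pos_b r hr
  have hw := W.wt_pos hr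
  have h1 := (hB.fun_mul (W.hasDerivAt_a hr)).fun_div (W.hasDerivAt_b hr) hb.ne'
  have h2 := hB.fun_div (W.hasDerivAt_b hr) hb.ne'
  have h3 : (a r / b r) ^ (1 / p) / wt p a b r = 1 / b r := by
    rw [div_eq_div_iff hw.ne' hb.ne', one_mul]
    calc _ = (a r / b r) ^ (1 / p) * (wt p a b r * (b r / a r) ^ (1 / p)) := by rw [W.wt_mul_rpow hp hr]
      _ = _ := by rw [mul_left_comm, div_rpow_mul_div_rpow ha hb, mul_one]
  have h4 : capB b r * psi p a b r / wt p a b r = capB b r *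
      (1 / p * (deriv a r / a r) + 1 / p.conjExponent * (deriv b r / b r)) / b r := by
    rw [psi, ← mul_assoc, mul_div_assoc, h3]; ring
  rw [critFun, h1.deriv, h2.deriv, h4, Real.conjExponent]
  have hp0 : p ≠ 0 := by linarith
  have hp1 : p - 1 ≠ 0 := by linarith
  field_simp
  ring

end CondW1

lemma force_primF {f : ℝ → ℝ} (h₁ : CondF1 f) {βm βp : ℝ} {L : EReal} (hm : βm < 0) (hp : 0 < βp)
    (neg : ∀ s ∈ Ioo βm βp, s ≠ 0 → primF f s < 0) (zm : primF f βm = 0) (zp : primF f βp = 0)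
    (pos : ∀ s, βp ≤ s → 0 < f s) (neg' : ∀ s, s ≤ βm → f s < 0)
    (top : Tendsto (fun s => (primF f s : EReal)) atTop (𝓝 L))
    (bot : Tendsto (fun s => (primF f s : EReal)) atBot (𝓝 L)) : Force f (primF f) βm βp L where
  cont := h₁.cont
  lip := h₁.locLip
  zero := h₁.zero
  hasDeriv s := intervalIntegral.integral_hasDerivAt_right (h₁.cont.intervalIntegrable _ _)
    (h₁.cont.stronglyMeasurableAtFilter _ _) h₁.cont.continuousAt
  zero' := by simp [primF]
  βm_neg := hm
  βp_pos := hp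
  neg := neg
  map_βm := zm
  map_βp := zp
  pos := pos
  neg' := neg'
  top := top
  bot := bot

end NodalRadial

/-! ### Transfer of the hypotheses and of the solution. -/

namespace NodalRadial

namespace CondW1

variable {p : ℝ} {a b f q η : ℝ → ℝ} {C₁ C₂ : ℝ}

lemma subcritical_slope (W : CondW1 p a b) (hp : 1 < p) (w : Weight q η C₁ C₂)
    (hq : ∀ r, 0 < r → q (chi p a b r) = wt p a b r)
    (hη : ∀ r, 0 < r → η (chi p a b r) = psi p a b r) {μ r₀ : ℝ} (hr₀ : 0 < r₀)
    (h : ∀ r ∈ Ioo 0 r₀, 0 ≤ μ + deriv (fun t => capB b t / b t) r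
      - 1 / (p * a r) * deriv (fun t => capB b t * a t / b t) r) :
    ∀ t ∈ Ioc 0 (chi p a b (r₀ / 2)), capB q t * η t ≤ (μ + 1 / p.conjExponent) * q t := by
  intro t ht
  have hr := W.chiInv_pos ht.1
  have hrt := W.chi_chiInv ht.1.le
  generalize chiInv p a b t = r at hr hrt
  subst hrt
  have hr' : r < r₀ := by
    have := (W.strictMonoOn_chi.le_iff_le (mem_Ici.2 hr.le) (mem_Ici.2 (half_pos hr₀).le)).1 ht.2
    linarith
  have hB : HasDerivAt (capB b) (b r) r := by
    refine (((w.hasDerivAt_capB (W.chi_pos hr)).comp r (W.hasDerivAt_chi hr)).congr_deriv ?_).congr_of_eventuallyEq ?_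
    · rw [hq r hr, W.wt_mul_rpow hp hr]
    · filter_upwards [Ioi_mem_nhds hr] with x hx
      exact W.capB_eq hp w hq (mem_Ioi.1 hx).le
  have h1 := h r ⟨hr, hr'⟩
  have h2 := W.critFun_eq hp hr hB
  have hw := W.wt_pos hr
  have h3 : capB b r * psi p a b r / wt p a b r ≤ μ + 1 / p.conjExponent := by
    rw [critFun] at h2; linarith
  rw [div_le_iff₀ hw] at h3
  rwa [hη r hr, hq r hr, ← W.capB_eq hp w hq hr.le]

/-- The limit controls B at T_W⁻¹(z) with z = (1 - α)l/φ_P(f(s₁)). Any ρ whose travel is at least z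
lies beyond that point, and B is nondecreasing. -/
lemma subcritical_limit (W : CondW1 p a b) (hp : 1 < p) (w : Weight q η C₁ C₂)
    (hq : ∀ r, 0 < r → q (chi p a b r) = wt p a b r) {α μ βp : ℝ} (hα : α ∈ Ioo (0:ℝ) 1)
    (pos : ∀ s, βp ≤ s → 0 < f s)
    (h : Tendsto (fun s : ℝ => ⨅ s₁ ∈ Icc (α * s) s, ⨅ s₂ ∈ Icc (α * s) s,
      (((primF f s₂ - μ * s₂ * f s₂) *
        capB b (capTInv p a b ((1 - α) * s / phi p.conjExponent (f s₁))) : ℝ) : EReal))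
      atTop (𝓝 ⊤)) (N : ℝ) :
    ∃ s₀, ∀ l ≥ s₀, ∀ s₁ ∈ Icc (α * l) l, ∀ s₂ ∈ Icc (α * l) l, ∀ ρ, 0 < ρ →
      (1 - α) * l ≤ f s₁ ^ (p.conjExponent - 1) * travel q p.conjExponent ρ →
      N ≤ (primF f s₂ - μ * s₂ * f s₂) * capB q ρ := by
  -- The maximum with 0 makes F - μ s f nonnegative, so that enlarging B can only enlarge the
  -- product.
  have h1 := EReal.tendsto_nhds_top_iff_real.1 h (max N 0)
  obtain ⟨s₀, hs₀⟩ := eventually_atTop.1 ((h1.and (eventually_ge_atTop (βp / α))).and (eventually_ge_atTop 0))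
  refine ⟨s₀, fun l hl s₁ h₁ s₂ h₂ ρ hρ hle => ?_⟩
  obtain ⟨⟨hinf, hlβ⟩, hl0⟩ := hs₀ l hl
  have hf : 0 < f s₁ := pos _ (by
    rw [div_le_iff₀ hα.1] at hlβ
    linarith [h₁.1])
  have h2 := hinf.trans_le ((iInf₂_le s₁ h₁).trans (iInf₂_le s₂ h₂))
  rw [EReal.coe_lt_coe_iff] at h2
  have hφ : 0 < phi p.conjExponent (f s₁) := phi_pos hf
  have hr := W.chiInv_pos hρ
  have hrρ := W.chi_chiInv hρ.le
  generalize chiInv p a b ρ = r at hr hrρ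
  subst hrρ
  rw [← W.capT_eq hp w hq hr.le, ← phi_of_pos hf, ← div_le_iff₀' hφ] at hle
  have hz : 0 ≤ (1 - α) * l / phi p.conjExponent (f s₁) :=
    div_nonneg (mul_nonneg (by linarith [hα.2]) hl0) hφ.le
  have hm := W.capTInv_mem hp w hq hr.le hz hle
  have hB : capB b (capTInv p a b ((1 - α) * l / phi p.conjExponent (f s₁))) ≤ capB q (chi p a b r) := by
    rw [W.capB_eq hp w hq hm.1]
    exact w.capB_mono (W.chi_nonneg hm.1) (W.strictMonoOn_chi.monotoneOn hm.1 (mem_Ici.2 hr.le) hm.2)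
  have hB0 : 0 ≤ capB b (capTInv p a b ((1 - α) * l / phi p.conjExponent (f s₁))) := by
    rw [W.capB_eq hp w hq hm.1, ← Weight.capB_zero (q := q)]
    exact w.capB_mono le_rfl (W.chi_nonneg hm.1)
  have hF : 0 ≤ primF f s₂ - μ * s₂ * f s₂ :=
    (pos_of_mul_pos_left ((le_max_right N 0).trans_lt h2) hB0).le
  exact ((le_max_left N 0).trans h2.le).trans (mul_le_mul_of_nonneg_left hB hF)

section Transfer

variable {F V Y : ℝ → ℝ} {M : ℝ}

lemma hasDerivAt_comp_chi (W : CondW1 p a b) (S : LimitSol p.conjExponent η f F V Y) {r : ℝ} (hr : 0 < r) :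
    HasDerivAt (fun r => V (chi p a b r))
      (phi p.conjExponent (Y (chi p a b r)) * (b r / a r) ^ (1 / p)) r :=
  (S.dv _ (W.chi_pos hr)).comp r (W.hasDerivAt_chi hr)

lemma flux_comp_chi (W : CondW1 p a b) (hp : 1 < p) (S : LimitSol p.conjExponent η f F V Y)
    (hq : ∀ r, 0 < r → q (chi p a b r) = wt p a b r) {r : ℝ} (hr : 0 < r) :
    a r * phi p (deriv (fun r => V (chi p a b r)) r) = q (chi p a b r) * Y (chi p a b r) := by
  rw [(W.hasDerivAt_comp_chi S hr).deriv, phi_mul_of_pos (W.rpow_pos hr), phi_phi_conjExponent hp, hq r hr,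
    wt, ← mul_div_rpow_rpow hp (W.pos_a r hr) (W.pos_b r hr)]
  ring

lemma hasDerivAt_flux (W : CondW1 p a b) (hp : 1 < p) (w : Weight q η C₁ C₂)
    (S : LimitSol p.conjExponent η f F V Y)
    (hq : ∀ r, 0 < r → q (chi p a b r) = wt p a b r) {r : ℝ} (hr : 0 < r) :
    HasDerivAt (fun r => a r * phi p (deriv (fun r => V (chi p a b r)) r))
      (-(b r * f (V (chi p a b r)))) r := by
  have ht := W.chi_pos hr
  refine ((((w.deriv _ ht).fun_mul (S.dy _ ht)).comp r (W.hasDerivAt_chi hr)).congr_deriv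
    ?_).congr_of_eventuallyEq ?_
  · have h := W.wt_mul_rpow hp hr
    rw [← hq r hr] at h
    linear_combination -(f (V (chi p a b r))) * h
  · filter_upwards [Ioi_mem_nhds hr] with x hx
    exact W.flux_comp_chi hp S hq hx

/-- The flux is q Y by `flux_comp_chi`; being differentiable in r, it gives the regularity and the
equation, and its bound by a multiple of B gives the vanishing at the origin. -/
lemma isSolution_comp_chi (W : CondW1 p a b) (hp : 1 < p) (w : Weight q η C₁ C₂)
    (S : LimitSol p.conjExponent η f F V Y) (hf : Continuous f)
    (hq : ∀ r, 0 < r → q (chi p a b r) = wt p a b r) (hV : Continuous V)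
    (hY : ∀ t, 0 < t → |q t * Y t| ≤ M * capB q t) (h0 : Tendsto V atTop (𝓝 0)) :
    IsSolution p a b f (fun r => V (chi p a b r)) where
  cont := hV.comp_continuousOn W.continuousOn_chi
  smooth := by
    refine contDiffOn_one_of_hasDerivAt (fun r hr => W.hasDerivAt_comp_chi S hr)
      (ContinuousOn.mul ?_ W.continuousOn_rpow)
    refine (continuous_phi (one_lt_conjExponent hp)).comp_continuousOn fun r hr => ?_
    exact ((S.dy _ (W.chi_pos hr)).continuousAt.comp (W.hasDerivAt_chi hr).continuousAt).continuousWithinAt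
  smooth_flux := contDiffOn_one_of_hasDerivAt (fun r hr => W.hasDerivAt_flux hp w S hq hr)
    (W.smooth_b.continuousOn.mul ((hf.comp hV).comp_continuousOn
      (W.continuousOn_chi.mono Ioi_subset_Ici_self))).neg
  eqn r hr := by rw [(W.hasDerivAt_flux hp w S hq hr).deriv]; ring
  flux_zero := by
    have hB : ContinuousOn (fun r => M * capB q (chi p a b r)) (Ici 0) :=
      continuousOn_const.mul ((continuousOn_primitive_Ici fun t ht => w.intervalIntegrable le_rfl ht).comp
        W.continuousOn_chi fun r hr => W.chi_nonneg hr)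
    have hB0 := (hB 0 self_mem_Ici).tendsto
    simp only [chi_zero, Weight.capB_zero, mul_zero] at hB0
    refine squeeze_zero_norm' ?_ (hB0.mono_left (nhdsWithin_mono 0 Ioi_subset_Ici_self))
    filter_upwards [self_mem_nhdsWithin] with r hr
    rw [W.flux_comp_chi hp S hq hr]
    exact hY _ (W.chi_pos hr)
  decay := h0.comp W.tendsto_chi

/-- A zero with Y = 0 starts permanent rest by `eq_zero_after`, so the support ends there at the
latest and the zero is not interior. At a zero with Y ≠ 0 the derivative is nonzero, so the zero is
isolated and a whole neighbourhood lies in the support. -/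
lemma encard_nodes_comp_chi (W : CondW1 p a b) (hp : 1 < p) (w : Weight q η C₁ C₂)
    (S : LimitSol p.conjExponent η f F V Y) (hF : ∀ s, HasDerivAt F (f s) s) (hF0 : F 0 = 0) :
    (nodes (fun r => V (chi p a b r))).encard = {t | 0 < t ∧ V t = 0 ∧ Y t ≠ 0}.encard := by
  have hP := one_lt_conjExponent hp
  have hinj : InjOn (chi p a b) (nodes (fun r => V (chi p a b r))) :=
    W.strictMonoOn_chi.injOn.mono fun r hr => hr.1.le
  rw [← hinj.encard_image]
  congr 1
  ext t
  constructor
  · rintro ⟨r, ⟨hr, hv, hint⟩, rfl⟩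
    refine ⟨W.chi_pos hr, hv, fun hy => ?_⟩
    have hz := S.eq_zero_after w hP hF hF0 (W.chi_pos hr) hv hy
    have h1 : closure {x | 0 ≤ x ∧ V (chi p a b x) ≠ 0} ⊆ Iic r := by
      refine closure_minimal (fun x hx => ?_) isClosed_Iic
      by_contra! hxr
      exact hx.2 (hz _ (W.strictMonoOn_chi.monotoneOn (mem_Ici.2 hr.le) (mem_Ici.2 hx.1)
        (not_le.1 hxr).le))
    have h2 := interior_mono h1 hint
    rw [interior_Iic] at h2
    exact lt_irrefl r h2
  · rintro ⟨ht, hv, hy⟩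
    have hr := W.chiInv_pos ht
    have hrt := W.chi_chiInv ht.le
    generalize chiInv p a b t = r at hr hrt
    subst hrt
    refine ⟨r, ⟨hr, hv, ?_⟩, rfl⟩
    have hd := W.hasDerivAt_comp_chi S hr
    have hne := hd.eventually_ne (c := 0)
      (mul_ne_zero (fun h => hy ((phi_eq_zero hP).1 h)) (W.rpow_pos hr).ne')
    have hpos : ∀ᶠ x in 𝓝 r, 0 < x := Ioi_mem_nhds hr
    have hfreq : r ∈ closure {x | 0 ≤ x ∧ V (chi p a b x) ≠ 0} := by
      rw [mem_closure_iff_frequently]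
      have h2 : ∀ᶠ x in 𝓝[≠] r, 0 ≤ x ∧ V (chi p a b x) ≠ 0 := by
        filter_upwards [hne, hpos.filter_mono nhdsWithin_le_nhds] with x h1 h2
        exact ⟨h2.le, h1⟩
      exact h2.frequently.filter_mono nhdsWithin_le_nhds
    rw [mem_interior_iff_mem_nhds]
    filter_upwards [eventually_nhdsWithin_iff.1 hne, hpos] with x h1 h2
    rcases eq_or_ne x r with rfl | h3
    · exact hfreq
    · exact subset_closure ⟨h2.le, h1 h3⟩

end Transfer

end CondW1

end NodalRadial


/-! ### Conclusion: solving in the variable χ and returning to r. -/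

theorem mainTheorem2 (p : ℝ) (hp : 1 < p) (a b f : ℝ → ℝ)
    (hW1 : NodalRadial.CondW1 p a b) (hW2 : NodalRadial.CondW2 p a b)
    (hW3 : NodalRadial.CondW3 p a b) (hW4 : NodalRadial.CondW4 p a b)
    (hf1 : NodalRadial.CondF1 f) (hf2 : NodalRadial.CondF2 f)
    (hSC : NodalRadial.CondSCW p a b f) (k : ℕ) :
    ∃ u : ℝ → ℝ, NodalRadial.IsSolution p a b f u ∧ 0 < u 0 ∧
      (NodalRadial.nodes u).encard = k := by
  obtain ⟨C₁, C₂, h₁, h₂, W3⟩ := hW3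
  obtain ⟨⟨βm, βp, hm, hβp, neg, zm, zp, pos, neg'⟩, L, top, bot⟩ := hf2
  obtain ⟨α, μ, r₀, hα, -, hr₀, hslope, hlim⟩ := hSC
  have w := hW1.weight hW2 h₁ h₂ W3
  have X := NodalRadial.force_primF hf1 hm hβp neg zm zp pos neg' top bot
  have hP := NodalRadial.one_lt_conjExponent hp
  have hq : ∀ r, 0 < r → NodalRadial.wt p a b (NodalRadial.chiInv p a b (NodalRadial.chi p a b r))
      = NodalRadial.wt p a b r := fun r hr => by rw [hW1.chiInv_chi hr.le]
  have hη : ∀ r, 0 < r → NodalRadial.psi p a b (NodalRadial.chiInv p a b (NodalRadial.chi p a b r))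
      = NodalRadial.psi p a b r := fun r hr => by rw [hW1.chiInv_chi hr.le]
  obtain ⟨V, Y, M, S, hlip, hV0, hY, hdecay, hcard⟩ := NodalRadial.exists_limitSol w hP X hα
    (hW1.chi_pos (half_pos hr₀)) (hW1.subcritical_slope hp w hq hη hr₀ hslope)
    (hW1.subcritical_limit hp w hq hα pos hlim) k
  have hV : Continuous V := (LipschitzWith.of_dist_le' hlip).continuous
  refine ⟨fun r => V (NodalRadial.chi p a b r),
    hW1.isSolution_comp_chi hp w S hf1.cont hq hV hY hdecay, ?_, ?_⟩
  · simpa only [NodalRadial.CondW1.chi_zero] using hV0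
  · rw [hW1.encard_nodes_comp_chi hp w S X.hasDeriv X.zero', hcard]
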